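/- Let $\mathbb K$ be a field of characteristic $0$, let $(X,\mathcal O)$ be a ringed space whose structure sheaf is a sheaf of commutative $\mathbb K$-algebras, let $\mathcal L$ be a Lie algebroid over $(X,\mathcal O)$ (a sheaf of Lie–Rinehart algebras over $\mathbb K$) which is locally free of constant finite rank as a sheaf of $\mathcal O$-modules, and let $\mathcal E$ be a locally free sheaf of $\mathcal O$-modules of constant finite rank. Let $\nabla^{\mathcal L}$ and $\nabla^{\mathcal E}$ be $\mathcal L$-connections on $\mathcal L$ and on $\mathcal E$ (not necessarily flat), i.e. morphisms of sheaves $(X,m)\mapsto\nabla_Xm$ that are additive, $\mathcal O$-linear in $X$ and satisfy $\nabla_X(rm)=r\nabla_Xm+X(r)m$. Notation. $\mathcal U(\mathcal L)$ is the sheaf of universal enveloping algebras of $\mathcal L$, with its filtration $F_k\mathcal U(\mathcal L)$ and its coproduct $D\mapsto D_{(1)}\otimes D_{(2)}$; $\mathcal J(\mathcal L)=\mathcal Hom_{\mathcal O}(\mathcal U(\mathcal L),\mathcal O)$ (left-linear morphisms) is the jet algebra, with product $(\phi\psi)(D)=\phi(D_{(1)})\psi(D_{(2)})$. It has two $\mathcal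 O$-module structures, $(r\cdot_1\phi)(D)=r\,\phi(D)$ and $(r\cdot_2\phi)(D)=\phi(Dr)$, and the second one extends to the $\mathcal U(\mathcal L)$-module structure $(D'\cdot_2\phi)(D)=\phi(DD')$; for $X\in\mathcal L$ write $\nabla^{(2)}_X\phi=X\cdot_2\phi$. $\mathcal O_{X_1},\mathcal O_{X_2}$ indicate which structure is used. $I^k\subset\mathcal J(\mathcal L)$ consists of the $\phi$ that vanish on $F_j\mathcal U(\mathcal L)$ for $j<k$. $\widehat{\mathrm{Sym}}(\mathcal L^\vee)$ is the completed symmetric algebra, i.e. the jet algebra of the Lie algebroid obtained from $\mathcal L$ by putting bracket and anchor equal to zero; it is paired with $\mathrm{Sym}(\mathcal L)$. Put $\mathcal J(\mathcal L;\mathcal E)=\mathcal J(\mathcal L)\otimes_{\mathcal O_{X_2}}\mathcal E$ and $\mathcal U(\mathcal L;\mathcal E)=\mathcal Hom^{\rm cont}_{\mathcal O_{X_1}}(\mathcal J(\mathcal L;\mathcal E),\mathcal E)$, where continuous means vanishing, locally on $X$, on $I^k\mathcal J(\mathcal L;\mathcal E)$ for some $k$. $\mathrm{Diff}_{\mathcal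 O}(\widehat{\mathrm{Sym}}(\mathcal L^\vee)\otimes_{\mathcal O}\mathcal E)$ is the sheaf of algebras whose sections are the $\mathcal O$-linear sheaf endomorphisms $d$ which locally satisfy, for some $k$, $[\phi_0,[\dots,[\phi_k,d]\dots]]=0$ for all $\phi_i\in\widehat{\mathrm{Sym}}(\mathcal L^\vee)$. All tensor products are tensor products of sheaves. Then: (i) There is an isomorphism of sheaves $\mathcal E\otimes_l\mathcal U(\mathcal L)\otimes_r\mathcal E^\vee\cong\mathcal U(\mathcal L;\mathcal E)$ (tensor products for the left and the right $\mathcal O$-module structure of $\mathcal U(\mathcal L)$), which sends $e\otimes D\otimes f$ to the morphism $\phi\otimes s\mapsto\phi(D\,f(s))\,e$. In (iii), $\mathcal U(\mathcal L;\mathcal E)$ is identified with $\mathcal E\otimes_l\mathcal U(\mathcal L)\otimes_r\mathcal E^\vee$ through it. (ii) There is an isomorphism of sheaves of $\mathbb K$-vector spaces $j:\mathcal J(\mathcal L;\mathcal E)\to\widehat{\mathrm{Sym}}(\mathcal L^\vee)\otimes_{\mathcal O}\mathcal E$ such that, for all $n\ge0$ and all local sections $t$ of $\mathcal J(\mathcal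 L;\mathcal E)$ and $X_1,\dots,X_n$ of $\mathcal L$, $$\langle j(t),X_1\cdots X_n\rangle=\tfrac1{n!}\,\mathrm{ev}_1\big((D^nt)(X_1,\dots,X_n)\big),\qquad \mathrm{ev}_1(\phi\otimes e)=\phi(1)e,$$ where $D$ is the symmetrized connection: $D^0t=t$ and $$(D^{n+1}t)(X_0,\dots,X_n)=\sum_{i}\Big(\nabla_{X_i}\big((D^nt)(\dots\widehat{X_i}\dots)\big)-\sum_{j\ne i}(D^nt)(\dots\widehat{X_i}\dots,\nabla^{\mathcal L}_{X_i}X_j,\dots)\Big),$$ with $\nabla=\nabla^{(2)}\otimes1+1\otimes\nabla^{\mathcal E}$ on $\mathcal J(\mathcal L;\mathcal E)$ and $\nabla^{\mathcal L}_{X_i}X_j$ in the place of $X_j$. (iii) There is an isomorphism of sheaves of $\mathbb K$-algebras $$\Phi:\ \mathcal J(\mathcal L)\otimes_{\mathcal O_{X_2}}\mathcal U(\mathcal L;\mathcal E)\ \xrightarrow{\ \sim\ }\ \mathrm{Diff}_{\mathcal O}\big(\widehat{\mathrm{Sym}}(\mathcal L^\vee)\otimes_{\mathcal O}\mathcal E\big),$$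 where the product on the left is $(\phi\otimes e\otimes D\otimes f)(\psi\otimes e'\otimes D'\otimes f')=\phi\,(D_{(1)}\cdot_2\psi)\otimes e\otimes D_{(2)}f(e')D'\otimes f'$, and $\Phi$ is given by $$\Phi(\phi\otimes e\otimes D\otimes f)\big(j(\psi\otimes s)\big)=j\Big(\phi\cdot\big(D\cdot_2(f(s)\cdot_2\psi)\big)\otimes e\Big).$$ -/

import Mathlib

open CategoryTheory TopologicalSpace Opposite TensorProduct

universe u

noncomputable section

namespace LieAlg

section Enveloping

variable (R L : Type u) [CommRing R] [LieRing L] [Module R L] [LieRingModule L R]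

/-- The defining relations of the universal enveloping algebra of a Lie-Rinehart algebra. -/
inductive UEA.Rel : FreeAlgebra ℤ (R ⊕ L) → FreeAlgebra ℤ (R ⊕ L) → Prop
  | add_left (r s : R) : UEA.Rel (FreeAlgebra.ι ℤ (Sum.inl (r + s)))
      (FreeAlgebra.ι ℤ (Sum.inl r) + FreeAlgebra.ι ℤ (Sum.inl s))
  | mul_left (r s : R) : UEA.Rel (FreeAlgebra.ι ℤ (Sum.inl (r * s)))
      (FreeAlgebra.ι ℤ (Sum.inl r) * FreeAlgebra.ι ℤ (Sum.inl s))
  | one_left : UEA.Rel (FreeAlgebra.ι ℤ (Sum.inl 1)) 1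
  | add_right (x y : L) : UEA.Rel (FreeAlgebra.ι ℤ (Sum.inr (x + y)))
      (FreeAlgebra.ι ℤ (Sum.inr x) + FreeAlgebra.ι ℤ (Sum.inr y))
  | smul_right (r : R) (x : L) : UEA.Rel
      (FreeAlgebra.ι ℤ (Sum.inl r) * FreeAlgebra.ι ℤ (Sum.inr x))
      (FreeAlgebra.ι ℤ (Sum.inr (r • x)))
  | comm (x : L) (r : R) : UEA.Rel
      (FreeAlgebra.ι ℤ (Sum.inr x) * FreeAlgebra.ι ℤ (Sum.inl r))
      (FreeAlgebra.ι ℤ (Sum.inl r) * FreeAlgebra.ι ℤ (Sum.inr x)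
        + FreeAlgebra.ι ℤ (Sum.inl ⁅x, r⁆))
  | lie (x y : L) : UEA.Rel
      (FreeAlgebra.ι ℤ (Sum.inr x) * FreeAlgebra.ι ℤ (Sum.inr y))
      (FreeAlgebra.ι ℤ (Sum.inr y) * FreeAlgebra.ι ℤ (Sum.inr x)
        + FreeAlgebra.ι ℤ (Sum.inr ⁅x, y⁆))

/-- The universal enveloping algebra `U(L, R)` of a Lie-Rinehart algebra `(R, L)`: the universal
  ring with a ring homomorphism `ιR` from `R` and an additive map `ιL` from `L` such that
`ιR r * ιL x = ιL (r • x)`, `ιL x * ιR r - ιR r * ιL x = ιR (x(r))` and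
`ιL x * ιL y - ιL y * ιL x = ιL [x, y]`. When `(R, L)` is a Lie-Rinehart algebra over `K`, its
`K`-algebra structure is the one through `K → R`: the image of `K` is central. -/
def UEA : Type u := RingQuot (UEA.Rel R L)

instance : Ring (UEA R L) := inferInstanceAs (Ring (RingQuot (UEA.Rel R L)))

namespace UEA

variable {R}

/-- The structure map `R → U(L, R)`. -/
def ιR : R →+* UEA R L where
  toFun r := RingQuot.mkRingHom (Rel R L) (FreeAlgebra.ι ℤ (Sum.inl r))
  map_one' := (RingQuot.mkRingHom_rel Rel.one_left).trans (map_one _)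
  map_mul' r s := (RingQuot.mkRingHom_rel (Rel.mul_left r s)).trans (map_mul _ _ _)
  map_add' r s := (RingQuot.mkRingHom_rel (Rel.add_left r s)).trans (map_add _ _ _)
  map_zero' := by
    have h := (RingQuot.mkRingHom_rel (Rel.add_left (L := L) (0 : R) 0)).trans (map_add _ _ _)
    rw [add_zero] at h
    exact left_eq_add.mp h

variable (R) {L}

/-- The structure map `L → U(L, R)`. -/
def ιL : L →+ UEA R L :=
  AddMonoidHom.mk' (fun x => RingQuot.mkRingHom (Rel R L) (FreeAlgebra.ι ℤ (Sum.inr x)))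
    fun x y => (RingQuot.mkRingHom_rel (Rel.add_right x y)).trans (map_add _ _ _)

variable {R}

lemma ιR_mul_ιL (r : R) (x : L) : ιR L r * ιL R x = ιL R (r • x) :=
  (map_mul _ _ _).symm.trans (RingQuot.mkRingHom_rel (Rel.smul_right r x))

lemma ιL_mul_ιR (x : L) (r : R) : ιL R x * ιR L r = ιR L r * ιL R x + ιR L ⁅x, r⁆ := by
  refine (map_mul (RingQuot.mkRingHom (Rel R L)) _ _).symm.trans
    ((RingQuot.mkRingHom_rel (Rel.comm x r)).trans ?_)
  rw [map_add, map_mul]; rfl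

lemma ιL_mul_ιL (x y : L) : ιL R x * ιL R y = ιL R y * ιL R x + ιL R ⁅x, y⁆ := by
  refine (map_mul (RingQuot.mkRingHom (Rel R L)) _ _).symm.trans
    ((RingQuot.mkRingHom_rel (Rel.lie x y)).trans ?_)
  rw [map_add, map_mul]; rfl

/-- The universal property of `U(L, R)`. -/
def lift {A : Type*} [Ring A] (f : R →+* A) (g : L →+ A)
    (h₁ : ∀ r x, f r * g x = g (r • x))
    (h₂ : ∀ x r, g x * f r = f r * g x + f ⁅x, r⁆)
    (h₃ : ∀ x y, g x * g y = g y * g x + g ⁅x, y⁆) : UEA R L →+* A :=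
  RingQuot.lift ⟨(FreeAlgebra.lift ℤ (Sum.elim f g) : FreeAlgebra ℤ (R ⊕ L) →ₐ[ℤ] A).toRingHom, by
    intro a b h
    induction h with
    | add_left r s => simp
    | mul_left r s => simp
    | one_left => simp
    | add_right x y => simp
    | smul_right r x => simpa using h₁ r x
    | comm x r => simpa using h₂ x r
    | lie x y => simpa using h₃ x y⟩

section lift
variable {A : Type*} [Ring A] (f : R →+* A) (g : L →+ A)
    (h₁ : ∀ r x, f r * g x = g (r • x))
    (h₂ : ∀ x r, g x * f r = f r * g x + f ⁅x, r⁆)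
    (h₃ : ∀ x y, g x * g y = g y * g x + g ⁅x, y⁆)

@[simp] lemma lift_ιR (r : R) : lift f g h₁ h₂ h₃ (ιR L r) = f r := by
  refine (RingQuot.lift_mkRingHom_apply _ _ _).trans ?_
  simp

@[simp] lemma lift_ιL (x : L) : lift f g h₁ h₂ h₃ (ιL R x) = g x := by
  refine (RingQuot.lift_mkRingHom_apply _ _ _).trans ?_
  simp

end lift

/-- `U(L, R)` is generated by `R` and `L`. -/
@[elab_as_elim]
lemma induction {p : UEA R L → Prop} (hR : ∀ r, p (ιR L r)) (hL : ∀ x, p (ιL R x))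
    (hadd : ∀ a b, p a → p b → p (a + b)) (hmul : ∀ a b, p a → p b → p (a * b))
    (D : UEA R L) : p D := by
  obtain ⟨a, rfl⟩ := RingQuot.mkRingHom_surjective (Rel R L) D
  induction a with
  | grade0 n =>
    have : RingQuot.mkRingHom (Rel R L) (algebraMap ℤ _ n) = ιR L (n : R) := by
      simp only [eq_intCast, map_intCast]
      rfl
    exact this ▸ hR _
  | grade1 x => cases x with
    | inl r => exact hR r
    | inr x => exact hL x
  | mul a b ha hb => rw [map_mul]; exact hmul _ _ ha hb
  | add a b ha hb => rw [map_add]; exact hadd _ _ ha hb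

/-- The left `R`-module structure of `U(L, R)`. -/
instance : Module R (UEA R L) := Module.compHom _ (ιR L)

/-- The right `R`-module structure of `U(L, R)`. -/
instance : Module Rᵐᵒᵖ (UEA R L) := Module.compHom _ (ιR L).op

lemma smul_def (r : R) (D : UEA R L) : r • D = ιR L r * D := rfl
lemma op_smul_def (r : Rᵐᵒᵖ) (D : UEA R L) : r • D = D * ιR L r.unop := rfl

instance : IsScalarTower R (UEA R L) (UEA R L) := ⟨fun r D E => mul_assoc (ιR L r) D E⟩
instance : SMulCommClass Rᵐᵒᵖ R (UEA R L) := ⟨fun _ s D => mul_assoc (ιR L s) D _⟩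
instance : SMulCommClass Rᵐᵒᵖ (UEA R L) (UEA R L) := ⟨fun _ D E => mul_assoc D E _⟩

section TensorAction

variable (M N : Type*) [AddCommGroup M] [Module R M] [Module (UEA R L) M]
  [IsScalarTower R (UEA R L) M] [AddCommGroup N] [Module R N] [Module (UEA R L) N]
  [IsScalarTower R (UEA R L) N]

lemma ιR_smul {M : Type*} [AddCommGroup M] [Module R M] [Module (UEA R L) M]
    [IsScalarTower R (UEA R L) M] (r : R) (m : M) : ιR L r • m = r • m := by
  rw [← mul_one (ιR L r), ← smul_def, smul_assoc, one_smul]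

lemma ιL_smul_smul {M : Type*} [AddCommGroup M] [Module R M] [Module (UEA R L) M]
    [IsScalarTower R (UEA R L) M] (x : L) (r : R) (m : M) :
    ιL R x • r • m = r • ιL R x • m + ⁅x, r⁆ • m := by
  rw [← ιR_smul (L := L) r m, ← mul_smul, ιL_mul_ιR, add_smul, mul_smul, ιR_smul, ιR_smul]

/-- The action of `x ∈ L` on `M ⊗ N` for two `U(L, R)`-modules:
`x (m ⊗ n) = x m ⊗ n + m ⊗ x n`. -/
def tensorL (x : L) : M ⊗[R] N →+ M ⊗[R] N :=
  liftAddHom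
    (AddMonoidHom.mk' (fun m => AddMonoidHom.mk'
      (fun n => (ιL R x • m) ⊗ₜ[R] n + m ⊗ₜ[R] (ιL R x • n))
      (fun n n' => by simp only [smul_add, tmul_add]; abel))
      (fun m m' => by ext n; simp only [smul_add, add_tmul, AddMonoidHom.mk'_apply,
        AddMonoidHom.add_apply]; abel))
    (fun r m n => by
      simp only [AddMonoidHom.mk'_apply, ιL_smul_smul, add_tmul, tmul_add, smul_tmul]
      abel)

variable {M N} in
@[simp] lemma tensorL_tmul (x : L) (m : M) (n : N) :
    tensorL M N x (m ⊗ₜ[R] n) = (ιL R x • m) ⊗ₜ[R] n + m ⊗ₜ[R] (ιL R x • n) := rfl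

lemma end_tensor_ext {R M N : Type*} [CommRing R] [AddCommGroup M] [AddCommGroup N] [Module R M]
    [Module R N] {f g : AddMonoid.End (M ⊗[R] N)}
    (h : ∀ m n, f (m ⊗ₜ n) = g (m ⊗ₜ n)) : f = g := by
  refine AddMonoidHom.ext fun t => ?_
  induction t with
  | zero => exact (map_zero f).trans (map_zero g).symm
  | tmul m n => exact h m n
  | add s t hs ht => exact (map_add f s t).trans ((congrArg₂ _ hs ht).trans (map_add g s t).symm)

/-- The tensor product over `R` of two `U(L, R)`-modules, as a `U(L, R)`-module. In Sweedler
  notation, `D (m ⊗ n) = D₍₁₎ m ⊗ D₍₂₎ n`. -/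
def tensorAct : UEA R L →+* AddMonoid.End (M ⊗[R] N) :=
  lift (Module.toAddMonoidEnd R (M ⊗[R] N))
    (AddMonoidHom.mk' (fun x => (tensorL M N x : AddMonoid.End (M ⊗[R] N))) fun x y => by
      refine end_tensor_ext fun m n => ?_
      change tensorL M N (x + y) (m ⊗ₜ[R] n) = tensorL M N x (m ⊗ₜ[R] n) + tensorL M N y (m ⊗ₜ[R] n)
      simp only [tensorL_tmul, map_add, add_smul, add_tmul, tmul_add]
      abel)
    (fun r x => by
      refine end_tensor_ext fun m n => ?_
      change r • tensorL M N x (m ⊗ₜ[R] n) = tensorL M N (r • x) (m ⊗ₜ[R] n)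
      simp only [tensorL_tmul, smul_add, ← ιR_mul_ιL, mul_smul, ιR_smul, smul_tmul', tmul_smul])
    (fun x r => by
      refine end_tensor_ext fun m n => ?_
      change tensorL M N x (r • (m ⊗ₜ[R] n)) = r • tensorL M N x (m ⊗ₜ[R] n) + ⁅x, r⁆ • (m ⊗ₜ[R] n)
      simp only [smul_tmul', tensorL_tmul, ιL_smul_smul, add_tmul, smul_add]
      abel)
    (fun x y => by
      refine end_tensor_ext fun m n => ?_
      change tensorL M N x (tensorL M N y (m ⊗ₜ[R] n)) = tensorL M N y (tensorL M N x (m ⊗ₜ[R] n))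
        + tensorL M N ⁅x, y⁆ (m ⊗ₜ[R] n)
      simp only [tensorL_tmul, map_add, ← mul_smul, ιL_mul_ιL x y, add_smul, add_tmul, tmul_add]
      abel)

variable {M N}

lemma tensorAct_ιR (r : R) (t : M ⊗[R] N) : tensorAct M N (ιR L r) t = r • t :=
  congrArg (fun f : AddMonoid.End (M ⊗[R] N) => f t) (lift_ιR _ _ _ _ _ r)

lemma tensorAct_ιL (x : L) (t : M ⊗[R] N) : tensorAct M N (ιL R x) t = tensorL M N x t :=
  congrArg (fun f : AddMonoid.End (M ⊗[R] N) => f t) (lift_ιL _ _ _ _ _ x)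

lemma tensorAct_mul (D E : UEA R L) (t : M ⊗[R] N) :
    tensorAct M N (D * E) t = tensorAct M N D (tensorAct M N E t) := by
  rw [map_mul]; rfl

lemma tensorAct_add (D E : UEA R L) (t : M ⊗[R] N) :
    tensorAct M N (D + E) t = tensorAct M N D t + tensorAct M N E t := by
  rw [map_add]; rfl

end TensorAction

variable (R L) in
/-- The coproduct `Δ : U(L, R) → U(L, R) ⊗ U(L, R)` (tensor product over `R` for the left module
  structures): `Δ D = D (1 ⊗ 1)`. -/
def comul : UEA R L →ₗ[R] UEA R L ⊗[R] UEA R L where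
  toFun D := tensorAct (UEA R L) (UEA R L) D (1 ⊗ₜ 1)
  map_add' D E := tensorAct_add _ _ _
  map_smul' r D := by rw [smul_def, tensorAct_mul, tensorAct_ιR]; rfl

lemma comul_ιL (x : L) : comul R L (ιL R x) = ιL R x ⊗ₜ 1 + 1 ⊗ₜ ιL R x := by
  refine (tensorAct_ιL x _).trans ?_
  simp

lemma comul_ιR (r : R) : comul R L (ιR L r) = ιR L r ⊗ₜ 1 := by
  refine (tensorAct_ιR r _).trans ?_
  rw [smul_tmul', smul_def, mul_one]

lemma map_tensorAct {S L' : Type u} [CommRing S] [LieRing L'] [Module S L'] [LieRingModule L' S]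
    {σ : R →+* S} (F : UEA R L →+* UEA S L') (hR : ∀ r, F (ιR L r) = ιR L' (σ r))
    (hL : ∀ x, ∃ y, F (ιL R x) = ιL S y)
    {M N M' N' : Type*} [AddCommGroup M] [Module R M] [Module (UEA R L) M]
    [IsScalarTower R (UEA R L) M] [AddCommGroup N] [Module R N] [Module (UEA R L) N]
    [IsScalarTower R (UEA R L) N] [AddCommGroup M'] [Module S M'] [Module (UEA S L') M']
    [IsScalarTower S (UEA S L') M'] [AddCommGroup N'] [Module S N'] [Module (UEA S L') N']
    [IsScalarTower S (UEA S L') N'] (a : M →ₛₗ[σ] M') (b : N →ₛₗ[σ] N')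
    (ha : ∀ (D : UEA R L) m, a (D • m) = F D • a m)
    (hb : ∀ (D : UEA R L) n, b (D • n) = F D • b n) (D : UEA R L) (t : M ⊗[R] N) :
    TensorProduct.map a b (tensorAct M N D t)
      = tensorAct M' N' (F D) (TensorProduct.map a b t) := by
  induction D using UEA.induction generalizing t with
  | hR r => rw [tensorAct_ιR, hR, tensorAct_ιR, LinearMap.map_smulₛₗ]
  | hL x =>
    obtain ⟨y, hy⟩ := hL x
    rw [tensorAct_ιL, hy, tensorAct_ιL]
    induction t with
    | zero => simp
    | tmul m n => simp [ha, hb, hy]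
    | add s t hs ht => rw [map_add, map_add, map_add, map_add, hs, ht]
  | hadd D E hD hE => rw [tensorAct_add, map_add, map_add, tensorAct_add, hD, hE]
  | hmul D E hD hE => rw [tensorAct_mul, map_mul, tensorAct_mul, hD, hE]

section Functoriality

variable {K S L' : Type u} [CommRing K] [Algebra K R] [LieAlgebra K L]
  [CommRing S] [Algebra K S] [LieRing L'] [Module S L'] [LieRingModule L' S] [LieAlgebra K L']
  {σ : R →ₐ[K] S}

/-- The ring homomorphism of enveloping algebras induced by a morphism of Lie-Rinehart algebras. -/
def map (f : LieRinehartAlgebra.Hom σ L L') : UEA R L →+* UEA S L' :=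
  lift ((ιR L').comp (σ : R →+* S)) ((ιL S).comp (f.toLieHom : L →ₗ[K] L').toAddMonoidHom)
    (fun r x => by
      simp [ιR_mul_ιL, f.map_smul_apply'])
    (fun x r => by
      simp [ιL_mul_ιR, f.apply_lie'])
    (fun x y => by
      simpa using ιL_mul_ιL (R := S) (f.toLieHom x) (f.toLieHom y))

@[simp] lemma map_ιR (f : LieRinehartAlgebra.Hom σ L L') (r : R) :
    map f (ιR L r) = ιR L' (σ r) := lift_ιR _ _ _ _ _ r

@[simp] lemma map_ιL (f : LieRinehartAlgebra.Hom σ L L') (x : L) :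
    map f (ιL R x) = ιL S (f x) := lift_ιL _ _ _ _ _ x

/-- `UEA.map` as a semilinear map for the left module structures. -/
def mapₛ (f : LieRinehartAlgebra.Hom σ L L') : UEA R L →ₛₗ[(σ : R →+* S)] UEA S L' where
  toFun := map f
  map_add' := map_add _
  map_smul' r D := by rw [smul_def, map_mul, map_ιR]; rfl

/-- `UEA.map` as a semilinear map for the right module structures. -/
def mapᵣ (f : LieRinehartAlgebra.Hom σ L L') :
    UEA R L →ₛₗ[(σ : R →+* S).op] UEA S L' where
  toFun := map f
  map_add' := map_add _
  map_smul' r D := by rw [op_smul_def, map_mul, map_ιR]; rfl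

lemma map_comul (f : LieRinehartAlgebra.Hom σ L L') (D : UEA R L) :
    TensorProduct.map (mapₛ f) (mapₛ f) (comul R L D) = comul S L' (map f D) := by
  refine (map_tensorAct (σ := (σ : R →+* S)) (map f) (map_ιR f) (fun x => ⟨f x, map_ιL f x⟩) (mapₛ f) (mapₛ f)
    (fun D E => map_mul (map f) D E) (fun D E => map_mul (map f) D E) D _).trans ?_
  exact congrArg (tensorAct _ _ _)
    (congrArg₂ (fun a b => a ⊗ₜ[S] b) (map_one (map f)) (map_one (map f)))

end Functoriality

/-- Right multiplication by `E`, as a left `R`-linear endomorphism of `U(L, R)`. -/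
def mulRight (E : UEA R L) : UEA R L →ₗ[R] UEA R L where
  toFun D := D * E
  map_add' _ _ := add_mul _ _ _
  map_smul' _ _ := mul_assoc _ _ _

lemma comul_mul_ιR_left (D : UEA R L) (r : R) :
    comul R L (D * ιR L r) = TensorProduct.map (mulRight (ιR L r)) LinearMap.id (comul R L D) := by
  refine Eq.trans ?_ (map_tensorAct (RingHom.id _) (σ := RingHom.id R) (fun _ => rfl)
    (fun x => ⟨x, rfl⟩) (mulRight (ιR L r)) LinearMap.id (fun D E => mul_assoc D E _)
    (fun D E => rfl) D _).symm
  refine (tensorAct_mul _ _ _).trans (congrArg (tensorAct _ _ D) ?_)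
  rw [tensorAct_ιR, TensorProduct.map_tmul, smul_tmul']
  congr 1
  change ιR L r * 1 = 1 * ιR L r
  rw [one_mul, mul_one]

lemma comul_mul_ιR_right (D : UEA R L) (r : R) :
    comul R L (D * ιR L r) = TensorProduct.map LinearMap.id (mulRight (ιR L r)) (comul R L D) := by
  refine Eq.trans ?_ (map_tensorAct (RingHom.id _) (σ := RingHom.id R) (fun _ => rfl)
    (fun x => ⟨x, rfl⟩) LinearMap.id (mulRight (ιR L r)) (fun D E => rfl)
    (fun D E => mul_assoc D E _) D _).symm
  refine (tensorAct_mul _ _ _).trans (congrArg (tensorAct _ _ D) ?_)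
  rw [tensorAct_ιR, TensorProduct.map_tmul, ← tmul_smul]
  congr 1
  change ιR L r * 1 = 1 * ιR L r
  rw [one_mul, mul_one]

end UEA

end Enveloping

section Sheaves

variable {K : Type u} [Field K] {X : TopCat.{u}}

/-- Sections of the structure sheaf `O` over `U`. -/
abbrev Sec (O : TopCat.Sheaf (CommAlgCat.{u} K) X) (U : Opens X) : Type u := O.presheaf.obj (op U)

/-- Restriction of sections of the structure sheaf. -/
def rsA (O : TopCat.Sheaf (CommAlgCat.{u} K) X) {U V : Opens X} (h : V ≤ U) :
    Sec O U →ₐ[K] Sec O V := (O.presheaf.map (homOfLE h).op).hom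

/-- Restriction of sections of the structure sheaf, as a ring homomorphism. -/
abbrev rs (O : TopCat.Sheaf (CommAlgCat.{u} K) X) {U V : Opens X} (h : V ≤ U) :
    Sec O U →+* Sec O V := (rsA O h : Sec O U →+* Sec O V)

variable {O : TopCat.Sheaf (CommAlgCat.{u} K) X}

lemma rs_refl {U : Opens X} (a : Sec O U) : rs O (le_refl U) a = a := by
  change (O.presheaf.map (𝟙 (op U))).hom a = a
  rw [O.presheaf.map_id]; rfl

lemma rs_rs {U V W : Opens X} (h : V ≤ U) (h' : W ≤ V) (a : Sec O U) :
    rs O h' (rs O h a) = rs O (h'.trans h) a := by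
  change (O.presheaf.map (homOfLE h').op).hom ((O.presheaf.map (homOfLE h).op).hom a) =
    (O.presheaf.map ((homOfLE h).op ≫ (homOfLE h').op)).hom a
  rw [O.presheaf.map_comp]; rfl

/-- The sheaf condition for a presheaf on `X`: compatible families of sections glue uniquely. -/
def Gluing (F : Opens X → Type u) (res : ∀ {U V : Opens X}, V ≤ U → F U → F V) : Prop :=
  ∀ (ι : Type u) (U : ι → Opens X) (s : ∀ i, F (U i)),
    (∀ i j, res (inf_le_left : U i ⊓ U j ≤ U i) (s i) = res (inf_le_right : U i ⊓ U j ≤ U j) (s j)) →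
    ∃! t : F (iSup U), ∀ i, res (le_iSup U i) t = s i

variable (O) in
/-- A presheaf of `O`-modules. -/
structure PMod where
  obj : Opens X → Type u
  [addCommGroup : ∀ U, AddCommGroup (obj U)]
  [module : ∀ U, Module (Sec O U) (obj U)]
  res {U V : Opens X} (h : V ≤ U) : obj U →ₛₗ[rs O h] obj V
  res_refl {U : Opens X} (m : obj U) : res (le_refl U) m = m
  res_res {U V W : Opens X} (h : V ≤ U) (h' : W ≤ V) (m : obj U) :
    res h' (res h m) = res (h'.trans h) m

attribute [instance] PMod.addCommGroup PMod.module

namespace PMod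

/-- The presheaf of `O`-modules is a sheaf. -/
def IsSheaf (F : PMod O) : Prop := Gluing F.obj fun h => F.res h

/-- `F` is locally free of rank `n`: locally there are `n` sections which, restricted to any smaller
  open set `W`, form a basis of the `O(W)`-module of sections over `W`. -/
def IsLocallyFree (F : PMod O) (n : ℕ) : Prop :=
  ∀ x : X, ∃ (V : Opens X) (_ : x ∈ V) (e : Fin n → F.obj V), ∀ (W : Opens X) (h : W ≤ V),
    LinearIndependent (Sec O W) (fun i => F.res h (e i)) ∧
      Submodule.span (Sec O W) (Set.range fun i => F.res h (e i)) = ⊤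

variable (O) in
/-- The structure sheaf as a module over itself. -/
abbrev unit : PMod O where
  obj U := Sec O U
  res h := { toFun := rs O h, map_add' := map_add _, map_smul' := map_mul _ }
  res_refl := rs_refl
  res_res := rs_rs

/-- The internal hom: sections over `U` are the `O`-linear morphisms from `F|U` to `G|U`. -/
def homs (F G : PMod O) (U : Opens X) :
    AddSubgroup ((V : Set.Iic U) → (F.obj V →ₗ[Sec O V] G.obj V)) where
  carrier := {f | ∀ (V W : Set.Iic U) (h : W.1 ≤ V.1) (m : F.obj V),
    f W (F.res h m) = G.res h (f V m)}
  add_mem' {f g} hf hg V W h m := by simp [hf V W h, hg V W h]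
  zero_mem' V W h m := by simp
  neg_mem' {f} hf V W h m := by simp [hf V W h]

/-- The internal hom: sections over `U` are the `O`-linear morphisms from `F|U` to `G|U`. -/
def Hom (F G : PMod O) (U : Opens X) : Type u := homs F G U

namespace Hom
variable {F G : PMod O} {U V W : Opens X}

instance : AddCommGroup (Hom F G U) := inferInstanceAs (AddCommGroup (homs F G U))

/-- The component at `V` of a morphism from `F|U` to `G|U`. -/
def app (f : Hom F G U) (h : V ≤ U) : F.obj V →ₗ[Sec O V] G.obj V := f.1 ⟨V, h⟩

lemma app_res (f : Hom F G U) (h : V ≤ U) (h' : W ≤ V) (m : F.obj V) :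
    f.app (h'.trans h) (F.res h' m) = G.res h' (f.app h m) := f.2 ⟨V, h⟩ ⟨W, h'.trans h⟩ h' m

/-- Construct a morphism from its components. -/
def mk (f : ∀ {V : Opens X}, V ≤ U → (F.obj V →ₗ[Sec O V] G.obj V))
    (hf : ∀ {V W : Opens X} (h : V ≤ U) (h' : W ≤ V) (m : F.obj V),
      f (h'.trans h) (F.res h' m) = G.res h' (f h m)) : Hom F G U :=
  ⟨fun V => f V.2, fun V _ h m => hf V.2 h m⟩

@[simp] lemma mk_app (f : ∀ {V : Opens X}, V ≤ U → (F.obj V →ₗ[Sec O V] G.obj V)) (hf)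
    (h : V ≤ U) : (mk f hf : Hom F G U).app h = f h := rfl

@[ext] lemma ext {f g : Hom F G U}
    (h : ∀ (V : Opens X) (hV : V ≤ U) m, f.app hV m = g.app hV m) : f = g :=
  Subtype.ext (funext fun V => LinearMap.ext fun m => h V.1 V.2 m)

@[simp] lemma add_app (f g : Hom F G U) (h : V ≤ U) : (f + g).app h = f.app h + g.app h := rfl
@[simp] lemma zero_app (h : V ≤ U) : (0 : Hom F G U).app h = 0 := rfl

instance : Module (Sec O U) (Hom F G U) where
  smul r f := mk (fun h => rs O h r • f.app h) fun h h' m => by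
    rw [LinearMap.smul_apply, app_res f h h', LinearMap.smul_apply, LinearMap.map_smulₛₗ, rs_rs]
  one_smul f := by ext V h m; change rs O h 1 • f.app h m = _; simp
  mul_smul r s f := by
    ext V h m; change rs O h (r * s) • f.app h m = rs O h r • rs O h s • f.app h m
    rw [map_mul, mul_smul]
  smul_zero r := by ext V h m; exact smul_zero (rs O h r)
  smul_add r f g := by ext V h m; exact smul_add (rs O h r) _ _
  add_smul r s f := by
    ext V h m; change rs O h (r + s) • f.app h m = rs O h r • f.app h m + rs O h s • f.app h m
    rw [map_add, add_smul]
  zero_smul f := by ext V h m; change rs O h 0 • f.app h m = 0; simp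

lemma smul_app (r : Sec O U) (f : Hom F G U) (h : V ≤ U) (m : F.obj V) :
    (r • f).app h m = rs O h r • f.app h m := rfl

/-- Restriction of morphisms to smaller open sets. -/
def restrict (h : V ≤ U) (f : Hom F G U) : Hom F G V :=
  mk (fun h' => f.app (h'.trans h)) fun h' h'' m => f.app_res (h'.trans h) h'' m

@[simp] lemma restrict_app (h : V ≤ U) (f : Hom F G U) (h' : W ≤ V) :
    (f.restrict h).app h' = f.app (h'.trans h) := rfl

end Hom

/-- The dual `E^∨` of a module: the sheaf of `O`-linear morphisms from `E` to `O`. -/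
def dual (E : PMod O) : PMod O where
  obj U := Hom E (unit O) U
  res h :=
    { toFun := Hom.restrict h
      map_add' := fun _ _ => rfl
      map_smul' := fun r f => by
        ext W h' m
        simp only [Hom.restrict_app]
        exact congrArg (· • f.app _ m) (rs_rs h h' r).symm }
  res_refl _ := rfl
  res_res _ _ _ := rfl

/-- Sections of a dual as a module over the opposite of the (commutative) ring of functions. -/
instance (E : PMod O) (U : Opens X) : Module (Sec O U)ᵐᵒᵖ (E.dual.obj U) :=
  Module.compHom _ (RingEquiv.toOpposite (Sec O U)).symm.toRingHom

/-- The pairing of `E^∨` with `E`. -/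
def ev {E : PMod O} {U : Opens X} (f : E.dual.obj U) : E.obj U →ₗ[Sec O U] Sec O U :=
  Hom.app (G := unit O) f le_rfl

/-- The pairing of a section of `E^∨` over `U` with the sections of `E` over `V ⊆ U`. -/
def evOn {E : PMod O} {U V : Opens X} (f : E.dual.obj U) (h : V ≤ U) : E.obj V →ₗ[Sec O V] Sec O V :=
  Hom.app (G := unit O) f h

/-- The tensor product presheaf. -/
abbrev tensor (F G : PMod O) : PMod O where
  obj U := F.obj U ⊗[Sec O U] G.obj U
  res h := TensorProduct.map (F.res h) (G.res h)
  res_refl {U} t := by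
    induction t with
    | zero => simp
    | tmul m n => simp [F.res_refl, G.res_refl]
    | add s t hs ht => rw [map_add, hs, ht]
  res_res h h' t := by
    induction t with
    | zero => simp
    | tmul m n => simp [F.res_res, G.res_res]
    | add s t hs ht => simp only [map_add, hs, ht]

end PMod

end Sheaves

section Algebroids

variable {K : Type u} [Field K] {X : TopCat.{u}} {O : TopCat.Sheaf (CommAlgCat.{u} K) X}

variable (O) in
/-- A Lie algebroid over `(X, O)`: a sheaf of `O`-modules such that `(O(U), L(U))` is a Lie-Rinehart
algebra over `K` for all `U` and restrictions are morphisms of Lie-Rinehart algebras. -/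
structure LieAlgebroid where
  obj : Opens X → Type u
  [lieRing : ∀ U, LieRing (obj U)]
  [module : ∀ U, Module (Sec O U) (obj U)]
  [lieRingModule : ∀ U, LieRingModule (obj U) (Sec O U)]
  [lieAlgebra : ∀ U, LieAlgebra K (obj U)]
  [lieRinehartRing : ∀ U, LieRinehartRing (Sec O U) (obj U)]
  [lieRinehartAlgebra : ∀ U, LieRinehartAlgebra K (Sec O U) (obj U)]
  res {U V : Opens X} (h : V ≤ U) : LieRinehartAlgebra.Hom (rsA O h) (obj U) (obj V)
  res_refl {U : Opens X} (x : obj U) : res (le_refl U) x = x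
  res_res {U V W : Opens X} (h : V ≤ U) (h' : W ≤ V) (x : obj U) :
    res h' (res h x) = res (h'.trans h) x
  isSheaf : Gluing obj fun h => res h

attribute [instance] LieAlgebroid.lieRing LieAlgebroid.module LieAlgebroid.lieRingModule
  LieAlgebroid.lieAlgebra LieAlgebroid.lieRinehartRing LieAlgebroid.lieRinehartAlgebra

/-- A copy of the module `M` with zero Lie bracket and zero anchor. -/
def Abelian (M : Type u) : Type u := M

namespace Abelian

variable {R k M : Type u} [CommRing R] [CommRing k] [Algebra k R] [LieRing M]

instance : AddCommGroup (Abelian M) := inferInstanceAs (AddCommGroup M)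

instance : LieRing (Abelian M) where
  bracket _ _ := 0
  add_lie _ _ _ := (add_zero 0).symm
  lie_add _ _ _ := (add_zero 0).symm
  lie_self _ := rfl
  leibniz_lie _ _ _ := (add_zero 0).symm

instance [Module R M] : Module R (Abelian M) := inferInstanceAs (Module R M)

instance : LieRingModule (Abelian M) R where
  bracket _ _ := 0
  add_lie _ _ _ := (add_zero 0).symm
  lie_add _ _ _ := (add_zero 0).symm
  leibniz_lie _ _ _ := (add_zero 0).symm

instance [LieAlgebra k M] : LieAlgebra k (Abelian M) :=
  { (inferInstance : Module k (Abelian M)) with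
    lie_smul := fun t _ _ => (smul_zero (A := Abelian M) t).symm }

instance [Module R M] : LieRinehartRing R (Abelian M) where
  lie_smul_eq_mul' a _ _ := (mul_zero a).symm
  leibniz_mul_right' _ a b := by
    change (0 : R) = a • (0 : R) + 0 * b
    simp
  leibniz_smul_right' _ y a := by
    change (0 : Abelian M) = a • (0 : Abelian M) + (0 : R) • y
    simp

instance [Module R M] [LieAlgebra k M] [IsScalarTower k R M] :
    LieRinehartAlgebra k R (Abelian M) where
  smul_assoc := IsScalarTower.smul_assoc (M := k) (N := R) (α := M)
  smul_lie t _ _ := (smul_zero t).symm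
  lie_smul t _ _ := (smul_zero t).symm

end Abelian

namespace LieAlgebroid

/-- The underlying sheaf of `O`-modules of a Lie algebroid. -/
def toPMod (L : LieAlgebroid O) : PMod O where
  obj := L.obj
  res h := (L.res h).toLinearMap'
  res_refl := L.res_refl
  res_res := L.res_res

/-- The Lie algebroid with the same underlying sheaf of modules, and with bracket and anchor equal
to zero. -/
def abelian (L : LieAlgebroid O) : LieAlgebroid O where
  obj U := Abelian (L.obj U)
  res h :=
    { toFun := L.res h
      map_add' := map_add (L.res h).toLieHom
      map_smul' := map_smul (L.res h).toLieHom
      map_lie' := fun {_ _} => map_zero (L.res h).toLieHom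
      map_smul_apply' := (L.res h).map_smul_apply'
      apply_lie' := fun _ _ => map_zero (rsA O h) }
  res_refl := L.res_refl
  res_res := L.res_res
  isSheaf := L.isSheaf

variable (L : LieAlgebroid O)

/-- The universal enveloping algebra of `(O(U), L(U))`. -/
abbrev UE (U : Opens X) : Type u := UEA (Sec O U) (L.obj U)

/-- Restriction of sections of the presheaf of enveloping algebras. -/
abbrev ures {U V : Opens X} (h : V ≤ U) : L.UE U →+* L.UE V := UEA.map (L.res h)

variable {L} in
lemma ures_refl {U : Opens X} (D : L.UE U) : L.ures (le_refl U) D = D := by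
  induction D using UEA.induction with
  | hR r => rw [UEA.map_ιR]; exact congrArg _ (rs_refl r)
  | hL x => rw [UEA.map_ιL, L.res_refl]
  | hadd a b ha hb => rw [map_add, ha, hb]
  | hmul a b ha hb => rw [map_mul, ha, hb]

variable {L} in
lemma ures_ures {U V W : Opens X} (h : V ≤ U) (h' : W ≤ V) (D : L.UE U) :
    L.ures h' (L.ures h D) = L.ures (h'.trans h) D := by
  induction D using UEA.induction with
  | hR r => rw [UEA.map_ιR, UEA.map_ιR, UEA.map_ιR]; exact congrArg _ (rs_rs h h' r)
  | hL x => rw [UEA.map_ιL, UEA.map_ιL, UEA.map_ιL, L.res_res]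
  | hadd a b ha hb => simp only [map_add, ha, hb]
  | hmul a b ha hb => simp only [map_mul, ha, hb]

/-- The presheaf of universal enveloping algebras of a Lie algebroid, as a presheaf of `O`-modules
for the left module structure. -/
abbrev UEmod : PMod O where
  obj := L.UE
  res h := UEA.mapₛ (L.res h)
  res_refl := ures_refl
  res_res := ures_ures

/-- The jet algebra `J(L)`: its sections over `U` are the `O`-linear morphisms, for the left module
  structure, from the enveloping algebra of `L|U` to `O|U`. (Morphisms from the presheaf of enveloping
algebras to the sheaf `O` are the same as morphisms from its associated sheaf.) -/
def Jet (U : Opens X) : Type u := PMod.Hom L.UEmod (PMod.unit O) U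

end LieAlgebroid

namespace Jet

variable {L : LieAlgebroid O} {U V W : Opens X}

instance : AddCommGroup (L.Jet U) := inferInstanceAs (AddCommGroup (PMod.Hom _ _ U))

/-- The value of a jet on an element of the enveloping algebra. -/
def app (φ : L.Jet U) (h : V ≤ U) : L.UE V →ₗ[Sec O V] Sec O V := PMod.Hom.app φ h

lemma app_res (φ : L.Jet U) (h : V ≤ U) (h' : W ≤ V) (D : L.UE V) :
    app φ (h'.trans h) (L.ures h' D) = rs O h' (app φ h D) := PMod.Hom.app_res φ h h' D

/-- Construct a jet from its components. -/
def mk (f : ∀ {V : Opens X}, V ≤ U → (L.UE V →ₗ[Sec O V] Sec O V))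
    (hf : ∀ {V W : Opens X} (h : V ≤ U) (h' : W ≤ V) (D : L.UE V),
      f (h'.trans h) (L.ures h' D) = rs O h' (f h D)) : L.Jet U :=
  PMod.Hom.mk (G := PMod.unit O) f hf

@[simp] lemma mk_app (f : ∀ {V : Opens X}, V ≤ U → (L.UE V →ₗ[Sec O V] Sec O V)) (hf)
    (h : V ≤ U) : app (mk f hf : L.Jet U) h = f h := rfl

@[ext] lemma ext {φ ψ : L.Jet U}
    (h : ∀ (V : Opens X) (hV : V ≤ U) D, app φ hV D = app ψ hV D) : φ = ψ :=
  PMod.Hom.ext h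

@[simp] lemma add_app (φ ψ : L.Jet U) (h : V ≤ U) : app (φ + ψ) h = app φ h + app ψ h := rfl
@[simp] lemma zero_app (h : V ≤ U) : app (0 : L.Jet U) h = 0 := rfl

/-- The second `U(L)`-module structure on jets: `(D φ)(E) = φ(E D)`. -/
instance : Module (L.UE U) (L.Jet U) where
  smul D φ := mk
    (fun h => (app φ h).comp
      (UEA.mulRight (L.ures h D)))
    fun h h' E => by
      change app φ _ (L.ures h' E * L.ures _ D) = rs O h' (app φ h (E * L.ures h D))
      rw [← app_res, map_mul (L.ures h'), LieAlgebroid.ures_ures]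
  one_smul φ := by
    ext V h E; change app φ h (E * L.ures h 1) = _; rw [map_one, mul_one]
  mul_smul D D' φ := by
    ext V h E
    change app φ h (E * L.ures h (D * D')) = app φ h (E * L.ures h D * L.ures h D')
    rw [map_mul (L.ures h), mul_assoc]
  smul_zero D := rfl
  smul_add D φ ψ := rfl
  add_smul D D' φ := by
    ext V h E
    change app φ h (E * L.ures h (D + D')) = app φ h (E * L.ures h D) + app φ h (E * L.ures h D')
    rw [map_add, mul_add, map_add]
  zero_smul φ := by
    ext V h E; change app φ h (E * L.ures h 0) = 0; rw [map_zero, mul_zero, map_zero]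

lemma smul_app (D : L.UE U) (φ : L.Jet U) (h : V ≤ U) (E : L.UE V) :
    app (D • φ) h E = app φ h (E * L.ures h D) := rfl

/-- The second `O`-module structure on jets: `(r φ)(E) = φ(E r)`. -/
instance : Module (Sec O U) (L.Jet U) := Module.compHom _ (UEA.ιR (L.obj U))

lemma ring_smul_app (r : Sec O U) (φ : L.Jet U) (h : V ≤ U) (E : L.UE V) :
    app (r • φ) h E = app φ h (E * UEA.ιR _ (rs O h r)) :=
  congrArg (fun D => app φ h (E * D)) (UEA.map_ιR (L.res h) r)

instance : IsScalarTower (Sec O U) (L.UE U) (L.Jet U) :=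
  ⟨fun r D φ => mul_smul (UEA.ιR _ r) D φ⟩

/-- Restriction of jets. -/
def restrict (h : V ≤ U) (φ : L.Jet U) : L.Jet V := PMod.Hom.restrict h φ

end Jet

end Algebroids

section Sheafification

variable {K : Type u} [Field K] {X : TopCat.{u}} {O : TopCat.Sheaf (CommAlgCat.{u} K) X}

/-- The open neighbourhoods of a point. -/
structure Nhd (x : X) : Type u where
  set : Opens X
  mem : x ∈ set

/-- Neighbourhoods are ordered by reverse inclusion. -/
instance (x : X) : Preorder (Nhd x) where
  le V W := W.set ≤ V.set
  le_refl V := le_refl V.set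
  le_trans _ _ _ h h' := le_trans h' h

instance (x : X) : IsDirectedOrder (Nhd x) :=
  ⟨fun a b => ⟨⟨a.set ⊓ b.set, a.mem, b.mem⟩, fun _ h => h.1, fun _ h => h.2⟩⟩

instance (x : X) : Nonempty (Nhd x) := ⟨⟨⊤, trivial⟩⟩

namespace PMod

/-- The restriction maps between neighbourhoods of a point. -/
def nhdRes (F : PMod O) (x : X) (V W : Nhd x) (h : V ≤ W) : F.obj V.set →+ F.obj W.set :=
  (F.res h).toAddMonoidHom

instance (F : PMod O) (x : X) :
    DirectedSystem (fun V : Nhd x => F.obj V.set) (F.nhdRes x · · ·) where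
  map_self _ m := F.res_refl m
  map_map _ _ _ _ _ m := F.res_res _ _ m

/-- The stalk of a presheaf at a point. -/
abbrev Stalk (F : PMod O) (x : X) : Type u := DirectLimit (fun V : Nhd x => F.obj V.set) (F.nhdRes x)

variable {F G P : PMod O} {U V W : Opens X}

/-- The germ at `x` of a section. -/
def germ {x : X} (hx : x ∈ V) : F.obj V →+ F.Stalk x where
  toFun m := (⟦⟨(⟨V, hx⟩ : Nhd x), m⟩⟧ : DirectLimit (fun V : Nhd x => F.obj V.set) (F.nhdRes x))
  map_zero' := (DirectLimit.zero_def (f := F.nhdRes x) _).symm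
  map_add' m n := (DirectLimit.add_def (f := F.nhdRes x) (⟨V, hx⟩ : Nhd x) m n).symm

lemma germ_res {x : X} (h : W ≤ V) (hx : x ∈ W) (m : F.obj V) :
    germ hx (F.res h m) = germ (h hx) m :=
  (DirectLimit.eq_of_le (f := F.nhdRes x) (⟨⟨V, h hx⟩, m⟩ : Σ V : Nhd x, F.obj V.set)
    (⟨W, hx⟩ : Nhd x) h).symm

lemma exists_germ {x : X} (s : F.Stalk x) : ∃ (V : Opens X) (hx : x ∈ V) (m : F.obj V),
    s = germ hx m := by
  obtain ⟨V, m, h⟩ := DirectLimit.exists_eq_mk (F.nhdRes x) s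
  exact ⟨V.set, V.mem, m, h⟩

/-- A biadditive pairing of presheaves `P × F → G`. -/
structure Pairing (P F G : PMod O) where
  app (U : Opens X) : P.obj U →+ F.obj U →+ G.obj U
  app_res {U V : Opens X} (h : V ≤ U) (p : P.obj U) (m : F.obj U) :
    app V (P.res h p) (F.res h m) = G.res h (app U p m)

/-- The map induced on stalks by a pairing of presheaves. -/
def Pairing.stalk (β : Pairing P F G) (x : X) (p : P.Stalk x) (s : F.Stalk x) : G.Stalk x :=
  DirectLimit.map₂ (P.nhdRes x) (F.nhdRes x) (G.nhdRes x)
    (fun V p m => β.app V.set p m)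
    (fun _ _ _ p m => (β.app_res _ p m).symm) p s

lemma Pairing.stalk_germ (β : Pairing P F G) {x : X} (hx : x ∈ V) (p : P.obj V) (m : F.obj V) :
    β.stalk x (germ hx p) (germ hx m) = germ hx (β.app V p m) :=
  DirectLimit.map₂_def (F₁ := fun V : Nhd x => P.obj V.set) (F₂ := fun V : Nhd x => F.obj V.set)
    (F := fun V : Nhd x => G.obj V.set) (P.nhdRes x) (F.nhdRes x) (G.nhdRes x)
    (fun V p m => β.app V.set p m) (fun _ _ _ p m => (β.app_res _ p m).symm) ⟨V, hx⟩ p m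

lemma Pairing.stalk_germ' (β : Pairing P F G) {x : X} (hx : x ∈ V) (hx' : x ∈ W) (p : P.obj V)
    (m : F.obj W) : β.stalk x (germ hx p) (germ hx' m)
      = germ (V := V ⊓ W) (show x ∈ V ⊓ W from ⟨hx, hx'⟩) (β.app (V ⊓ W) (P.res inf_le_left p) (F.res inf_le_right m)) := by
  rw [← stalk_germ, germ_res, germ_res]

lemma Pairing.stalk_add_left (β : Pairing P F G) {x : X} (p q : P.Stalk x) (s : F.Stalk x) :
    β.stalk x (p + q) s = β.stalk x p s + β.stalk x q s := by
  obtain ⟨V, hV, p, rfl⟩ := exists_germ p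
  obtain ⟨V', hV', q, rfl⟩ := exists_germ q
  obtain ⟨W, hW, m, rfl⟩ := exists_germ s
  have h : x ∈ V ⊓ V' ⊓ W := ⟨⟨hV, hV'⟩, hW⟩
  rw [← germ_res (inf_le_left.trans inf_le_left : V ⊓ V' ⊓ W ≤ V) h p,
    ← germ_res (inf_le_left.trans inf_le_right : V ⊓ V' ⊓ W ≤ V') h q,
    ← germ_res (inf_le_right : V ⊓ V' ⊓ W ≤ W) h m, ← map_add (germ (F := P) h)]
  rw [stalk_germ, stalk_germ, stalk_germ, map_add (β.app _), AddMonoidHom.add_apply, map_add]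

lemma Pairing.stalk_add_right (β : Pairing P F G) {x : X} (p : P.Stalk x) (s t : F.Stalk x) :
    β.stalk x p (s + t) = β.stalk x p s + β.stalk x p t := by
  obtain ⟨V, hV, p, rfl⟩ := exists_germ p
  obtain ⟨V', hV', m, rfl⟩ := exists_germ s
  obtain ⟨W, hW, n, rfl⟩ := exists_germ t
  have h : x ∈ V ⊓ V' ⊓ W := ⟨⟨hV, hV'⟩, hW⟩
  rw [← germ_res (inf_le_left.trans inf_le_left : V ⊓ V' ⊓ W ≤ V) h p,
    ← germ_res (inf_le_left.trans inf_le_right : V ⊓ V' ⊓ W ≤ V') h m,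
    ← germ_res (inf_le_right : V ⊓ V' ⊓ W ≤ W) h n, ← map_add (germ (F := F) h)]
  rw [stalk_germ, stalk_germ, stalk_germ, map_add (β.app _ _), map_add]

variable (F) in
/-- Scalar multiplication as a pairing. -/
def smulPairing : Pairing (unit O) F F where
  app U := AddMonoidHom.mk' (fun r => AddMonoidHom.mk' (fun m => (show Sec O U from r) • m)
    (fun m n => smul_add _ m n)) (fun r s => by ext m; exact add_smul _ _ m)
  app_res h r m := ((F.res h).map_smulₛₗ r m).symm

variable (F) in
/-- The sections over `U` of the sheaf associated to `F`: the families of germs which are locally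
given by sections of `F`. -/
def shSections (U : Opens X) : AddSubgroup ((x : U) → F.Stalk x.1) where
  carrier := {s | ∀ x : U, ∃ (V : Opens X) (h : V ≤ U) (_ : x.1 ∈ V) (m : F.obj V),
    ∀ (y : X) (hy : y ∈ V), s ⟨y, h hy⟩ = germ hy m}
  add_mem' {s t} hs ht x := by
    obtain ⟨V, hV, hx, m, hm⟩ := hs x
    obtain ⟨W, hW, hx', n, hn⟩ := ht x
    refine ⟨V ⊓ W, inf_le_left.trans hV, ⟨hx, hx'⟩, F.res inf_le_left m + F.res inf_le_right n,
      fun y hy => ?_⟩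
    rw [map_add, germ_res, germ_res, ← hm y hy.1, ← hn y hy.2]; rfl
  zero_mem' x := ⟨U, le_rfl, x.2, 0, fun y hy => (map_zero (germ (F := F) hy)).symm⟩
  neg_mem' {s} hs x := by
    obtain ⟨V, hV, hx, m, hm⟩ := hs x
    refine ⟨V, hV, hx, -m, fun y hy => ?_⟩
    rw [map_neg, ← hm y hy]; rfl

variable (F) in
/-- The sections over `U` of the sheaf associated to `F`. -/
def ShObj (U : Opens X) : Type u := shSections F U

namespace ShObj

instance : AddCommGroup (ShObj F U) := inferInstanceAs (AddCommGroup (shSections F U))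

/-- Construct a section of the associated sheaf from a locally given family of germs. -/
def mk (s : (x : U) → F.Stalk x.1) (hs : ∀ x : U, ∃ (V : Opens X) (h : V ≤ U) (_ : x.1 ∈ V)
    (m : F.obj V), ∀ (y : X) (hy : y ∈ V), s ⟨y, h hy⟩ = germ hy m) : ShObj F U := ⟨s, hs⟩

lemma isLocal (s : ShObj F U) (x : U) : ∃ (V : Opens X) (h : V ≤ U) (_ : x.1 ∈ V)
    (m : F.obj V), ∀ (y : X) (hy : y ∈ V), s.1 ⟨y, h hy⟩ = germ hy m := s.2 x

@[ext] lemma ext {s t : ShObj F U} (h : ∀ x, s.1 x = t.1 x) : s = t := Subtype.ext (funext h)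

/-- The map from sections of a presheaf to sections of the associated sheaf. -/
def of (m : F.obj U) : ShObj F U :=
  mk (fun x => germ x.2 m) fun x => ⟨U, le_rfl, x.2, m, fun _ _ => rfl⟩

/-- The pairing of associated sheaves induced by a pairing of presheaves. -/
def pair (β : Pairing P F G) (p : ShObj P U) (s : ShObj F U) : ShObj G U :=
  mk (fun x => β.stalk x.1 (p.1 x) (s.1 x)) fun x => by
    obtain ⟨V, hV, hx, q, hq⟩ := p.isLocal x
    obtain ⟨W, hW, hx', m, hm⟩ := s.isLocal x
    refine ⟨V ⊓ W, inf_le_left.trans hV, ⟨hx, hx'⟩,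
      β.app _ (P.res inf_le_left q) (F.res inf_le_right m), fun y hy => ?_⟩
    rw [hq y hy.1, hm y hy.2, Pairing.stalk_germ']

lemma pair_add_right (β : Pairing P F G) (p : ShObj P U) (s t : ShObj F U) :
    pair β p (s + t) = pair β p s + pair β p t :=
  ext fun _ => β.stalk_add_right _ _ _

lemma pair_add_left (β : Pairing P F G) (p q : ShObj P U) (s : ShObj F U) :
    pair β (p + q) s = pair β p s + pair β q s :=
  ext fun _ => β.stalk_add_left _ _ _

/-- Restriction of sections of the associated sheaf. -/
def res (h : V ≤ U) (s : ShObj F U) : ShObj F V :=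
  mk (fun x => s.1 ⟨x.1, h x.2⟩) fun x => by
    obtain ⟨W, hW, hx, m, hm⟩ := s.isLocal ⟨x.1, h x.2⟩
    exact ⟨W ⊓ V, inf_le_right, ⟨hx, x.2⟩, F.res inf_le_left m, fun y hy => by
      rw [germ_res, ← hm y hy.1]⟩

instance : Module (Sec O U) (ShObj F U) where
  smul r s := pair (smulPairing F) (of (F := unit O) r) s
  one_smul s := by
    refine ext fun x => ?_
    change (smulPairing F).stalk _ (germ (F := unit O) x.2 (1 : Sec O U)) (s.1 x) = s.1 x
    obtain ⟨V, hV, m, hm⟩ := exists_germ (s.1 x)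
    have h : x.1 ∈ U ⊓ V := ⟨x.2, hV⟩
    rw [hm, Pairing.stalk_germ']
    change germ (F := F) h (rs O (inf_le_left : U ⊓ V ≤ U) 1 • F.res (inf_le_right : U ⊓ V ≤ V) m) = _
    rw [map_one, one_smul, germ_res]
  mul_smul r r' s := by
    refine ext fun x => ?_
    change (smulPairing F).stalk _ (germ (F := unit O) x.2 (r * r' : Sec O U)) (s.1 x) =
      (smulPairing F).stalk _ (germ (F := unit O) x.2 r)
        ((smulPairing F).stalk _ (germ (F := unit O) x.2 r') (s.1 x))
    obtain ⟨V, hV, m, hm⟩ := exists_germ (s.1 x)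
    have h : x.1 ∈ U ⊓ V := ⟨x.2, hV⟩
    rw [hm, ← germ_res inf_le_left h, ← germ_res inf_le_left h, ← germ_res inf_le_left h,
      ← germ_res inf_le_right h, Pairing.stalk_germ, Pairing.stalk_germ, Pairing.stalk_germ]
    change germ (F := F) h (rs O (inf_le_left : U ⊓ V ≤ U) (r * r') • F.res (inf_le_right : U ⊓ V ≤ V) m) =
      germ (F := F) h (rs O (inf_le_left : U ⊓ V ≤ U) r • rs O (inf_le_left : U ⊓ V ≤ U) r' • F.res (inf_le_right : U ⊓ V ≤ V) m)
    rw [map_mul, mul_smul]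
  smul_add r s t := pair_add_right _ _ _ _
  smul_zero r := by
    have h := pair_add_right (smulPairing F) (of (F := unit O) r) (0 : ShObj F U) 0
    rw [add_zero] at h
    exact left_eq_add.mp h
  add_smul r r' s := by
    refine Eq.trans ?_ (pair_add_left _ _ _ _)
    exact congrArg (pair _ · s) (ext fun x => map_add (germ (F := unit O) x.2) r r')
  zero_smul s := by
    refine ext fun x => ?_
    change (smulPairing F).stalk _ (germ (F := unit O) x.2 (0 : Sec O U)) (s.1 x) = 0
    obtain ⟨V, hV, m, hm⟩ := exists_germ (s.1 x)
    have h : x.1 ∈ U ⊓ V := ⟨x.2, hV⟩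
    rw [hm, Pairing.stalk_germ']
    change germ (F := F) h (rs O (inf_le_left : U ⊓ V ≤ U) 0 • F.res (inf_le_right : U ⊓ V ≤ V) m) = _
    rw [map_zero, zero_smul, map_zero]

lemma smul_def (r : Sec O U) (s : ShObj F U) :
    r • s = pair (smulPairing F) (of (F := unit O) r) s := rfl

lemma res_pair (β : Pairing P F G) (h : V ≤ U) (p : ShObj P U) (s : ShObj F U) :
    res h (pair β p s) = pair β (res h p) (res h s) := rfl

lemma res_of (h : V ≤ U) (m : F.obj U) : res h (of m) = of (F.res h m) :=
  ext fun x => (germ_res h x.2 m).symm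

end ShObj

/-- The sheaf of `O`-modules associated to a presheaf of `O`-modules. -/
def sh (F : PMod O) : PMod O where
  obj := ShObj F
  res h :=
    { toFun := ShObj.res h
      map_add' := fun _ _ => rfl
      map_smul' := fun r s => by
        rw [ShObj.smul_def, ShObj.smul_def, ShObj.res_pair, ShObj.res_of]; rfl }
  res_refl _ := rfl
  res_res _ _ _ := rfl

/-- The canonical morphism from a presheaf to the associated sheaf. -/
def toSh (F : PMod O) (U : Opens X) : F.obj U →ₗ[Sec O U] F.sh.obj U where
  toFun := ShObj.of
  map_add' m n := ShObj.ext fun x => map_add (germ x.2) m n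
  map_smul' r m := ShObj.ext fun x => ((smulPairing F).stalk_germ x.2 r m).symm

/-- The pairing of associated sheaves induced by a pairing of presheaves. -/
def Pairing.sh (β : Pairing P F G) : Pairing P.sh F.sh G.sh where
  app U := AddMonoidHom.mk' (fun p => AddMonoidHom.mk' (fun s => ShObj.pair β p s)
    (ShObj.pair_add_right β p)) (fun p q => by ext s; exact ShObj.pair_add_left β p q s)
  app_res _ _ _ := rfl

lemma Pairing.sh_toSh (β : Pairing P F G) (p : P.obj U) (m : F.obj U) :
    β.sh.app U (P.toSh U p) (F.toSh U m) = G.toSh U (β.app U p m) :=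
  ShObj.ext fun x => β.stalk_germ x.2 p m

lemma Pairing.sh_smul (β : Pairing P F G)
    (h : ∀ (V : Opens X) (p : P.obj V) (r : Sec O V) (m : F.obj V),
      β.app V p (r • m) = r • β.app V p m) (p : P.sh.obj U) (r : Sec O U) (s : F.sh.obj U) :
    β.sh.app U p (r • s) = r • β.sh.app U p s := by
  refine ShObj.ext fun x => ?_
  change β.stalk _ (p.1 x) ((smulPairing F).stalk _ (germ (F := unit O) x.2 r) (s.1 x)) =
    (smulPairing G).stalk _ (germ (F := unit O) x.2 r) (β.stalk _ (p.1 x) (s.1 x))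
  obtain ⟨V, hV, m, hm⟩ := exists_germ (s.1 x)
  obtain ⟨W, hW, q, hq⟩ := exists_germ (p.1 x)
  have hx : x.1 ∈ U ⊓ V ⊓ W := ⟨⟨x.2, hV⟩, hW⟩
  rw [hm, hq, ← germ_res (inf_le_left.trans inf_le_left : U ⊓ V ⊓ W ≤ U) hx,
    ← germ_res (inf_le_left.trans inf_le_right : U ⊓ V ⊓ W ≤ V) hx,
    ← germ_res (inf_le_right : U ⊓ V ⊓ W ≤ W) hx, Pairing.stalk_germ, Pairing.stalk_germ,
    Pairing.stalk_germ, Pairing.stalk_germ]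
  exact congrArg (germ hx) (h _ _ _ _)

instance (F : PMod O) (U : Opens X) : Module K (F.sh.obj U) :=
  Module.compHom _ (algebraMap K (Sec O U))

instance (F : PMod O) (U : Opens X) : IsScalarTower K (Sec O U) (F.sh.obj U) :=
  ⟨fun c r s => by rw [Algebra.smul_def, mul_smul]; rfl⟩

end PMod

end Sheafification

section TwistedJets

variable {K : Type u} [Field K] {X : TopCat.{u}} {O : TopCat.Sheaf (CommAlgCat.{u} K) X}

namespace Jet

variable {L : LieAlgebroid O} {U V W : Opens X}

/-- Evaluation of `φ ⊗ ψ` on `U(L) ⊗ U(L)`: `D ⊗ E ↦ φ(D) ψ(E)`. -/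
def evalTwo {R L : Type u} [CommRing R] [LieRing L] [Module R L] [LieRingModule L R]
    (φ ψ : UEA R L →ₗ[R] R) : UEA R L ⊗[R] UEA R L →ₗ[R] R :=
  LinearMap.mul' R R ∘ₗ TensorProduct.map φ ψ

/-- The product of jets: `(φ ψ)(D) = φ(D₍₁₎) ψ(D₍₂₎)`. -/
def mul (φ ψ : L.Jet U) : L.Jet U :=
  mk (fun {V} h => evalTwo (app φ h) (app ψ h) ∘ₗ UEA.comul (Sec O V) (L.obj V))
    fun {V W} h h' D => by
      change evalTwo (app φ _) (app ψ _) (UEA.comul _ _ (L.ures h' D)) =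
        rs O h' (evalTwo (app φ h) (app ψ h) (UEA.comul _ _ D))
      rw [← UEA.map_comul]
      generalize UEA.comul (Sec O V) (L.obj V) D = t
      induction t with
      | zero => simp
      | tmul a b =>
        rw [TensorProduct.map_tmul]
        change app φ _ (L.ures h' a) * app ψ _ (L.ures h' b) = rs O h' (app φ h a * app ψ h b)
        rw [app_res φ h h', app_res ψ h h', map_mul]
      | add s t hs ht => simp only [map_add, hs, ht]

lemma mul_app (φ ψ : L.Jet U) (h : V ≤ U) (D : L.UE V) :
    app (mul φ ψ) h D = evalTwo (app φ h) (app ψ h) (UEA.comul _ _ D) := rfl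

lemma add_mul (φ φ' ψ : L.Jet U) : mul (φ + φ') ψ = mul φ ψ + mul φ' ψ := by
  ext V h D
  simp only [mul_app, add_app, LinearMap.add_apply, evalTwo, TensorProduct.map_add_left,
    LinearMap.comp_add]

lemma mul_add (φ ψ ψ' : L.Jet U) : mul φ (ψ + ψ') = mul φ ψ + mul φ ψ' := by
  ext V h D
  simp only [mul_app, add_app, LinearMap.add_apply, evalTwo, TensorProduct.map_add_right,
    LinearMap.comp_add]

lemma smul_mul (r : Sec O U) (φ ψ : L.Jet U) : mul (r • φ) ψ = r • mul φ ψ := by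
  ext V h D
  rw [ring_smul_app, mul_app, mul_app, UEA.comul_mul_ιR_left]
  generalize UEA.comul (Sec O V) (L.obj V) D = t
  induction t with
  | zero => simp
  | tmul a b => exact congrArg (· * app ψ h b) (ring_smul_app r φ h a)
  | add s t hs ht => simp only [map_add, hs, ht]

lemma mul_smul' (r : Sec O U) (φ ψ : L.Jet U) : mul φ (r • ψ) = r • mul φ ψ := by
  ext V h D
  rw [ring_smul_app, mul_app, mul_app, UEA.comul_mul_ιR_right]
  generalize UEA.comul (Sec O V) (L.obj V) D = t
  induction t with
  | zero => simp
  | tmul a b => exact congrArg (app φ h a * ·) (ring_smul_app r ψ h b)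
  | add s t hs ht => simp only [map_add, hs, ht]

/-- Multiplication by `φ`, which is linear for the second `O`-module structure. -/
def mulLeft (φ : L.Jet U) : L.Jet U →ₗ[Sec O U] L.Jet U where
  toFun := mul φ
  map_add' := mul_add φ
  map_smul' r ψ := mul_smul' r φ ψ

/-- The first `O`-module structure on jets: `(r φ)(D) = r φ(D)`. -/
def smul₁ (r : Sec O U) : L.Jet U →ₗ[Sec O U] L.Jet U where
  toFun φ := mk (fun h => rs O h r • app φ h) fun h h' D => by
    rw [LinearMap.smul_apply, LinearMap.smul_apply, app_res φ h h', smul_eq_mul, smul_eq_mul,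
      map_mul, rs_rs]
  map_add' φ ψ := by ext V h D; exact smul_add (rs O h r) _ _
  map_smul' s φ := by
    ext V h D
    rw [RingHom.id_apply, ring_smul_app, mk_app, mk_app, LinearMap.smul_apply,
      LinearMap.smul_apply, ring_smul_app]

lemma smul₁_app (r : Sec O U) (φ : L.Jet U) (h : V ≤ U) (D : L.UE V) :
    app (smul₁ r φ) h D = rs O h r * app φ h D := rfl

lemma restrict_app (h : V ≤ U) (φ : L.Jet U) (h' : W ≤ V) :
    app (restrict h φ) h' = app φ (h'.trans h) := rfl

lemma restrict_smul (h : V ≤ U) (D : L.UE U) (φ : L.Jet U) :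
    restrict h (D • φ) = L.ures h D • restrict h φ := by
  ext W h' E
  rw [restrict_app, smul_app, smul_app, LieAlgebroid.ures_ures]; rfl

end Jet

namespace LieAlgebroid

variable (L : LieAlgebroid O)

/-- The jet algebra as a presheaf of modules for the second `O`-module structure. -/
abbrev JetMod : PMod O where
  obj := L.Jet
  res h :=
    { toFun := Jet.restrict h
      map_add' := fun _ _ => rfl
      map_smul' := fun r φ => by
        refine (Jet.restrict_smul h (UEA.ιR _ r) φ).trans ?_
        exact congrArg (· • Jet.restrict h φ) (UEA.map_ιR (L.res h) r) }
  res_refl _ := rfl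
  res_res _ _ _ := rfl

/-- The presheaf tensor product of `J(L)`, with its second `O`-module structure, and `E`. -/
abbrev preTwJet (E : PMod O) : PMod O := L.JetMod.tensor E

/-- The jets with coefficients `J(L; E)`: the tensor product of `J(L)`, with its second `O`-module
  structure, and `E` as a sheaf of `O`-modules. -/
abbrev TwJet (E : PMod O) : PMod O := (L.preTwJet E).sh

/-- The section `φ ⊗ e` of `J(L; E)`. -/
def twJet {E : PMod O} {U : Opens X} (φ : L.Jet U) (e : E.obj U) : (L.TwJet E).obj U :=
  (L.preTwJet E).toSh U (φ ⊗ₜ[Sec O U] e)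

/-- The action of `J(L)` on `J(L; E)`: `φ (ψ ⊗ e) = φ ψ ⊗ e`. -/
def jetPairing (E : PMod O) : PMod.Pairing L.JetMod (L.preTwJet E) (L.preTwJet E) where
  app U := AddMonoidHom.mk' (fun φ : L.Jet U =>
      (TensorProduct.map (Jet.mulLeft φ) LinearMap.id :
        L.Jet U ⊗[Sec O U] E.obj U →ₗ[Sec O U] L.Jet U ⊗[Sec O U] E.obj U).toAddMonoidHom)
    fun φ ψ => by
      refine UEA.end_tensor_ext fun χ e => ?_
      change Jet.mul (φ + ψ) χ ⊗ₜ[Sec O U] e = Jet.mul φ χ ⊗ₜ e + Jet.mul ψ χ ⊗ₜ e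
      rw [Jet.add_mul, add_tmul]
  app_res {U V} h φ t := by
    induction t using TensorProduct.induction_on with
    | zero => simp only [map_zero]
    | tmul ψ e => rfl
    | add s t hs ht => simp only [map_add, hs, ht]

/-- The action of `O` on `J(L; E)` through the first `O`-module structure of `J(L)`. -/
def smulPairing₁ (E : PMod O) : PMod.Pairing (PMod.unit O) (L.preTwJet E) (L.preTwJet E) where
  app U := AddMonoidHom.mk' (fun r : Sec O U =>
      (TensorProduct.map (Jet.smul₁ r) LinearMap.id :
        L.Jet U ⊗[Sec O U] E.obj U →ₗ[Sec O U] L.Jet U ⊗[Sec O U] E.obj U).toAddMonoidHom)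
    fun r s => by
      refine UEA.end_tensor_ext fun χ e => ?_
      change Jet.smul₁ (r + s) χ ⊗ₜ[Sec O U] e = Jet.smul₁ r χ ⊗ₜ e + Jet.smul₁ s χ ⊗ₜ e
      rw [← add_tmul]
      congr 1
      ext V h D
      rw [Jet.add_app, LinearMap.add_apply, Jet.smul₁_app, Jet.smul₁_app, Jet.smul₁_app, map_add,
        _root_.add_mul]
  app_res {U V} h r t := by
    induction t using TensorProduct.induction_on with
    | zero => simp only [map_zero]
    | tmul ψ e =>
      change Jet.smul₁ (rs O h r) (Jet.restrict h ψ) ⊗ₜ[Sec O V] E.res h e =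
        Jet.restrict h (Jet.smul₁ r ψ) ⊗ₜ[Sec O V] E.res h e
      congr 1
      ext W h' D
      rw [Jet.restrict_app, Jet.smul₁_app, Jet.smul₁_app, rs_rs]; rfl
    | add s t hs ht => simp only [map_add, hs, ht]

/-- Multiplication by a jet on `J(L; E)`. It is linear for the second `O`-module structure. -/
def jetAct {E : PMod O} {U : Opens X} (φ : L.Jet U) :
    Module.End (Sec O U) ((L.TwJet E).obj U) where
  toFun := (L.jetPairing E).sh.app U (L.JetMod.toSh U φ)
  map_add' := map_add _
  map_smul' r s := (L.jetPairing E).sh_smul (fun V (p : L.Jet V) r m =>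
    (TensorProduct.map (Jet.mulLeft p) LinearMap.id :
        L.Jet V ⊗[Sec O V] E.obj V →ₗ[Sec O V] L.Jet V ⊗[Sec O V] E.obj V).map_smul r m) _ r s

/-- The action of a function on `J(L; E)` for the first `O`-module structure. -/
def smulAct₁ {E : PMod O} {U : Opens X} (r : Sec O U) :
    (L.TwJet E).obj U →+ (L.TwJet E).obj U :=
  (L.smulPairing₁ E).sh.app U ((PMod.unit O).toSh U r)

end LieAlgebroid

end TwistedJets

section TwistedEnveloping

variable {K : Type u} [Field K] {X : TopCat.{u}} {O : TopCat.Sheaf (CommAlgCat.{u} K) X}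

/-- Restriction of sections of the dual, for the modules over the opposite rings. -/
def PMod.dualRes (E : PMod O) {U V : Opens X} (h : V ≤ U) :
    E.dual.obj U →ₛₗ[(rs O h).op] E.dual.obj V where
  toFun := E.dual.res h
  map_add' := map_add _
  map_smul' r f := (E.dual.res h).map_smulₛₗ r.unop f

namespace LieAlgebroid

variable (L : LieAlgebroid O) (E : PMod O)

/-- `U(L) ⊗ᵣ E^∨`, the tensor product with respect to the right `O`-module structure of `U(L)`; it
is a left `U(L)`-module and in particular a (left) `O`-module. -/
abbrev UEdual : PMod O where
  obj U := L.UE U ⊗[(Sec O U)ᵐᵒᵖ] E.dual.obj U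
  res h :=
    { toFun := TensorProduct.map (UEA.mapᵣ (L.res h)) (E.dualRes h)
      map_add' := map_add _
      map_smul' := fun r t => by
        induction t using TensorProduct.induction_on with
        | zero => simp only [smul_zero, map_zero]
        | tmul D f =>
          rw [smul_tmul', map_tmul, map_tmul, smul_tmul']
          congr 1
          exact (UEA.mapₛ (L.res h)).map_smulₛₗ r D
        | add s t hs ht => simp only [smul_add, map_add, hs, ht] }
  res_refl {U} t := by
    induction t using TensorProduct.induction_on with
    | zero => simp only [map_zero]
    | tmul D f => exact congrArg (· ⊗ₜ f) (ures_refl D)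
    | add s t hs ht => rw [map_add, hs, ht]
  res_res {U V W} h h' t := by
    induction t using TensorProduct.induction_on with
    | zero => simp only [map_zero]
    | tmul D f => exact congrArg (· ⊗ₜ E.dual.res (h'.trans h) f) (ures_ures h h' D)
    | add s t hs ht => simp only [map_add, hs, ht]

/-- The presheaf `E ⊗ₗ U(L) ⊗ᵣ E^∨`, an `O`-module through `E`. -/
abbrev preTwUE : PMod O := E.tensor (L.UEdual E)

/-- The presheaf tensor product of `J(L)`, with its second `O`-module structure, and
`U(L; E) = E ⊗ₗ U(L) ⊗ᵣ E^∨`. -/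
abbrev preJetUE : PMod O := L.JetMod.tensor (L.preTwUE E)

variable {L E} {U V : Opens X}

/-- The element `e ⊗ D ⊗ f` of `E ⊗ₗ U(L) ⊗ᵣ E^∨`. -/
def ueTmul (e : E.obj U) (D : L.UE U) (f : E.dual.obj U) : (L.preTwUE E).obj U :=
  e ⊗ₜ[Sec O U] (D ⊗ₜ[(Sec O U)ᵐᵒᵖ] f)

/-- The element `φ ⊗ e ⊗ D ⊗ f` of `J(L) ⊗ (E ⊗ₗ U(L) ⊗ᵣ E^∨)`. -/
def jueTmul (φ : L.Jet U) (e : E.obj U) (D : L.UE U) (f : E.dual.obj U) :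
    (L.preJetUE E).obj U :=
  φ ⊗ₜ[Sec O U] ueTmul e D f

/-- The map `ψ ⊗ w ↦ φ ψ ⊗ (e ⊗ w)`. -/
def jueInsert (φ : L.Jet U) (e : E.obj U) :
    L.Jet U ⊗[Sec O U] (L.UEdual E).obj U →ₗ[Sec O U] (L.preJetUE E).obj U :=
  TensorProduct.map (Jet.mulLeft φ) (TensorProduct.mk (Sec O U) (E.obj U) ((L.UEdual E).obj U) e)

/-- The map `ψ ⊗ (e ⊗ w) ↦ ψ ⊗ f(e) w`. -/
def jueContract (f : E.dual.obj U) :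
    (L.preJetUE E).obj U →ₗ[Sec O U] L.Jet U ⊗[Sec O U] (L.UEdual E).obj U :=
  TensorProduct.map LinearMap.id
    (TensorProduct.lift (LinearMap.lsmul (Sec O U) ((L.UEdual E).obj U) ∘ₗ PMod.ev f))

/-- Left multiplication by `φ ⊗ e ⊗ D ⊗ f`:
`ψ ⊗ e' ⊗ D' ⊗ f' ↦ φ D₍₁₎(ψ) ⊗ e ⊗ D₍₂₎ f(e') D' ⊗ f'`. -/
def jueMulLeft (φ : L.Jet U) (e : E.obj U) (D : L.UE U) (f : E.dual.obj U) :
    (L.preJetUE E).obj U →+ (L.preJetUE E).obj U :=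
  (jueInsert φ e).toAddMonoidHom.comp
    (AddMonoidHom.comp (UEA.tensorAct (L.Jet U) ((L.UEdual E).obj U) D)
      (jueContract f).toAddMonoidHom)

lemma jueMulLeft_tmul (φ : L.Jet U) (e : E.obj U) (D : L.UE U) (f : E.dual.obj U)
    (t : (L.preJetUE E).obj U) :
    jueMulLeft φ e D f t =
      jueInsert φ e (UEA.tensorAct (L.Jet U) ((L.UEdual E).obj U) D (jueContract f t)) := rfl

lemma jueInsert_add_left (φ φ' : L.Jet U) (e : E.obj U) :
    jueInsert (φ + φ') e = jueInsert φ e + jueInsert φ' e := by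
  refine TensorProduct.ext' fun ψ w => ?_
  exact (congrArg (· ⊗ₜ (e ⊗ₜ w)) (Jet.add_mul φ φ' ψ)).trans (add_tmul _ _ _)

lemma jueInsert_add_right (φ : L.Jet U) (e e' : E.obj U) :
    jueInsert φ (e + e') = jueInsert φ e + jueInsert φ e' := by
  refine TensorProduct.ext' fun ψ w => ?_
  exact (congrArg (Jet.mul φ ψ ⊗ₜ ·) (add_tmul e e' w)).trans (tmul_add _ _ _)

lemma jueInsert_smul_left (r : Sec O U) (φ : L.Jet U) (e : E.obj U) :
    jueInsert (r • φ) e = r • jueInsert φ e := by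
  refine TensorProduct.ext' fun ψ w => ?_
  exact congrArg (· ⊗ₜ (e ⊗ₜ w)) (Jet.smul_mul r φ ψ)

lemma jueInsert_smul_right (r : Sec O U) (φ : L.Jet U) (e : E.obj U) :
    jueInsert φ (r • e) = r • jueInsert φ e := by
  refine TensorProduct.ext' fun ψ w => ?_
  exact (congrArg (Jet.mul φ ψ ⊗ₜ ·) (smul_tmul' r e w).symm).trans (tmul_smul _ _ _)

lemma jueContract_add (f f' : E.dual.obj U) :
    jueContract (L := L) (f + f') = jueContract f + jueContract f' := by
  refine TensorProduct.ext' fun ψ t => ?_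
  induction t using TensorProduct.induction_on with
  | zero => simp only [tmul_zero, map_zero]
  | tmul e w =>
    exact (congrArg (ψ ⊗ₜ ·) (add_smul (PMod.ev f e) (PMod.ev f' e) w)).trans (tmul_add _ _ _)
  | add s t hs ht => simp only [tmul_add, map_add, hs, ht]

lemma jueContract_smul (r : Sec O U) (f : E.dual.obj U) :
    jueContract (L := L) (r • f) = r • jueContract f := by
  refine TensorProduct.ext' fun ψ t => ?_
  induction t using TensorProduct.induction_on with
  | zero => simp only [tmul_zero, map_zero]
  | tmul e w =>
    refine Eq.trans ?_ (tmul_smul r ψ _)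
    refine congrArg (ψ ⊗ₜ ·) ?_
    refine Eq.trans ?_ (mul_smul r (PMod.ev f e) w)
    exact congrArg (fun a : Sec O U => (a * PMod.ev f e) • w) (rs_refl r)
  | add s t hs ht => simp only [tmul_add, map_add, hs, ht]

lemma jueMulLeft_add_one (φ φ' : L.Jet U) (e : E.obj U) (D : L.UE U) (f : E.dual.obj U) :
    jueMulLeft (φ + φ') e D f = jueMulLeft φ e D f + jueMulLeft φ' e D f :=
  AddMonoidHom.ext fun _ => LinearMap.congr_fun (jueInsert_add_left φ φ' e) _

lemma jueMulLeft_add_two (φ : L.Jet U) (e e' : E.obj U) (D : L.UE U) (f : E.dual.obj U) :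
    jueMulLeft φ (e + e') D f = jueMulLeft φ e D f + jueMulLeft φ e' D f :=
  AddMonoidHom.ext fun _ => LinearMap.congr_fun (jueInsert_add_right φ e e') _

lemma jueMulLeft_add_three (φ : L.Jet U) (e : E.obj U) (D D' : L.UE U) (f : E.dual.obj U) :
    jueMulLeft φ e (D + D') f = jueMulLeft φ e D f + jueMulLeft φ e D' f :=
  AddMonoidHom.ext fun t => (congrArg (jueInsert φ e)
    (UEA.tensorAct_add D D' (jueContract f t))).trans (map_add (jueInsert φ e) _ _)

lemma jueMulLeft_add_four (φ : L.Jet U) (e : E.obj U) (D : L.UE U) (f f' : E.dual.obj U) :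
    jueMulLeft φ e D (f + f') = jueMulLeft φ e D f + jueMulLeft φ e D f' := by
  refine AddMonoidHom.ext fun t => ?_
  refine (congrArg (fun a => jueInsert φ e (UEA.tensorAct (L.Jet U) ((L.UEdual E).obj U) D a))
    (LinearMap.congr_fun (jueContract_add f f') t)).trans ?_
  exact (congrArg (jueInsert φ e) (map_add (UEA.tensorAct (L.Jet U) ((L.UEdual E).obj U) D)
    (jueContract f t) (jueContract f' t))).trans (map_add (jueInsert φ e) _ _)

lemma jueMulLeft_smul_dual (φ : L.Jet U) (e : E.obj U) (r : Sec O U) (D : L.UE U)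
    (f : E.dual.obj U) :
    jueMulLeft φ e (D * UEA.ιR (L.obj U) r) f = jueMulLeft φ e D (r • f) := by
  refine AddMonoidHom.ext fun t => ?_
  refine congrArg (jueInsert φ e) ?_
  refine (UEA.tensorAct_mul D _ (jueContract f t)).trans ?_
  refine congrArg (UEA.tensorAct (L.Jet U) ((L.UEdual E).obj U) D) ?_
  exact (UEA.tensorAct_ιR r (jueContract f t)).trans
    (LinearMap.congr_fun (jueContract_smul r f) t).symm

lemma jueMulLeft_smul_mid (φ : L.Jet U) (e : E.obj U) (r : Sec O U) (D : L.UE U)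
    (f : E.dual.obj U) : jueMulLeft φ (r • e) D f = jueMulLeft φ e (r • D) f := by
  refine AddMonoidHom.ext fun t => ?_
  refine (LinearMap.congr_fun (jueInsert_smul_right r φ e) _).trans ?_
  refine ((jueInsert φ e).map_smul r _).symm.trans (congrArg (jueInsert φ e) ?_)
  exact ((UEA.tensorAct_mul _ D (jueContract f t)).trans (UEA.tensorAct_ιR r _)).symm

lemma jueMulLeft_smul_left (φ : L.Jet U) (e : E.obj U) (r : Sec O U) (D : L.UE U)
    (f : E.dual.obj U) : jueMulLeft (r • φ) e D f = jueMulLeft φ (r • e) D f :=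
  AddMonoidHom.ext fun _ => (LinearMap.congr_fun (jueInsert_smul_left r φ e) _).trans
    (LinearMap.congr_fun (jueInsert_smul_right r φ e) _).symm

/-- Left multiplication by `φ ⊗ e ⊗ w`, for `w` in `U(L) ⊗ᵣ E^∨`. -/
def jueMul₂ (φ : L.Jet U) (e : E.obj U) :
    (L.UEdual E).obj U →+ (L.preJetUE E).obj U →+ (L.preJetUE E).obj U :=
  liftAddHom
    (AddMonoidHom.mk' (fun D => AddMonoidHom.mk' (fun f => jueMulLeft φ e D f)
      (jueMulLeft_add_four φ e D))
      (fun D D' => AddMonoidHom.ext fun f => jueMulLeft_add_three φ e D D' f))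
    (fun r D f => jueMulLeft_smul_dual φ e r.unop D f)

lemma jueMul₂_ext {A : Type*} [AddCommGroup A] {a b : (L.UEdual E).obj U →+ A}
    (h : ∀ D f, a (D ⊗ₜ f) = b (D ⊗ₜ f)) (w : (L.UEdual E).obj U) : a w = b w := by
  induction w using TensorProduct.induction_on with
  | zero => exact (map_zero a).trans (map_zero b).symm
  | tmul D f => exact h D f
  | add s t hs ht => exact (map_add a s t).trans ((congrArg₂ _ hs ht).trans (map_add b s t).symm)

/-- Left multiplication by `φ ⊗ t`, for `t` in `E ⊗ₗ U(L) ⊗ᵣ E^∨`. -/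
def jueMul₁ (φ : L.Jet U) :
    (L.preTwUE E).obj U →+ (L.preJetUE E).obj U →+ (L.preJetUE E).obj U :=
  liftAddHom
    (AddMonoidHom.mk' (fun e => jueMul₂ φ e) (fun e e' => AddMonoidHom.ext fun w =>
      jueMul₂_ext (a := jueMul₂ φ (e + e')) (b := jueMul₂ φ e + jueMul₂ φ e')
        (fun D f => jueMulLeft_add_two φ e e' D f) w))
    (fun r e w => jueMul₂_ext (a := jueMul₂ φ (r • e))
      (b := (jueMul₂ φ e).comp (DistribSMul.toAddMonoidHom _ r))
      (fun D f => jueMulLeft_smul_mid φ e r D f) w)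

lemma jueMul₁_ext {A : Type*} [AddCommGroup A] {a b : (L.preTwUE E).obj U →+ A}
    (h : ∀ e D f, a (ueTmul e D f) = b (ueTmul e D f)) (w : (L.preTwUE E).obj U) : a w = b w := by
  induction w using TensorProduct.induction_on with
  | zero => exact (map_zero a).trans (map_zero b).symm
  | tmul e w =>
    exact jueMul₂_ext (a := a.comp (TensorProduct.mk (Sec O U) _ _ e).toAddMonoidHom)
      (b := b.comp (TensorProduct.mk (Sec O U) _ _ e).toAddMonoidHom) (h e) w
  | add s t hs ht => exact (map_add a s t).trans ((congrArg₂ _ hs ht).trans (map_add b s t).symm)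

variable (L E U) in
/-- The multiplication
`(φ ⊗ e ⊗ D ⊗ f) (ψ ⊗ e' ⊗ D' ⊗ f') = φ D₍₁₎(ψ) ⊗ e ⊗ D₍₂₎ f(e') D' ⊗ f'`. -/
def jueMul : (L.preJetUE E).obj U →+ (L.preJetUE E).obj U →+ (L.preJetUE E).obj U :=
  liftAddHom
    (AddMonoidHom.mk' (fun φ : L.Jet U => jueMul₁ φ) (fun φ φ' => AddMonoidHom.ext fun w =>
      jueMul₁_ext (a := jueMul₁ (φ + φ')) (b := jueMul₁ φ + jueMul₁ φ')
        (fun e D f => by rw [AddMonoidHom.add_apply]; exact jueMulLeft_add_one φ φ' e D f) w))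
    (fun r (φ : L.Jet U) w => jueMul₁_ext (a := jueMul₁ (r • φ))
      (b := (jueMul₁ φ).comp (DistribSMul.toAddMonoidHom _ r))
      (fun e D f => jueMulLeft_smul_left φ e r D f) w)

lemma jueMul_tmul (φ : L.Jet U) (e : E.obj U) (D : L.UE U) (f : E.dual.obj U) :
    jueMul L E U (jueTmul φ e D f) = jueMulLeft φ e D f := rfl

lemma jueMul_ext {A : Type*} [AddCommGroup A] {a b : (L.preJetUE E).obj U →+ A}
    (h : ∀ φ e D f, a (jueTmul φ e D f) = b (jueTmul φ e D f)) (w : (L.preJetUE E).obj U) :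
    a w = b w := by
  induction w using TensorProduct.induction_on with
  | zero => exact (map_zero a).trans (map_zero b).symm
  | tmul e w =>
    exact jueMul₁_ext (a := a.comp (TensorProduct.mk (Sec O U) _ _ e).toAddMonoidHom)
      (b := b.comp (TensorProduct.mk (Sec O U) _ _ e).toAddMonoidHom) (h e) w
  | add s t hs ht => exact (map_add a s t).trans ((congrArg₂ _ hs ht).trans (map_add b s t).symm)

lemma jueInsert_res (h : V ≤ U) (φ : L.Jet U) (e : E.obj U)
    (t : L.Jet U ⊗[Sec O U] (L.UEdual E).obj U) :
    jueInsert (Jet.restrict h φ) (E.res h e) ((L.JetMod.tensor (L.UEdual E)).res h t) =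
      (L.preJetUE E).res h (jueInsert φ e t) := by
  induction t using TensorProduct.induction_on with
  | zero => simp only [map_zero]
  | tmul ψ w => rfl
  | add s t hs ht => simp only [map_add, hs, ht]

lemma jueContract_res (h : V ≤ U) (f : E.dual.obj U) (t : (L.preJetUE E).obj U) :
    jueContract (E.dual.res h f) ((L.preJetUE E).res h t) =
      (L.JetMod.tensor (L.UEdual E)).res h (jueContract f t) := by
  induction t using TensorProduct.induction_on with
  | zero => simp only [map_zero]
  | tmul ψ w =>
    induction w using TensorProduct.induction_on with
    | zero => simp only [tmul_zero, map_zero]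
    | tmul e w =>
      refine congrArg (Jet.restrict h ψ ⊗ₜ[Sec O V] ·) ?_
      refine Eq.trans ?_ (((L.UEdual E).res h).map_smulₛₗ (PMod.ev f e) w).symm
      exact congrArg (fun a : Sec O V => a • (L.UEdual E).res h w)
        (PMod.Hom.app_res (G := PMod.unit O) f le_rfl h e)
    | add s t hs ht => simp only [tmul_add, map_add, hs, ht]
  | add s t hs ht => simp only [map_add, hs, ht]

lemma jueMulLeft_res (h : V ≤ U) (φ : L.Jet U) (e : E.obj U) (D : L.UE U) (f : E.dual.obj U)
    (t : (L.preJetUE E).obj U) :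
    jueMulLeft (Jet.restrict h φ) (E.res h e) (L.ures h D) (E.dual.res h f)
      ((L.preJetUE E).res h t) = (L.preJetUE E).res h (jueMulLeft φ e D f t) := by
  rw [jueMulLeft_tmul, jueMulLeft_tmul, ← jueInsert_res, jueContract_res]
  refine congrArg (jueInsert (Jet.restrict h φ) (E.res h e)) ?_
  refine (UEA.map_tensorAct (σ := rs O h) (L.ures h) (UEA.map_ιR (L.res h))
    (fun x => ⟨L.res h x, UEA.map_ιL (L.res h) x⟩) (L.JetMod.res h) ((L.UEdual E).res h)
    (fun D φ => Jet.restrict_smul h D φ) (fun D w => ?_) D (jueContract f t)).symm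
  induction w using TensorProduct.induction_on with
  | zero => simp only [smul_zero, map_zero]
  | tmul D' f => exact congrArg (· ⊗ₜ E.dual.res h f) (map_mul (L.ures h) D D')
  | add s t hs ht => simp only [smul_add, map_add, hs, ht]

variable (L E) in
/-- The multiplication of `J(L) ⊗ U(L; E)`, as a pairing of presheaves. -/
def juePairing : PMod.Pairing (L.preJetUE E) (L.preJetUE E) (L.preJetUE E) where
  app := jueMul L E
  app_res {U V} h s t := jueMul_ext
    (a := ((jueMul L E V).flip ((L.preJetUE E).res h t)).comp
      ((L.preJetUE E).res h).toAddMonoidHom)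
    (b := ((L.preJetUE E).res h).toAddMonoidHom.comp ((jueMul L E U).flip t))
    (fun φ e D f => jueMulLeft_res h φ e D f t) s

/-- The sheaf `J(L) ⊗ U(L; E)`, the tensor product being with respect to the second `O`-module
  structure of `J(L)`, for `U(L; E) = E ⊗ₗ U(L) ⊗ᵣ E^∨`. -/
abbrev JetUE (L : LieAlgebroid O) (E : PMod O) : PMod O := (L.preJetUE E).sh

/-- The section `φ ⊗ e ⊗ D ⊗ f` of `J(L) ⊗ U(L; E)`. -/
def jetUE (φ : L.Jet U) (e : E.obj U) (D : L.UE U) (f : E.dual.obj U) : (L.JetUE E).obj U :=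
  (L.preJetUE E).toSh U (jueTmul φ e D f)

/-- The multiplication of sections of `J(L) ⊗ U(L; E)`:
`(φ ⊗ e ⊗ D ⊗ f) (ψ ⊗ e' ⊗ D' ⊗ f') = φ D₍₁₎(ψ) ⊗ e ⊗ D₍₂₎ f(e') D' ⊗ f'`. -/
instance (L : LieAlgebroid O) (E : PMod O) (U : Opens X) : Mul ((L.JetUE E).obj U) :=
  ⟨fun s t => (juePairing L E).sh.app U s t⟩

end LieAlgebroid

end TwistedEnveloping

section PBW

variable {K : Type u} [Field K] {X : TopCat.{u}} {O : TopCat.Sheaf (CommAlgCat.{u} K) X}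

namespace LieAlgebroid

/-- An `L`-connection on a sheaf of `O`-modules `M`: a morphism of sheaves
`L ⊗ M → M`, `x ⊗ m ↦ ∇ₓ m`, which is `O`-linear in `x` and a derivation in `m`
(so that `∇ₓ` is `K`-linear, as the derivations `⁅x, ·⁆` of `O` are). -/
structure Connection (L : LieAlgebroid O) (M : PMod O) where
  nabla (U : Opens X) : L.obj U →+ M.obj U →+ M.obj U
  smul_nabla {U : Opens X} (r : Sec O U) (x : L.obj U) (m : M.obj U) :
    nabla U (r • x) m = r • nabla U x m
  leibniz {U : Opens X} (x : L.obj U) (r : Sec O U) (m : M.obj U) :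
    nabla U x (r • m) = r • nabla U x m + ⁅x, r⁆ • m
  nabla_res {U V : Opens X} (h : V ≤ U) (x : L.obj U) (m : M.obj U) :
    nabla V (L.res h x) (M.res h m) = M.res h (nabla U x m)

variable {L : LieAlgebroid O} {E : PMod O} {U V : Opens X}

/-- The operator `∇⁽²⁾ₓ ⊗ 1 + 1 ⊗ ∇ₓ` on `J(L) ⊗ E`, where `∇⁽²⁾ₓ φ = x φ` is the action of `x` on
jets through the second module structure: `(∇⁽²⁾ₓ φ)(D) = φ(D x)`. -/
def twNabla (nE : L.Connection E) (x : L.obj U) : (L.preTwJet E).obj U →+ (L.preTwJet E).obj U :=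
  liftAddHom
    (AddMonoidHom.mk' (fun φ : L.Jet U => AddMonoidHom.mk'
      (fun e => (UEA.ιL (Sec O U) x • φ) ⊗ₜ[Sec O U] e + φ ⊗ₜ[Sec O U] nE.nabla U x e)
      (fun e e' => by simp only [tmul_add, map_add]; abel))
      (fun φ φ' => by
        ext e
        simp only [smul_add, add_tmul, AddMonoidHom.mk'_apply, AddMonoidHom.add_apply]
        abel))
    (fun r φ e => by
      simp only [AddMonoidHom.mk'_apply, UEA.ιL_smul_smul, nE.leibniz, add_tmul, tmul_add,
        smul_tmul]
      abel)

/-- The powers `Dⁿ t`, evaluated on `(X₁, …, Xₙ)`, of the symmetrized connection `D` on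
`J(L) ⊗ Ŝym(L^∨) ⊗ E`:
`(D α)(X₀, …, Xₙ) = ∑ᵢ (∇_{Xᵢ} α)(X₀, …, X̂ᵢ, …, Xₙ)`, where
`(∇_Y α)(Y₁, …, Yₙ) = ∇_Y (α(Y₁, …, Yₙ)) - ∑ⱼ α(Y₁, …, ∇_Y Yⱼ, …, Yₙ)`. -/
def dpow (nL : L.Connection L.toPMod) (nE : L.Connection E) :
    (n : ℕ) → (L.preTwJet E).obj U → (Fin n → L.obj U) → (L.preTwJet E).obj U
  | 0, t, _ => t
  | n + 1, t, x => ∑ i : Fin (n + 1),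
      (twNabla nE (x i) (dpow nL nE n t (i.removeNth x)) - ∑ j : Fin n,
        dpow nL nE n t
          (Function.update (i.removeNth x) j (nL.nabla U (x i) (i.removeNth x j))))

/-- Evaluation of jets at `1 ∈ U(L)`: `φ ⊗ e ↦ φ(1) e`. -/
def evOne : (L.preTwJet E).obj U →ₗ[Sec O U] E.obj U :=
  TensorProduct.lift (LinearMap.lsmul (Sec O U) (E.obj U) ∘ₗ
    { toFun := fun φ : L.Jet U => Jet.app φ le_rfl 1
      map_add' := fun _ _ => rfl
      map_smul' := fun r φ => by
        rw [Jet.ring_smul_app, one_mul, rs_refl, ← mul_one (UEA.ιR _ r)]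
        exact (Jet.app φ le_rfl).map_smul r 1 })

lemma evOne_tmul (φ : L.Jet U) (e : E.obj U) :
    evOne (E := E) (φ ⊗ₜ[Sec O U] e) = Jet.app φ le_rfl 1 • e := rfl

/-- In the enveloping algebra of a Lie algebroid with zero anchor, functions are central. -/
lemma abelian_comm (D : L.abelian.UE U) (r : Sec O U) :
    D * UEA.ιR _ r = UEA.ιR _ r * D := by
  induction D using UEA.induction with
  | hR s => rw [← map_mul, ← map_mul, mul_comm]
  | hL x =>
    rw [UEA.ιL_mul_ιR]
    refine (congrArg (_ + ·) ?_).trans (add_zero _)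
    exact map_zero (UEA.ιR (L.abelian.obj U))
  | hadd a b ha hb => rw [add_mul, mul_add, ha, hb]
  | hmul a b ha hb => rw [mul_assoc, hb, ← mul_assoc, ha, mul_assoc]

/-- For a Lie algebroid with zero bracket and anchor (so that `U(L) = Sym(L)` and
`J(L) = Ŝym(L^∨)`): the pairing `(D, φ ⊗ e) ↦ φ(D) e` of `Sym(L)` with `Ŝym(L^∨) ⊗ E`. -/
def symPairing (L : LieAlgebroid O) (E : PMod O) :
    PMod.Pairing L.abelian.UEmod (L.abelian.preTwJet E) E where
  app U := AddMonoidHom.mk' (fun D : L.abelian.UE U => (TensorProduct.lift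
      (LinearMap.lsmul (Sec O U) (E.obj U) ∘ₗ
        { toFun := fun φ : L.abelian.Jet U => Jet.app φ le_rfl D
          map_add' := fun _ _ => rfl
          map_smul' := fun r φ => by
            rw [Jet.ring_smul_app, rs_refl, abelian_comm]
            exact (Jet.app φ le_rfl).map_smul r D })).toAddMonoidHom)
    fun D D' => by
      refine AddMonoidHom.ext fun t => ?_
      induction t using TensorProduct.induction_on with
      | zero => simp only [map_zero]
      | tmul φ e =>
        refine Eq.trans ?_ (add_smul (Jet.app φ le_rfl D) (Jet.app φ le_rfl D') e)
        exact congrArg (· • e) (map_add (Jet.app φ le_rfl) D D')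
      | add s t hs ht =>
        exact (map_add _ s t).trans ((congrArg₂ _ hs ht).trans (map_add _ s t).symm)
  app_res {U V} h D t := by
    induction t using TensorProduct.induction_on with
    | zero => simp only [map_zero]
    | tmul φ e =>
      refine Eq.trans ?_ ((E.res h).map_smulₛₗ (Jet.app φ le_rfl D) e).symm
      exact congrArg (· • E.res h e) (Jet.app_res φ le_rfl h D)
    | add s t hs ht => simp only [map_add, hs, ht]

lemma symPairing_tmul (D : L.abelian.UE U) (φ : L.abelian.Jet U) (e : E.obj U) :
    (symPairing L E).app U D (φ ⊗ₜ[Sec O U] e) = Jet.app φ le_rfl D • e := rfl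

/-- The product `X₁ ⋯ Xₙ` in `Sym(L)`. -/
def symProd {n : ℕ} (x : Fin n → L.obj U) : L.abelian.UE U :=
  (List.ofFn fun i => UEA.ιL (Sec O U) (show L.abelian.obj U from x i)).prod

/-- `⟨s, X₁ ⋯ Xₙ⟩`, for a section `s` of `Ŝym(L^∨) ⊗ E` and sections `X₁, …, Xₙ` of `L`, as a section
of `E` (that is, of its associated sheaf). -/
def symEval (s : (L.abelian.TwJet E).obj U) {n : ℕ} (x : Fin n → L.obj U) : E.sh.obj U :=
  (symPairing L E).sh.app U (L.abelian.UEmod.toSh U (symProd x)) s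

end LieAlgebroid

end PBW

section DifferentialOperators

/-- The endomorphisms `d` with `[φ₁, [φ₂, …, [φₙ, d] …]] = 0` for all `φ₁, …, φₙ` in a set of
endomorphisms, the multiplications by functions: the differential operators of order `< n`. -/
def OrderLT {A : Type*} [Ring A] (S : Set A) : ℕ → A → Prop
  | 0, d => d = 0
  | n + 1, d => ∀ φ ∈ S, OrderLT S n (φ * d - d * φ)

namespace OrderLT

variable {A : Type*} [Ring A] {S : Set A}

lemma zero (n : ℕ) : OrderLT S n 0 := by
  induction n with
  | zero => rfl
  | succ n ih => intro φ _; rwa [mul_zero, zero_mul, sub_zero]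

lemma succ {n : ℕ} {d : A} (h : OrderLT S n d) : OrderLT S (n + 1) d := by
  induction n generalizing d with
  | zero => rw [show d = 0 from h]; exact zero 1
  | succ n ih => exact fun φ hφ => ih (h φ hφ)

lemma mono {m n : ℕ} (hmn : m ≤ n) {d : A} (h : OrderLT S m d) : OrderLT S n d := by
  induction hmn with
  | refl => exact h
  | step _ ih => exact succ ih

lemma add {n : ℕ} {d d' : A} (h : OrderLT S n d) (h' : OrderLT S n d') :
    OrderLT S n (d + d') := by
  induction n generalizing d d' with
  | zero => rw [show d = 0 from h, show d' = 0 from h', add_zero]; rfl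
  | succ n ih =>
    intro φ hφ
    have e : φ * (d + d') - (d + d') * φ = (φ * d - d * φ) + (φ * d' - d' * φ) := by
      rw [mul_add, add_mul]; abel
    rw [e]
    exact ih (h φ hφ) (h' φ hφ)

lemma mul {m n : ℕ} {d d' : A} (h : OrderLT S m d) (h' : OrderLT S n d') :
    OrderLT S (m + n) (d * d') := by
  induction hN : m + n generalizing m n d d' with
  | zero =>
    obtain rfl : m = 0 := by omega
    rw [show d = 0 from h, zero_mul]; rfl
  | succ N ih =>
    rcases m with _ | m
    · rw [show d = 0 from h, zero_mul]; exact zero _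
    rcases n with _ | n
    · rw [show d' = 0 from h', mul_zero]; exact zero _
    intro φ hφ
    have e : φ * (d * d') - d * d' * φ = (φ * d - d * φ) * d' + d * (φ * d' - d' * φ) := by
      noncomm_ring
    rw [e]
    exact add (ih (h φ hφ) h' (by omega)) (ih h (h' φ hφ) (by omega))

lemma of_comm {d : A} (h : ∀ φ ∈ S, φ * d = d * φ) : OrderLT S 1 d :=
  fun φ hφ => sub_eq_zero.mpr (h φ hφ)

end OrderLT

variable {K : Type u} [Field K] {X : TopCat.{u}} {O : TopCat.Sheaf (CommAlgCat.{u} K) X}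

namespace LieAlgebroid

/-- The sheaf `Ŝym(L^∨) ⊗ E`, where `Ŝym(L^∨)` is the jet algebra of the Lie algebroid obtained from
`L` by putting the bracket and the anchor equal to zero. -/
abbrev SymMod (L : LieAlgebroid O) (E : PMod O) : PMod O := L.abelian.TwJet E

/-- The sections over `U` of `Diff_O(Ŝym(L^∨) ⊗ E)`: the families of `O`-linear endomorphisms of
  the sections over the open subsets of `U` which are compatible with restrictions and which are,
locally on `U`, differential operators of some finite order over `Ŝym(L^∨)`. -/
def Diff (L : LieAlgebroid O) (E : PMod O) (U : Opens X) :
    Subalgebra K ((W : Set.Iic U) → Module.End (Sec O W.1) ((L.SymMod E).obj W.1)) where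
  carrier := {d | (∀ (V W : Set.Iic U) (h : W.1 ≤ V.1) (s : (L.SymMod E).obj V.1),
      d W ((L.SymMod E).res h s) = (L.SymMod E).res h (d V s)) ∧
    ∀ x ∈ U, ∃ (V : Opens X) (_ : x ∈ V) (_ : V ≤ U) (k : ℕ), ∀ (W : Set.Iic U), W.1 ≤ V →
      OrderLT (Set.range fun φ : L.abelian.Jet W.1 => L.abelian.jetAct (E := E) φ) k (d W)}
  mul_mem' {d d'} hd hd' := by
    refine ⟨fun V W h s => ?_, fun x hx => ?_⟩
    · change d W (d' W _) = _
      rw [hd'.1 V W h, hd.1 V W h]; rfl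
    · obtain ⟨V, hxV, hV, k, hk⟩ := hd.2 x hx
      obtain ⟨V', hxV', _, k', hk'⟩ := hd'.2 x hx
      exact ⟨V ⊓ V', ⟨hxV, hxV'⟩, inf_le_left.trans hV, k + k', fun W hW =>
        (hk W (hW.trans inf_le_left)).mul (hk' W (hW.trans inf_le_right))⟩
  add_mem' {d d'} hd hd' := by
    refine ⟨fun V W h s => ?_, fun x hx => ?_⟩
    · change d W _ + d' W _ = _
      rw [hd.1 V W h, hd'.1 V W h, ← map_add]; rfl
    · obtain ⟨V, hxV, hV, k, hk⟩ := hd.2 x hx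
      obtain ⟨V', hxV', _, k', hk'⟩ := hd'.2 x hx
      exact ⟨V ⊓ V', ⟨hxV, hxV'⟩, inf_le_left.trans hV, k + k', fun W hW =>
        ((hk W (hW.trans inf_le_left)).mono (by omega)).add
          ((hk' W (hW.trans inf_le_right)).mono (by omega))⟩
  algebraMap_mem' c := by
    refine ⟨fun V W h s => ?_, fun x hx => ⟨U, hx, le_rfl, 1, fun W _ =>
      OrderLT.of_comm fun φ _ => (Algebra.commutes c φ).symm⟩⟩
    change algebraMap K (Sec O W.1) c • (L.SymMod E).res h s =
      (L.SymMod E).res h (algebraMap K (Sec O V.1) c • s)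
    refine Eq.trans ?_ (((L.SymMod E).res h).map_smulₛₗ (algebraMap K (Sec O V.1) c) s).symm
    exact congrArg (· • (L.SymMod E).res h s) ((rsA O h).commutes c).symm

variable {L : LieAlgebroid O} {E : PMod O} {U V W : Opens X}

namespace Diff

/-- The action of a differential operator over `U` on the sections over `V ⊆ U`. -/
def app (d : Diff L E U) (h : V ≤ U) : Module.End (Sec O V) ((L.SymMod E).obj V) := d.1 ⟨V, h⟩

/-- Restriction of differential operators. -/
def restrict (h : V ≤ U) (d : Diff L E U) : Diff L E V :=
  ⟨fun W => Diff.app d (W.2.trans h), fun V' W h' s => d.2.1 ⟨V'.1, V'.2.trans h⟩ ⟨W.1, W.2.trans h⟩ h' s,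
    fun x hx => by
      obtain ⟨V', hxV', _, k, hk⟩ := d.2.2 x (h hx)
      exact ⟨V' ⊓ V, ⟨hxV', hx⟩, inf_le_right, k, fun W hW =>
        hk ⟨W.1, W.2.trans h⟩ (hW.trans inf_le_left)⟩⟩

end Diff

/-- The elements of `F_k U(L)`: sums of elements `r x₁ ⋯ xⱼ` with `j ≤ k`, `r` in `O` and `xᵢ`
  in `L`. -/
def filt (L : LieAlgebroid O) (U : Opens X) (k : ℕ) : Submodule (Sec O U) (L.UE U) :=
  Submodule.span (Sec O U)
    {D | ∃ l : List (L.obj U), l.length ≤ k ∧ D = (l.map (UEA.ιL (Sec O U))).prod}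

/-- The condition `φ ∈ Iᵏ`, i.e. `φ(D) = 0` for `D ∈ F_j U(L)` with `j < k`. -/
def InIdeal (k : ℕ) (φ : L.Jet U) : Prop :=
  ∀ (V : Opens X) (h : V ≤ U) (j : ℕ), j < k → ∀ D ∈ L.filt V j, Jet.app φ h D = 0

/-- The sections over `U` of `U(L; E) = Hom^cont(J(L; E), E)`: the morphisms from `J(L; E)|U` to
`E|U` which are linear for the first `O`-module structure of `J(L; E)` and continuous for the
`I`-adic topology, i.e. which vanish, locally on `U`, on `Iᵏ J(L; E)` for some `k`. -/
def homConts (L : LieAlgebroid O) (E : PMod O) (U : Opens X) :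
    AddSubgroup ((W : Set.Iic U) → ((L.TwJet E).obj W.1 →+ E.obj W.1)) where
  carrier := {P | (∀ (V W : Set.Iic U) (h : W.1 ≤ V.1) (s : (L.TwJet E).obj V.1),
      P W ((L.TwJet E).res h s) = E.res h (P V s)) ∧
    (∀ (V : Set.Iic U) (r : Sec O V.1) (s : (L.TwJet E).obj V.1),
      P V (L.smulAct₁ r s) = r • P V s) ∧
    ∀ x ∈ U, ∃ (V : Opens X) (_ : x ∈ V) (_ : V ≤ U) (k : ℕ), ∀ (W : Set.Iic U), W.1 ≤ V →
      ∀ φ : L.Jet W.1, InIdeal k φ → ∀ e : E.obj W.1, P W (L.twJet φ e) = 0}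
  add_mem' {P Q} hP hQ := by
    refine ⟨fun V W h s => ?_, fun V r s => ?_, fun x hx => ?_⟩
    · change P W _ + Q W _ = _
      rw [hP.1 V W h, hQ.1 V W h, ← map_add]; rfl
    · change P V _ + Q V _ = _
      rw [hP.2.1, hQ.2.1, ← smul_add]; rfl
    · obtain ⟨V, hxV, hV, k, hk⟩ := hP.2.2 x hx
      obtain ⟨V', hxV', _, k', hk'⟩ := hQ.2.2 x hx
      refine ⟨V ⊓ V', ⟨hxV, hxV'⟩, inf_le_left.trans hV, k + k', fun W hW φ hφ e => ?_⟩
      change P W _ + Q W _ = 0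
      rw [hk W (hW.trans inf_le_left) φ (fun V h j hj => hφ V h j (by omega)) e,
        hk' W (hW.trans inf_le_right) φ (fun V h j hj => hφ V h j (by omega)) e, add_zero]
  zero_mem' := ⟨fun _ _ h _ => (map_zero (E.res h)).symm, fun _ r _ => (smul_zero r).symm,
    fun x hx => ⟨U, hx, le_rfl, 0, fun _ _ _ _ _ => rfl⟩⟩
  neg_mem' {P} hP := by
    refine ⟨fun V W h s => ?_, fun V r s => ?_, fun x hx => ?_⟩
    · change - P W _ = _
      rw [hP.1 V W h, ← map_neg]; rfl
    · change - P V _ = _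
      rw [hP.2.1, ← smul_neg]; rfl
    · obtain ⟨V, hxV, hV, k, hk⟩ := hP.2.2 x hx
      refine ⟨V, hxV, hV, k, fun W hW φ hφ e => ?_⟩
      change - P W _ = 0
      rw [hk W hW φ hφ e, neg_zero]

/-- The sections over `U` of `U(L; E) = Hom^cont(J(L; E), E)`. -/
def HomCont (L : LieAlgebroid O) (E : PMod O) (U : Opens X) : Type u := homConts L E U

namespace HomCont

instance : AddCommGroup (HomCont L E U) := inferInstanceAs (AddCommGroup (homConts L E U))

/-- The values on the sections over `V ⊆ U`. -/
def app (P : HomCont L E U) (h : V ≤ U) : (L.TwJet E).obj V →+ E.obj V := P.1 ⟨V, h⟩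

/-- Restriction to smaller open sets. -/
def restrict (h : V ≤ U) (P : HomCont L E U) : HomCont L E V :=
  ⟨fun W => P.app (W.2.trans h), fun V' W h' s => P.2.1 ⟨V'.1, V'.2.trans h⟩ ⟨W.1, W.2.trans h⟩ h' s,
    fun W r s => P.2.2.1 ⟨W.1, W.2.trans h⟩ r s,
    fun x hx => by
      obtain ⟨V', hxV', _, k, hk⟩ := P.2.2.2 x (h hx)
      exact ⟨V' ⊓ V, ⟨hxV', hx⟩, inf_le_right, k, fun W hW =>
        hk ⟨W.1, W.2.trans h⟩ (hW.trans inf_le_left)⟩⟩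

end HomCont

end LieAlgebroid

end DifferentialOperators

end LieAlg

end

/-! All three maps are fixed by formulas that mention no local choice, so the work is local. The
open sets over which `L` and `E` have frames cover `X` and are stable under shrinking
(`isLocalBasis_hasFrames`); `IsLocalBasis.PreEquiv.sh` and `IsLocalBasis.bijective_of_local` pass
from them to the associated sheaves.

Over such an open set the Poincaré-Birkhoff-Witt theorem (`UEA.pbw`) makes the ordered monomials a
basis of `U(L)` adapted to the filtration (`UEA.mem_fil_iff`). A jet is therefore an arbitrary
family of functions, its values on the monomials (`jetVal_bijective`), and a twisted jet is an
arbitrary family of sections of `E` (`twVal_bijective`).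

For (i), frames turn an element of `E ⊗ U(L) ⊗ E^∨` into a matrix over `U(L)`
(`ueMatrix_surjective`). The jets dual to the monomials read off the coefficients of its entries, so
the pairing is nondegenerate; a continuous morphism depends on finitely many of these values, and
they are the coefficients of a matrix inducing it (`exists_valPairing_eq`).

For (ii), if the values of `t` on monomials vanish below degree `n`, then `ev₁(Dⁿ t) / n!` on a
monomial of degree `n` is the value of `t` there (`IsFiltered.formMap_eq`). A map with this
triangular shape is bijective by successive approximation (`triangular_bijective`). The same applies
to the abelianization of `L` with zero connections, where the `n`-th power is `n!` times the pairing
with the product (`symPairing_symD_zeroConn`). So `j` matches the elements with equal symmetrized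
values; this relation (`Corr`) involves no frame, hence `j` glues.

For (iii), dividing also by `α!` turns the symmetrized values into a formal power series. The
Leibniz rule `symD_mul` makes this expansion a ring isomorphism from `J(L)` onto power series over
`O` (`jetSer_mul`) and `J(L; E)` a free module over them, linearly for the first `O`-structure.
Since jets of `L` and of its abelianization expand into the same ring, `j` matches the two kinds of
multiplication operators, hence also the differential operators. The algebra `J(L) ⊗ U(L; E)` acts
on `J(L; E)`, its product being composition (`jueOp_jueMul`). An operator of order `≤ k` on power
series is determined by its values on monomials of degree `≤ k` (`eq_zero_of_orderLT`), and the
matrix of values of the ordered monomials of `U(L)` of degree `≤ k` is invertible, being block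
triangular at the origin with diagonal entries `α!` (`isUnit_det_symbolMatrix`). Existence
(`exists_jueOp_eq`) and uniqueness (`eq_zero_of_jueOp_eq_zero`) of the coefficients of an operator
follow. -/

noncomputable section

set_option linter.unusedSectionVars false
set_option linter.unusedSimpArgs false

namespace LieAlg

namespace UEA

/-! ### The Poincaré-Birkhoff-Witt theorem for a Lie-Rinehart algebra with a finite basis. -/

section PBW

/-- The multi-index of a single variable. -/
abbrev unitIdx {n : ℕ} (i : Fin n) : Fin n →₀ ℕ := Finsupp.single i 1

lemma exists_lead {n : ℕ} {i : Fin n} {α : Fin n →₀ ℕ} (h : ¬∀ k, α k ≠ 0 → i ≤ k) :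
    ∃ (j : Fin n) (β : Fin n →₀ ℕ), α = β + unitIdx j ∧ (∀ k, β k ≠ 0 → j ≤ k) ∧ j < i := by
  push Not at h
  obtain ⟨k, hk, hki⟩ := h
  have hne : α.support.Nonempty := ⟨k, Finsupp.mem_support_iff.mpr hk⟩
  have h1 : α (α.support.min' hne) ≠ 0 := Finsupp.mem_support_iff.mp (Finset.min'_mem _ _)
  have h2 : ∀ k, α k ≠ 0 → α.support.min' hne ≤ k := fun k hk =>
    Finset.min'_le _ _ (Finsupp.mem_support_iff.mpr hk)
  have h3 := tsub_add_cancel_of_le (Finsupp.single_le_iff.mpr (Nat.one_le_iff_ne_zero.mpr h1))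
  exact ⟨_, α - unitIdx _, h3.symm, fun k hk => h2 k fun h0 => hk (by simp [h0]),
    lt_of_le_of_lt (h2 k hk) hki⟩

variable {R L : Type u} [CommRing R] [LieRing L] [Module R L] [LieRingModule L R]
  [LieRinehartRing R L] {n : ℕ} (e : Module.Basis (Fin n) R L)

lemma lie_one_eq_zero (x : L) : ⁅x, (1 : R)⁆ = 0 := by
  have h := LieRinehartRing.leibniz_mul_right x (1 : R) 1
  simpa using h

lemma smul_lie_eq (r : R) (x y : L) : ⁅r • x, y⁆ = r • ⁅x, y⁆ - ⁅y, r⁆ • x := by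
  rw [← lie_skew, LieRinehartRing.leibniz_smul_right, ← lie_skew x y, smul_neg]
  abel

/-- The action of `e i` on the monomial `x ^ α` in the polynomial model of `U(L, R)`. -/
def monoOp (i : Fin n) (α : Fin n →₀ ℕ) : (Fin n →₀ ℕ) →₀ R :=
  open Classical in
  if h : ∃ j, α j ≠ 0 ∧ (∀ k, α k ≠ 0 → j ≤ k) ∧ j < i then
    let j := h.choose
    let β := α - unitIdx j
    have : β.degree < α.degree := by
      have h1 : β + unitIdx j = α :=
        tsub_add_cancel_of_le (Finsupp.single_le_iff.mpr (Nat.one_le_iff_ne_zero.mpr h.choose_spec.1))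
      rw [← h1, map_add]
      simp
    -- With `x ^ α = e j · x ^ β`, the summands are those of `e j · (e i · x ^ β) + ⁅e i, e j⁆ · x ^
    -- β`; the top term `x ^ (β + i)` of `e i · x ^ β` is sent by `e j` to the monomial written
    -- here. The test on `γ.degree` only makes the recursion well founded: by `monoOp_sub_mem` it
    -- always succeeds.
    Finsupp.single (α + unitIdx i) 1 +
      ((monoOp i β - Finsupp.single (β + unitIdx i) 1).sum fun γ c =>
        if hγ : γ.degree < α.degree then c • monoOp j γ + Finsupp.single γ ⁅e j, c⁆ else 0) +
      ∑ k, e.repr ⁅e i, e j⁆ k • monoOp k β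
  else Finsupp.single (α + unitIdx i) 1
termination_by α.degree

/-- The polynomials of degree at most `k`. -/
abbrev degLE (R : Type u) [CommRing R] (n k : ℕ) : Submodule R ((Fin n →₀ ℕ) →₀ R) :=
  Finsupp.supported R R {α | α.degree ≤ k}

lemma degLE_mono {k l : ℕ} (h : k ≤ l) : degLE R n k ≤ degLE R n l :=
  Finsupp.supported_mono fun _ hα => le_trans hα h

/-- The action of `x ∈ L` on the polynomial model of `U(L, R)`. -/
def polyOp (x : L) : ((Fin n →₀ ℕ) →₀ R) →+ ((Fin n →₀ ℕ) →₀ R) :=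
  Finsupp.liftAddHom fun α => AddMonoidHom.mk'
    (fun c => c • (∑ k, e.repr x k • monoOp e k α) + Finsupp.single α ⁅x, c⁆) fun c d => by
      rw [add_smul, lie_add, Finsupp.single_add]; abel

lemma polyOp_single (x : L) (α : Fin n →₀ ℕ) (c : R) :
    polyOp e x (Finsupp.single α c) =
      c • (∑ k, e.repr x k • monoOp e k α) + Finsupp.single α ⁅x, c⁆ := by
  simp [polyOp]

lemma polyOp_basis (i : Fin n) (α : Fin n →₀ ℕ) :
    polyOp e (e i) (Finsupp.single α 1) = monoOp e i α := by
  rw [polyOp_single, lie_one_eq_zero, Finsupp.single_zero, add_zero, one_smul,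
    Finset.sum_eq_single i] <;> simp +contextual [Finsupp.single_apply, eq_comm]

lemma polyOp_add (x y : L) (p) : polyOp e (x + y) p = polyOp e x p + polyOp e y p := by
  induction p using Finsupp.induction_linear with
  | zero => simp
  | add p q hp hq => simp only [map_add, hp, hq]; abel
  | single α c =>
    simp only [polyOp_single, map_add, Finsupp.add_apply, add_smul, Finset.sum_add_distrib, smul_add,
      add_lie, Finsupp.single_add]
    abel

lemma polyOp_smul_left (r : R) (x : L) (p) : polyOp e (r • x) p = r • polyOp e x p := by
  induction p using Finsupp.induction_linear with
  | zero => simp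
  | add p q hp hq => simp only [map_add, hp, hq, smul_add]
  | single α c =>
    simp only [polyOp_single, map_smul, Finsupp.smul_apply, smul_eq_mul, mul_smul,
      ← Finset.smul_sum, LieRinehartRing.lie_smul_eq_mul, smul_add, Finsupp.smul_single]
    rw [smul_comm]

lemma polyOp_smul_right (x : L) (r : R) (p) :
    polyOp e x (r • p) = r • polyOp e x p + ⁅x, r⁆ • p := by
  induction p using Finsupp.induction_linear with
  | zero => simp
  | add p q hp hq => simp only [map_add, hp, hq, smul_add]; abel
  | single α c =>
    simp only [polyOp_single, Finsupp.smul_single, smul_eq_mul, LieRinehartRing.leibniz_mul_right,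
      smul_add, Finsupp.single_add, mul_smul]
    abel

lemma monoOp_of_le {i : Fin n} {α : Fin n →₀ ℕ} (h : ∀ k, α k ≠ 0 → i ≤ k) :
    monoOp e i α = Finsupp.single (α + unitIdx i) 1 := by
  rw [monoOp, dif_neg]
  rintro ⟨j, hj, -, hji⟩
  exact absurd (h j hj) (not_le.mpr hji)

lemma polyOp_mem_degLE_of {k : ℕ}
    (h : ∀ i (α : Fin n →₀ ℕ), α.degree ≤ k → monoOp e i α ∈ degLE R n (k + 1))
    (x : L) {p} (hp : p ∈ degLE R n k) : polyOp e x p ∈ degLE R n (k + 1) := by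
  rw [← Finsupp.sum_single p, Finsupp.sum, map_sum]
  refine Submodule.sum_mem _ fun α hα => ?_
  have hα' : α.degree ≤ k := hp hα
  rw [polyOp_single]
  refine add_mem (Submodule.smul_mem _ _ (Submodule.sum_mem _ fun i _ =>
    Submodule.smul_mem _ _ (h i α hα'))) ?_
  exact Finsupp.single_mem_supported R _ (show α.degree ≤ k + 1 by omega)

/-- Identifies the variable picked by `choose` in `monoOp` with a given least variable. -/
lemma lead_unique {α : Fin n →₀ ℕ} {j l : Fin n} (hj : α j ≠ 0)
    (hj' : ∀ k, α k ≠ 0 → j ≤ k) (hl : α l ≠ 0) (hl' : ∀ k, α k ≠ 0 → l ≤ k) : j = l :=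
  le_antisymm (hj' l hl) (hl' j hj)

lemma monoOp_rec_aux {i j : Fin n} {β : Fin n →₀ ℕ} (hji : j < i) (h : ∀ k, β k ≠ 0 → j ≤ k) :
    monoOp e i (β + unitIdx j) = Finsupp.single (β + unitIdx j + unitIdx i) 1 +
      ((monoOp e i β - Finsupp.single (β + unitIdx i) 1).sum fun γ c =>
        if γ.degree < β.degree + 1 then c • monoOp e j γ + Finsupp.single γ ⁅e j, c⁆ else 0) +
      ∑ k, e.repr ⁅e i, e j⁆ k • monoOp e k β := by
  have h1 : (β + unitIdx j) j ≠ 0 := by simp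
  have h2 : ∀ k, (β + unitIdx j) k ≠ 0 → j ≤ k := fun k hk => by
    by_cases hkj : j = k
    · exact hkj.le
    · refine h k ?_
      simpa [Finsupp.single_apply, hkj] using hk
  have hex : ∃ j', (β + unitIdx j) j' ≠ 0 ∧ (∀ k, (β + unitIdx j) k ≠ 0 → j' ≤ k) ∧ j' < i :=
    ⟨j, h1, h2, hji⟩
  rw [monoOp, dif_pos hex]
  have hc : hex.choose = j :=
    lead_unique hex.choose_spec.1 hex.choose_spec.2.1 h1 h2
  have hd : (β + unitIdx j).degree = β.degree + 1 := by simp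
  simp only [hc, add_tsub_cancel_right, hd, dite_eq_ite]

/-- By induction the correction `e i · x ^ β - x ^ (β + i)` has degree at most `|β| = |α| - 1`, and
one more operator raises degrees by at most one. This bound makes the test in `monoOp` vacuous. -/
lemma monoOp_sub_mem (i : Fin n) (α : Fin n →₀ ℕ) :
    monoOp e i α - Finsupp.single (α + unitIdx i) 1 ∈ degLE R n α.degree := by
  induction hN : α.degree using Nat.strong_induction_on generalizing i α with
  | _ N ih =>
  have key : ∀ k < N, ∀ i (α : Fin n →₀ ℕ), α.degree ≤ k → monoOp e i α ∈ degLE R n (k + 1) := by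
    intro k hk i α hα
    have h1 := ih _ (lt_of_le_of_lt hα hk) i α rfl
    rw [← sub_add_cancel (monoOp e i α) (Finsupp.single (α + unitIdx i) 1)]
    refine add_mem (degLE_mono (by omega) h1) (Finsupp.single_mem_supported R _ ?_)
    change (α + unitIdx i).degree ≤ k + 1
    simpa using hα
  by_cases h : ∀ k, α k ≠ 0 → i ≤ k
  · rw [monoOp_of_le e h, sub_self]; exact zero_mem _
  · obtain ⟨j, β, rfl, hβ, hji⟩ := exists_lead h
    have hd : β.degree + 1 = N := by rw [← hN]; simp
    rw [monoOp_rec_aux e hji hβ, add_assoc, add_sub_cancel_left]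
    refine add_mem (Submodule.sum_mem _ fun γ hγ => ?_) (Submodule.sum_mem _ fun k _ =>
      Submodule.smul_mem _ _ ?_)
    · dsimp only
      split_ifs with hlt
      · refine add_mem (Submodule.smul_mem _ _ ?_) (Finsupp.single_mem_supported R _ ?_)
        · have := key γ.degree (by omega) j γ le_rfl
          exact degLE_mono (by omega) this
        · change γ.degree ≤ N
          omega
      · exact zero_mem _
    · have := key β.degree (by omega) k β le_rfl
      rwa [hd] at this

lemma monoOp_mem (i : Fin n) (α : Fin n →₀ ℕ) : monoOp e i α ∈ degLE R n (α.degree + 1) := by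
  rw [← sub_add_cancel (monoOp e i α) (Finsupp.single (α + unitIdx i) 1)]
  refine add_mem (degLE_mono (by omega) (monoOp_sub_mem e i α))
    (Finsupp.single_mem_supported R _ ?_)
  change (α + unitIdx i).degree ≤ _
  simp

lemma polyOp_mem (x : L) {k : ℕ} {p} (hp : p ∈ degLE R n k) : polyOp e x p ∈ degLE R n (k + 1) :=
  polyOp_mem_degLE_of e (fun i α hα => degLE_mono (by omega) (monoOp_mem e i α)) x hp

/-- With the degree bound the test disappears, and the recursion becomes `e i e j = e j e i + ⁅e i,
e j⁆` applied to `x ^ β`, with the top term split off. -/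
lemma monoOp_rec {i j : Fin n} {β : Fin n →₀ ℕ} (hji : j < i) (h : ∀ k, β k ≠ 0 → j ≤ k) :
    monoOp e i (β + unitIdx j) = Finsupp.single (β + unitIdx j + unitIdx i) 1 +
      polyOp e (e j) (monoOp e i β - Finsupp.single (β + unitIdx i) 1) +
      polyOp e ⁅e i, e j⁆ (Finsupp.single β 1) := by
  rw [monoOp_rec_aux e hji h]
  refine congrArg₂ (· + ·) (congrArg (_ + ·) ?_) ?_
  · have h1 := monoOp_sub_mem e i β
    generalize monoOp e i β - Finsupp.single (β + unitIdx i) 1 = p at *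
    conv_rhs => rw [← Finsupp.sum_single p, Finsupp.sum, map_sum]
    refine Finset.sum_congr rfl fun γ hγ => ?_
    have h2 : γ.degree ≤ β.degree := h1 hγ
    beta_reduce
    rw [if_pos (by omega), polyOp_single]
    congr 2
    rw [Finset.sum_eq_single j] <;> simp +contextual [Finsupp.single_apply, eq_comm]
  · rw [polyOp_single, lie_one_eq_zero, Finsupp.single_zero, add_zero, one_smul]

/-- The failure of `polyOp` to respect brackets. -/
def polyCurv (x y : L) (p : (Fin n →₀ ℕ) →₀ R) : (Fin n →₀ ℕ) →₀ R :=
  polyOp e x (polyOp e y p) - polyOp e y (polyOp e x p) - polyOp e ⁅x, y⁆ p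

lemma polyOp_neg_left (x : L) (p) : polyOp e (-x) p = -polyOp e x p := by
  rw [← neg_one_smul R x, polyOp_smul_left, neg_one_smul]

lemma polyOp_sub_left (x y : L) (p) : polyOp e (x - y) p = polyOp e x p - polyOp e y p := by
  rw [sub_eq_add_neg, polyOp_add, polyOp_neg_left, sub_eq_add_neg]

lemma polyCurv_add (x y : L) (p q) :
    polyCurv e x y (p + q) = polyCurv e x y p + polyCurv e x y q := by
  simp only [polyCurv, map_add]; abel

/-- The Leibniz terms cancel because the anchor respects brackets; so the curvature can be tested on
monomials with coefficient one. -/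
lemma polyCurv_smul (x y : L) (r : R) (p) :
    polyCurv e x y (r • p) = r • polyCurv e x y p := by
  simp only [polyCurv, polyOp_smul_right, map_add, smul_sub, lie_lie, sub_smul]; abel

lemma polyCurv_skew (x y : L) (p) : polyCurv e x y p = -polyCurv e y x p := by
  simp only [polyCurv]
  rw [← lie_skew, polyOp_neg_left]; abel

lemma polyCurv_add_left (x x' y : L) (p) :
    polyCurv e (x + x') y p = polyCurv e x y p + polyCurv e x' y p := by
  simp only [polyCurv, polyOp_add, add_lie, map_add]; abel

lemma polyCurv_smul_left (r : R) (x y : L) (p) :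
    polyCurv e (r • x) y p = r • polyCurv e x y p := by
  simp only [polyCurv, polyOp_smul_left, polyOp_smul_right, smul_lie_eq, polyOp_sub_left, smul_sub]
  abel

/-- Skew symmetry and `R`-linearity in each argument leave only pairs of basis vectors, in one
order. -/
lemma polyCurv_eq_zero_of_basis (p) (h : ∀ i j, j < i → polyCurv e (e i) (e j) p = 0) (x y : L) :
    polyCurv e x y p = 0 := by
  have h1 : ∀ i j, polyCurv e (e i) (e j) p = 0 := by
    intro i j
    rcases lt_trichotomy j i with hij | rfl | hij
    · exact h i j hij
    · simp [polyCurv, show polyOp e (0 : L) p = 0 by simpa using polyOp_smul_left e 0 (0 : L) p]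
    · rw [polyCurv_skew, h j i hij, neg_zero]
  let f (y : L) : L →ₗ[R] ((Fin n →₀ ℕ) →₀ R) :=
    { toFun := fun x => polyCurv e x y p
      map_add' := fun x x' => polyCurv_add_left e x x' y p
      map_smul' := fun r x => polyCurv_smul_left e r x y p }
  have h2 : ∀ j x, polyCurv e x (e j) p = 0 := fun j x => by
    have : f (e j) = 0 := e.ext fun i => h1 i j
    exact LinearMap.congr_fun this x
  have h3 : f x = 0 := e.ext fun j => by
    change polyCurv e (e j) x p = 0
    rw [polyCurv_skew, h2, neg_zero]
  rw [polyCurv_skew]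
  exact neg_eq_zero.mpr (LinearMap.congr_fun h3 y)

lemma polyCurv_eq_zero_of_single {k : ℕ} {x y : L}
    (h : ∀ α : Fin n →₀ ℕ, α.degree ≤ k → polyCurv e x y (Finsupp.single α 1) = 0)
    {p} (hp : p ∈ degLE R n k) : polyCurv e x y p = 0 := by
  let f : ((Fin n →₀ ℕ) →₀ R) →ₗ[R] ((Fin n →₀ ℕ) →₀ R) :=
    { toFun := polyCurv e x y
      map_add' := polyCurv_add e x y
      map_smul' := polyCurv_smul e x y }
  change f p = 0
  rw [← Finsupp.sum_single p, Finsupp.sum, map_sum]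
  refine Finset.sum_eq_zero fun α hα => ?_
  rw [← mul_one (p α), ← smul_eq_mul, ← Finsupp.smul_single, map_smul]
  exact (congrArg _ (h α (hp hα))).trans (smul_zero _)

/-- Here `e j` simply multiplies `x ^ α`, and the recursion for `e i` on the resulting monomial was
chosen to make this relation true. -/
lemma polyCurv_of_le {i j : Fin n} {α : Fin n →₀ ℕ} (hji : j < i) (h : ∀ k, α k ≠ 0 → j ≤ k) :
    polyCurv e (e i) (e j) (Finsupp.single α 1) = 0 := by
  rw [polyCurv, polyOp_basis, polyOp_basis, monoOp_of_le e h, polyOp_basis, monoOp_rec e hji h]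
  have h1 : polyOp e (e j) (Finsupp.single (α + unitIdx i) 1)
      = Finsupp.single (α + unitIdx j + unitIdx i) 1 := by
    rw [polyOp_basis, monoOp_of_le, add_right_comm]
    intro k hk
    by_cases hki : i = k
    · exact hki ▸ hji.le
    · exact h k (by simpa [Finsupp.single_apply, hki] using hk)
  rw [map_sub, h1]
  abel

/-- Induction on the degree. If some variable of `α` is smaller than `j`, write `x ^ α = e l · x ^
β` with `l` least, so that `l < j < i`. Moving `e l` to the left past `e i` and `e j` uses relations
of lower degree or relations involving `e l`, and what remains is the Jacobi identity. -/
lemma polyCurv_eq_zero (x y : L) (p) : polyCurv e x y p = 0 := by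
  have main : ∀ N, ∀ α : Fin n →₀ ℕ, α.degree = N → ∀ x y,
      polyCurv e x y (Finsupp.single α 1) = 0 := by
    intro N
    induction N using Nat.strong_induction_on with
    | _ N ih =>
    intro α hN
    refine polyCurv_eq_zero_of_basis e _ fun i j hji => ?_
    by_cases hj : ∀ k, α k ≠ 0 → j ≤ k
    · exact polyCurv_of_le e hji hj
    obtain ⟨l, β, rfl, hβ, hlj⟩ := exists_lead hj
    have hd : β.degree + 1 = N := by rw [← hN]; simp
    have hlow : ∀ x y p, p ∈ degLE R n β.degree → polyCurv e x y p = 0 := fun x y p hp =>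
      polyCurv_eq_zero_of_single e (fun γ hγ => ih _ (by omega) γ rfl x y) hp
    have hq : Finsupp.single (β + unitIdx l) (1 : R) = polyOp e (e l) (Finsupp.single β 1) := by
      rw [polyOp_basis, monoOp_of_le e hβ]
    -- `e j · x ^ β` is `x ^ (β + j)` plus terms of degree at most `|β|`. The former falls under
    -- `polyCurv_of_le`, since `l` is at most every variable of `β + j`; the latter under the
    -- induction hypothesis.
    have hside : ∀ i j, l < i → l < j →
        polyCurv e (e i) (e l) (polyOp e (e j) (Finsupp.single β 1)) = 0 := by
      intro i j hli hlj
      rw [polyOp_basis, ← sub_add_cancel (monoOp e j β) (Finsupp.single (β + unitIdx j) 1),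
        polyCurv_add, hlow _ _ _ (monoOp_sub_mem e j β), zero_add]
      refine polyCurv_of_le e hli fun k hk => ?_
      by_cases hkj : j = k
      · exact hkj ▸ hlj.le
      · exact hβ k (by simpa [Finsupp.single_apply, hkj] using hk)
    have hb : Finsupp.single β (1 : R) ∈ degLE R n β.degree :=
      Finsupp.single_mem_supported R _ (show β.degree ≤ β.degree from le_rfl)
    have h0 : ∀ x y, polyOp e x (polyOp e y (Finsupp.single β 1)) =
        polyOp e y (polyOp e x (Finsupp.single β 1)) + polyOp e ⁅x, y⁆ (Finsupp.single β 1) :=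
      fun x y => by
        have := hlow x y _ hb
        rw [polyCurv, sub_sub, sub_eq_zero] at this
        exact this
    have h1 := hside i j (hlj.trans hji) hlj
    have h2 := hside j i hlj (hlj.trans hji)
    rw [polyCurv, sub_sub, sub_eq_zero] at h1 h2
    rw [polyCurv, hq, h0 (e j) (e l), h0 (e i) (e l), map_add, map_add, h1, h2, h0 (e i) (e j),
      map_add, h0 (e i) ⁅e j, e l⁆, h0 (e j) ⁅e i, e l⁆, h0 ⁅e i, e j⁆ (e l)]
    have hJ : ⁅⁅e i, e j⁆, e l⁆ = ⁅e i, ⁅e j, e l⁆⁆ - ⁅e j, ⁅e i, e l⁆⁆ := lie_lie _ _ _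
    rw [hJ, polyOp_sub_left]
    abel
  have hp : ∃ k, p ∈ degLE R n k :=
    ⟨p.support.sup Finsupp.degree, fun α hα => Finset.le_sup (f := Finsupp.degree) hα⟩
  obtain ⟨k, hk⟩ := hp
  exact polyCurv_eq_zero_of_single e (fun α _ => main _ α rfl x y) hk

/-- The action of `U(L, R)` on its polynomial model. -/
def polyAct : UEA R L →+* AddMonoid.End ((Fin n →₀ ℕ) →₀ R) :=
  lift (A := AddMonoid.End ((Fin n →₀ ℕ) →₀ R)) (Module.toAddMonoidEnd R ((Fin n →₀ ℕ) →₀ R))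
    (AddMonoidHom.mk' (fun x => (polyOp e x : AddMonoid.End ((Fin n →₀ ℕ) →₀ R)))
      fun x y => AddMonoidHom.ext (polyOp_add e x y))
    (fun r x => AddMonoidHom.ext fun p => (polyOp_smul_left e r x p).symm)
    (fun x r => AddMonoidHom.ext fun p => polyOp_smul_right e x r p)
    (fun x y => AddMonoidHom.ext fun p => by
      have h := polyCurv_eq_zero e x y p
      rw [polyCurv, sub_sub, sub_eq_zero] at h
      exact h)

lemma polyAct_ιR (r : R) (p) : polyAct e (ιR L r) p = r • p :=
  congrArg (fun f : AddMonoid.End _ => f p) (lift_ιR _ _ _ _ _ r)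

lemma polyAct_ιL (x : L) (p) : polyAct e (ιL R x) p = polyOp e x p :=
  congrArg (fun f : AddMonoid.End _ => f p) (lift_ιL _ _ _ _ _ x)

lemma polyAct_mul (D E : UEA R L) (p) :
    polyAct e (D * E) p = polyAct e D (polyAct e E p) := by
  rw [map_mul]; rfl

lemma polyAct_add (D E : UEA R L) (p) :
    polyAct e (D + E) p = polyAct e D p + polyAct e E p := by
  rw [map_add]; rfl

/-- The ordered monomials in the elements of a basis of `L`. -/
def mono (e : Fin n → L) (α : Fin n →₀ ℕ) : UEA R L :=
  ((α.toMultiset.sort (· ≤ ·)).map fun i => ιL R (e i)).prod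

lemma mono_zero (e : Fin n → L) : mono (R := R) e 0 = 1 := by simp [mono]

lemma mono_add_unitIdx (e : Fin n → L) {i : Fin n} {α : Fin n →₀ ℕ} (h : ∀ k, α k ≠ 0 → i ≤ k) :
    mono e (α + unitIdx i) = ιL R (e i) * mono e α := by
  have h1 : (α + unitIdx i).toMultiset = i ::ₘ α.toMultiset := by
    rw [map_add, Finsupp.toMultiset_single, one_smul, add_comm, Multiset.singleton_add]
  rw [mono, h1, Multiset.sort_cons, List.map_cons, List.prod_cons, mono]
  intro k hk
  exact h k (Finsupp.mem_support_iff.mp ((Finsupp.mem_toMultiset α k).mp hk))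

lemma exists_lead_of_ne {α : Fin n →₀ ℕ} (h : α ≠ 0) :
    ∃ (j : Fin n) (β : Fin n →₀ ℕ), α = β + unitIdx j ∧ (∀ k, β k ≠ 0 → j ≤ k) := by
  have hne : α.support.Nonempty := Finsupp.support_nonempty_iff.mpr h
  have h1 : α (α.support.min' hne) ≠ 0 := Finsupp.mem_support_iff.mp (Finset.min'_mem _ _)
  have h2 : ∀ k, α k ≠ 0 → α.support.min' hne ≤ k := fun k hk =>
    Finset.min'_le _ _ (Finsupp.mem_support_iff.mpr hk)
  have h3 := tsub_add_cancel_of_le (Finsupp.single_le_iff.mpr (Nat.one_le_iff_ne_zero.mpr h1))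
  exact ⟨_, α - unitIdx _, h3.symm, fun k hk => h2 k fun h0 => hk (by simp [h0])⟩

/-- Induction on multi-indices, adding a variable which is at most all the variables present. -/
lemma idx_induction {p : (Fin n →₀ ℕ) → Prop} (h0 : p 0)
    (h1 : ∀ (α : Fin n →₀ ℕ) (i : Fin n), (∀ k, α k ≠ 0 → i ≤ k) → p α → p (α + unitIdx i))
    (α : Fin n →₀ ℕ) : p α := by
  induction hN : α.degree generalizing α with
  | zero => rwa [(Finsupp.degree_eq_zero_iff α).mp hN]
  | succ N ih =>
    have hα : α ≠ 0 := by rintro rfl; simp at hN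
    obtain ⟨j, β, rfl, hβ⟩ := exists_lead_of_ne hα
    exact h1 β j hβ (ih β (by simpa using hN))

/-- An ordered monomial is built by left multiplication with smaller and smaller variables, so only
the case of `monoOp` without correction terms occurs. -/
lemma polyAct_mono (α : Fin n →₀ ℕ) :
    polyAct e (mono e α) (Finsupp.single 0 1) = Finsupp.single α 1 := by
  induction α using idx_induction with
  | h0 => rw [mono_zero, map_one]; rfl
  | h1 α i h ih =>
    rw [mono_add_unitIdx _ h, polyAct_mul, ih, polyAct_ιL, polyOp_basis, monoOp_of_le e h]

/-- The map from the polynomial model to `U(L, R)`. -/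
def ofPoly (e : Fin n → L) : ((Fin n →₀ ℕ) →₀ R) →ₗ[R] UEA R L :=
  Finsupp.linearCombination R (mono e)

lemma ofPoly_single (α : Fin n →₀ ℕ) (c : R) :
    ofPoly e (Finsupp.single α c) = ιR L c * mono e α :=
  Finsupp.linearCombination_single R c α

lemma ιL_mul_smul (x : L) (r : R) (D : UEA R L) :
    ιL R x * (r • D) = r • (ιL R x * D) + ⁅x, r⁆ • D := by
  rw [smul_def, smul_def, smul_def, ← mul_assoc, ιL_mul_ιR, add_mul, mul_assoc]

lemma ιL_smul (r : R) (x : L) : ιL R (r • x) = r • ιL R x := (ιR_mul_ιL r x).symm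

lemma ιL_eq_sum (x : L) : ιL R x = ∑ i, e.repr x i • ιL R (e i) := by
  conv_lhs => rw [← e.sum_repr x]
  simp only [map_sum, ιL_smul]

/-- The recursion for `monoOp` uses nothing but relations of `U(L, R)`, so it is satisfied by
ordered monomials there. Applied to `D * 1` this shows that ordered monomials span. -/
lemma ofPoly_polyOp (x : L) (p) : ofPoly e (polyOp e x p) = ιL R x * ofPoly e p := by
  -- Extends the identity from basis vectors and monomials to all `x` and `p`. The degree bound is
  -- kept because the extension is needed inside the induction.
  have reduce : ∀ k : ℕ, (∀ i (α : Fin n →₀ ℕ), α.degree ≤ k →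
      ofPoly e (monoOp e i α) = ιL R (e i) * mono e α) →
      ∀ x p, p ∈ degLE R n k → ofPoly e (polyOp e x p) = ιL R x * ofPoly e p := by
    intro k hk x p hp
    rw [← Finsupp.sum_single p, Finsupp.sum, map_sum, map_sum, map_sum, Finset.mul_sum]
    refine Finset.sum_congr rfl fun α hα => ?_
    have h1 : ofPoly e (Finsupp.single α (p α)) = p α • mono e α := ofPoly_single e α (p α)
    have h2 : ofPoly e (Finsupp.single α ⁅x, p α⁆) = ⁅x, p α⁆ • mono e α := ofPoly_single e α _
    rw [polyOp_single, map_add, map_smul, map_sum, h1, h2, ιL_mul_smul, ιL_eq_sum e x,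
      Finset.sum_mul]
    congr 2
    refine Finset.sum_congr rfl fun i _ => ?_
    rw [map_smul, hk i α (hp hα), smul_mul_assoc]
  have main : ∀ N i (α : Fin n →₀ ℕ), α.degree = N →
      ofPoly e (monoOp e i α) = ιL R (e i) * mono e α := by
    intro N
    induction N using Nat.strong_induction_on with
    | _ N ih =>
    intro i α hN
    by_cases h : ∀ k, α k ≠ 0 → i ≤ k
    · rw [monoOp_of_le e h, ofPoly_single, map_one, one_mul, mono_add_unitIdx _ h]
    obtain ⟨j, β, rfl, hβ, hji⟩ := exists_lead h
    have hd : β.degree + 1 = N := by rw [← hN]; simp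
    have red := reduce β.degree fun i α hα => ih _ (by omega) i α rfl
    have h1 : ofPoly e (Finsupp.single (β + unitIdx j + unitIdx i) (1 : R)) =
        ιL R (e j) * ofPoly e (Finsupp.single (β + unitIdx i) 1) := by
      rw [ofPoly_single, ofPoly_single, map_one, one_mul, one_mul, add_right_comm,
        mono_add_unitIdx]
      intro k hk
      by_cases hki : i = k
      · exact hki ▸ hji.le
      · exact hβ k (by simpa [Finsupp.single_apply, hki] using hk)
    rw [monoOp_rec e hji hβ, map_add, map_add, red _ _ (monoOp_sub_mem e i β),
      red _ _ (Finsupp.single_mem_supported R _ (show β.degree ≤ β.degree from le_rfl)), h1,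
      map_sub, ih _ (by omega) i β rfl, mono_add_unitIdx _ hβ, ← mul_assoc (ιL R (e i)),
      ιL_mul_ιL (e i) (e j), show ofPoly e (Finsupp.single β (1 : R)) = mono e β by
        rw [ofPoly_single, map_one, one_mul]]
    noncomm_ring
  obtain ⟨k, hk⟩ : ∃ k, p ∈ degLE R n k :=
    ⟨p.support.sup Finsupp.degree, fun α hα => Finset.le_sup (f := Finsupp.degree) hα⟩
  exact reduce k (fun i α _ => main _ i α rfl) x p hk

lemma ofPoly_polyAct (D : UEA R L) (p) : ofPoly e (polyAct e D p) = D * ofPoly e p := by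
  induction D using UEA.induction generalizing p with
  | hR r => rw [polyAct_ιR, map_smul, smul_def]
  | hL x => rw [polyAct_ιL, ofPoly_polyOp]
  | hadd a b ha hb => rw [polyAct_add, map_add, ha, hb, add_mul]
  | hmul a b ha hb => rw [polyAct_mul, ha, hb, mul_assoc]

/-- The Poincaré-Birkhoff-Witt isomorphism of `U(L, R)` with its polynomial model. -/
def polyEquiv : UEA R L ≃ₗ[R] ((Fin n →₀ ℕ) →₀ R) where
  toFun D := polyAct e D (Finsupp.single 0 1)
  map_add' D E := polyAct_add e D E _
  map_smul' r D := by rw [smul_def, polyAct_mul, polyAct_ιR]; rfl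
  invFun := ofPoly e
  left_inv D := by
    rw [ofPoly_polyAct, ofPoly_single, map_one, mono_zero, mul_one, mul_one]
  right_inv p := by
    change polyAct e (ofPoly e p) (Finsupp.single 0 1) = p
    induction p using Finsupp.induction_linear with
    | zero => rw [map_zero, map_zero]; rfl
    | add p q hp hq => rw [map_add, polyAct_add, hp, hq]
    | single α c =>
      rw [ofPoly_single, polyAct_mul, polyAct_mono, polyAct_ιR, Finsupp.smul_single, smul_eq_mul,
        mul_one]

/-- The Poincaré-Birkhoff-Witt basis of `U(L, R)`, for a Lie-Rinehart algebra with a basis. -/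
def pbw : Module.Basis (Fin n →₀ ℕ) R (UEA R L) := .ofRepr (polyEquiv e)

lemma pbw_apply (α : Fin n →₀ ℕ) : pbw e α = mono e α := by
  change ofPoly e (Finsupp.single α 1) = _
  rw [ofPoly_single, map_one, one_mul]

lemma pbw_repr (D : UEA R L) : (pbw e).repr D = polyAct e D (Finsupp.single 0 1) := rfl

/-! ### The order filtration of the enveloping algebra. -/

variable (R) in
/-- The filtration of `U(L, R)`. -/
def fil (L : Type u) [LieRing L] [Module R L] [LieRingModule L R] (k : ℕ) :
    Submodule R (UEA R L) :=
  Submodule.span R {D | ∃ l : List L, l.length ≤ k ∧ D = (l.map (ιL R)).prod}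

lemma fil_mono {k l : ℕ} (h : k ≤ l) : fil R L k ≤ fil R L l :=
  Submodule.span_mono fun _ ⟨m, hm, hD⟩ => ⟨m, hm.trans h, hD⟩

lemma prod_mem_fil {k : ℕ} (l : List L) (h : l.length ≤ k) : (l.map (ιL R)).prod ∈ fil R L k :=
  Submodule.subset_span ⟨l, h, rfl⟩

lemma one_mem_fil (k : ℕ) : (1 : UEA R L) ∈ fil R L k := by
  simpa using prod_mem_fil (R := R) (L := L) (k := k) [] (Nat.zero_le k)

lemma mono_mem_fil (e : Fin n → L) (α : Fin n →₀ ℕ) : mono e α ∈ fil R L α.degree := by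
  have h : mono e α = ((((α.toMultiset.sort (· ≤ ·)).map e)).map (ιL R)).prod := by
    rw [List.map_map]; rfl
  rw [h]
  refine prod_mem_fil _ ?_
  rw [List.length_map, Multiset.length_sort, Finsupp.card_toMultiset, Finsupp.degree_apply]
  rfl

lemma ιL_mul_mem_fil (x : L) {k : ℕ} {D : UEA R L} (hD : D ∈ fil R L k) :
    ιL R x * D ∈ fil R L (k + 1) := by
  induction hD using Submodule.span_induction with
  | mem D h =>
    obtain ⟨l, hl, rfl⟩ := h
    exact prod_mem_fil (x :: l) (by simpa using hl)
  | zero => rw [mul_zero]; exact zero_mem _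
  | add D E _ _ hD hE => rw [mul_add]; exact add_mem hD hE
  | smul r D hD' hD =>
    rw [ιL_mul_smul]
    exact add_mem (Submodule.smul_mem _ _ hD) (Submodule.smul_mem _ _ (fil_mono (by omega) hD'))

lemma list_prod_mul_mem_fil (l : List L) {m : ℕ} {D : UEA R L}
    (hD : D ∈ fil R L m) : (l.map (ιL R)).prod * D ∈ fil R L (l.length + m) := by
  induction l with
  | nil => simpa using hD
  | cons x l ih =>
    rw [List.map_cons, List.prod_cons, mul_assoc, List.length_cons, Nat.add_right_comm]
    exact ιL_mul_mem_fil x ih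

lemma mul_mem_fil {k m : ℕ} {D E : UEA R L} (hD : D ∈ fil R L k) (hE : E ∈ fil R L m) :
    D * E ∈ fil R L (k + m) := by
  induction hD using Submodule.span_induction with
  | mem D h =>
    obtain ⟨l, hl, rfl⟩ := h
    exact fil_mono (by omega) (list_prod_mul_mem_fil l hE)
  | zero => rw [zero_mul]; exact zero_mem _
  | add D E _ _ hD hE => rw [add_mul]; exact add_mem hD hE
  | smul r D hD' hD => rw [smul_mul_assoc]; exact Submodule.smul_mem _ _ hD

lemma ιR_mem_fil (r : R) (k : ℕ) : ιR L r ∈ fil R L k := by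
  have h : ιR L r = r • (1 : UEA R L) := by rw [smul_def, mul_one]
  rw [h]
  exact Submodule.smul_mem (fil R L k) r (one_mem_fil k)

lemma mul_ιR_mem_fil {k : ℕ} {D : UEA R L} (hD : D ∈ fil R L k) (r : R) :
    D * ιR L r ∈ fil R L k := by
  have h := mul_mem_fil (m := 0) hD (ιR_mem_fil r 0)
  rwa [add_zero] at h

lemma ιL_mem_fil (x : L) : ιL R x ∈ fil R L 1 := by
  simpa using prod_mem_fil (R := R) (k := 1) [x] le_rfl

lemma exists_mem_fil (D : UEA R L) : ∃ k, D ∈ fil R L k := by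
  induction D using UEA.induction with
  | hR r => exact ⟨0, ιR_mem_fil r 0⟩
  | hL x => exact ⟨1, ιL_mem_fil x⟩
  | hadd a b ha hb =>
    obtain ⟨k, hk⟩ := ha
    obtain ⟨m, hm⟩ := hb
    exact ⟨k + m, add_mem (fil_mono (by omega) hk) (fil_mono (by omega) hm)⟩
  | hmul a b ha hb =>
    obtain ⟨k, hk⟩ := ha
    obtain ⟨m, hm⟩ := hb
    exact ⟨k + m, mul_mem_fil hk hm⟩

/-- Commutation with `x` is a derivation which maps `L` to `L` and `R` to `R`, so it does not raise
the order. -/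
lemma comm_mem_fil (x : L) {k : ℕ} {D : UEA R L} (hD : D ∈ fil R L k) :
    D * ιL R x - ιL R x * D ∈ fil R L k := by
  induction hD using Submodule.span_induction with
  | mem D h =>
    obtain ⟨l, hl, rfl⟩ := h
    refine fil_mono hl ?_
    clear hl
    induction l with
    | nil => simp
    | cons y l ih =>
      have h1 : ((y :: l).map (ιL R)).prod * ιL R x - ιL R x * ((y :: l).map (ιL R)).prod =
          ιL R y * ((l.map (ιL R)).prod * ιL R x - ιL R x * (l.map (ιL R)).prod) -
            ιL R ⁅x, y⁆ * (l.map (ιL R)).prod := by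
        rw [List.map_cons, List.prod_cons, ← mul_assoc (ιL R x), ιL_mul_ιL x y]
        noncomm_ring
      rw [h1, List.length_cons]
      exact sub_mem (ιL_mul_mem_fil y ih) (ιL_mul_mem_fil _ (prod_mem_fil l le_rfl))
  | zero => simp
  | add D E _ _ hD hE =>
    rw [add_mul, mul_add, add_sub_add_comm]; exact add_mem hD hE
  | smul r D hD' hD =>
    rw [ιL_mul_smul, smul_mul_assoc, ← sub_sub, ← smul_sub]
    exact sub_mem (Submodule.smul_mem _ _ hD) (Submodule.smul_mem _ _ hD')

lemma polyAct_mem {k m : ℕ} {D : UEA R L} (hD : D ∈ fil R L k) {p} (hp : p ∈ degLE R n m) :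
    polyAct e D p ∈ degLE R n (k + m) := by
  induction hD using Submodule.span_induction with
  | mem D h =>
    obtain ⟨l, hl, rfl⟩ := h
    refine degLE_mono (Nat.add_le_add_right hl m) ?_
    clear hl
    induction l with
    | nil => simpa using hp
    | cons y l ih =>
      rw [List.map_cons, List.prod_cons, polyAct_mul, polyAct_ιL, List.length_cons,
        Nat.add_right_comm]
      exact polyOp_mem e y ih
  | zero => rw [map_zero]; exact zero_mem _
  | add D E _ _ hD hE => rw [polyAct_add]; exact add_mem hD hE
  | smul r D hD' hD => rw [smul_def, polyAct_mul, polyAct_ιR]; exact Submodule.smul_mem _ _ hD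

/-- An element of order at most `k` applied to the polynomial `1` gives a polynomial of degree at
most `k`, and the coefficients of that polynomial are the coordinates. -/
lemma mem_fil_iff {k : ℕ} {D : UEA R L} :
    D ∈ fil R L k ↔ ∀ α : Fin n →₀ ℕ, (pbw e).repr D α ≠ 0 → α.degree ≤ k := by
  constructor
  · intro hD α hα
    have h := polyAct_mem e hD (m := 0)
      (Finsupp.single_mem_supported R (1 : R) (show (0 : Fin n →₀ ℕ).degree ≤ 0 by simp))
    exact h (Finsupp.mem_support_iff.mpr hα)
  · intro h
    rw [← (pbw e).linearCombination_repr D, Finsupp.linearCombination_apply]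
    refine Submodule.sum_mem _ fun α hα => Submodule.smul_mem _ _ ?_
    rw [pbw_apply]
    exact fil_mono (h α (Finsupp.mem_support_iff.mp hα)) (mono_mem_fil e α)

lemma ιL_mul_mono_sub_mem (i : Fin n) (α : Fin n →₀ ℕ) :
    ιL R (e i) * mono e α - mono e (α + unitIdx i) ∈ fil R L α.degree := by
  rw [mem_fil_iff e]
  intro γ hγ
  have h1 : (pbw e).repr (ιL R (e i) * mono e α - mono e (α + unitIdx i)) =
      monoOp e i α - Finsupp.single (α + unitIdx i) 1 := by
    rw [map_sub, pbw_repr, pbw_repr, polyAct_mul, polyAct_mono, polyAct_mono, polyAct_ιL,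
      polyOp_basis]
  rw [h1] at hγ
  exact monoOp_sub_mem e i α (Finsupp.mem_support_iff.mpr hγ)

/-- Jets are differentiated by multiplying their arguments on the right, so the leading term is
needed on this side; it differs from the one on the left by a commutator. -/
lemma mono_mul_ιL_sub_mem (i : Fin n) (α : Fin n →₀ ℕ) :
    mono e α * ιL R (e i) - mono e (α + unitIdx i) ∈ fil R L α.degree := by
  have h := add_mem (comm_mem_fil (e i) (mono_mem_fil (R := R) e α))
    (ιL_mul_mono_sub_mem e i α)
  rwa [sub_add_sub_cancel] at h

end PBW
end UEA
end LieAlg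

namespace LieAlg

/-! ### Powers of a symmetrized connection: multilinearity and the Leibniz rule. -/

section SymmetrizedConnection

variable {R L M : Type*} [CommRing R] [LieRing L] [Module R L] [LieRingModule L R]
  [AddCommGroup M] [Module R M]

/-- The axioms of a connection. -/
structure IsConn (nab : L → M →+ M) : Prop where
  add_left : ∀ x y m, nab (x + y) m = nab x m + nab y m
  smul_left : ∀ (r : R) x m, nab (r • x) m = r • nab x m
  leibniz : ∀ x (r : R) m, nab x (r • m) = r • nab x m + ⁅x, r⁆ • m

variable {ι : Type*} [DecidableEq ι]

/-- The powers of the symmetrized connection, evaluated on the family `x` restricted to `S`. -/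
def symD (nL : L → L →+ L) (nab : L → M →+ M) : ℕ → Finset ι → (ι → L) → M → M
  | 0, _, _, t => t
  | n + 1, S, x, t => ∑ i ∈ S, (nab (x i) (symD nL nab n (S.erase i) x t) -
      ∑ j ∈ S.erase i, symD nL nab n (S.erase i) (Function.update x j (nL (x i) (x j))) t)

variable (nL : L → L →+ L) (nab : L → M →+ M)

lemma symD_succ (n : ℕ) (S : Finset ι) (x : ι → L) (t : M) :
    symD nL nab (n + 1) S x t = ∑ i ∈ S, (nab (x i) (symD nL nab n (S.erase i) x t) -
      ∑ j ∈ S.erase i, symD nL nab n (S.erase i) (Function.update x j (nL (x i) (x j))) t) := rfl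

/-- Arguments form a total family with a finite set of active indices, so that omitting `Xᵢ` needs
no renumbering; the values at inactive indices are irrelevant. -/
lemma symD_congr (n : ℕ) {S : Finset ι} {x y : ι → L} (h : ∀ i ∈ S, x i = y i) (t : M) :
    symD nL nab n S x t = symD nL nab n S y t := by
  induction n generalizing S x y with
  | zero => rfl
  | succ n ih =>
    refine Finset.sum_congr rfl fun i hi => ?_
    rw [h i hi, ih fun j hj => h j (Finset.mem_of_mem_erase hj)]
    congr 1
    refine Finset.sum_congr rfl fun j hj => ih fun k hk => ?_
    by_cases hkj : k = j
    · subst hkj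
      rw [Function.update_self, Function.update_self, h k (Finset.mem_of_mem_erase hk)]
    · rw [Function.update_of_ne hkj, Function.update_of_ne hkj, h k (Finset.mem_of_mem_erase hk)]

lemma symD_update_of_notMem (n : ℕ) {S : Finset ι} {k : ι} (hk : k ∉ S) (x : ι → L) (y : L)
    (t : M) : symD nL nab n S (Function.update x k y) t = symD nL nab n S x t :=
  symD_congr nL nab n (fun i hi => Function.update_of_ne (fun h : i = k => hk (h ▸ hi)) _ _) t

lemma symD_map {κ : Type*} [DecidableEq κ] (f : κ ↪ ι) (n : ℕ) (S : Finset κ) (x : ι → L) (t : M) :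
    symD nL nab n (S.map f) x t = symD nL nab n S (x ∘ f) t := by
  induction n generalizing S x with
  | zero => rfl
  | succ n ih =>
    rw [symD_succ, symD_succ, Finset.sum_map]
    refine Finset.sum_congr rfl fun i hi => ?_
    rw [← Finset.map_erase, ih, Finset.sum_map]
    congr 1
    refine Finset.sum_congr rfl fun j hj => ?_
    rw [ih]
    congr 1
    exact Function.update_comp_eq_of_injective _ f.injective _ _

lemma symD_add (n : ℕ) (S : Finset ι) (x : ι → L) (s t : M) :
    symD nL nab n S x (s + t) = symD nL nab n S x s + symD nL nab n S x t := by
  induction n generalizing S x with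
  | zero => rfl
  | succ n ih =>
    simp only [symD_succ, ih, map_add, Finset.sum_add_distrib, Finset.sum_sub_distrib]
    abel

/-- `symD` is natural. -/
lemma map_symD {L' M' : Type*} [AddCommGroup M'] [LieRing L'] (nL' : L' → L' →+ L')
    (nab' : L' → M' →+ M')
    (F : M →+ M') (f : L → L') (hF : ∀ x m, F (nab x m) = nab' (f x) (F m))
    (hf : ∀ x y, f (nL x y) = nL' (f x) (f y)) (n : ℕ) (S : Finset ι) (x : ι → L) (t : M) :
    F (symD nL nab n S x t) = symD nL' nab' n S (f ∘ x) (F t) := by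
  induction n generalizing S x with
  | zero => rfl
  | succ n ih =>
    simp only [symD_succ, map_sum, map_sub, hF, ih, Function.comp_apply, Function.comp_update, hf]

variable {nL nab}

/-- The changed argument is either the direction of the outer derivative or an argument of the lower
power; in the latter case it also meets the connection on `L`, in the correction `j = k`. -/
lemma symD_update_add (hL : IsConn (R := R) nL) (h : IsConn (R := R) nab) {n : ℕ} {S : Finset ι}
    {k : ι} (hk : k ∈ S) (x : ι → L) (y z : L) (t : M) (hS : S.card = n) :
    symD nL nab n S (Function.update x k (y + z)) t =
      symD nL nab n S (Function.update x k y) t + symD nL nab n S (Function.update x k z) t := by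
  induction n generalizing S x k y z with
  | zero => simp [Finset.card_eq_zero.mp hS] at hk
  | succ n ih =>
    rw [symD_succ, symD_succ, symD_succ, ← Finset.sum_add_distrib]
    refine Finset.sum_congr rfl fun i hi => ?_
    have hc : (S.erase i).card = n := by rw [Finset.card_erase_of_mem hi, hS]; rfl
    by_cases hik : i = k
    · subst hik
      have hni : i ∉ S.erase i := Finset.notMem_erase i S
      rw [Function.update_self, Function.update_self, Function.update_self, h.add_left]
      simp only [symD_update_of_notMem nL nab n hni]
      have : ∀ j ∈ S.erase i, ∀ w w', symD nL nab n (S.erase i)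
          (Function.update (Function.update x i w) j (nL w' (Function.update x i w j))) t =
          symD nL nab n (S.erase i) (Function.update x j (nL w' (x j))) t := fun j hj w w' => by
        have hji := Finset.ne_of_mem_erase hj
        rw [Function.update_of_ne hji, Function.update_comm hji.symm,
          symD_update_of_notMem nL nab n hni]
      rw [Finset.sum_congr rfl fun j hj => this j hj _ _,
        Finset.sum_congr rfl fun j hj => this j hj y _,
        Finset.sum_congr rfl fun j hj => this j hj z _]
      rw [Finset.sum_congr rfl fun j hj => by
        rw [hL.add_left, ih hj _ _ _ hc], Finset.sum_add_distrib]
      abel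
    · have hk' : k ∈ S.erase i := Finset.mem_erase.mpr ⟨fun h => hik h.symm, hk⟩
      simp only [Function.update_of_ne hik]
      rw [ih hk' x y z hc, map_add]
      have : ∀ j ∈ S.erase i, symD nL nab n (S.erase i) (Function.update
            (Function.update x k (y + z)) j (nL (x i) (Function.update x k (y + z) j))) t =
          symD nL nab n (S.erase i) (Function.update
            (Function.update x k y) j (nL (x i) (Function.update x k y j))) t +
          symD nL nab n (S.erase i) (Function.update
            (Function.update x k z) j (nL (x i) (Function.update x k z j))) t := fun j hj => by
        by_cases hjk : j = k
        · subst hjk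
          simp only [Function.update_self, Function.update_idem, map_add]
          exact ih hj x _ _ hc
        · simp only [Function.update_of_ne hjk, Function.update_comm (Ne.symm hjk)]
          exact ih hk' _ _ _ hc
      rw [Finset.sum_congr rfl this, Finset.sum_add_distrib]
      abel

/-- The derivative of `r` produced by `∇` on `M` cancels the one produced by `∇ᴸ (r • y)` in the
slot `k`. The corrections by `∇ᴸ` are there for this cancellation, which makes the powers tensorial.
-/
lemma symD_update_smul (hL : IsConn (R := R) nL) (h : IsConn (R := R) nab) {n : ℕ} {S : Finset ι}
    {k : ι} (hk : k ∈ S) (x : ι → L) (r : R) (y : L) (t : M) (hS : S.card = n) :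
    symD nL nab n S (Function.update x k (r • y)) t =
      r • symD nL nab n S (Function.update x k y) t := by
  induction n generalizing S x k y r with
  | zero => simp [Finset.card_eq_zero.mp hS] at hk
  | succ n ih =>
    rw [symD_succ, symD_succ, Finset.smul_sum]
    refine Finset.sum_congr rfl fun i hi => ?_
    have hc : (S.erase i).card = n := by rw [Finset.card_erase_of_mem hi, hS]; rfl
    by_cases hik : i = k
    · subst hik
      have hni : i ∉ S.erase i := Finset.notMem_erase i S
      rw [Function.update_self, Function.update_self, h.smul_left]
      simp only [symD_update_of_notMem nL nab n hni]
      have : ∀ j ∈ S.erase i, ∀ w w', symD nL nab n (S.erase i)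
          (Function.update (Function.update x i w) j (nL w' (Function.update x i w j))) t =
          symD nL nab n (S.erase i) (Function.update x j (nL w' (x j))) t := fun j hj w w' => by
        have hji := Finset.ne_of_mem_erase hj
        rw [Function.update_of_ne hji, Function.update_comm hji.symm,
          symD_update_of_notMem nL nab n hni]
      rw [Finset.sum_congr rfl fun j hj => this j hj _ _,
        Finset.sum_congr rfl fun j hj => this j hj y _]
      rw [Finset.sum_congr rfl fun j hj => by
        rw [hL.smul_left, ih hj _ _ _ hc], ← Finset.smul_sum, ← smul_sub]
    · have hk' : k ∈ S.erase i := Finset.mem_erase.mpr ⟨fun h => hik h.symm, hk⟩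
      simp only [Function.update_of_ne hik]
      rw [ih hk' x r y hc, h.leibniz]
      have : ∀ j ∈ S.erase i, symD nL nab n (S.erase i) (Function.update
            (Function.update x k (r • y)) j (nL (x i) (Function.update x k (r • y) j))) t =
          r • symD nL nab n (S.erase i) (Function.update
            (Function.update x k y) j (nL (x i) (Function.update x k y j))) t +
          if j = k then ⁅x i, r⁆ • symD nL nab n (S.erase i) (Function.update x k y) t
            else 0 := fun j hj => by
        by_cases hjk : j = k
        · subst hjk
          simp only [Function.update_self, Function.update_idem, if_true, hL.leibniz]
          rw [symD_update_add hL h hj _ _ _ _ hc, ih hj _ _ _ hc, ih hj _ _ _ hc]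
        · simp only [Function.update_of_ne hjk, Function.update_comm (Ne.symm hjk), if_neg hjk,
            add_zero]
          exact ih hk' _ _ _ hc
      rw [Finset.sum_congr rfl this, Finset.sum_add_distrib, Finset.sum_ite_eq' , if_pos hk',
        ← Finset.smul_sum, smul_sub]
      abel

/-- Each derivative falls on one of the two factors, and `A` records the directions used on the
first. By induction a given `A` arises `n.choose (A.card - 1)` times with the outermost direction in
`A` and `n.choose A.card` times with it outside; Pascal's rule adds the two. -/
lemma symD_mul {M₁ M₂ : Type*} [AddCommGroup M₁] [AddCommGroup M₂]
    (nab₁ : L → M₁ →+ M₁) (nab₂ : L → M₂ →+ M₂) (μ : M₁ →+ M₂ →+ M)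
    (hμ : ∀ x a b, nab x (μ a b) = μ (nab₁ x a) b + μ a (nab₂ x b))
    {n : ℕ} {S : Finset ι} (hS : S.card = n) (x : ι → L) (a : M₁) (b : M₂) :
    symD nL nab n S x (μ a b) = ∑ A ∈ S.powerset, n.choose A.card •
      μ (symD nL nab₁ A.card A x a) (symD nL nab₂ (S \ A).card (S \ A) x b) := by
  induction n generalizing S x with
  | zero =>
    obtain rfl := Finset.card_eq_zero.mp hS
    simp [symD]
  | succ n ih =>
    -- `P i A` and `Q i A` are the terms with outermost direction `i` in the next power, on the
    -- first and on the second factor.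
    let P (i : ι) (A : Finset ι) : M₁ := nab₁ (x i) (symD nL nab₁ A.card A x a) -
      ∑ j ∈ A, symD nL nab₁ A.card A (Function.update x j (nL (x i) (x j))) a
    let Q (i : ι) (A : Finset ι) : M₂ := nab₂ (x i) (symD nL nab₂ A.card A x b) -
      ∑ j ∈ A, symD nL nab₂ A.card A (Function.update x j (nL (x i) (x j))) b
    have hP : ∀ A : Finset ι, A.Nonempty → symD nL nab₁ A.card A x a = ∑ i ∈ A, P i (A.erase i) :=
      fun A hA => by
        obtain ⟨m, hm⟩ := Nat.exists_eq_succ_of_ne_zero (Finset.card_ne_zero.mpr hA)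
        rw [hm, symD_succ]
        refine Finset.sum_congr rfl fun i hi => ?_
        have : (A.erase i).card = m := by rw [Finset.card_erase_of_mem hi, hm]; rfl
        simp only [P, this]
    have hQ : ∀ A : Finset ι, A.Nonempty → symD nL nab₂ A.card A x b = ∑ i ∈ A, Q i (A.erase i) :=
      fun A hA => by
        obtain ⟨m, hm⟩ := Nat.exists_eq_succ_of_ne_zero (Finset.card_ne_zero.mpr hA)
        rw [hm, symD_succ]
        refine Finset.sum_congr rfl fun i hi => ?_
        have : (A.erase i).card = m := by rw [Finset.card_erase_of_mem hi, hm]; rfl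
        simp only [Q, this]
    have step : ∀ i ∈ S, nab (x i) (symD nL nab n (S.erase i) x (μ a b)) -
        ∑ j ∈ S.erase i, symD nL nab n (S.erase i) (Function.update x j (nL (x i) (x j))) (μ a b) =
        ∑ A ∈ (S.erase i).powerset, (n.choose A.card •
          μ (P i A) (symD nL nab₂ (S.erase i \ A).card (S.erase i \ A) x b) +
          n.choose A.card • μ (symD nL nab₁ A.card A x a) (Q i (S.erase i \ A))) := fun i hi => by
      have hc : (S.erase i).card = n := by rw [Finset.card_erase_of_mem hi, hS]; rfl
      rw [ih hc, map_sum, Finset.sum_congr rfl fun j _ => ih hc _, Finset.sum_comm,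
        ← Finset.sum_sub_distrib]
      refine Finset.sum_congr rfl fun A hA => ?_
      have hA' : A ⊆ S.erase i := Finset.mem_powerset.mp hA
      rw [← Finset.smul_sum, map_nsmul, ← smul_sub, ← smul_add]
      congr 1
      -- Changing `x j` affects only the factor whose index set contains `j`. The corrections split
      -- accordingly and complete the two terms of the Leibniz rule.
      rw [← Finset.sum_sdiff hA', hμ]
      rw [Finset.sum_congr (s₁ := S.erase i \ A) rfl fun j hj => by
        rw [symD_update_of_notMem nL nab₁ _ (Finset.mem_sdiff.mp hj).2]]
      rw [Finset.sum_congr (s₁ := A) rfl fun j hj => by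
        rw [symD_update_of_notMem nL nab₂ _ (fun h => (Finset.mem_sdiff.mp h).2 hj)]]
      simp only [P, Q, map_sub, AddMonoidHom.sub_apply, map_sum, AddMonoidHom.finsetSum_apply]
      abel
    rw [symD_succ, Finset.sum_congr rfl step]
    simp only [Finset.sum_add_distrib]
    -- The direction `i` acted on the first factor, so the term is counted by `insert i A`; this
    -- shifts the binomial coefficient by one.
    have e1 : ∑ i ∈ S, ∑ A ∈ (S.erase i).powerset, n.choose A.card •
          μ (P i A) (symD nL nab₂ (S.erase i \ A).card (S.erase i \ A) x b) =
        ∑ A ∈ S.powerset, ∑ i ∈ A, n.choose (A.card - 1) •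
          μ (P i (A.erase i)) (symD nL nab₂ (S \ A).card (S \ A) x b) := by
      rw [Finset.sum_sigma', Finset.sum_sigma']
      refine Finset.sum_bij' (fun p _ => ⟨insert p.1 p.2, p.1⟩) (fun p _ => ⟨p.2, p.1.erase p.2⟩)
        ?_ ?_ ?_ ?_ ?_
      · rintro ⟨i, A⟩ h
        simp only [Finset.mem_sigma, Finset.mem_powerset] at h ⊢
        exact ⟨Finset.insert_subset h.1 (h.2.trans (Finset.erase_subset _ _)),
          Finset.mem_insert_self _ _⟩
      · rintro ⟨A, i⟩ h
        simp only [Finset.mem_sigma, Finset.mem_powerset] at h ⊢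
        exact ⟨h.1 h.2, Finset.erase_subset_erase _ h.1⟩
      · rintro ⟨i, A⟩ h
        simp only [Finset.mem_sigma, Finset.mem_powerset] at h
        have : i ∉ A := fun hi => Finset.notMem_erase i S (h.2 hi)
        simp [Finset.erase_insert this]
      · rintro ⟨A, i⟩ h
        simp only [Finset.mem_sigma, Finset.mem_powerset] at h
        simp [Finset.insert_erase h.2]
      · rintro ⟨i, A⟩ h
        simp only [Finset.mem_sigma, Finset.mem_powerset] at h
        have : i ∉ A := fun hi => Finset.notMem_erase i S (h.2 hi)
        have h2 : S \ insert i A = S.erase i \ A := by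
          ext k; simp only [Finset.mem_sdiff, Finset.mem_insert, Finset.mem_erase]; tauto
        simp [Finset.erase_insert this, Finset.card_insert_of_notMem this, h2]
    have e2 : ∑ i ∈ S, ∑ A ∈ (S.erase i).powerset, n.choose A.card •
          μ (symD nL nab₁ A.card A x a) (Q i (S.erase i \ A)) =
        ∑ A ∈ S.powerset, ∑ i ∈ S \ A, n.choose A.card •
          μ (symD nL nab₁ A.card A x a) (Q i ((S \ A).erase i)) := by
      rw [Finset.sum_comm' (t' := S.powerset) (s' := fun A => S \ A)]
      · refine Finset.sum_congr rfl fun A _ => Finset.sum_congr rfl fun i _ => ?_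
        rw [Finset.erase_sdiff_comm]
      · intro i A
        simp only [Finset.mem_powerset, Finset.mem_sdiff, Finset.subset_erase]
        tauto
    rw [e1, e2, ← Finset.sum_add_distrib]
    refine Finset.sum_congr rfl fun A hA => ?_
    have hA' := Finset.mem_powerset.mp hA
    rw [← Finset.smul_sum, ← Finset.smul_sum, ← map_sum, ← AddMonoidHom.finsetSum_apply,
      ← map_sum]
    -- If `A` is empty or all of `S`, only one of the two sums is present and all binomial
    -- coefficients involved equal one.
    rcases A.eq_empty_or_nonempty with rfl | hne
    · rw [hQ (S \ ∅) (by rw [Finset.sdiff_empty]; exact Finset.card_ne_zero.mp (by omega))]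
      simp
    · rw [← hP A hne]
      rcases (S \ A).eq_empty_or_nonempty with h0 | hne'
      · have hSA : A = S := hA'.antisymm (Finset.sdiff_eq_empty_iff_subset.mp h0)
        subst hSA
        rw [hS]
        simp
      · rw [← hQ _ hne', ← add_smul]
        obtain ⟨m, hm⟩ := Nat.exists_eq_succ_of_ne_zero (Finset.card_ne_zero.mpr hne)
        rw [hm, Nat.succ_sub_one, ← Nat.choose_succ_succ]

end SymmetrizedConnection

/-! ### Triangular maps and the leading terms of symmetrized powers. -/

section Triangular

/-- In the lowest degree where `κ t` does not vanish, `T t` has the same coordinates. -/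
lemma triangular_zero {I M E : Type*} [AddCommGroup M] [AddCommGroup E] (deg : I → ℕ)
    {κ T : M →+ (I → E)} (hT : ∀ n t, (∀ α, deg α < n → κ t α = 0) →
      ∀ α, deg α ≤ n → T t α = κ t α) {N : ℕ} {t : M} (ht : ∀ α, deg α < N → T t α = 0) :
    ∀ α, deg α < N → κ t α = 0 := by
  suffices h : ∀ n ≤ N, ∀ α, deg α < n → κ t α = 0 from h N le_rfl
  intro n
  induction n with
  | zero => intro _ α hα; omega
  | succ n ih =>
    intro hn α hα
    rw [← hT n t (ih (by omega)) α (by omega)]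
    exact ht α (by omega)

/-- `T` and `κ` have the same lowest-degree part. Preimages under `T` are built by correcting one
degree at a time, and surjectivity of `κ` onto all families supplies the limit of the corrections.
-/
lemma triangular_bijective {I M E : Type*} [AddCommGroup M] [AddCommGroup E] (deg : I → ℕ)
    {κ T : M →+ (I → E)} (hκ : Function.Bijective κ)
    (hT : ∀ n t, (∀ α, deg α < n → κ t α = 0) → ∀ α, deg α ≤ n → T t α = κ t α) :
    Function.Bijective T := by
  constructor
  · rw [injective_iff_map_eq_zero]
    intro t ht
    refine (injective_iff_map_eq_zero κ).mp hκ.1 t (funext fun α => ?_)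
    exact triangular_zero deg hT (N := deg α + 1) (fun β _ => by rw [ht]; rfl) α (by omega)
  · intro s
    classical
    -- The next approximation changes the `κ`-coordinates of degree `n` by the error of `T t` in
    -- that degree.
    have hstep : ∀ (n : ℕ) (t : M), ∃ t' : M, ∀ α, κ t' α =
        κ t α + if deg α = n then s α - T t α else 0 := fun n t =>
      ⟨(hκ.2 fun α => κ t α + if deg α = n then s α - T t α else 0).choose, fun α =>
        congrFun (hκ.2 fun α => κ t α + if deg α = n then s α - T t α else 0).choose_spec α⟩
    choose f hf using hstep
    let g : ℕ → M := fun n => Nat.rec 0 (fun n t => f n t) n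
    have hg : ∀ n, g (n + 1) = f n (g n) := fun _ => rfl
    have hlow : ∀ n m α, deg α < n → κ (g (n + m)) α = κ (g n) α := by
      intro n m α hα
      induction m with
      | zero => rfl
      | succ m ih => rw [← add_assoc, hg, hf, if_neg (by omega), add_zero, ih]
    have hTeq : ∀ n t t', (∀ α, deg α < n → κ t α = κ t' α) → ∀ α, deg α ≤ n →
        T t α = T t' α + (κ t α - κ t' α) := by
      intro n t t' h α hα
      have := hT n (t - t') (fun β hβ => by simp [h β hβ]) α hα
      simp only [map_sub, Pi.sub_apply] at this
      rw [← this]; abel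
    have hgT : ∀ n α, deg α < n → T (g n) α = s α := by
      intro n
      induction n with
      | zero => intro α hα; omega
      | succ n ih =>
        intro α hα
        have h1 := hTeq n (g (n + 1)) (g n) (fun β hβ => hlow n 1 β hβ) α (by omega)
        rw [hg, hf] at h1
        rw [hg, h1]
        split_ifs with h
        · abel
        · rw [ih α (by omega)]; abel
    -- Coordinates of degree `deg α` are constant from `g (deg α + 1)` on, so this is the limit.
    obtain ⟨t, ht⟩ := hκ.2 fun α => κ (g (deg α + 1)) α
    refine ⟨t, funext fun α => ?_⟩
    have h2 : ∀ β, deg β < deg α + 1 → κ t β = κ (g (deg α + 1)) β := fun β hβ => by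
      have := hlow (deg β + 1) (deg α - deg β) β (by omega)
      rw [show deg β + 1 + (deg α - deg β) = deg α + 1 by omega] at this
      rw [ht, this]
    rw [hTeq (deg α + 1) t _ h2 α (by omega), h2 α (by omega), sub_self, add_zero,
      hgT (deg α + 1) α (by omega)]

end Triangular

section Leading

variable {L M E : Type*} [LieRing L] [AddCommGroup M] [AddCommGroup E] {r : ℕ}
  {ι : Type*} [DecidableEq ι]

/-- A basis of `L` and coordinates on `M` for which a connection lowers the filtration by degree,
with the expected leading part. -/
structure IsFiltered (e : Fin r → L) (nab : L → M →+ M) (κ : M →+ ((Fin r →₀ ℕ) → E)) : Prop where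
  nab_fil : ∀ x n t, (∀ α, α.degree < n + 1 → κ t α = 0) → ∀ α, α.degree < n → κ (nab x t) α = 0
  nab_lead : ∀ i n t, (∀ α, α.degree < n + 1 → κ t α = 0) → ∀ α, α.degree = n →
    κ (nab (e i) t) α = κ t (α + Finsupp.single i 1)

variable {e : Fin r → L} {nab : L → M →+ M} {κ : M →+ ((Fin r →₀ ℕ) → E)} (nL : L → L →+ L)

/-- Each derivative costs one degree of vanishing, and the corrections contain fewer derivatives. -/
lemma IsFiltered.symD_fil (h : IsFiltered e nab κ) {m n : ℕ} {t : M}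
    (ht : ∀ α, α.degree < n + m → κ t α = 0) (S : Finset ι) (x : ι → L) :
    ∀ α, α.degree < n → κ (symD nL nab m S x t) α = 0 := by
  induction m generalizing n S x with
  | zero => exact ht
  | succ m ih =>
    intro α hα
    have ih' := fun S x => ih (n := n + 1) (fun α hα => ht α (by omega)) S x
    rw [symD_succ, map_sum, Finset.sum_apply]
    refine Finset.sum_eq_zero fun i _ => ?_
    rw [map_sub, Pi.sub_apply, h.nab_fil _ n _ (ih' _ _) α hα, map_sum, Finset.sum_apply,
      Finset.sum_eq_zero fun j _ => ih' _ _ α (by omega), sub_zero]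

/-- The corrections contain one derivative less and hence vanish in degree `n`. The `m + 1` choices
of the outermost direction contribute equally, which produces the factorial. -/
lemma IsFiltered.symD_lead (h : IsFiltered e nab κ) {m n : ℕ} {t : M}
    (ht : ∀ α, α.degree < n + m → κ t α = 0) (S : Finset ι) (hS : S.card = m) (y : ι → Fin r)
    {β : Fin r →₀ ℕ} (hβ : β.degree = n) :
    κ (symD nL nab m S (e ∘ y) t) β =
      m.factorial • κ t (β + ∑ i ∈ S, Finsupp.single (y i) 1) := by
  induction m generalizing n S β with
  | zero =>
    obtain rfl := Finset.card_eq_zero.mp hS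
    simp [symD]
  | succ m ih =>
    rw [symD_succ, map_sum, Finset.sum_apply]
    have key : ∀ i ∈ S, κ (nab ((e ∘ y) i) (symD nL nab m (S.erase i) (e ∘ y) t) -
        ∑ j ∈ S.erase i, symD nL nab m (S.erase i)
          (Function.update (e ∘ y) j (nL ((e ∘ y) i) ((e ∘ y) j))) t) β =
        m.factorial • κ t (β + ∑ i ∈ S, Finsupp.single (y i) 1) := fun i hi => by
      have hc : (S.erase i).card = m := by rw [Finset.card_erase_of_mem hi, hS]; rfl
      have hfil := fun x => h.symD_fil nL (m := m) (n := n + 1)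
        (fun α hα => ht α (by omega)) (S.erase i) x
      rw [map_sub, Pi.sub_apply, map_sum, Finset.sum_apply,
        Finset.sum_eq_zero fun j _ => hfil _ β (by omega), sub_zero]
      rw [Function.comp_apply, h.nab_lead _ n _ (hfil _) β hβ,
        ih (n := n + 1) (fun α hα => ht α (by omega)) _ hc (by simp [hβ]), ← Finset.add_sum_erase S _ hi,
        add_assoc]
    rw [Finset.sum_congr rfl key, Finset.sum_const, hS, ← mul_smul, Nat.factorial_succ]

end Leading
end LieAlg

namespace LieAlg

/-! ### Coordinates of tensors, and multi-indices. -/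

section TensorCoordinates

variable {R N F : Type*} [CommRing R] [AddCommGroup N] [Module R N] [AddCommGroup F] [Module R F]
  {q : ℕ} (b : Module.Basis (Fin q) R F)

/-- The coordinates of a tensor, for a basis of the right factor. -/
def tcoord (a : Fin q) : N ⊗[R] F →ₗ[R] N :=
  TensorProduct.lift (LinearMap.mk₂ R (fun n s => b.repr s a • n) (fun _ _ _ => smul_add _ _ _)
    (fun c n s => smul_comm _ _ _) (fun n s t => by rw [map_add, Finsupp.add_apply, add_smul])
    (fun c n s => by rw [map_smul, Finsupp.smul_apply, smul_eq_mul, mul_smul]))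

lemma tcoord_tmul (a : Fin q) (n : N) (s : F) : tcoord b a (n ⊗ₜ s) = b.repr s a • n := rfl

lemma sum_tcoord (t : N ⊗[R] F) : ∑ a, tcoord b a t ⊗ₜ[R] b a = t := by
  induction t with
  | zero => simp
  | tmul n s =>
    conv_rhs => rw [← b.sum_repr s, tmul_sum]
    exact Finset.sum_congr rfl fun a _ => by rw [tcoord_tmul, smul_tmul]
  | add s t hs ht => simp only [map_add, add_tmul, Finset.sum_add_distrib, hs, ht]

lemma tcoord_sum (g : Fin q → N) (a : Fin q) :
    tcoord b a (∑ c, g c ⊗ₜ[R] b c) = g a := by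
  rw [map_sum, Finset.sum_eq_single a]
  · rw [tcoord_tmul, b.repr_self, Finsupp.single_eq_same, one_smul]
  · intro c _ hc
    rw [tcoord_tmul, b.repr_self, Finsupp.single_apply, if_neg hc, zero_smul]
  · simp

lemma tcoord_ext {s t : N ⊗[R] F} (h : ∀ a, tcoord b a s = tcoord b a t) : s = t := by
  rw [← sum_tcoord b s, ← sum_tcoord b t]
  simp only [h]

end TensorCoordinates

section MultiIndices

variable {r : ℕ}

/-- The sorted list of the variables of a monomial. -/
abbrev idxList (α : Fin r →₀ ℕ) : List (Fin r) := α.toMultiset.sort (· ≤ ·)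

lemma length_idxList (α : Fin r →₀ ℕ) : (idxList α).length = α.degree := by
  rw [Multiset.length_sort, Finsupp.card_toMultiset, Finsupp.degree_apply]; rfl

lemma sum_idxList (α : Fin r →₀ ℕ) :
    ∑ i, Finsupp.single ((idxList α).get i) 1 = α := by
  have h : ∑ i, Finsupp.single ((idxList α).get i) 1 =
      ((idxList α).map fun j => Finsupp.single j 1).sum := by
    rw [← List.sum_ofFn]
    congr 1
    exact List.ext_get (by simp) (by simp)
  rw [h, ← Multiset.sum_coe, ← Multiset.map_coe, Multiset.sort_eq]
  apply Function.LeftInverse.injective (g := Multiset.toFinsupp) Finsupp.toMultiset_toFinsupp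
  rw [map_multiset_sum, Multiset.map_map]
  simp

/-- Equal multi-indices mean that the fibres over each variable have equal cardinality; bijections
of the fibres assemble. -/
lemma exists_equiv_of_sum_eq {ι κ : Type*} [Fintype ι] [Fintype κ] {x : ι → Fin r} {y : κ → Fin r}
    (h : ∑ i, Finsupp.single (x i) 1 = ∑ j, Finsupp.single (y j) 1) :
    ∃ σ : ι ≃ κ, ∀ i, y (σ i) = x i := by
  classical
  have hc : ∀ c, Fintype.card {i // x i = c} = Fintype.card {j // y j = c} := fun c => by
    have := DFunLike.congr_fun h c
    simp only [Finsupp.coe_finsetSum, Finset.sum_apply, Finsupp.single_apply] at this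
    rw [Fintype.card_subtype, Fintype.card_subtype, Finset.card_filter, Finset.card_filter]
    exact this
  exact ⟨Equiv.ofFiberEquiv fun c => Fintype.equivOfCardEq (hc c),
    fun i => Equiv.ofFiberEquiv_map _ i⟩

variable {L M : Type*} [LieRing L] [AddCommGroup M] (nL : L → L →+ L) (nab : L → M →+ M)
  (e : Fin r → L)

/-- The value of the symmetrized powers of a connection on the monomial of multi-index `α`. -/
def symDIdx (α : Fin r →₀ ℕ) (t : M) : M :=
  symD nL nab (idxList α).length Finset.univ (e ∘ (idxList α).get) t

/-- By `symD_map` the powers do not depend on a numbering of the arguments, so on vectors of a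
family they depend only on how often each vector occurs. -/
lemma symD_comp_eq_symDIdx {ι : Type*} [DecidableEq ι] (S : Finset ι) (y : ι → Fin r) (t : M) :
    symD nL nab S.card S (e ∘ y) t = symDIdx nL nab e (∑ i ∈ S, Finsupp.single (y i) 1) t := by
  set α := ∑ i ∈ S, Finsupp.single (y i) 1 with hα
  have h : ∑ i, Finsupp.single ((idxList α).get i) 1 =
      ∑ j : S, Finsupp.single (y j) 1 := by
    rw [sum_idxList, hα, Finset.sum_coe_sort S fun j => Finsupp.single (y j) 1]
  obtain ⟨σ, hσ⟩ := exists_equiv_of_sum_eq h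
  have hm : S = Finset.univ.map (σ.toEmbedding.trans (Function.Embedding.subtype _)) := by
    rw [← Finset.map_map, Finset.map_univ_equiv, Finset.univ_eq_attach]
    exact (Finset.attach_map_val (s := S)).symm
  have hn : S.card = (idxList α).length := by
    rw [← Fintype.card_coe, ← Fintype.card_congr σ, Fintype.card_fin]
  rw [symDIdx, hn]
  conv_lhs => rw [hm]
  rw [symD_map]
  congr 1
  funext i
  exact congrArg e (hσ i)

end MultiIndices

/-! ### Jets and twisted jets in local frames. -/

section Frames

variable {K : Type u} [Field K] {X : TopCat.{u}} {O : TopCat.Sheaf (CommAlgCat.{u} K) X}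

namespace PMod

/-- A local frame of `F` over `V`: sections over `V` which form a basis over all smaller open
sets. -/
structure Frame (F : PMod O) (n : ℕ) (V : Opens X) where
  vec : Fin n → F.obj V
  li : ∀ (W : Opens X) (h : W ≤ V), LinearIndependent (Sec O W) (fun i => F.res h (vec i))
  span : ∀ (W : Opens X) (h : W ≤ V),
    Submodule.span (Sec O W) (Set.range fun i => F.res h (vec i)) = ⊤

namespace Frame

variable {F : PMod O} {n : ℕ} {V W : Opens X}

/-- The restriction of a frame. -/
def restrict (f : F.Frame n V) (h : W ≤ V) : F.Frame n W where
  vec i := F.res h (f.vec i)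
  li W' h' := by simpa only [F.res_res] using f.li W' (h'.trans h)
  span W' h' := by simpa only [F.res_res] using f.span W' (h'.trans h)

/-- The basis of sections given by a frame. -/
def basis (f : F.Frame n V) : Module.Basis (Fin n) (Sec O V) (F.obj V) :=
  Module.Basis.mk (v := f.vec) (by simpa only [F.res_refl] using f.li V le_rfl)
    (by simpa only [F.res_refl] using (f.span V le_rfl).ge)

@[simp] lemma basis_apply (f : F.Frame n V) (i : Fin n) : f.basis i = f.vec i := by
  simp [basis]

lemma restrict_vec (f : F.Frame n V) (h : W ≤ V) (i : Fin n) :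
    (f.restrict h).vec i = F.res h (f.vec i) := rfl

lemma repr_res (f : F.Frame n V) (h : W ≤ V) (s : F.obj V) (i : Fin n) :
    (f.restrict h).basis.repr (F.res h s) i = rs O h (f.basis.repr s i) := by
  conv_lhs => rw [← f.basis.sum_repr s, map_sum]
  simp only [LinearMap.map_smulₛₗ, basis_apply, ← restrict_vec]
  rw [map_sum, Finsupp.coe_finsetSum, Finset.sum_apply]
  simp only [map_smul, ← basis_apply, Module.Basis.repr_self, Finsupp.smul_apply,
    Finsupp.single_apply, smul_eq_mul, mul_ite, mul_one, mul_zero]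
  simp

end Frame

end PMod

namespace LieAlgebroid

variable {L : LieAlgebroid O} {V W : Opens X} {r : ℕ}

/-- A frame of a Lie algebroid, as a basis of sections. -/
def lbasis (f : L.toPMod.Frame r V) : Module.Basis (Fin r) (Sec O V) (L.obj V) := f.basis

/-- The sections of a frame of a Lie algebroid. -/
def lvec (f : L.toPMod.Frame r V) : Fin r → L.obj V := f.vec

lemma lbasis_coe (f : L.toPMod.Frame r V) : ⇑(lbasis f) = lvec f :=
  funext fun i => f.basis_apply i

/-- A frame of a Lie algebroid, as a frame of its abelianization. -/
def abFrame (f : L.toPMod.Frame r V) : L.abelian.toPMod.Frame r V := ⟨f.vec, f.li, f.span⟩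

/-- The monomials in a frame. -/
abbrev fmono (f : L.toPMod.Frame r V) (α : Fin r →₀ ℕ) : L.UE V :=
  UEA.mono (R := Sec O V) (lvec f) α

lemma ures_fmono (f : L.toPMod.Frame r V) (h : W ≤ V) (α : Fin r →₀ ℕ) :
    L.ures h (fmono f α) = fmono (f.restrict h) α := by
  refine (map_list_prod (L.ures h) _).trans ?_
  rw [List.map_map]
  refine congrArg List.prod (List.map_congr_left fun i _ => ?_)
  exact UEA.map_ιL (L.res h) (lvec f i)

/-- The monomial basis of the enveloping algebra. -/
def ubasis (f : L.toPMod.Frame r V) : Module.Basis (Fin r →₀ ℕ) (Sec O V) (L.UE V) :=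
  UEA.pbw (lbasis f)

lemma ubasis_apply (f : L.toPMod.Frame r V) (α : Fin r →₀ ℕ) : ubasis f α = fmono f α := by
  rw [ubasis, UEA.pbw_apply, lbasis_coe]

/-- The restricted monomials are bases over all smaller open sets, so the values over `V` determine
the others. -/
lemma jet_ext (f : L.toPMod.Frame r V) {φ ψ : L.Jet V}
    (h : ∀ α, Jet.app φ le_rfl (fmono f α) = Jet.app ψ le_rfl (fmono f α)) : φ = ψ := by
  ext W hW D
  have : Jet.app φ hW = Jet.app ψ hW := by
    refine (ubasis (f.restrict hW)).ext fun α => ?_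
    rw [ubasis_apply, ← ures_fmono]
    refine (Jet.app_res φ le_rfl hW _).trans (Eq.trans ?_ (Jet.app_res ψ le_rfl hW _).symm)
    rw [h]
  rw [this]

/-- The jet with given values on the monomials in a frame. -/
def jetOf (f : L.toPMod.Frame r V) (c : (Fin r →₀ ℕ) → Sec O V) : L.Jet V :=
  Jet.mk (fun {W} h => (ubasis (f.restrict h)).constr (Sec O W) fun α => rs O h (c α))
    fun {W W'} h h' D => by
      let F₁ : L.UE W →ₛₗ[rs O h'] Sec O W' :=
        ((ubasis (f.restrict (h'.trans h))).constr (Sec O W')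
          fun α => rs O (h'.trans h) (c α)).comp (UEA.mapₛ (L.res h'))
      let F₂ : L.UE W →ₛₗ[rs O h'] Sec O W' :=
        ((PMod.unit O).res h').comp
          ((ubasis (f.restrict h)).constr (Sec O W) fun α => rs O h (c α))
      have : F₁ = F₂ := (ubasis (f.restrict h)).ext fun α => by
        change (ubasis (f.restrict (h'.trans h))).constr (Sec O W') _
            (L.ures h' (ubasis (f.restrict h) α)) =
          rs O h' ((ubasis (f.restrict h)).constr (Sec O W) _ (ubasis (f.restrict h) α))
        rw [Module.Basis.constr_basis, ubasis_apply, ures_fmono, rs_rs]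
        have h2 : fmono ((f.restrict h).restrict h') α = ubasis (f.restrict (h'.trans h)) α := by
          rw [ubasis_apply, ← ures_fmono, ← ures_fmono, ← ures_fmono, ures_ures]
        rw [h2, Module.Basis.constr_basis]
      exact LinearMap.congr_fun this D

lemma jetOf_app (f : L.toPMod.Frame r V) (c : (Fin r →₀ ℕ) → Sec O V) (α : Fin r →₀ ℕ) :
    Jet.app (jetOf f c) le_rfl (fmono f α) = c α := by
  have h2 : fmono f α = ubasis (f.restrict le_rfl) α := by
    rw [ubasis_apply, ← ures_fmono, ures_refl]
  change (ubasis (f.restrict le_rfl)).constr (Sec O V) _ (fmono f α) = _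
  rw [h2, Module.Basis.constr_basis, rs_refl]

/-- The values of a jet on the monomials in a frame. -/
def jetVal (f : L.toPMod.Frame r V) : L.Jet V →+ ((Fin r →₀ ℕ) → Sec O V) where
  toFun φ α := Jet.app φ le_rfl (fmono f α)
  map_zero' := rfl
  map_add' _ _ := rfl

lemma jetVal_apply (f : L.toPMod.Frame r V) (φ : L.Jet V) (α) :
    jetVal f φ α = Jet.app φ le_rfl (fmono f α) := rfl

lemma jetVal_bijective (f : L.toPMod.Frame r V) : Function.Bijective (jetVal f) :=
  ⟨fun _ _ h => jet_ext f fun α => congrFun h α, fun c => ⟨jetOf f c, funext (jetOf_app f c)⟩⟩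

lemma jetVal_restrict (f : L.toPMod.Frame r V) (h : W ≤ V) (φ : L.Jet V) (α) :
    jetVal (f.restrict h) (Jet.restrict h φ) α = rs O h (jetVal f φ α) := by
  rw [jetVal_apply, jetVal_apply, ← ures_fmono]
  exact Jet.app_res φ le_rfl h _

lemma app_eq_zero_of_mem_fil (f : L.toPMod.Frame r V) {n : ℕ} {φ : L.Jet V}
    (h : ∀ α, α.degree < n → jetVal f φ α = 0) {k : ℕ} (hk : k < n) {D : L.UE V}
    (hD : D ∈ UEA.fil (Sec O V) (L.obj V) k) : Jet.app φ le_rfl D = 0 := by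
  rw [← (ubasis f).linearCombination_repr D, Finsupp.linearCombination_apply, Finsupp.sum, map_sum]
  refine Finset.sum_eq_zero fun α hα => ?_
  rw [map_smul, ubasis_apply]
  have := (UEA.mem_fil_iff (lbasis f)).mp hD α (Finsupp.mem_support_iff.mp hα)
  exact (congrArg _ (h α (by omega))).trans (smul_zero _)

/-- The action of `x ∈ L` on jets through the second module structure. -/
def jetNab (V : Opens X) (x : L.obj V) : L.Jet V →+ L.Jet V :=
  DistribSMul.toAddMonoidHom _ (UEA.ιL (Sec O V) x)

lemma jetNab_app (x : L.obj V) (φ : L.Jet V) (D : L.UE V) :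
    Jet.app (jetNab V x φ) le_rfl D = Jet.app φ le_rfl (D * UEA.ιL (Sec O V) x) := by
  refine (Jet.smul_app _ _ _ _).trans ?_
  rw [ures_refl]

lemma isConn_jetNab (V : Opens X) : IsConn (R := Sec O V) (jetNab (L := L) V) where
  add_left x y φ := by
    change UEA.ιL (Sec O V) (x + y) • φ = UEA.ιL (Sec O V) x • φ + UEA.ιL (Sec O V) y • φ
    rw [map_add, add_smul]
  smul_left s x φ := by
    change UEA.ιL (Sec O V) (s • x) • φ = s • UEA.ιL (Sec O V) x • φ
    rw [UEA.ιL_smul, smul_assoc]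
  leibniz x s φ := UEA.ιL_smul_smul x s φ

lemma ring_smul_app_refl (s : Sec O V) (φ : L.Jet V) (D : L.UE V) :
    Jet.app (s • φ) le_rfl D = Jet.app φ le_rfl (D * UEA.ιR _ s) := by
  rw [Jet.ring_smul_app, rs_refl]

lemma jetVal_smul_fil (f : L.toPMod.Frame r V) {n : ℕ} {φ : L.Jet V}
    (h : ∀ α, α.degree < n → jetVal f φ α = 0) (s : Sec O V) :
    ∀ α, α.degree < n → jetVal f (s • φ) α = 0 := fun α hα => by
  rw [jetVal_apply, ring_smul_app_refl]
  exact app_eq_zero_of_mem_fil f h hα (UEA.mul_ιR_mem_fil (UEA.mono_mem_fil _ α) s)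

/-- `∇⁽²⁾` multiplies the argument by `x` on the right. This raises the order by one, and for a
frame vector it gives the next monomial up to an element of order `|α|`, where `φ` vanishes. -/
lemma isFiltered_jet (f : L.toPMod.Frame r V) : IsFiltered (lvec f) (jetNab V) (jetVal f) where
  nab_fil x n φ h α hα := by
    rw [jetVal_apply, jetNab_app]
    refine app_eq_zero_of_mem_fil f h (k := α.degree + 1) (by omega)
      (UEA.mul_mem_fil (UEA.mono_mem_fil _ α) (UEA.ιL_mem_fil x))
  nab_lead i n φ h α hα := by
    rw [jetVal_apply, jetNab_app, jetVal_apply, ← sub_eq_zero, ← map_sub]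
    have h1 := UEA.mono_mul_ιL_sub_mem (lbasis f) i α
    rw [lbasis_coe] at h1
    exact app_eq_zero_of_mem_fil f h (k := α.degree) (by omega) h1

variable {E : PMod O} {q : ℕ}

/-- The coordinates of an element of `J(L) ⊗ E` for frames of `L` and `E`. -/
def twVal (f : L.toPMod.Frame r V) (b : E.Frame q V) :
    (L.preTwJet E).obj V →+ ((Fin r →₀ ℕ) → E.obj V) where
  toFun t α := ∑ a, jetVal f (tcoord b.basis a t) α • b.vec a
  map_zero' := by
    funext α
    refine Finset.sum_eq_zero fun a _ => ?_
    rw [map_zero, map_zero]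
    exact zero_smul _ _
  map_add' s t := by
    funext α
    rw [Pi.add_apply, ← Finset.sum_add_distrib]
    refine Finset.sum_congr rfl fun a _ => ?_
    rw [map_add, map_add, Pi.add_apply, add_smul]

lemma twVal_repr (f : L.toPMod.Frame r V) (b : E.Frame q V) (t : (L.preTwJet E).obj V)
    (α : Fin r →₀ ℕ) (a : Fin q) :
    b.basis.repr (twVal f b t α) a = jetVal f (tcoord b.basis a t) α := by
  change b.basis.repr (∑ a, jetVal f (tcoord b.basis a t) α • b.vec a) a = _
  simp only [← b.basis_apply]
  rw [b.basis.repr_sum_self]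

lemma twVal_eq_zero_iff (f : L.toPMod.Frame r V) (b : E.Frame q V) (t : (L.preTwJet E).obj V)
    (α : Fin r →₀ ℕ) :
    twVal f b t α = 0 ↔ ∀ a, jetVal f (tcoord b.basis a t) α = 0 := by
  simp only [← twVal_repr]
  constructor
  · intro h a; rw [h, map_zero]; rfl
  · intro h; exact b.basis.repr.map_eq_zero_iff.mp (Finsupp.ext h)

lemma twVal_bijective (f : L.toPMod.Frame r V) (b : E.Frame q V) :
    Function.Bijective (twVal f b) := by
  constructor
  · intro s t h
    refine tcoord_ext b.basis fun a => (jetVal_bijective f).1 (funext fun α => ?_)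
    rw [← twVal_repr, ← twVal_repr, h]
  · intro c
    choose g hg using fun a : Fin q => (jetVal_bijective f).2 fun α => b.basis.repr (c α) a
    refine ⟨∑ a, g a ⊗ₜ[Sec O V] b.basis a, funext fun α => b.basis.repr.injective
      (Finsupp.ext fun a => ?_)⟩
    rw [twVal_repr, tcoord_sum, hg]

/-- The underlying operators of a connection on `L`. -/
abbrev lnab (nL : L.Connection L.toPMod) (V : Opens X) (x : L.obj V) : L.obj V →+ L.obj V :=
  nL.nabla V x

lemma isConn_lnab (nL : L.Connection L.toPMod) (V : Opens X) :
    IsConn (R := Sec O V) (lnab nL V) where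
  add_left x y m := by
    change nL.nabla V (x + y) m = nL.nabla V x m + nL.nabla V y m
    rw [map_add]; rfl
  smul_left s x m := nL.smul_nabla s x m
  leibniz x s m := nL.leibniz x s m

lemma twNabla_tmul (nE : L.Connection E) (x : L.obj V) (φ : L.Jet V) (s : E.obj V) :
    twNabla nE x (φ ⊗ₜ[Sec O V] s) = (jetNab V x φ) ⊗ₜ[Sec O V] s +
      φ ⊗ₜ[Sec O V] nE.nabla V x s := rfl

lemma twHom_ext {A : Type*} [AddCommGroup A] {F G : (L.preTwJet E).obj V →+ A}
    (h : ∀ (φ : L.Jet V) (s : E.obj V), F (φ ⊗ₜ[Sec O V] s) = G (φ ⊗ₜ[Sec O V] s)) : F = G := by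
  ext t
  induction t using TensorProduct.induction_on with
  | zero => rw [map_zero, map_zero]
  | tmul φ s => exact h φ s
  | add s t hs ht => rw [map_add, map_add, hs, ht]

lemma isConn_twNabla (nE : L.Connection E) (V : Opens X) :
    IsConn (R := Sec O V) (twNabla nE (L := L) (U := V)) where
  add_left x y t := by
    refine DFunLike.congr_fun (twHom_ext (F := twNabla nE (x + y))
      (G := twNabla nE x + twNabla nE y) fun φ s => ?_) t
    rw [AddMonoidHom.add_apply, twNabla_tmul, twNabla_tmul, twNabla_tmul, map_add,
      (isConn_jetNab V).add_left, add_tmul, AddMonoidHom.add_apply, tmul_add]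
    abel
  smul_left c x t := by
    refine DFunLike.congr_fun (twHom_ext (F := twNabla nE (c • x))
      (G := (DistribSMul.toAddMonoidHom _ c).comp (twNabla nE x)) fun φ s => ?_) t
    change _ = c • twNabla nE x (φ ⊗ₜ[Sec O V] s)
    rw [twNabla_tmul, twNabla_tmul, (isConn_jetNab V).smul_left, nE.smul_nabla, smul_add,
      smul_tmul', tmul_smul]
  leibniz x c t := by
    refine DFunLike.congr_fun (twHom_ext
      (F := (twNabla nE x).comp (DistribSMul.toAddMonoidHom _ c))
      (G := (DistribSMul.toAddMonoidHom _ c).comp (twNabla nE x) +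
        DistribSMul.toAddMonoidHom _ ⁅x, c⁆) fun φ s => ?_) t
    change twNabla nE x (c • (φ ⊗ₜ[Sec O V] s)) =
      c • twNabla nE x (φ ⊗ₜ[Sec O V] s) + ⁅x, c⁆ • (φ ⊗ₜ[Sec O V] s)
    rw [smul_tmul', twNabla_tmul, twNabla_tmul, (isConn_jetNab V).leibniz, smul_add, add_tmul,
      smul_tmul', smul_tmul', smul_tmul']
    abel

/-- In a frame of `E` the twisted connection is `∇⁽²⁾` plus a matrix of functions; the matrix has
order zero and does not affect leading terms. -/
lemma tcoord_twNabla (nE : L.Connection E) (b : E.Frame q V) (x : L.obj V)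
    (t : (L.preTwJet E).obj V) (a : Fin q) :
    tcoord b.basis a (twNabla nE x t) = jetNab V x (tcoord b.basis a t) +
      ∑ c, b.basis.repr (nE.nabla V x (b.vec c)) a • tcoord b.basis c t := by
  have h : twNabla nE x t = ∑ c, jetNab V x (tcoord b.basis c t) ⊗ₜ[Sec O V] b.basis c +
      ∑ c, tcoord b.basis c t ⊗ₜ[Sec O V] nE.nabla V x (b.vec c) := by
    conv_lhs => rw [← sum_tcoord b.basis t]
    rw [map_sum (twNabla nE x), ← Finset.sum_add_distrib]
    refine Finset.sum_congr rfl fun c _ => ?_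
    rw [twNabla_tmul, b.basis_apply]
  rw [h, map_add, tcoord_sum, map_sum]
  rfl

lemma isFiltered_twNabla (nE : L.Connection E) (f : L.toPMod.Frame r V) (b : E.Frame q V) :
    IsFiltered (lvec f) (twNabla nE (L := L) (U := V)) (twVal f b) where
  nab_fil x n t h α hα := by
    have h' : ∀ a, ∀ α : Fin r →₀ ℕ, α.degree < n + 1 → jetVal f (tcoord b.basis a t) α = 0 :=
      fun a α hα => (twVal_eq_zero_iff f b t α).mp (h α hα) a
    rw [twVal_eq_zero_iff]
    intro a
    rw [tcoord_twNabla, map_add, Pi.add_apply, (isFiltered_jet f).nab_fil x n _ (h' a) α hα,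
      zero_add, map_sum, Finset.sum_apply]
    exact Finset.sum_eq_zero fun c _ => jetVal_smul_fil f (h' c) _ α (by omega)
  nab_lead i n t h α hα := by
    have h' : ∀ a, ∀ α : Fin r →₀ ℕ, α.degree < n + 1 → jetVal f (tcoord b.basis a t) α = 0 :=
      fun a α hα => (twVal_eq_zero_iff f b t α).mp (h α hα) a
    refine b.basis.repr.injective (Finsupp.ext fun a => ?_)
    rw [twVal_repr, twVal_repr, tcoord_twNabla, map_add, Pi.add_apply,
      (isFiltered_jet f).nab_lead i n _ (h' a) α hα, map_sum, Finset.sum_apply,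
      Finset.sum_eq_zero fun c _ => jetVal_smul_fil f (h' c) _ α (by omega), add_zero]

end LieAlgebroid
end Frames
end LieAlg

namespace LieAlg

/-! ### Formal expansions along a connection. -/

section Correspondence

variable {R L L' M M' E : Type*} [CommRing R] [LieRing L] [Module R L] [LieRingModule L R]
  [LieRing L'] [Module R L'] [LieRingModule L' R]
  [AddCommGroup M] [Module R M] [AddCommGroup M'] [Module R M'] [AddCommGroup E] [Module R E]
  {nL : L → L →+ L} {nab : L → M →+ M} {nL' : L' → L' →+ L'} {nab' : L' → M' →+ M'}

/-- The values of the symmetrized powers of a connection, as multilinear maps. -/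
def symDMultilinear (hL : IsConn (R := R) nL) (h : IsConn (R := R) nab) (ev : M →ₗ[R] E) (n : ℕ)
    (t : M) : MultilinearMap R (fun _ : Fin n => L) E :=
  MultilinearMap.mk' (fun x => ev (symD nL nab n Finset.univ x t))
    (fun x i y z => by
      rw [symD_update_add hL h (Finset.mem_univ _) x y z t (by simp), map_add])
    (fun x i c y => by
      rw [symD_update_smul hL h (Finset.mem_univ i) x c y t (by simp), map_smul])

/-- Both sides are multilinear, so tuples of basis vectors suffice, and there only the multi-index
matters. -/
lemma symD_univ_eq_of_symDIdx_eq {r : ℕ} (e : Module.Basis (Fin r) R L) (g : L →ₗ[R] L')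
    (hL : IsConn (R := R) nL) (h : IsConn (R := R) nab) (ev : M →ₗ[R] E)
    (hL' : IsConn (R := R) nL') (h' : IsConn (R := R) nab') (ev' : M' →ₗ[R] E) {t : M} {t' : M'}
    (H : ∀ α, ev' (symDIdx nL' nab' (g ∘ e) α t') = ev (symDIdx nL nab e α t))
    (n : ℕ) (x : Fin n → L) :
    ev' (symD nL' nab' n Finset.univ (g ∘ x) t') = ev (symD nL nab n Finset.univ x t) := by
  have : (symDMultilinear hL' h' ev' n t').compLinearMap (fun _ => g) =
      symDMultilinear hL h ev n t := by
    refine Module.Basis.ext_multilinear (fun _ => e) fun v => ?_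
    have h1 := symD_comp_eq_symDIdx nL nab e Finset.univ v t
    have h2 := symD_comp_eq_symDIdx nL' nab' (g ∘ e) Finset.univ v t'
    rw [Finset.card_univ, Fintype.card_fin] at h1 h2
    exact (congrArg ev' h2).trans ((H _).trans (congrArg ev h1).symm)
  exact DFunLike.congr_fun this x

end Correspondence

section FormalExpansion

variable (K : Type*) {R : Type*} [Field K] [CommRing R] [Algebra K R]

/-- The inverse in a `K`-algebra of a natural number. -/
def natInv (R : Type*) [CommRing R] [Algebra K R] (n : ℕ) : R := algebraMap K R (n : K)⁻¹

lemma mul_natInv [CharZero K] {n : ℕ} (hn : n ≠ 0) : (n : R) * natInv K R n = 1 := by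
  rw [natInv, ← map_natCast (algebraMap K R), ← map_mul, mul_inv_cancel₀ (Nat.cast_ne_zero.mpr hn),
    map_one]

variable [CharZero K]

/-- The factorial of a multi-index. -/
def mfac {r : ℕ} (α : Fin r →₀ ℕ) : ℕ := ∏ i, (α i).factorial

lemma mfac_ne_zero {r : ℕ} (α : Fin r →₀ ℕ) : mfac α ≠ 0 :=
  Finset.prod_ne_zero_iff.mpr fun _ _ => Nat.factorial_ne_zero _

lemma mfac_zero {r : ℕ} : mfac (0 : Fin r →₀ ℕ) = 1 := by simp [mfac]

lemma mfac_add_single {r : ℕ} (α : Fin r →₀ ℕ) (i : Fin r) :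
    mfac (α + Finsupp.single i 1) = (α i + 1) * mfac α := by
  rw [mfac, mfac, ← Finset.mul_prod_erase _ _ (Finset.mem_univ i),
    ← Finset.mul_prod_erase _ (fun i => (α i).factorial) (Finset.mem_univ i), ← mul_assoc]
  congr 1
  · simp [Nat.factorial_succ]
  · refine Finset.prod_congr rfl fun j hj => ?_
    rw [Finsupp.add_apply, Finsupp.single_apply, if_neg (Finset.ne_of_mem_erase hj).symm, add_zero]

/-- The iterated derivative at `0` of a power series. -/
def derivAt {r : ℕ} (α : Fin r →₀ ℕ) : MvPowerSeries (Fin r) R →ₗ[R] R :=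
  (mfac α : R) • MvPowerSeries.coeff α

lemma derivAt_apply {r : ℕ} (α : Fin r →₀ ℕ) (f : MvPowerSeries (Fin r) R) :
    derivAt α f = mfac α * MvPowerSeries.coeff α f := rfl

lemma derivAt_pderiv {r : ℕ} (α : Fin r →₀ ℕ) (i : Fin r) (f : MvPowerSeries (Fin r) R) :
    derivAt α (MvPowerSeries.pderiv R i f) = derivAt (α + Finsupp.single i 1) f := by
  rw [derivAt_apply, derivAt_apply, MvPowerSeries.coeff_pderiv, mfac_add_single]
  push_cast
  ring

/-- Indexed by subsets, the Leibniz rule for power series has no binomial coefficients. It has the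
shape of `symD_mul` once the powers are divided by factorials. -/
lemma derivAt_mul {r : ℕ} {ι : Type*} [DecidableEq ι] (S : Finset ι) (y : ι → Fin r)
    (f g : MvPowerSeries (Fin r) R) :
    derivAt (∑ i ∈ S, Finsupp.single (y i) 1) (f * g) = ∑ A ∈ S.powerset,
      derivAt (∑ i ∈ A, Finsupp.single (y i) 1) f *
        derivAt (∑ i ∈ S \ A, Finsupp.single (y i) 1) g := by
  induction S using Finset.induction_on generalizing f g with
  | empty => simp [derivAt_apply, mfac_zero]
  | insert i S hi ih =>
    rw [Finset.sum_insert hi, add_comm, ← derivAt_pderiv, Derivation.leibniz, map_add,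
      Finset.sum_powerset_insert hi, smul_eq_mul, smul_eq_mul, ih, mul_comm g, ih]
    refine congrArg₂ _ (Finset.sum_congr rfl fun A hA => ?_) (Finset.sum_congr rfl fun A hA => ?_)
    · have hA' := Finset.mem_powerset.mp hA
      rw [derivAt_pderiv, Finset.insert_sdiff_of_notMem _ fun h => hi (hA' h),
        Finset.sum_insert fun h => hi (Finset.mem_sdiff.mp h).1, add_comm (Finsupp.single (y i) 1)]
    · have hA' := Finset.mem_powerset.mp hA
      rw [derivAt_pderiv, Finset.sum_insert fun h => hi (hA' h), add_comm (Finsupp.single (y i) 1),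
        Finset.insert_sdiff_insert, Finset.sdiff_insert_of_notMem hi]

variable {L M E : Type*} [LieRing L] [Module R L] [LieRingModule L R] [AddCommGroup M] [Module R M]
  [AddCommGroup E] [Module R E] (nL : L → L →+ L) (nab : L → M →+ M) {r : ℕ} (e : Fin r → L)

/-- The values at the origin of the symmetrized powers of a connection, divided by factorials. -/
def formMap (ev : M →ₗ[R] E) : M →+ ((Fin r →₀ ℕ) → E) where
  toFun t α := natInv K R α.degree.factorial • ev (symDIdx nL nab e α t)
  map_zero' := by
    funext α
    have h := symD_add nL nab (idxList α).length Finset.univ (e ∘ (idxList α).get) 0 0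
    rw [add_zero] at h
    rw [symDIdx, left_eq_add.mp h, map_zero, smul_zero, Pi.zero_apply]
  map_add' s t := by
    funext α
    rw [symDIdx, symD_add, map_add, smul_add]; rfl

lemma formMap_apply (ev : M →ₗ[R] E) (t : M) (α : Fin r →₀ ℕ) :
    formMap K nL nab e ev t α = natInv K R α.degree.factorial • ev (symDIdx nL nab e α t) := rfl

lemma factorial_smul_formMap (ev : M →ₗ[R] E) (t : M) (α : Fin r →₀ ℕ) :
    (α.degree.factorial : R) • formMap K nL nab e ev t α = ev (symDIdx nL nab e α t) := by
  rw [formMap_apply, ← mul_smul, mul_natInv K (Nat.factorial_ne_zero _), one_smul]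

variable {nL nab e}

/-- The normalization of `formMap` cancels the factorial of `symD_lead`, using characteristic zero.
This is the triangularity required by `triangular_bijective`. -/
lemma IsFiltered.formMap_eq {κ : M →+ ((Fin r →₀ ℕ) → E)} (h : IsFiltered e nab κ)
    (ev : M →ₗ[R] E) (hev : ∀ t, κ t 0 = ev t) {t : M} (α : Fin r →₀ ℕ)
    (ht : ∀ β : Fin r →₀ ℕ, β.degree < α.degree → κ t β = 0) :
    formMap K nL nab e ev t α = κ t α := by
  rw [formMap_apply, ← hev, symDIdx, h.symD_lead nL (n := 0)
    (fun β hβ => ht β (by rw [length_idxList] at hβ; omega)) Finset.univ (by simp) _ (map_zero _),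
    zero_add, sum_idxList, length_idxList, ← Nat.cast_smul_eq_nsmul R, ← mul_smul,
    mul_comm, mul_natInv K (Nat.factorial_ne_zero _), one_smul]

lemma IsFiltered.formMap_bijective {κ : M →+ ((Fin r →₀ ℕ) → E)} (h : IsFiltered e nab κ)
    (hκ : Function.Bijective κ) (ev : M →ₗ[R] E) (hev : ∀ t, κ t 0 = ev t) :
    Function.Bijective (formMap K nL nab e ev) :=
  triangular_bijective (fun α => α.degree) hκ fun _ _ ht α hα =>
    h.formMap_eq K ev hev α fun β hβ => ht β (by omega)

variable (nL nab e)

/-- The formal power series expansion given by a connection. -/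
def pser (ev : M →ₗ[R] R) : M →+ MvPowerSeries (Fin r) R where
  toFun t α := natInv K R (mfac α) * formMap K nL nab e ev t α
  map_zero' := by
    funext α
    rw [map_zero]
    exact mul_zero _
  map_add' s t := by
    funext α
    rw [map_add, Pi.add_apply, mul_add]; rfl

lemma coeff_pser (ev : M →ₗ[R] R) (t : M) (α : Fin r →₀ ℕ) :
    MvPowerSeries.coeff α (pser K nL nab e ev t) =
      natInv K R (mfac α) * formMap K nL nab e ev t α := rfl

/-- The factor `1 / α!` in `pser` is chosen so that iterated derivatives at the origin return the
values of `formMap`. -/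
lemma derivAt_pser (ev : M →ₗ[R] R) (t : M) (α : Fin r →₀ ℕ) :
    derivAt α (pser K nL nab e ev t) = formMap K nL nab e ev t α := by
  rw [derivAt_apply, coeff_pser, ← mul_assoc, mul_natInv K (mfac_ne_zero α), one_mul]

lemma derivAt_pser_sum (ev : M →ₗ[R] R) (t : M) {ι : Type*} [DecidableEq ι] (S : Finset ι)
    (y : ι → Fin r) : derivAt (∑ i ∈ S, Finsupp.single (y i) 1) (pser K nL nab e ev t) =
      natInv K R S.card.factorial * ev (symD nL nab S.card S (e ∘ y) t) := by
  rw [derivAt_pser, formMap_apply, symD_comp_eq_symDIdx, smul_eq_mul]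
  congr 3
  simp

lemma derivAt_ext (K : Type*) {R : Type*} [Field K] [CharZero K] [CommRing R] [Algebra K R]
    {r : ℕ} {f g : MvPowerSeries (Fin r) R} (h : ∀ α, derivAt α f = derivAt α g) : f = g := by
  ext α
  have h1 := h α
  rw [derivAt_apply, derivAt_apply] at h1
  have h2 := mul_natInv K (R := R) (mfac_ne_zero α)
  linear_combination natInv K R (mfac α) * h1 +
    (MvPowerSeries.coeff α g - MvPowerSeries.coeff α f) * h2

lemma pser_injective {ev : M →ₗ[R] R} (h : Function.Injective (formMap K nL nab e ev)) :
    Function.Injective (pser K nL nab e ev) := fun s t hst =>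
  h (funext fun α => by rw [← derivAt_pser, hst, derivAt_pser])

lemma pser_surjective {ev : M →ₗ[R] R} (h : Function.Surjective (formMap K nL nab e ev)) :
    Function.Surjective (pser K nL nab e ev) := fun f => by
  obtain ⟨t, ht⟩ := h fun α => derivAt α f
  exact ⟨t, derivAt_ext K fun α => by rw [derivAt_pser, ht]⟩

/-- The expansion is multiplicative. -/
lemma pser_mul {M₁ M₂ : Type*} [AddCommGroup M₁] [AddCommGroup M₂] [Module R M₁] [Module R M₂]
    (nab₁ : L → M₁ →+ M₁) (nab₂ : L → M₂ →+ M₂) (μ : M₁ →+ M₂ →+ M)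
    (hμ : ∀ x a b, nab x (μ a b) = μ (nab₁ x a) b + μ a (nab₂ x b))
    (ev₁ : M₁ →ₗ[R] R) (ev₂ : M₂ →ₗ[R] R) (ev : M →ₗ[R] R)
    (hev : ∀ a b, ev (μ a b) = ev₁ a * ev₂ b) (a : M₁) (b : M₂) :
    pser K nL nab e ev (μ a b) = pser K nL nab₁ e ev₁ a * pser K nL nab₂ e ev₂ b := by
  refine derivAt_ext K fun α => ?_
  conv_lhs => rw [← sum_idxList α]
  conv_rhs => rw [← sum_idxList α]
  rw [derivAt_pser_sum, derivAt_mul, symD_mul nab₁ nab₂ μ hμ rfl, map_sum, Finset.mul_sum]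
  refine Finset.sum_congr rfl fun A hA => ?_
  rw [derivAt_pser_sum, derivAt_pser_sum, map_nsmul, hev, nsmul_eq_mul,
    Finset.card_sdiff_of_subset (Finset.mem_powerset.mp hA)]
  have hle := Finset.card_le_card (Finset.mem_powerset.mp hA)
  generalize Finset.card (Finset.univ : Finset (Fin (idxList α).length)) = n at *
  -- The binomial coefficient of `symD_mul` is absorbed by the three factorial normalizations.
  have h1 : natInv K R n.factorial * (n.choose A.card : R) =
      natInv K R A.card.factorial * natInv K R (n - A.card).factorial := by
    have h2 := congrArg (fun k : ℕ => (k : R)) (Nat.choose_mul_factorial_mul_factorial hle)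
    simp only [Nat.cast_mul] at h2
    have h3 := mul_natInv K (R := R) (Nat.factorial_ne_zero A.card)
    have h4 := mul_natInv K (R := R) (Nat.factorial_ne_zero (n - A.card))
    have h5 := mul_natInv K (R := R) (Nat.factorial_ne_zero n)
    linear_combination -(natInv K R n.factorial * n.choose A.card * (n - A.card).factorial *
        natInv K R (n - A.card).factorial) * h3 - natInv K R n.factorial * n.choose A.card * h4 +
      natInv K R A.card.factorial * natInv K R (n - A.card).factorial * natInv K R n.factorial * h2 +
      natInv K R A.card.factorial * natInv K R (n - A.card).factorial * h5
  linear_combination (ev₁ (symD nL nab₁ A.card A (e ∘ (idxList α).get) a) *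
    ev₂ (symD nL nab₂ (n - A.card) (Finset.univ \ A) (e ∘ (idxList α).get) b)) * h1

end FormalExpansion

/-! ### The abelianized Lie algebroid and its zero connections. -/

section Abelian

variable {K : Type u} [Field K] {X : TopCat.{u}} {O : TopCat.Sheaf (CommAlgCat.{u} K) X}

namespace LieAlgebroid

variable {L : LieAlgebroid O} {V W : Opens X} {r q : ℕ} {E : PMod O}

lemma ab_mul_comm (D D' : L.abelian.UE V) : D * D' = D' * D := by
  induction D using UEA.induction with
  | hR s => rw [abelian_comm]
  | hL x =>
    induction D' using UEA.induction with
    | hR s => rw [abelian_comm]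
    | hL y =>
      rw [UEA.ιL_mul_ιL]
      exact (congrArg (_ + ·) (map_zero (UEA.ιL (Sec O V) (L := L.abelian.obj V)))).trans
        (add_zero _)
    | hadd a b ha hb => rw [mul_add, add_mul, ha, hb]
    | hmul a b ha hb => rw [← mul_assoc, ha, mul_assoc, hb, mul_assoc]
  | hadd a b ha hb => rw [add_mul, mul_add, ha, hb]
  | hmul a b ha hb => rw [mul_assoc, hb, ← mul_assoc, ha, mul_assoc]

/-- `U(L)` for a Lie algebroid with zero bracket and anchor, as a commutative ring. -/
abbrev abCommRing (L : LieAlgebroid O) (V : Opens X) : CommRing (L.abelian.UE V) :=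
  { (inferInstance : Ring (L.abelian.UE V)) with mul_comm := ab_mul_comm }

/-- Commutativity of `Sym(L)` allows any factor to be taken out in front. -/
lemma symProd_succAbove {n : ℕ} (x : Fin (n + 1) → L.obj V) (i : Fin (n + 1)) :
    UEA.ιL (Sec O V) (show L.abelian.obj V from x i) * symProd (x ∘ i.succAbove) = symProd x := by
  let _ := abCommRing L V
  have h : ∀ {m : ℕ} (y : Fin m → L.obj V), symProd y =
      ∏ i, UEA.ιL (Sec O V) (show L.abelian.obj V from y i) := fun y => List.prod_ofFn
  rw [h, h, Fin.prod_univ_succAbove _ i]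
  rfl

/-- The zero connection for a Lie algebroid with zero anchor. -/
def zeroConn (L : LieAlgebroid O) (E : PMod O) : L.abelian.Connection E where
  nabla _ := 0
  smul_nabla s _ _ := (smul_zero s).symm
  leibniz {U} _ s m := by
    change (0 : E.obj U) = s • (0 : E.obj U) + (0 : Sec O U) • m
    rw [smul_zero, zero_smul, add_zero]
  nabla_res h _ _ := (map_zero (E.res h)).symm

/-- Evaluation of jets at `1`. -/
def jetEv (V : Opens X) : L.Jet V →ₗ[Sec O V] Sec O V where
  toFun φ := Jet.app φ le_rfl 1
  map_add' _ _ := rfl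
  map_smul' s φ := by
    rw [ring_smul_app_refl, one_mul, ← mul_one (UEA.ιR _ s)]
    exact (Jet.app φ le_rfl).map_smul s 1


end LieAlgebroid
end Abelian

end LieAlg

namespace LieAlg

/-! ### Jets as formal power series, multiplicatively. -/

section CoproductRules

variable {R L : Type u} [CommRing R] [LieRing L] [Module R L] [LieRingModule L R]

namespace UEA

/-- Right multiplications commute with the left action which defines the coproduct, and `x` is
primitive. -/
lemma comul_mul_ιL (D : UEA R L) (x : L) : comul R L (D * ιL R x) =
    TensorProduct.map (mulRight (ιL R x)) LinearMap.id (comul R L D) +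
      TensorProduct.map LinearMap.id (mulRight (ιL R x)) (comul R L D) := by
  have h1 := map_tensorAct (RingHom.id _) (σ := RingHom.id R) (fun _ => rfl)
    (fun y => ⟨y, rfl⟩) (mulRight (ιL R x)) LinearMap.id (fun D E => mul_assoc D E _)
    (fun D E => rfl) D ((1 : UEA R L) ⊗ₜ[R] (1 : UEA R L))
  have h2 := map_tensorAct (RingHom.id _) (σ := RingHom.id R) (fun _ => rfl)
    (fun y => ⟨y, rfl⟩) LinearMap.id (mulRight (ιL R x)) (fun D E => rfl)
    (fun D E => mul_assoc D E _) D ((1 : UEA R L) ⊗ₜ[R] (1 : UEA R L))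
  refine Eq.trans ?_ (congrArg₂ (· + ·) h1 h2).symm
  refine (tensorAct_mul D _ _).trans (Eq.trans ?_ (map_add (tensorAct (UEA R L) (UEA R L) D) _ _))
  refine congrArg (tensorAct (UEA R L) (UEA R L) D) ((tensorAct_ιL _ _).trans ?_)
  rw [tensorL_tmul, TensorProduct.map_tmul, TensorProduct.map_tmul]
  change (ιL R x * 1) ⊗ₜ[R] (1 : UEA R L) + 1 ⊗ₜ[R] (ιL R x * 1) =
    (1 * ιL R x) ⊗ₜ[R] 1 + 1 ⊗ₜ[R] (1 * ιL R x)
  rw [mul_one, one_mul]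

lemma comul_one : comul R L 1 = 1 ⊗ₜ[R] 1 := by
  change tensorAct (UEA R L) (UEA R L) 1 (1 ⊗ₜ 1) = _
  rw [map_one]; rfl

end UEA

end CoproductRules

section PowerSeriesMap

variable (K : Type*) {R L M : Type*} [Field K] [CharZero K] [CommRing R] [Algebra K R] [LieRing L]
  [Module R L] [LieRingModule L R] [AddCommGroup M] [Module R M] {r : ℕ}
  {nL : L → L →+ L} {nab : L → M →+ M} {e : Fin r → L}

/-- The two Lie-Rinehart algebras may differ: this is how jets of `L` are compared with jets of its
abelianization. -/
lemma pser_eq_iff {L' M' : Type*} [LieRing L'] [Module R L'] [LieRingModule L' R]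
    [AddCommGroup M'] [Module R M'] {nL' : L' → L' →+ L'} {nab' : L' → M' →+ M'} {e' : Fin r → L'}
    {ev : M →ₗ[R] R} {ev' : M' →ₗ[R] R} {t : M} {t' : M'} :
    pser K nL' nab' e' ev' t' = pser K nL nab e ev t ↔
      ∀ α, ev' (symDIdx nL' nab' e' α t') = ev (symDIdx nL nab e α t) := by
  constructor
  · intro h α
    rw [← factorial_smul_formMap K, ← factorial_smul_formMap K, ← derivAt_pser, h, derivAt_pser]
  · intro h
    refine derivAt_ext K fun α => ?_
    rw [derivAt_pser, derivAt_pser, formMap_apply, formMap_apply, h]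

lemma pser_map_smul (F : M →+ M) (c : R) (hF : ∀ x m, F (nab x m) = nab x (F m)) (ev : M →ₗ[R] R)
    (hev : ∀ m, ev (F m) = c * ev m) (t : M) :
    pser K nL nab e ev (F t) = c • pser K nL nab e ev t := by
  refine derivAt_ext K fun α => ?_
  rw [map_smul, derivAt_pser, derivAt_pser, formMap_apply, formMap_apply, symDIdx,
    ← Function.id_comp (e ∘ _), ← map_symD nL nab nL nab F id hF (fun _ _ => rfl), hev, symDIdx,
    smul_eq_mul, smul_eq_mul, smul_eq_mul]
  exact mul_left_comm _ _ _

end PowerSeriesMap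

variable {K : Type u} [Field K] {X : TopCat.{u}} {O : TopCat.Sheaf (CommAlgCat.{u} K) X}

namespace LieAlgebroid

variable {L : LieAlgebroid O} {V W : Opens X} {r q : ℕ} {E : PMod O}

section JetMultiplication

lemma jetEv_apply (φ : L.Jet V) : jetEv V φ = Jet.app φ le_rfl 1 := rfl

/-- Dual to `comul_mul_ιL`: multiplication of the argument by a primitive element is a derivation of
the product of jets. -/
lemma jetNab_mul (x : L.obj V) (φ ψ : L.Jet V) :
    jetNab V x (Jet.mul φ ψ) = Jet.mul (jetNab V x φ) ψ + Jet.mul φ (jetNab V x ψ) := by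
  ext W h D
  have hx : L.ures h (UEA.ιL (Sec O V) x) = UEA.ιL (Sec O W) (L.res h x) := UEA.map_ιL (L.res h) x
  refine (Jet.smul_app _ _ _ _).trans ?_
  rw [hx, Jet.mul_app, UEA.comul_mul_ιL, map_add, Jet.add_app, LinearMap.add_apply, Jet.mul_app,
    Jet.mul_app]
  generalize UEA.comul (Sec O W) (L.obj W) D = t
  congr 1
  · induction t with
    | zero => simp
    | tmul a b =>
      refine congrArg (· * Jet.app ψ h b) ?_
      exact ((Jet.smul_app _ _ _ _).trans (by rw [hx]; rfl)).symm
    | add s t hs ht => simp only [map_add, hs, ht]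
  · induction t with
    | zero => simp
    | tmul a b =>
      refine congrArg (Jet.app φ h a * ·) ?_
      exact ((Jet.smul_app _ _ _ _).trans (by rw [hx]; rfl)).symm
    | add s t hs ht => simp only [map_add, hs, ht]

lemma jetEv_mul (φ ψ : L.Jet V) : jetEv V (Jet.mul φ ψ) = jetEv V φ * jetEv V ψ := by
  rw [jetEv_apply, Jet.mul_app, UEA.comul_one]; rfl

/-- The multiplication of jets, as a biadditive map. -/
def jetMul (L : LieAlgebroid O) (V : Opens X) : L.Jet V →+ L.Jet V →+ L.Jet V :=
  AddMonoidHom.mk' (fun φ => (Jet.mulLeft φ).toAddMonoidHom)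
    fun φ φ' => AddMonoidHom.ext fun ψ => Jet.add_mul φ φ' ψ

/-- The multiplication of a twisted jet by a jet. -/
abbrev twMul (φ : L.Jet V) : (L.preTwJet E).obj V →+ (L.preTwJet E).obj V :=
  (L.jetPairing E).app V φ

lemma twMul_tmul (φ ψ : L.Jet V) (s : E.obj V) :
    twMul φ (ψ ⊗ₜ[Sec O V] s) = Jet.mul φ ψ ⊗ₜ[Sec O V] s := rfl

lemma twMul_smul (φ : L.Jet V) (c : Sec O V) (t : (L.preTwJet E).obj V) :
    twMul φ (c • t) = c • twMul φ t :=
  (TensorProduct.map (Jet.mulLeft φ) LinearMap.id :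
        L.Jet V ⊗[Sec O V] E.obj V →ₗ[Sec O V] L.Jet V ⊗[Sec O V] E.obj V).map_smul c t

lemma twNabla_twMul (nE : L.Connection E) (x : L.obj V) (φ : L.Jet V) (t : (L.preTwJet E).obj V) :
    twNabla nE x (twMul φ t) = twMul (jetNab V x φ) t + twMul φ (twNabla nE x t) := by
  refine DFunLike.congr_fun (twHom_ext (F := (twNabla nE x).comp (twMul φ))
    (G := twMul (jetNab V x φ) + (twMul φ).comp (twNabla nE x)) fun ψ s => ?_) t
  change twNabla nE x (Jet.mul φ ψ ⊗ₜ s) = Jet.mul (jetNab V x φ) ψ ⊗ₜ s +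
    twMul φ (twNabla nE x (ψ ⊗ₜ s))
  rw [twNabla_tmul, twNabla_tmul, map_add, twMul_tmul, twMul_tmul, jetNab_mul, add_tmul, add_assoc]

lemma evOne_twMul (φ : L.Jet V) (t : (L.preTwJet E).obj V) :
    evOne (twMul φ t) = jetEv V φ • evOne t := by
  refine DFunLike.congr_fun (twHom_ext (F := (evOne (E := E)).toAddMonoidHom.comp (twMul φ))
    (G := (DistribSMul.toAddMonoidHom _ (jetEv V φ)).comp (evOne (E := E)).toAddMonoidHom)
    fun ψ s => ?_) t
  change evOne (E := E) (Jet.mul φ ψ ⊗ₜ[Sec O V] s) = jetEv V φ • evOne (E := E) (ψ ⊗ₜ[Sec O V] s)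
  rw [evOne_tmul, evOne_tmul, ← mul_smul]
  exact congrArg (· • s) (jetEv_mul φ ψ)

/-- The action of a function on twisted jets through the first module structure. -/
abbrev twSmul₁ (c : Sec O V) : (L.preTwJet E).obj V →+ (L.preTwJet E).obj V :=
  (L.smulPairing₁ E).app V c

lemma twSmul₁_tmul (c : Sec O V) (ψ : L.Jet V) (s : E.obj V) :
    twSmul₁ c (ψ ⊗ₜ[Sec O V] s) = Jet.smul₁ c ψ ⊗ₜ[Sec O V] s := rfl

/-- The first structure acts on values and the second on arguments. For this reason all expansions
are linear for the first structure, though the connections are not linear for the second. -/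
lemma jetNab_smul₁ (x : L.obj V) (c : Sec O V) (φ : L.Jet V) :
    Jet.smul₁ c (jetNab V x φ) = jetNab V x (Jet.smul₁ c φ) := rfl

lemma jetEv_smul₁ (c : Sec O V) (φ : L.Jet V) : jetEv V (Jet.smul₁ c φ) = c * jetEv V φ := by
  rw [jetEv_apply, Jet.smul₁_app, rs_refl]; rfl

lemma twNabla_twSmul₁ (nE : L.Connection E) (x : L.obj V) (c : Sec O V)
    (t : (L.preTwJet E).obj V) : twSmul₁ c (twNabla nE x t) = twNabla nE x (twSmul₁ c t) := by
  refine DFunLike.congr_fun (twHom_ext (F := (twSmul₁ c).comp (twNabla nE x))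
    (G := (twNabla nE x).comp (twSmul₁ c)) fun ψ s => ?_) t
  change twSmul₁ c (twNabla nE x (ψ ⊗ₜ s)) = twNabla nE x (Jet.smul₁ c ψ ⊗ₜ s)
  rw [twNabla_tmul, twNabla_tmul, map_add, twSmul₁_tmul, twSmul₁_tmul, jetNab_smul₁]

lemma evOne_twSmul₁ (c : Sec O V) (t : (L.preTwJet E).obj V) :
    evOne (twSmul₁ c t) = c • evOne t := by
  refine DFunLike.congr_fun (twHom_ext (F := (evOne (E := E)).toAddMonoidHom.comp (twSmul₁ c))
    (G := (DistribSMul.toAddMonoidHom _ c).comp (evOne (E := E)).toAddMonoidHom)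
    fun ψ s => ?_) t
  change evOne (E := E) (Jet.smul₁ c ψ ⊗ₜ[Sec O V] s) = c • evOne (E := E) (ψ ⊗ₜ[Sec O V] s)
  rw [evOne_tmul, evOne_tmul, ← mul_smul]
  exact congrArg (· • s) (jetEv_smul₁ c ψ)

end JetMultiplication

section Expansions

variable [CharZero K] (nL : L.Connection L.toPMod) (nE : L.Connection E)
  (f : L.toPMod.Frame r V)

lemma jetVal_zero (φ : L.Jet V) : jetVal f φ 0 = jetEv V φ :=
  congrArg (Jet.app φ le_rfl) (UEA.mono_zero _)

lemma twVal_zero (b : E.Frame q V) (t : (L.preTwJet E).obj V) : twVal f b t 0 = evOne t := by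
  let P : (L.preTwJet E).obj V →+ E.obj V :=
    { toFun := fun t => twVal f b t 0
      map_zero' := by rw [map_zero]; rfl
      map_add' := fun s t => by rw [map_add]; rfl }
  refine DFunLike.congr_fun (twHom_ext (F := P) (G := (evOne (E := E)).toAddMonoidHom)
    fun φ s => ?_) t
  change ∑ a, jetVal f (tcoord b.basis a (φ ⊗ₜ[Sec O V] s)) 0 • b.vec a =
    evOne (E := E) (φ ⊗ₜ[Sec O V] s)
  rw [evOne_tmul]
  conv_rhs => rw [← b.basis.sum_repr s, Finset.smul_sum]
  refine Finset.sum_congr rfl fun a _ => ?_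
  rw [tcoord_tmul, jetVal_zero, map_smul, b.basis_apply, ← mul_smul, smul_eq_mul, mul_comm]; rfl

/-- The formal expansion of jets given by a connection on `L` and a frame. -/
def jetSer : L.Jet V →+ MvPowerSeries (Fin r) (Sec O V) :=
  pser K (lnab nL V) (jetNab V) (lvec f) (jetEv V)

lemma jetForm_bijective :
    Function.Bijective (formMap K (lnab nL V) (jetNab V) (lvec f) (jetEv V)) :=
  (isFiltered_jet f).formMap_bijective K (jetVal_bijective f) _ (jetVal_zero f)

lemma jetSer_bijective : Function.Bijective (jetSer nL f) :=
  ⟨pser_injective K _ _ _ (jetForm_bijective nL f).1,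
    pser_surjective K _ _ _ (jetForm_bijective nL f).2⟩

lemma jetSer_mul (φ ψ : L.Jet V) :
    jetSer nL f (Jet.mul φ ψ) = jetSer nL f φ * jetSer nL f ψ :=
  pser_mul K _ _ _ (jetNab V) (jetNab V) (jetMul L V) (fun x a b => jetNab_mul x a b) _ _ _
    jetEv_mul φ ψ

lemma jetSer_smul₁ (c : Sec O V) (φ : L.Jet V) :
    jetSer nL f (Jet.smul₁ c φ) = c • jetSer nL f φ :=
  pser_map_smul K (Jet.smul₁ c).toAddMonoidHom c (fun x m => jetNab_smul₁ x c m) _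
    (jetEv_smul₁ c) φ

/-- The formal expansion of twisted jets given by connections and frames. -/
def twSer (b : E.Frame q V) (a : Fin q) : (L.preTwJet E).obj V →+ MvPowerSeries (Fin r) (Sec O V) :=
  pser K (lnab nL V) (twNabla nE) (lvec f) (b.basis.coord a ∘ₗ evOne)

lemma twForm_bijective (b : E.Frame q V) :
    Function.Bijective (formMap K (lnab nL V) (twNabla nE) (lvec f) (evOne (E := E))) :=
  (isFiltered_twNabla nE f b).formMap_bijective K (twVal_bijective f b) _ (twVal_zero f b)

variable (b : E.Frame q V)

/-- Coordinates are taken after evaluation at `1`, so the connection on `E` need not preserve the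
frame. -/
lemma coord_formMap (a : Fin q) (t : (L.preTwJet E).obj V) (α : Fin r →₀ ℕ) :
    formMap K (lnab nL V) (twNabla nE) (lvec f) (b.basis.coord a ∘ₗ evOne) t α =
      b.basis.repr (formMap K (lnab nL V) (twNabla nE) (lvec f) (evOne (E := E)) t α) a := by
  rw [formMap_apply, formMap_apply, map_smul]; rfl

lemma twSer_bijective : Function.Bijective fun (t : (L.preTwJet E).obj V) a => twSer nL nE f b a t := by
  constructor
  · intro s t h
    refine (twForm_bijective nL nE f b).1 (funext fun α => b.basis.repr.injective
      (Finsupp.ext fun a => ?_))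
    rw [← coord_formMap, ← coord_formMap, ← derivAt_pser, ← derivAt_pser]
    exact congrArg (derivAt α) (congrFun h a)
  · intro g
    obtain ⟨t, ht⟩ := (twForm_bijective nL nE f b).2 fun α =>
      b.basis.equivFun.symm fun a => derivAt α (g a)
    refine ⟨t, funext fun a => derivAt_ext K fun α => ?_⟩
    refine (derivAt_pser K _ _ _ _ t α).trans ?_
    rw [coord_formMap, ht]
    exact congrFun (b.basis.equivFun.apply_symm_apply fun a => derivAt α (g a)) a

lemma twSer_twMul (a : Fin q) (φ : L.Jet V) (t : (L.preTwJet E).obj V) :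
    twSer nL nE f b a (twMul φ t) = jetSer nL f φ * twSer nL nE f b a t :=
  pser_mul K _ _ _ (jetNab V) (twNabla nE) ((L.jetPairing E).app V)
    (fun x φ t => twNabla_twMul nE x φ t) _ _ _
    (fun φ t => (congrArg (b.basis.coord a) (evOne_twMul φ t)).trans (map_smul _ _ _)) φ t

lemma twSer_twSmul₁ (a : Fin q) (c : Sec O V) (t : (L.preTwJet E).obj V) :
    twSer nL nE f b a (twSmul₁ c t) = c • twSer nL nE f b a t :=
  pser_map_smul K (twSmul₁ c) c (fun x m => twNabla_twSmul₁ nE x c m) _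
    (fun t => (congrArg (b.basis.coord a) (evOne_twSmul₁ c t)).trans (map_smul _ _ _)) t

end Expansions

section Commutativity

variable [CharZero K]

/-- Read off from power series instead of cocommutativity of the coproduct; the connection and the
frame are only tools. -/
lemma jet_mul_comm (nL : L.Connection L.toPMod) (f : L.toPMod.Frame r V) (φ ψ : L.Jet V) : Jet.mul φ ψ = Jet.mul ψ φ :=
  (jetSer_bijective nL f).1 (by rw [jetSer_mul, jetSer_mul, mul_comm])

lemma jet_mul_assoc (nL : L.Connection L.toPMod) (f : L.toPMod.Frame r V) (φ ψ χ : L.Jet V) : Jet.mul (Jet.mul φ ψ) χ = Jet.mul φ (Jet.mul ψ χ) :=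
  (jetSer_bijective nL f).1 (by simp only [jetSer_mul, mul_assoc])

end Commutativity

end LieAlgebroid
end LieAlg

namespace LieAlg

variable {K : Type u} [Field K] {X : TopCat.{u}} {O : TopCat.Sheaf (CommAlgCat.{u} K) X}

namespace LieAlgebroid

variable {L : LieAlgebroid O} {V W : Opens X} {r q : ℕ} {E : PMod O}

/-! ### The correspondence between twisted jets of `L` and of its abelianization. -/

section Powers

lemma univ_erase_eq_map_succAbove {n : ℕ} (i : Fin (n + 1)) :
    Finset.univ.erase i = Finset.univ.map (Fin.succAboveEmb i) := by
  ext j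
  simp only [Finset.mem_erase, Finset.mem_univ, and_true, Finset.mem_map, true_and]
  exact Fin.exists_succAbove_eq_iff.symm

/-- Omitting an entry of a tuple is composition with `i.succAbove`, which identifies `Fin n` with
the complement of `i`. -/
lemma dpow_eq_symD (nL : L.Connection L.toPMod) (nE : L.Connection E) (n : ℕ)
    (t : (L.preTwJet E).obj V) (x : Fin n → L.obj V) :
    dpow nL nE n t x = symD (lnab nL V) (twNabla nE) n Finset.univ x t := by
  induction n with
  | zero => rfl
  | succ n ih =>
    rw [dpow, symD_succ]
    refine Finset.sum_congr rfl fun i _ => ?_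
    rw [univ_erase_eq_map_succAbove, symD_map, ih, Finset.sum_map]
    refine congrArg₂ (· - ·) rfl (Finset.sum_congr rfl fun j _ => ?_)
    rw [symD_map, ih]
    congr 1
    exact (Function.update_comp_eq_of_injective x (Fin.succAboveEmb i).injective j _).symm

lemma twNabla_res (nE : L.Connection E) (h : W ≤ V) (x : L.obj V) (m : (L.preTwJet E).obj V) :
    (L.preTwJet E).res h (twNabla nE x m) = twNabla nE (L.res h x) ((L.preTwJet E).res h m) := by
  refine DFunLike.congr_fun (twHom_ext
    (F := ((L.preTwJet E).res h).toAddMonoidHom.comp (twNabla nE x))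
    (G := (twNabla nE (L.res h x)).comp ((L.preTwJet E).res h).toAddMonoidHom)
    fun φ s => ?_) m
  change (L.preTwJet E).res h (twNabla nE x (φ ⊗ₜ s)) =
    twNabla nE (L.res h x) (Jet.restrict h φ ⊗ₜ E.res h s)
  rw [twNabla_tmul, twNabla_tmul, map_add, nE.nabla_res]
  refine congrArg (· + _) (congrArg (· ⊗ₜ[Sec O W] E.res h s) ?_)
  exact (Jet.restrict_smul h _ φ).trans
    (congrArg (· • Jet.restrict h φ) (UEA.map_ιL (L.res h) x))

lemma evOne_res (h : W ≤ V) (m : (L.preTwJet E).obj V) :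
    evOne ((L.preTwJet E).res h m) = E.res h (evOne m) := by
  refine DFunLike.congr_fun (twHom_ext
    (F := (evOne (E := E)).toAddMonoidHom.comp ((L.preTwJet E).res h).toAddMonoidHom)
    (G := (E.res h).toAddMonoidHom.comp (evOne (E := E)).toAddMonoidHom) fun φ s => ?_) m
  refine Eq.trans ?_ ((E.res h).map_smulₛₗ (Jet.app φ le_rfl 1) s).symm
  refine congrArg (· • E.res h s) ((congrArg (Jet.app φ h) (map_one (L.ures h)).symm).trans
    (Jet.app_res φ le_rfl h 1))

lemma dpow_res (nL : L.Connection L.toPMod) (nE : L.Connection E) (h : W ≤ V) (n : ℕ)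
    (t : (L.preTwJet E).obj V) (x : Fin n → L.obj V) :
    dpow nL nE n ((L.preTwJet E).res h t) (L.res h ∘ x) =
      (L.preTwJet E).res h (dpow nL nE n t x) := by
  rw [dpow_eq_symD, dpow_eq_symD]
  exact (map_symD (lnab nL V) (twNabla nE) (lnab nL W) (twNabla nE)
    ((L.preTwJet E).res h).toAddMonoidHom (L.res h) (twNabla_res nE h)
    (fun x y => (nL.nabla_res h x y).symm) _ _ _ t).symm

lemma evOne_eq_symPairing (s : (L.abelian.preTwJet E).obj V) :
    evOne s = (symPairing L E).app V 1 s :=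
  DFunLike.congr_fun (twHom_ext (L := L.abelian) (F := (evOne (E := E)).toAddMonoidHom)
    (G := (symPairing L E).app V 1) fun _ _ => rfl) s

lemma symPairing_twNabla (D : L.abelian.UE V) (x : L.abelian.obj V)
    (s : (L.abelian.preTwJet E).obj V) :
    (symPairing L E).app V D (twNabla (zeroConn L E) x s) =
      (symPairing L E).app V (D * UEA.ιL (Sec O V) x) s := by
  refine DFunLike.congr_fun (twHom_ext (L := L.abelian)
    (F := ((symPairing L E).app V D).comp (twNabla (zeroConn L E) x))
    (G := (symPairing L E).app V (D * UEA.ιL (Sec O V) x)) fun φ s => ?_) s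
  change (symPairing L E).app V D (twNabla (zeroConn L E) x (φ ⊗ₜ s)) = _
  rw [twNabla_tmul, map_add, symPairing_tmul, symPairing_tmul, jetNab_app]
  have h0 : Jet.app φ le_rfl D • (zeroConn L E).nabla V x s = 0 := smul_zero _
  rw [h0, add_zero]; rfl

/-- The product of sections of the abelianization of `L`. -/
def abProd {n : ℕ} (x : Fin n → L.abelian.obj V) : L.abelian.UE V :=
  (List.ofFn fun i => UEA.ιL (Sec O V) (x i)).prod

lemma abProd_succAbove {n : ℕ} (x : Fin (n + 1) → L.abelian.obj V) (i : Fin (n + 1)) :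
    UEA.ιL (Sec O V) (x i) * abProd (x ∘ i.succAbove) = abProd x :=
  symProd_succAbove (L := L) x i

/-- For zero connections there are no corrections, and each derivative multiplies the argument by
one factor. The `n!` orders of the factors all give the same product. -/
lemma symPairing_symD_zeroConn {n : ℕ} (D : L.abelian.UE V) (x : Fin n → L.abelian.obj V)
    (s : (L.abelian.preTwJet E).obj V) :
    (symPairing L E).app V D (symD (lnab (zeroConn L L.abelian.toPMod) V)
      (twNabla (zeroConn L E)) n Finset.univ x s) =
        n.factorial • (symPairing L E).app V (D * abProd x) s := by
  induction n generalizing D with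
  | zero =>
    rw [Nat.factorial_zero, one_smul]
    change _ = (symPairing L E).app V (D * 1) s
    rw [mul_one]; rfl
  | succ n ih =>
    have key : ∀ i ∈ Finset.univ, (symPairing L E).app V D (twNabla (zeroConn L E) (x i)
        (symD (lnab (zeroConn L L.abelian.toPMod) V) (twNabla (zeroConn L E)) n
          (Finset.univ.erase i) x s) - ∑ j ∈ Finset.univ.erase i,
        symD (lnab (zeroConn L L.abelian.toPMod) V) (twNabla (zeroConn L E)) n
          (Finset.univ.erase i) (Function.update x j
            (lnab (zeroConn L L.abelian.toPMod) V (x i) (x j))) s) =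
        n.factorial • (symPairing L E).app V (D * abProd x) s := fun i _ => by
      rw [Finset.sum_eq_zero fun j hj => ?_, sub_zero, symPairing_twNabla,
        univ_erase_eq_map_succAbove, symD_map, ih, mul_assoc]
      · exact congrArg (fun D' => n.factorial • (symPairing L E).app V (D * D') s)
          (abProd_succAbove x i)
      -- Zero is written as a multiple by `0`, so that homogeneity in this slot annihilates the
      -- correction.
      · have h0 : (lnab (zeroConn L L.abelian.toPMod) V (x i)) (x j) =
          (0 : Sec O V) • (0 : L.abelian.obj V) :=
          (zero_smul (Sec O V) (0 : L.abelian.obj V)).symm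
        rw [h0]
        refine (symD_update_smul (isConn_lnab (zeroConn L L.abelian.toPMod) V)
          (isConn_twNabla (zeroConn L E) V) hj x 0 0 s (by simp)).trans (zero_smul _ _)
    rw [symD_succ, map_sum, Finset.sum_congr rfl key, Finset.sum_const, Finset.card_univ,
      Fintype.card_fin, ← mul_smul, Nat.factorial_succ]

end Powers

/-- Two twisted jets, for `L` and for its abelianization, correspond to each other if the values at
the origin of the symmetrized powers of the connections agree. -/
def Corr (nL : L.Connection L.toPMod) (nE : L.Connection E) (t : (L.preTwJet E).obj V)
    (s : (L.abelian.preTwJet E).obj V) : Prop :=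
  ∀ (n : ℕ) (x : Fin n → L.obj V),
    evOne (symD (lnab (zeroConn L L.abelian.toPMod) V) (twNabla (zeroConn L E)) n Finset.univ x s)
      = evOne (symD (lnab nL V) (twNabla nE) n Finset.univ x t)

section Correspondence

variable [CharZero K] {nL : L.Connection L.toPMod} {nE : L.Connection E}

/-- Division of `symPairing_symD_zeroConn` by `n!` gives the formula which characterizes `j`. -/
lemma Corr.symPairing_eq {t : (L.preTwJet E).obj V} {s : (L.abelian.preTwJet E).obj V}
    (h : Corr nL nE t s) (n : ℕ) (x : Fin n → L.obj V) :
    (symPairing L E).app V (symProd x) s =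
      algebraMap K (Sec O V) (n.factorial : K)⁻¹ • evOne (dpow nL nE n t x) := by
  rw [dpow_eq_symD, ← h n x, evOne_eq_symPairing]
  refine Eq.trans ?_ (congrArg (algebraMap K (Sec O V) (n.factorial : K)⁻¹ • ·)
    (symPairing_symD_zeroConn 1 x s)).symm
  rw [one_mul, ← Nat.cast_smul_eq_nsmul (Sec O V), ← mul_smul, mul_comm]
  exact ((congrArg (· • _) (mul_natInv K (Nat.factorial_ne_zero n))).trans (one_smul _ _)).symm

lemma corr_iff_symDIdx (f : L.toPMod.Frame r V) {t : (L.preTwJet E).obj V}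
    {s : (L.abelian.preTwJet E).obj V} : Corr nL nE t s ↔ ∀ α,
      evOne (symDIdx (lnab (zeroConn L L.abelian.toPMod) V) (twNabla (zeroConn L E))
        (lvec (abFrame f)) α s) =
      evOne (symDIdx (lnab nL V) (twNabla nE) (lvec f) α t) := by
  refine ⟨fun h α => h _ _, fun H n x => ?_⟩
  refine symD_univ_eq_of_symDIdx_eq (lbasis f) (L' := L.abelian.obj V)
    (g := (LinearMap.id : L.obj V →ₗ[Sec O V] L.obj V)) (isConn_lnab nL V) (isConn_twNabla nE V)
    evOne (isConn_lnab (zeroConn L L.abelian.toPMod) V) (isConn_twNabla (zeroConn L E) V) evOne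
    (fun α => ?_) n x
  rw [lbasis_coe]
  exact H α

lemma corr_iff_twSer (f : L.toPMod.Frame r V) (b : E.Frame q V) {t : (L.preTwJet E).obj V}
    {s : (L.abelian.preTwJet E).obj V} : Corr nL nE t s ↔ ∀ a,
      twSer (zeroConn L L.abelian.toPMod) (zeroConn L E) (abFrame f) b a s =
        twSer nL nE f b a t := by
  rw [corr_iff_symDIdx f]
  simp only [twSer, pser_eq_iff]
  constructor
  · intro h a α
    exact congrArg (b.basis.coord a) (h α)
  · intro h α
    exact b.basis.repr.injective (Finsupp.ext fun a => h a α)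

variable (nL nE) in
/-- The correspondence between twisted jets for `L` and for its abelianization, over an open set
with frames. -/
def jpre (f : L.toPMod.Frame r V) (b : E.Frame q V) :
    (L.preTwJet E).obj V ≃+ (L.abelian.preTwJet E).obj V :=
  (AddEquiv.ofBijective (AddMonoidHom.pi fun a => twSer nL nE f b a)
    (twSer_bijective nL nE f b)).trans
  (AddEquiv.ofBijective (AddMonoidHom.pi fun a =>
    twSer (zeroConn L L.abelian.toPMod) (zeroConn L E) (abFrame f) b a)
    (twSer_bijective (zeroConn L L.abelian.toPMod) (zeroConn L E) (abFrame f) b)).symm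

/-- `Corr` mentions no frame. Hence `jpre` does not depend on the frames used to construct it, and
it is compatible with restriction. -/
lemma jpre_eq_iff (f : L.toPMod.Frame r V) (b : E.Frame q V) {t : (L.preTwJet E).obj V}
    {s : (L.abelian.preTwJet E).obj V} : jpre nL nE f b t = s ↔ Corr nL nE t s := by
  rw [corr_iff_twSer f b, jpre, AddEquiv.trans_apply, AddEquiv.symm_apply_eq, funext_iff]
  exact forall_congr' fun a => eq_comm

/-- Over `W` it suffices to test on the restricted frame, whose vectors come from `V`; arbitrary
sections over `W` need not extend. -/
lemma Corr.res (f : L.toPMod.Frame r V) (h : W ≤ V) {t : (L.preTwJet E).obj V}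
    {s : (L.abelian.preTwJet E).obj V} (H : Corr nL nE t s) :
    Corr nL nE ((L.preTwJet E).res h t) ((L.abelian.preTwJet E).res h s) := by
  rw [corr_iff_symDIdx (f.restrict h)]
  have key : ∀ {L' : LieAlgebroid O} (nL : L'.Connection L'.toPMod) (nE : L'.Connection E)
      (f : L'.toPMod.Frame r V) (α : Fin r →₀ ℕ) (t : (L'.preTwJet E).obj V),
      evOne (symDIdx (lnab nL W) (twNabla nE) (lvec (f.restrict h)) α ((L'.preTwJet E).res h t)) =
        E.res h (evOne (symDIdx (lnab nL V) (twNabla nE) (lvec f) α t)) := by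
    intro L' nL nE f α t
    rw [← evOne_res]
    exact congrArg evOne (map_symD (lnab nL V) (twNabla nE) (lnab nL W) (twNabla nE)
      ((L'.preTwJet E).res h).toAddMonoidHom (L'.res h) (twNabla_res nE h)
      (fun x y => (nL.nabla_res h x y).symm) _ _ _ t).symm
  intro α
  have := (corr_iff_symDIdx f).mp H α
  exact (key (L' := L.abelian) (zeroConn L L.abelian.toPMod) (zeroConn L E) (abFrame f) α s).trans
    ((congrArg (E.res h) this).trans (key nL nE f α t).symm)

lemma Corr.twSmul₁ (f : L.toPMod.Frame r V) (b : E.Frame q V) (c : Sec O V)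
    {t : (L.preTwJet E).obj V} {s : (L.abelian.preTwJet E).obj V} (H : Corr nL nE t s) :
    Corr nL nE (twSmul₁ c t) (twSmul₁ (L := L.abelian) c s) := by
  rw [corr_iff_twSer f b] at H ⊢
  intro a
  rw [twSer_twSmul₁, twSer_twSmul₁, H a]

/-- On expansions both multiplications are multiplication by the same power series. -/
lemma Corr.twMul (f : L.toPMod.Frame r V) (b : E.Frame q V) {φ : L.Jet V} {ψ : L.abelian.Jet V}
    (h : jetSer (zeroConn L L.abelian.toPMod) (abFrame f) ψ = jetSer nL f φ)
    {t : (L.preTwJet E).obj V} {s : (L.abelian.preTwJet E).obj V} (H : Corr nL nE t s) :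
    Corr nL nE (twMul φ t) (twMul (L := L.abelian) ψ s) := by
  rw [corr_iff_twSer f b] at H ⊢
  intro a
  rw [twSer_twMul, twSer_twMul, H a, h]

/-- With zero anchor functions are central in the enveloping algebra, so acting on values or on
arguments is the same. -/
lemma twSmul₁_abelian (c : Sec O V) (s : (L.abelian.preTwJet E).obj V) :
    LieAlgebroid.twSmul₁ (L := L.abelian) c s = c • s := by
  refine DFunLike.congr_fun (twHom_ext (F := LieAlgebroid.twSmul₁ (L := L.abelian) c)
    (G := DistribSMul.toAddMonoidHom _ c) fun φ s => ?_) s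
  change Jet.smul₁ c φ ⊗ₜ s = c • (φ ⊗ₜ[Sec O V] s)
  rw [smul_tmul']
  congr 1
  ext W h D
  rw [Jet.smul₁_app, Jet.ring_smul_app, abelian_comm]
  exact ((Jet.app φ h).map_smul (rs O h c) D).symm

/-- Both module structures agree on constants. -/
lemma smul₁_algebraMap (c : K) (φ : L.Jet V) :
    Jet.smul₁ (algebraMap K (Sec O V) c) φ = algebraMap K (Sec O V) c • φ := by
  have hc : ∀ (W : Opens X) (D : L.UE W), D * UEA.ιR _ (algebraMap K (Sec O W) c) =
      UEA.ιR _ (algebraMap K (Sec O W) c) * D := fun W D => by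
    induction D using UEA.induction with
    | hR s => rw [← map_mul, ← map_mul, mul_comm]
    | hL x =>
      -- The anchor takes values in `K`-linear derivations, which kill constants.
      have h0 : ⁅x, algebraMap K (Sec O W) c⁆ = 0 := by
        rw [Algebra.algebraMap_eq_smul_one]
        refine (LieModule.lie_smul (R := K) c x (1 : Sec O W)).trans ?_
        rw [UEA.lie_one_eq_zero, smul_zero]
      rw [UEA.ιL_mul_ιR, h0, map_zero, add_zero]
    | hadd a b ha hb => rw [add_mul, mul_add, ha, hb]
    | hmul a b ha hb => rw [mul_assoc, hb, ← mul_assoc, ha, mul_assoc]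
  ext W h D
  have h1 : rs O h (algebraMap K (Sec O V) c) = algebraMap K (Sec O W) c := (rsA O h).commutes c
  rw [Jet.smul₁_app, Jet.ring_smul_app, h1, hc]
  exact ((Jet.app φ h).map_smul _ D).symm

end Correspondence

end LieAlgebroid
end LieAlg

namespace LieAlg

/-! ### Orders of differential operators under composition and transport. -/

namespace OrderLT

variable {A B : Type*} [Ring A] [Ring B] {S : Set A} {T : Set B}

/-- Orders in the sense of `≤` add under composition. The base case is that operators commuting with
`S` are closed under composition. -/
lemma mul_succ {m n : ℕ} {d d' : A} (h : OrderLT S (m + 1) d) (h' : OrderLT S (n + 1) d') :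
    OrderLT S (m + n + 1) (d * d') := by
  induction hN : m + n generalizing m n d d' with
  | zero =>
    obtain rfl : m = 0 := by omega
    obtain rfl : n = 0 := by omega
    refine of_comm fun φ hφ => ?_
    rw [← mul_assoc, sub_eq_zero.mp (h φ hφ), mul_assoc, sub_eq_zero.mp (h' φ hφ), mul_assoc]
  | succ N ih =>
    intro φ hφ
    have e : φ * (d * d') - d * d' * φ = (φ * d - d * φ) * d' + d * (φ * d' - d' * φ) := by
      noncomm_ring
    rw [e]
    refine add ?_ ?_
    · rcases m with _ | m
      · rw [show φ * d - d * φ = 0 from h φ hφ, zero_mul]; exact zero _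
      · exact ih (h φ hφ) h' (by omega)
    · rcases n with _ | n
      · rw [show φ * d' - d' * φ = 0 from h' φ hφ, mul_zero]; exact zero _
      · exact ih h (h' φ hφ) (by omega)

lemma one (S : Set A) : OrderLT S 1 1 := of_comm fun φ _ => by rw [mul_one, one_mul]

lemma list_prod {l : List A} (h : ∀ d ∈ l, OrderLT S 2 d) : OrderLT S (l.length + 1) l.prod := by
  induction l with
  | nil => exact one S
  | cons d l ih =>
    rw [List.prod_cons, List.length_cons, add_comm l.length]
    exact mul_succ (h d (List.mem_cons_self ..)) (ih fun d hd => h d (List.mem_cons_of_mem _ hd))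

lemma neg {n : ℕ} {d : A} (h : OrderLT S n d) : OrderLT S n (-d) := by
  induction n generalizing d with
  | zero => rw [show d = 0 from h, neg_zero]; rfl
  | succ n ih =>
    intro φ hφ
    rw [mul_neg, neg_mul, ← neg_sub_neg, neg_neg, neg_neg, ← neg_sub]
    exact ih (h φ hφ)

lemma sub {n : ℕ} {d d' : A} (h : OrderLT S n d) (h' : OrderLT S n d') : OrderLT S n (d - d') := by
  rw [sub_eq_add_neg]
  exact add h (neg h')

lemma sum {ι : Type*} {s : Finset ι} {d : ι → A} {n : ℕ} (h : ∀ i ∈ s, OrderLT S n (d i)) :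
    OrderLT S n (∑ i ∈ s, d i) := by
  classical
  induction s using Finset.induction_on with
  | empty => exact zero n
  | insert i s hi ih =>
    rw [Finset.sum_insert hi]
    exact add (h i (Finset.mem_insert_self i s)) (ih fun j hj => h j (Finset.mem_insert_of_mem hj))

/-- Additive maps compatible with commutators preserve differential operators. -/
lemma map (G : A →+ B) (hG : ∀ ψ ∈ T, ∃ φ ∈ S, ∀ d, G (φ * d - d * φ) = ψ * G d - G d * ψ)
    {n : ℕ} {d : A} (h : OrderLT S n d) : OrderLT T n (G d) := by
  induction n generalizing d with
  | zero => rw [show d = 0 from h, map_zero]; rfl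
  | succ n ih =>
    intro ψ hψ
    obtain ⟨φ, hφ, hd⟩ := hG ψ hψ
    rw [← hd]
    exact ih (h φ hφ)

/-- Together with `OrderLT.map` this transports the notion of order between different modules. -/
lemma of_map (G : A →+ B) (hinj : Function.Injective G)
    (hG : ∀ φ ∈ S, ∃ ψ ∈ T, ∀ d, G (φ * d - d * φ) = ψ * G d - G d * ψ)
    {n : ℕ} {d : A} (h : OrderLT T n (G d)) : OrderLT S n d := by
  induction n generalizing d with
  | zero => exact hinj ((show G d = 0 from h).trans (map_zero G).symm)
  | succ n ih =>
    intro φ hφ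
    obtain ⟨ψ, hψ, hd⟩ := hG φ hφ
    exact ih (by rw [hd]; exact h ψ hψ)

end OrderLT

/-! ### Linear differential operators on formal power series. -/

section PowerSeriesOperators

open MvPowerSeries

variable {R : Type*} [CommRing R] {r : ℕ}

/-- A power series is a constant plus a combination of multiples of the variables. -/
lemma exists_eq_C_add_sum (f : MvPowerSeries (Fin r) R) :
    ∃ (c : R) (g : Fin r → MvPowerSeries (Fin r) R), f = C c + ∑ i, X i * g i := by
  classical
  have hsub : ∀ {γ : Fin r →₀ ℕ} {i : Fin r}, γ i ≠ 0 →
      γ - Finsupp.single i 1 + Finsupp.single i 1 = γ := fun {γ i} h =>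
    tsub_add_cancel_of_le (Finsupp.single_le_iff.mpr (Nat.one_le_iff_ne_zero.mpr h))
  -- Each nonconstant monomial is assigned to its first variable, and `g i` collects the terms
  -- assigned to `i`, divided by `X i`.
  let p (i : Fin r) (γ : Fin r →₀ ℕ) : Prop := γ i ≠ 0 ∧ ∀ k < i, γ k = 0
  obtain ⟨g, hg⟩ : ∃ g : Fin r → MvPowerSeries (Fin r) R, ∀ i γ, coeff γ (g i) =
      if p i (γ + Finsupp.single i 1) then coeff (γ + Finsupp.single i 1) f else 0 :=
    ⟨fun i γ => if p i (γ + Finsupp.single i 1) then coeff (γ + Finsupp.single i 1) f else 0,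
      fun _ _ => rfl⟩
  refine ⟨constantCoeff f, g, ?_⟩
  ext γ
  have hX : ∀ i, coeff γ (X i * g i) = if p i γ then coeff γ f else 0 := fun i => by
    rw [X, coeff_monomial_mul, one_mul, hg]
    by_cases hi : γ i = 0
    · rw [if_neg (fun h => by simpa [hi] using Finsupp.single_le_iff.mp h),
        if_neg (fun h => h.1 hi)]
    · rw [if_pos (Finsupp.single_le_iff.mpr (Nat.one_le_iff_ne_zero.mpr hi)), hsub hi]
  rw [map_add, map_sum, coeff_C, Finset.sum_congr rfl fun i _ => hX i]
  by_cases hγ : γ = 0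
  · rw [if_pos hγ, Finset.sum_eq_zero fun i _ => if_neg fun h => h.1 (by rw [hγ]; rfl), add_zero, hγ]
    rfl
  · rw [if_neg hγ, zero_add]
    obtain ⟨i, hi⟩ : ∃ i, p i γ := by
      have : (Finset.univ.filter fun i => γ i ≠ 0).Nonempty := by
        by_contra hne
        rw [Finset.not_nonempty_iff_eq_empty, Finset.filter_eq_empty_iff] at hne
        exact hγ (Finsupp.ext fun i => not_not.mp (hne (Finset.mem_univ i)))
      refine ⟨_, (Finset.mem_filter.mp (Finset.min'_mem _ this)).2, fun k hk => ?_⟩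
      by_contra hk'
      exact absurd (Finset.min'_le _ k (Finset.mem_filter.mpr ⟨Finset.mem_univ k, hk'⟩))
        (not_le.mpr hk)
    rw [Finset.sum_eq_single i, if_pos hi]
    · intro k _ hk
      refine if_neg fun h => ?_
      rcases lt_trichotomy i k with h3 | h3 | h3
      · exact hi.1 (h.2 i h3)
      · exact hk h3.symm
      · exact h.1 (hi.2 k h3)
    · exact fun h => absurd (Finset.mem_univ i) h

/-- The multiplication operators on power series. -/
abbrev psMul (R : Type*) [CommRing R] (r : ℕ) : Set (Module.End R (MvPowerSeries (Fin r) R)) :=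
  Set.range (LinearMap.mulLeft R)

/-- No continuity is needed: from `f = c + ∑ X i * g i` follows `d f = ∑ X i * d (g i)`, so
coefficients of degree `n` of `d f` are coefficients of degree `n - 1` of values of `d`, and
constant terms vanish. -/
lemma eq_zero_of_comm_X {d : Module.End R (MvPowerSeries (Fin r) R)}
    (h : ∀ i f, d (X i * f) = X i * d f) (h1 : d 1 = 0) : d = 0 := by
  suffices H : ∀ n (γ : Fin r →₀ ℕ), γ.degree = n → ∀ f, coeff γ (d f) = 0 by
    ext f γ
    exact H _ γ rfl f
  intro n
  induction n with
  | zero =>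
    intro γ hγ f
    obtain ⟨c, g, rfl⟩ := exists_eq_C_add_sum f
    rw [(Finsupp.degree_eq_zero_iff γ).mp hγ, map_add, ← mul_one (C c), ← smul_eq_C_mul, map_smul,
      h1, smul_zero, zero_add, map_sum, map_sum]
    refine Finset.sum_eq_zero fun i _ => ?_
    rw [h, coeff_zero_X_mul]
  | succ n ih =>
    intro γ hγ f
    obtain ⟨c, g, rfl⟩ := exists_eq_C_add_sum f
    rw [map_add, ← mul_one (C c), ← smul_eq_C_mul, map_smul,
      h1, smul_zero, zero_add, map_sum, map_sum]
    refine Finset.sum_eq_zero fun i _ => ?_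
    rw [h, X, coeff_monomial_mul]
    split_ifs with hi
    · rw [ih, mul_zero]
      have h2 := congrArg Finsupp.degree (tsub_add_cancel_of_le hi)
      rw [map_add, Finsupp.degree_single] at h2
      omega
    · rfl

/-- A linear differential operator of order `≤ k` which kills the monomials of degree `≤ k`
vanishes. -/
lemma eq_zero_of_orderLT {k : ℕ} {d : Module.End R (MvPowerSeries (Fin r) R)}
    (h : OrderLT (psMul R r) (k + 1) d) (h0 : ∀ β, β.degree ≤ k → d (monomial β 1) = 0) :
    d = 0 := by
  induction k generalizing d with
  | zero =>
    refine eq_zero_of_comm_X (fun i f => ?_) (h0 0 (by simp))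
    exact (LinearMap.congr_fun (sub_eq_zero.mp (h _ ⟨X i, rfl⟩)) f).symm
  | succ k ih =>
    refine eq_zero_of_comm_X (fun i f => ?_) (h0 0 (by simp))
    -- The commutator with `X i` has order one less and kills the monomials of degree at most `k`.
    -- So it vanishes, and `d` commutes with `X i`.
    have h2 := ih (h _ ⟨X i, rfl⟩) fun β hβ => by
      change X i * d (monomial β 1) - d (X i * monomial β 1) = 0
      rw [h0 β (by omega), X, monomial_mul_monomial, mul_one, h0 _ (by
        rw [map_add, Finsupp.degree_single]; omega), mul_zero, sub_zero]
    exact (LinearMap.congr_fun (sub_eq_zero.mp h2) f).symm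

/-- The multi-indices of degree at most `k`. -/
def lowIdx (r k : ℕ) : Finset (Fin r →₀ ℕ) := (Finsupp.finite_of_degree_le k).toFinset

lemma mem_lowIdx {k : ℕ} {α : Fin r →₀ ℕ} : α ∈ lowIdx r k ↔ α.degree ≤ k := by
  rw [lowIdx, Set.Finite.mem_toFinset]; rfl

variable {θ : (Fin r →₀ ℕ) → Module.End R (MvPowerSeries (Fin r) R)}

/-- The values of a family of operators on monomials. -/
def symbolMatrix (θ : (Fin r →₀ ℕ) → Module.End R (MvPowerSeries (Fin r) R)) (k : ℕ) :
    Matrix (lowIdx r k) (lowIdx r k) (MvPowerSeries (Fin r) R) :=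
  Matrix.of fun β α => θ α (monomial β.1 1)

/-- A power series is a unit as soon as its constant coefficient is. At the origin the matrix is
block triangular with respect to the degree, and its diagonal blocks are diagonal with entries `α!`.
-/
lemma isUnit_det_symbolMatrix (hu : ∀ α : Fin r →₀ ℕ, IsUnit (mfac α : R))
    (hθ : ∀ (α : Fin r →₀ ℕ) f, (∀ β : Fin r →₀ ℕ, β.degree < α.degree → coeff β f = 0) →
      constantCoeff (θ α f) = mfac α * coeff α f) (k : ℕ) : IsUnit (symbolMatrix θ k).det := by
  classical
  have hv : ∀ β α : lowIdx r k, α.1.degree ≤ β.1.degree →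
      constantCoeff (θ α (monomial β.1 1)) = if β = α then (mfac α.1 : R) else 0 :=
    fun β α hle => by
      rw [hθ α.1 _ fun γ hγ => ?_, coeff_monomial]
      · by_cases h : β = α
        · rw [if_pos h, if_pos (congrArg Subtype.val h).symm, mul_one]
        · rw [if_neg h, if_neg fun h' => h (Subtype.ext h'.symm), mul_zero]
      · rw [coeff_monomial, if_neg]
        rintro rfl
        omega
  rw [isUnit_iff_constantCoeff, RingHom.map_det]
  have hT : (constantCoeff.mapMatrix (symbolMatrix θ k)).BlockTriangular
      fun β : lowIdx r k => β.1.degree := fun β α h => by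
    change constantCoeff (θ α (monomial β.1 1)) = 0
    rw [hv β α h.le, if_neg]
    rintro rfl
    exact lt_irrefl _ h
  rw [hT.det]
  refine IsUnit.prod_iff.mpr fun n _ => ?_
  have hD : (constantCoeff.mapMatrix (symbolMatrix θ k)).toSquareBlock
      (fun β : lowIdx r k => β.1.degree) n = Matrix.diagonal fun β => (mfac β.1.1 : R) := by
    ext β α
    rw [Matrix.diagonal_apply]
    refine (hv β.1 α.1 (α.2.trans β.2.symm).le).trans ?_
    split_ifs with h1 h2 h2
    · rw [h1]
    · exact absurd (Subtype.ext h1) h2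
    · exact absurd (congrArg Subtype.val h2) h1
    · rfl
  rw [hD, Matrix.det_diagonal]
  exact IsUnit.prod_iff.mpr fun β _ => hu _

/-- Linear differential operators on power series are unique combinations of a family of operators
with the right symbols. -/
lemma exists_eq_sum_of_orderLT (hu : ∀ α : Fin r →₀ ℕ, IsUnit (mfac α : R))
    (hθ : ∀ (α : Fin r →₀ ℕ) f, (∀ β : Fin r →₀ ℕ, β.degree < α.degree → coeff β f = 0) →
      constantCoeff (θ α f) = mfac α * coeff α f)
    (hord : ∀ α, OrderLT (psMul R r) (α.degree + 1) (θ α)) {k : ℕ}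
    {d : Module.End R (MvPowerSeries (Fin r) R)} (h : OrderLT (psMul R r) (k + 1) d) :
    ∃ g : (Fin r →₀ ℕ) → MvPowerSeries (Fin r) R,
      d = ∑ α ∈ lowIdx r k, LinearMap.mulLeft R (g α) * θ α := by
  classical
  let y : lowIdx r k → MvPowerSeries (Fin r) R := fun β => d (monomial β.1 1)
  -- These coefficients reproduce the values of `d` on the monomials of degree at most `k`; the
  -- difference is then zero by `eq_zero_of_orderLT`.
  let g := (symbolMatrix θ k)⁻¹.mulVec y
  have hg : (symbolMatrix θ k).mulVec g = y := by
    rw [Matrix.mulVec_mulVec, Matrix.mul_nonsing_inv _ (isUnit_det_symbolMatrix hu hθ k),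
      Matrix.one_mulVec]
  obtain ⟨G, hG⟩ : ∃ G : (Fin r →₀ ℕ) → MvPowerSeries (Fin r) R, ∀ α : lowIdx r k, G α = g α :=
    ⟨fun α => if hα : α ∈ lowIdx r k then g ⟨α, hα⟩ else 0, fun α => dif_pos α.2⟩
  refine ⟨G, sub_eq_zero.mp
    (eq_zero_of_orderLT (h.sub (OrderLT.sum fun α hα => ?_)) fun β hβ => ?_)⟩
  · refine OrderLT.mono (m := 0 + α.degree + 1) (by have := mem_lowIdx.mp hα; omega)
      (OrderLT.mul_succ (OrderLT.of_comm ?_) (hord α))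
    rintro _ ⟨f, rfl⟩
    exact LinearMap.ext fun _ => mul_left_comm _ _ _
  · have h1 := congrFun hg ⟨β, mem_lowIdx.mpr hβ⟩
    rw [LinearMap.sub_apply, sub_eq_zero, LinearMap.sum_apply, ← Finset.sum_coe_sort]
    refine h1.symm.trans (Finset.sum_congr rfl fun α _ => ?_)
    exact (mul_comm _ _).trans (congrArg (· * θ α (monomial β 1)) (hG α).symm)

/-- On the monomials of degree at most `k` the relation is a homogeneous linear system with
invertible matrix. -/
lemma eq_zero_of_sum_eq_zero (hu : ∀ α : Fin r →₀ ℕ, IsUnit (mfac α : R))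
    (hθ : ∀ (α : Fin r →₀ ℕ) f, (∀ β : Fin r →₀ ℕ, β.degree < α.degree → coeff β f = 0) →
      constantCoeff (θ α f) = mfac α * coeff α f) {k : ℕ}
    {g : (Fin r →₀ ℕ) → MvPowerSeries (Fin r) R}
    (h : ∀ f, ∑ α ∈ lowIdx r k, g α * θ α f = 0) : ∀ α ∈ lowIdx r k, g α = 0 := by
  classical
  have hg : (symbolMatrix θ k).mulVec (fun α => g α.1) = 0 := by
    funext β
    refine Eq.trans ?_ (h (monomial β.1 1))
    rw [← Finset.sum_coe_sort]
    exact Finset.sum_congr rfl fun α _ => mul_comm _ _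
  have h2 := congrArg ((symbolMatrix θ k)⁻¹.mulVec) hg
  rw [Matrix.mulVec_mulVec, Matrix.nonsing_inv_mul _ (isUnit_det_symbolMatrix hu hθ k),
    Matrix.one_mulVec, Matrix.mulVec_zero] at h2
  exact fun α hα => congrFun h2 ⟨α, hα⟩

end PowerSeriesOperators

end LieAlg

namespace LieAlg

variable {K : Type u} [Field K] {X : TopCat.{u}} {O : TopCat.Sheaf (CommAlgCat.{u} K) X}

/-! ### Gluing for presheaves of modules and their associated sheaves. -/

namespace PMod

variable {F F' E : PMod O} {U V W : Opens X}

lemma exists_res_eq_of_germ_eq {x : X} {hx : x ∈ V} {hx' : x ∈ W} {m : F.obj V} {n : F.obj W}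
    (h : germ hx m = germ hx' n) :
    ∃ (Z : Opens X) (_ : x ∈ Z) (h₁ : Z ≤ V) (h₂ : Z ≤ W), F.res h₁ m = F.res h₂ n := by
  obtain ⟨Z, h₁, h₂, h⟩ := Quotient.exact h
  exact ⟨Z.set, Z.mem, h₁, h₂, h⟩

lemma res_toSh (h : V ≤ U) (m : F.obj U) : F.sh.res h (F.toSh U m) = F.toSh V (F.res h m) :=
  ShObj.res_of h m

lemma sh_ext {s t : F.sh.obj U}
    (h : ∀ x ∈ U, ∃ (V : Opens X) (_ : x ∈ V) (hV : V ≤ U), F.sh.res hV s = F.sh.res hV t) :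
    s = t := by
  refine ShObj.ext fun x => ?_
  obtain ⟨V, hx, hV, e⟩ := h x.1 x.2
  exact congrArg (fun s : ShObj F V => s.1 ⟨x.1, hx⟩) e

lemma eq_of_toSh_eq {m n : F.obj U} (h : F.toSh U m = F.toSh U n) :
    ∀ x ∈ U, ∃ (V : Opens X) (_ : x ∈ V) (hV : V ≤ U), F.res hV m = F.res hV n := by
  intro x hx
  have e : germ hx m = germ hx n := congrArg (fun s : ShObj F U => s.1 ⟨x, hx⟩) h
  obtain ⟨Z, hxZ, h₁, h₂, h⟩ := exists_res_eq_of_germ_eq e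
  exact ⟨Z, hxZ, h₁, h⟩

/-- The sheaf condition for the open subsets of `V`. -/
def GluingBelow (F : PMod O) (V : Opens X) : Prop :=
  ∀ (ι : Type u) (U : ι → Opens X) (s : ∀ i, F.obj (U i)), (∀ i, U i ≤ V) →
    (∀ i j, F.res (inf_le_left : U i ⊓ U j ≤ U i) (s i) =
      F.res (inf_le_right : U i ⊓ U j ≤ U j) (s j)) →
    ∃! t : F.obj (iSup U), ∀ i, F.res (le_iSup U i) t = s i

lemma IsSheaf.gluingBelow (h : F.IsSheaf) (V : Opens X) : F.GluingBelow V :=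
  fun ι U s _ hs => h ι U s hs

lemma GluingBelow.mono (h : F.GluingBelow V) (hW : W ≤ V) : F.GluingBelow W :=
  fun ι U s hU hs => h ι U s (fun i => (hU i).trans hW) hs

lemma GluingBelow.ext (h : F.GluingBelow V) {m n : F.obj V}
    (H : ∀ x ∈ V, ∃ (W : Opens X) (_ : x ∈ W) (hW : W ≤ V), F.res hW m = F.res hW n) : m = n := by
  choose W hxW hW e using fun x : V => H x.1 x.2
  have hV : iSup W = V := le_antisymm (iSup_le hW)
    fun x hx => Opens.mem_iSup.mpr ⟨⟨x, hx⟩, hxW ⟨x, hx⟩⟩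
  -- The open set is made a variable, so that the equality with the supremum can be eliminated.
  have key : ∀ (V' : Opens X) (hV' : iSup W = V') (hW' : ∀ x, W x ≤ V') (m n : F.obj V'),
      (∀ x, F.res (hW' x) m = F.res (hW' x) n) → m = n := by
    rintro _ rfl hW' m n e
    refine (h V W (fun x => F.res (hW' x) m) hW fun i j => ?_).unique (fun i => rfl)
      fun i => (e i).symm
    rw [F.res_res, F.res_res]
  exact key V hV hW m n e

lemma GluingBelow.toSh_injective (h : F.GluingBelow V) : Function.Injective (F.toSh V) :=
  fun _ _ e => h.ext (eq_of_toSh_eq e)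

/-- A section of the associated sheaf is locally given by sections of `F`. By injectivity over the
overlaps these agree there, and they glue. -/
lemma GluingBelow.toSh_bijective (h : F.GluingBelow V) : Function.Bijective (F.toSh V) := by
  refine ⟨h.toSh_injective, fun s => ?_⟩
  choose W hW hxW m hm using s.isLocal
  have hV : iSup W = V := le_antisymm (iSup_le hW)
    fun x hx => Opens.mem_iSup.mpr ⟨⟨x, hx⟩, hxW ⟨x, hx⟩⟩
  have hloc : ∀ x : V, F.sh.res (hW x) s = F.toSh (W x) (m x) := fun x =>
    ShObj.ext fun y => hm x y.1 y.2
  have key : ∀ (V' : Opens X) (hV' : iSup W = V') (hW' : ∀ x, W x ≤ V'),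
      ∃ t : F.obj V', ∀ x, F.res (hW' x) t = m x := by
    rintro _ rfl hW'
    refine (h V W m hW fun i j => ?_).exists
    refine (h.mono (inf_le_left.trans (hW i))).toSh_injective ?_
    rw [← res_toSh, ← res_toSh, ← hloc, ← hloc]; rfl
  obtain ⟨t, ht⟩ := key V hV hW
  refine ⟨t, sh_ext fun x hx => ⟨W ⟨x, hx⟩, hxW _, hW _, ?_⟩⟩
  rw [res_toSh, ht, hloc]

/-- A presheaf which is locally a product of copies of a sheaf satisfies the sheaf condition. -/
lemma gluingBelow_of_equiv (hE : E.IsSheaf) {I : Type*}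
    (T : ∀ W : Opens X, W ≤ V → F.obj W →+ (I → E.obj W))
    (hT : ∀ (W : Opens X) (h : W ≤ V), Function.Bijective (T W h))
    (hres : ∀ (W W' : Opens X) (h : W ≤ V) (h' : W' ≤ W) (m : F.obj W) (i : I),
      T W' (h'.trans h) (F.res h' m) i = E.res h' (T W h m i)) : F.GluingBelow V := by
  intro ι U s hU hs
  have hS : iSup U ≤ V := iSup_le hU
  have hglue : ∀ i : I, ∃! t : E.obj (iSup U), ∀ k, E.res (le_iSup U k) t = T (U k) (hU k) (s k) i :=
    fun i => hE ι U (fun k => T (U k) (hU k) (s k) i) fun k l => by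
      change E.res _ _ = E.res _ _
      rw [← hres, ← hres, hs]
  choose t ht htu using fun i => hglue i
  obtain ⟨m, hm⟩ := (hT _ hS).2 t
  have hchar : ∀ m' : F.obj (iSup U), (∀ k, F.res (le_iSup U k) m' = s k) ↔ T _ hS m' = t := by
    intro m'
    constructor
    · exact fun h => funext fun i => htu i _ fun k => by rw [← hres _ _ hS, h]
    · intro h k
      refine (hT _ (hU k)).1 (funext fun i => ?_)
      rw [hres _ _ hS, h, ht]
  exact ⟨m, (hchar m).mpr hm, fun m' h => (hT _ hS).1 (((hchar m').mp h).trans hm.symm)⟩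

end PMod

/-! ### Morphisms of sheaves defined over a local basis. -/

/-- A class of open sets which is stable under passage to smaller open sets and covers. -/
structure IsLocalBasis (G : Opens X → Prop) : Prop where
  mono : ∀ {V W : Opens X}, W ≤ V → G V → G W
  cover : ∀ x : X, ∃ V, x ∈ V ∧ G V

namespace IsLocalBasis

open PMod

variable {G : Opens X → Prop} (hG : IsLocalBasis G) {F F' E : PMod O} {U V W : Opens X}

include hG in
lemma exists_le (x : X) (hx : x ∈ U) : ∃ V, x ∈ V ∧ V ≤ U ∧ G V := by
  obtain ⟨V, hxV, hV⟩ := hG.cover x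
  exact ⟨V ⊓ U, ⟨hxV, hx⟩, inf_le_right, hG.mono inf_le_left hV⟩

include hG in
lemma exists_toSh (s : F.sh.obj U) (x : X) (hx : x ∈ U) :
    ∃ (V : Opens X) (_ : x ∈ V) (h : V ≤ U) (m : F.obj V), G V ∧ F.sh.res h s = F.toSh V m := by
  obtain ⟨W, hW, hxW, m, hm⟩ := s.isLocal ⟨x, hx⟩
  obtain ⟨V, hxV, hV, hGV⟩ := hG.exists_le x hxW
  refine ⟨V, hxV, hV.trans hW, F.res hV m, hGV, ShObj.ext fun y => ?_⟩
  exact (hm y.1 (hV y.2)).trans (germ_res hV y.2 m).symm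

include hG in
lemma exists_toSh₂ (s : F.sh.obj U) (t : F'.sh.obj U) (x : X) (hx : x ∈ U) :
    ∃ (V : Opens X) (_ : x ∈ V) (h : V ≤ U) (m : F.obj V) (n : F'.obj V), G V ∧
      F.sh.res h s = F.toSh V m ∧ F'.sh.res h t = F'.toSh V n := by
  obtain ⟨W, hxW, hW, n, hGW, hn⟩ := hG.exists_toSh t x hx
  obtain ⟨V, hxV, hV, m, hGV, hm⟩ := hG.exists_toSh (F.sh.res hW s) x hxW
  refine ⟨V, hxV, hV.trans hW, m, F'.res hV n, hGV, hm, ?_⟩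
  rw [← F'.sh.res_res hW hV, hn, res_toSh]

include hG in
lemma exists_germ (x : X) (s : F.Stalk x) :
    ∃ (V : Opens X) (hx : x ∈ V) (m : F.obj V), G V ∧ s = germ hx m := by
  obtain ⟨W, hxW, m, rfl⟩ := PMod.exists_germ s
  obtain ⟨V, hxV, hV, hGV⟩ := hG.exists_le x hxW
  exact ⟨V, hxV, F.res hV m, hGV, (germ_res hV hxV m).symm⟩

/-- A morphism of presheaves which is defined over the members of a local basis. -/
structure PreHom (hG : IsLocalBasis G) (F F' : PMod O) where
  app (V : Opens X) : G V → (F.obj V →+ F'.obj V)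
  app_res {V W : Opens X} (hV : G V) (h : W ≤ V) (m : F.obj V) :
    app W (hG.mono h hV) (F.res h m) = F'.res h (app V hV m)

namespace PreHom

variable {hG} (φ : hG.PreHom F F')

/-- Makes `stalk` independent of the representative chosen for a germ. -/
lemma germ_app_eq {x : X} {hx : x ∈ V} {hx' : x ∈ W} {m : F.obj V} {n : F.obj W} (hV : G V)
    (hW : G W) (h : germ hx m = germ hx' n) :
    germ hx (φ.app V hV m) = germ hx' (φ.app W hW n) := by
  obtain ⟨Z, hxZ, h₁, h₂, e⟩ := exists_res_eq_of_germ_eq h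
  rw [← germ_res h₂ hxZ, ← germ_res h₁ hxZ, ← φ.app_res hW h₂, ← φ.app_res hV h₁, e]

/-- The map on stalks. -/
def stalk (x : X) (s : F.Stalk x) : F'.Stalk x :=
  germ (hG.exists_germ x s).choose_spec.choose
    (φ.app _ (hG.exists_germ x s).choose_spec.choose_spec.choose_spec.1
      (hG.exists_germ x s).choose_spec.choose_spec.choose)

lemma stalk_germ {x : X} (hx : x ∈ V) (hV : G V) (m : F.obj V) :
    φ.stalk x (germ hx m) = germ hx (φ.app V hV m) :=
  φ.germ_app_eq _ _ (hG.exists_germ x (germ hx m)).choose_spec.choose_spec.choose_spec.2.symm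

/-- The morphism of associated sheaves. -/
def sh (U : Opens X) : F.sh.obj U →+ F'.sh.obj U :=
  AddMonoidHom.mk' (fun s => ShObj.mk (fun x => φ.stalk x.1 (s.1 x)) fun x => by
    obtain ⟨V, hxV, hV, m, hGV, e⟩ := hG.exists_toSh s x.1 x.2
    refine ⟨V, hV, hxV, φ.app V hGV m, fun y hy => ?_⟩
    rw [← stalk_germ]
    exact congrArg (fun s : ShObj F V => φ.stalk y (s.1 ⟨y, hy⟩)) e)
  fun s t => ShObj.ext fun x => by
    obtain ⟨V, hxV, hV, m, hGV, e⟩ := hG.exists_toSh s x.1 x.2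
    obtain ⟨V', hxV', hV', m', hGV', e'⟩ := hG.exists_toSh t x.1 x.2
    have hs : s.1 x = germ (V := V ⊓ V') (show x.1 ∈ V ⊓ V' from ⟨hxV, hxV'⟩)
        (F.res inf_le_left m) := by
      rw [germ_res]
      exact congrArg (fun s : ShObj F V => s.1 ⟨x, hxV⟩) e
    have ht : t.1 x = germ (V := V ⊓ V') (show x.1 ∈ V ⊓ V' from ⟨hxV, hxV'⟩)
        (F.res inf_le_right m') := by
      rw [germ_res]
      exact congrArg (fun s : ShObj F V' => s.1 ⟨x, hxV'⟩) e'
    have hGW := hG.mono (inf_le_left : V ⊓ V' ≤ V) hGV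
    change φ.stalk x.1 (s.1 x + t.1 x) = φ.stalk x.1 (s.1 x) + φ.stalk x.1 (t.1 x)
    rw [hs, ht, ← map_add (germ (F := F) _), stalk_germ φ _ hGW, stalk_germ φ _ hGW,
      stalk_germ φ _ hGW, map_add, map_add]

lemma sh_res (h : V ≤ U) (s : F.sh.obj U) : φ.sh V (F.sh.res h s) = F'.sh.res h (φ.sh U s) := rfl

lemma sh_toSh (hV : G V) (m : F.obj V) : φ.sh V (F.toSh V m) = F'.toSh V (φ.app V hV m) :=
  ShObj.ext fun x => φ.stalk_germ x.2 hV m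

end PreHom

/-- An isomorphism of presheaves which is defined over the members of a local basis. -/
structure PreEquiv (hG : IsLocalBasis G) (F F' : PMod O) where
  app (V : Opens X) : G V → (F.obj V ≃+ F'.obj V)
  app_res {V W : Opens X} (hV : G V) (h : W ≤ V) (m : F.obj V) :
    app W (hG.mono h hV) (F.res h m) = F'.res h (app V hV m)

namespace PreEquiv

variable {hG} (φ : hG.PreEquiv F F')

/-- The underlying morphism. -/
def toPreHom : hG.PreHom F F' := ⟨fun V hV => (φ.app V hV).toAddMonoidHom, φ.app_res⟩

/-- The inverse morphism. -/
def invPreHom : hG.PreHom F' F :=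
  ⟨fun V hV => (φ.app V hV).symm.toAddMonoidHom, fun {V W} hV h m =>
    (φ.app W (hG.mono h hV)).injective (by
      refine ((φ.app W _).apply_symm_apply _).trans ?_
      refine Eq.trans ?_ (φ.app_res hV h _).symm
      exact congrArg _ ((φ.app V hV).apply_symm_apply m).symm)⟩

/-- The isomorphism of associated sheaves. -/
def sh (U : Opens X) : F.sh.obj U ≃+ F'.sh.obj U :=
  { φ.toPreHom.sh U with
    invFun := φ.invPreHom.sh U
    left_inv := fun s => sh_ext fun x hx => by
      obtain ⟨V, hxV, hV, m, hGV, e⟩ := hG.exists_toSh s x hx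
      refine ⟨V, hxV, hV, ?_⟩
      rw [← PreHom.sh_res]
      change φ.invPreHom.sh V (F'.sh.res hV (φ.toPreHom.sh U s)) = _
      rw [← PreHom.sh_res, e, PreHom.sh_toSh _ hGV, PreHom.sh_toSh _ hGV]
      exact congrArg _ ((φ.app V hGV).symm_apply_apply m)
    right_inv := fun s => sh_ext fun x hx => by
      obtain ⟨V, hxV, hV, m, hGV, e⟩ := hG.exists_toSh s x hx
      refine ⟨V, hxV, hV, ?_⟩
      change F'.sh.res hV (φ.toPreHom.sh U (φ.invPreHom.sh U s)) = _
      rw [← PreHom.sh_res, ← PreHom.sh_res, e, PreHom.sh_toSh _ hGV, PreHom.sh_toSh _ hGV]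
      exact congrArg _ ((φ.app V hGV).apply_symm_apply m) }

lemma sh_res (h : V ≤ U) (s : F.sh.obj U) : φ.sh V (F.sh.res h s) = F'.sh.res h (φ.sh U s) := rfl

lemma sh_toSh (hV : G V) (m : F.obj V) : φ.sh V (F.toSh V m) = F'.toSh V (φ.app V hV m) :=
  φ.toPreHom.sh_toSh hV m

end PreEquiv

include hG in
/-- A morphism from an associated sheaf to a separated presheaf is bijective if it is locally
injective on sections of the presheaf and locally surjective. -/
lemma bijective_of_local {T : Opens X → Type*} [∀ U, AddCommGroup (T U)]
    (res : ∀ {U V : Opens X}, V ≤ U → T U → T V)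
    (hrr : ∀ {U V W : Opens X} (h : V ≤ U) (h' : W ≤ V) (t : T U),
      res h' (res h t) = res (h'.trans h) t)
    (hsep : ∀ (U : Opens X) (t t' : T U), (∀ x ∈ U, ∃ (V : Opens X) (_ : x ∈ V) (h : V ≤ U),
      res h t = res h t') → t = t')
    (Ψ : ∀ U, F.sh.obj U →+ T U)
    (hΨ : ∀ {U V : Opens X} (h : V ≤ U) (s : F.sh.obj U), Ψ V (F.sh.res h s) = res h (Ψ U s))
    (hinj : ∀ V, G V → ∀ m : F.obj V, Ψ V (F.toSh V m) = 0 → m = 0)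
    (hsurj : ∀ (U : Opens X) (t : T U), ∀ x ∈ U, ∃ (V : Opens X) (_ : x ∈ V) (h : V ≤ U)
      (m : F.obj V), G V ∧ Ψ V (F.toSh V m) = res h t) (U : Opens X) :
    Function.Bijective (Ψ U) := by
  constructor
  · rw [injective_iff_map_eq_zero]
    intro s hs
    refine sh_ext fun x hx => ?_
    obtain ⟨V, hxV, hV, m, hGV, e⟩ := hG.exists_toSh s x hx
    refine ⟨V, hxV, hV, ?_⟩
    have h0 : Ψ V (F.toSh V m) = 0 := by
      have h1 := hΨ hV (0 : F.sh.obj U)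
      rw [map_zero, map_zero, map_zero] at h1
      rw [← e, hΨ, hs, ← h1]
    rw [e, hinj V hGV m h0, map_zero, map_zero]
  · intro t
    choose V hxV hV m hGV hm using fun x : U => hsurj U t x.1 x.2
    -- Two local preimages have the same image over an overlap, so they agree there by injectivity.
    -- Their germs therefore define a section of the associated sheaf.
    have hcomp : ∀ (x y : U) (z : X) (hx : z ∈ V x) (hy : z ∈ V y),
        germ hx (m x) = germ hy (m y) := fun x y z hx hy => by
      have h1 : F.res (inf_le_left : V x ⊓ V y ≤ V x) (m x) =
          F.res (inf_le_right : V x ⊓ V y ≤ V y) (m y) := by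
        rw [← sub_eq_zero]
        refine hinj _ (hG.mono inf_le_left (hGV x)) _ ?_
        rw [map_sub, map_sub, ← res_toSh, ← res_toSh, hΨ, hΨ, hm, hm, hrr, hrr, sub_self]
      have hz : z ∈ V x ⊓ V y := ⟨hx, hy⟩
      rw [← germ_res inf_le_left hz, h1, germ_res]
    obtain ⟨s, hs⟩ : ∃ s : F.sh.obj U, ∀ x, s.1 x = germ (hxV x) (m x) :=
      ⟨ShObj.mk (fun x => germ (hxV x) (m x)) fun x => ⟨V x, hV x, hxV x, m x,
        fun y hy => hcomp _ _ y _ _⟩, fun _ => rfl⟩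
    refine ⟨s, hsep U _ _ fun x hx => ⟨V ⟨x, hx⟩, hxV _, hV _, ?_⟩⟩
    rw [← hΨ, ← hm]
    exact congrArg _ (ShObj.ext fun y => (hs ⟨y.1, hV _ y.2⟩).trans (hcomp _ _ y.1 _ _))

end IsLocalBasis

end LieAlg

namespace LieAlg

variable {K : Type u} [Field K] {X : TopCat.{u}} {O : TopCat.Sheaf (CommAlgCat.{u} K) X}

namespace LieAlgebroid

variable {L : LieAlgebroid O} {E : PMod O} {U V W : Opens X} {r q : ℕ}

/-! ### The action of `J(L) ⊗ U(L; E)` on twisted jets. -/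

section Operators

/-- The contraction `ψ ⊗ s ↦ f(s) ψ`. -/
def twContract (f : E.dual.obj V) : (L.preTwJet E).obj V →ₗ[Sec O V] L.Jet V :=
  TensorProduct.lift (LinearMap.mk₂ (Sec O V) (fun (ψ : L.Jet V) (s : E.obj V) => PMod.ev f s • ψ)
    (fun _ _ _ => smul_add _ _ _) (fun _ _ _ => smul_comm _ _ _)
    (fun _ _ _ => by rw [map_add, add_smul])
    (fun c ψ s => by rw [map_smul, smul_eq_mul, mul_smul]))

lemma twContract_tmul (f : E.dual.obj V) (ψ : L.Jet V) (s : E.obj V) :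
    twContract f (ψ ⊗ₜ[Sec O V] s) = PMod.ev f s • ψ := rfl

lemma twContract_add (f g : E.dual.obj V) (t : (L.preTwJet E).obj V) :
    twContract (f + g) t = twContract f t + twContract g t := by
  refine DFunLike.congr_fun (twHom_ext (F := (twContract (f + g)).toAddMonoidHom)
    (G := (twContract f).toAddMonoidHom + (twContract g).toAddMonoidHom) fun ψ s => ?_) t
  exact add_smul (PMod.ev f s) (PMod.ev g s) ψ

lemma twContract_smul (c : Sec O V) (f : E.dual.obj V) (t : (L.preTwJet E).obj V) :
    twContract (c • f) t = c • twContract f t := by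
  refine DFunLike.congr_fun (twHom_ext (F := (twContract (c • f)).toAddMonoidHom)
    (G := (DistribSMul.toAddMonoidHom _ c).comp (twContract f).toAddMonoidHom) fun ψ s => ?_) t
  refine Eq.trans ?_ (mul_smul c (PMod.ev f s) ψ)
  exact congrArg (fun a : Sec O V => (a * PMod.ev f s) • ψ) (rs_refl c)

lemma twContract_twMul (f : E.dual.obj V) (φ : L.Jet V) (t : (L.preTwJet E).obj V) :
    twContract f (twMul φ t) = Jet.mul φ (twContract f t) := by
  refine DFunLike.congr_fun (twHom_ext (F := (twContract f).toAddMonoidHom.comp (twMul φ))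
    (G := (jetMul L V φ).comp (twContract f).toAddMonoidHom) fun ψ s => ?_) t
  exact (Jet.mul_smul' (PMod.ev f s) φ ψ).symm

lemma twContract_res (h : W ≤ V) (f : E.dual.obj V) (t : (L.preTwJet E).obj V) :
    twContract (E.dual.res h f) ((L.preTwJet E).res h t) = Jet.restrict h (twContract f t) := by
  refine DFunLike.congr_fun (twHom_ext
    (F := (twContract (E.dual.res h f)).toAddMonoidHom.comp ((L.preTwJet E).res h).toAddMonoidHom)
    (G := (L.JetMod.res h).toAddMonoidHom.comp (twContract f).toAddMonoidHom) fun ψ s => ?_) t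
  refine Eq.trans ?_ ((L.JetMod.res h).map_smulₛₗ (PMod.ev f s) ψ).symm
  exact congrArg (fun a : Sec O W => a • Jet.restrict h ψ)
    (PMod.Hom.app_res (G := PMod.unit O) f le_rfl h s)

lemma jet_ιR_smul (c : Sec O V) (φ : L.Jet V) : UEA.ιR (L.obj V) c • φ = c • φ := rfl

variable (L E V) in
/-- The action of `U(L) ⊗ E^∨` on twisted jets: `(D ⊗ f, t) ↦ D (f(t))`. -/
def dualOp : (L.UEdual E).obj V →+ (L.preTwJet E).obj V →+ L.Jet V :=
  liftAddHom
    (AddMonoidHom.mk' (fun D : L.UE V => AddMonoidHom.mk' (fun f : E.dual.obj V =>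
      (DistribSMul.toAddMonoidHom (L.Jet V) D).comp (twContract f).toAddMonoidHom)
      (fun f g => AddMonoidHom.ext fun t =>
        (congrArg (D • ·) (twContract_add f g t)).trans (smul_add _ _ _)))
      (fun D D' => AddMonoidHom.ext fun f => AddMonoidHom.ext fun t => add_smul D D' _))
    (fun c D f => AddMonoidHom.ext fun t => by
      refine (mul_smul D (UEA.ιR (L.obj V) c.unop) (twContract f t)).trans ?_
      exact congrArg (D • ·) (twContract_smul c.unop f t).symm)

lemma dualOp_smul (D : L.UE V) (w : (L.UEdual E).obj V) (t : (L.preTwJet E).obj V) :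
    dualOp L E V (D • w) t = D • dualOp L E V w t := by
  refine jueMul₂_ext (a := ((dualOp L E V).flip t).comp (DistribSMul.toAddMonoidHom _ D))
    (b := (DistribSMul.toAddMonoidHom _ D).comp ((dualOp L E V).flip t)) (fun D' f => ?_) w
  exact mul_smul D D' _

lemma dualOp_res (h : W ≤ V) (w : (L.UEdual E).obj V) (t : (L.preTwJet E).obj V) :
    dualOp L E W ((L.UEdual E).res h w) ((L.preTwJet E).res h t) =
      Jet.restrict h (dualOp L E V w t) := by
  refine jueMul₂_ext
    (a := ((dualOp L E W).flip ((L.preTwJet E).res h t)).comp ((L.UEdual E).res h).toAddMonoidHom)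
    (b := (L.JetMod.res h).toAddMonoidHom.comp ((dualOp L E V).flip t)) (fun D f => ?_) w
  change L.ures h D • twContract (E.dual.res h f) ((L.preTwJet E).res h t) =
    Jet.restrict h (D • twContract f t)
  rw [twContract_res, Jet.restrict_smul]

variable (L E V) in
/-- The action of `E ⊗ U(L) ⊗ E^∨` on twisted jets: `(e ⊗ D ⊗ f, t) ↦ D (f(t)) ⊗ e`. -/
def ueOp : (L.preTwUE E).obj V →+ (L.preTwJet E).obj V →+ (L.preTwJet E).obj V :=
  liftAddHom
    (AddMonoidHom.mk' (fun e : E.obj V => AddMonoidHom.mk' (fun w : (L.UEdual E).obj V =>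
      ((TensorProduct.mk (Sec O V) (L.Jet V) (E.obj V)).flip e).toAddMonoidHom.comp
        (dualOp L E V w))
      (fun w w' => AddMonoidHom.ext fun t =>
        (congrArg (fun d : (L.preTwJet E).obj V →+ L.Jet V => d t ⊗ₜ[Sec O V] e)
          (map_add (dualOp L E V) w w')).trans (add_tmul _ _ _)))
      (fun e e' => AddMonoidHom.ext fun w => AddMonoidHom.ext fun t => tmul_add _ _ _))
    (fun c e w => AddMonoidHom.ext fun t => by
      refine (smul_tmul c (dualOp L E V w t) e).symm.trans ?_
      exact congrArg (· ⊗ₜ[Sec O V] e) (dualOp_smul (UEA.ιR _ c) w t).symm)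

lemma ueOp_smul (c : Sec O V) (m : (L.preTwUE E).obj V) (t : (L.preTwJet E).obj V) :
    ueOp L E V (c • m) t = c • ueOp L E V m t := by
  refine jueMul₁_ext (a := ((ueOp L E V).flip t).comp (DistribSMul.toAddMonoidHom _ c))
    (b := (DistribSMul.toAddMonoidHom _ c).comp ((ueOp L E V).flip t)) (fun e D f => ?_) m
  exact tmul_smul c (D • twContract f t) e

lemma ueOp_res (h : W ≤ V) (m : (L.preTwUE E).obj V) (t : (L.preTwJet E).obj V) :
    ueOp L E W ((L.preTwUE E).res h m) ((L.preTwJet E).res h t) =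
      (L.preTwJet E).res h (ueOp L E V m t) := by
  refine jueMul₁_ext
    (a := ((ueOp L E W).flip ((L.preTwJet E).res h t)).comp ((L.preTwUE E).res h).toAddMonoidHom)
    (b := ((L.preTwJet E).res h).toAddMonoidHom.comp ((ueOp L E V).flip t)) (fun e D f => ?_) m
  exact congrArg (· ⊗ₜ[Sec O W] E.res h e) (dualOp_res h (D ⊗ₜ f) t)

variable (L E V) in
/-- The action of `J(L) ⊗ U(L; E)` on twisted jets:
`(φ ⊗ e ⊗ D ⊗ f, t) ↦ φ D (f(t)) ⊗ e`. -/
def jueOp : (L.preJetUE E).obj V →+ (L.preTwJet E).obj V →+ (L.preTwJet E).obj V :=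
  liftAddHom
    (AddMonoidHom.mk' (fun φ : L.Jet V => AddMonoidHom.mk' (fun m : (L.preTwUE E).obj V =>
      (twMul φ).comp (ueOp L E V m))
      (fun m m' => AddMonoidHom.ext fun t =>
        (congrArg (fun d : (L.preTwJet E).obj V →+ (L.preTwJet E).obj V => twMul φ (d t))
          (map_add (ueOp L E V) m m')).trans (map_add _ _ _)))
      (fun φ φ' => AddMonoidHom.ext fun m => AddMonoidHom.ext fun t =>
        DFunLike.congr_fun (map_add ((L.jetPairing E).app V) φ φ') _))
    (fun c φ m => AddMonoidHom.ext fun t => by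
      change twMul (c • φ) (ueOp L E V m t) = twMul φ (ueOp L E V (c • m) t)
      rw [ueOp_smul, twMul_smul]
      refine DFunLike.congr_fun (twHom_ext (F := twMul (c • φ))
        (G := (DistribSMul.toAddMonoidHom _ c).comp (twMul φ)) fun ψ s => ?_) _
      exact (congrArg (· ⊗ₜ[Sec O V] s) (Jet.smul_mul c φ ψ)).trans (smul_tmul' c _ s).symm)

lemma jueOp_tmul (φ : L.Jet V) (m : (L.preTwUE E).obj V) (t : (L.preTwJet E).obj V) :
    jueOp L E V (φ ⊗ₜ m) t = twMul φ (ueOp L E V m t) := rfl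

lemma jueOp_jueTmul (φ : L.Jet V) (e : E.obj V) (D : L.UE V) (f : E.dual.obj V)
    (t : (L.preTwJet E).obj V) : jueOp L E V (jueTmul φ e D f) t =
      Jet.mul φ (D • twContract f t) ⊗ₜ[Sec O V] e := rfl

lemma jueOp_res (h : W ≤ V) (m : (L.preJetUE E).obj V) (t : (L.preTwJet E).obj V) :
    jueOp L E W ((L.preJetUE E).res h m) ((L.preTwJet E).res h t) =
      (L.preTwJet E).res h (jueOp L E V m t) := by
  refine jueMul_ext
    (a := ((jueOp L E W).flip ((L.preTwJet E).res h t)).comp ((L.preJetUE E).res h).toAddMonoidHom)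
    (b := ((L.preTwJet E).res h).toAddMonoidHom.comp ((jueOp L E V).flip t)) (fun φ e D f => ?_) m
  exact (congrArg (twMul (Jet.restrict h φ)) (ueOp_res h (ueTmul e D f) t)).trans
    ((L.jetPairing E).app_res h φ (ueOp L E V (ueTmul e D f) t))

/-- Contractions, the action of `U(L)` and products of jets are all linear for the first module
structure. This is the source of the `O`-linearity of the operators in (iii). -/
lemma jueOp_twSmul₁ (m : (L.preJetUE E).obj V) (c : Sec O V) (t : (L.preTwJet E).obj V) :
    jueOp L E V m (twSmul₁ c t) = twSmul₁ c (jueOp L E V m t) := by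
  refine jueMul_ext (a := (jueOp L E V).flip (twSmul₁ c t))
    (b := (twSmul₁ c).comp ((jueOp L E V).flip t)) (fun φ e D f => ?_) m
  have h1 : twContract f (twSmul₁ c t) = Jet.smul₁ c (twContract f t) := by
    refine DFunLike.congr_fun (twHom_ext (F := (twContract f).toAddMonoidHom.comp (twSmul₁ c))
      (G := (Jet.smul₁ c).toAddMonoidHom.comp (twContract f).toAddMonoidHom) fun ψ s => ?_) t
    exact ((Jet.smul₁ c).map_smul (PMod.ev f s) ψ).symm
  have h2 : ∀ φ ψ : L.Jet V, Jet.mul φ (Jet.smul₁ c ψ) = Jet.smul₁ c (Jet.mul φ ψ) := fun φ ψ => by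
    ext W h D
    rw [Jet.smul₁_app, Jet.mul_app, Jet.mul_app]
    generalize UEA.comul (Sec O W) (L.obj W) D = z
    induction z with
    | zero => rw [map_zero, map_zero, mul_zero]
    | tmul a b => exact mul_left_comm _ _ _
    | add s t hs ht => rw [map_add, map_add, mul_add, hs, ht]
  change Jet.mul φ (D • twContract f (twSmul₁ c t)) ⊗ₜ[Sec O V] e =
    Jet.smul₁ c (Jet.mul φ (D • twContract f t)) ⊗ₜ[Sec O V] e
  rw [h1, ← h2]; rfl

lemma jueOp_smul_left (c : Sec O V) (m : (L.preJetUE E).obj V) (t : (L.preTwJet E).obj V) :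
    jueOp L E V (c • m) t = c • jueOp L E V m t := by
  refine jueMul_ext (a := ((jueOp L E V).flip t).comp (DistribSMul.toAddMonoidHom _ c))
    (b := (DistribSMul.toAddMonoidHom _ c).comp ((jueOp L E V).flip t)) (fun φ e D f => ?_) m
  change jueOp L E V ((c • φ) ⊗ₜ ueTmul e D f) t = c • jueOp L E V (φ ⊗ₜ ueTmul e D f) t
  rw [smul_tmul, jueOp_tmul, jueOp_tmul, ueOp_smul, twMul_smul]

/-- The action of `J(L) ⊗ U(L) ⊗ E^∨` on twisted jets: `(ψ ⊗ w, t) ↦ ψ w(t)`. -/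
def jetDualOp : L.Jet V ⊗[Sec O V] (L.UEdual E).obj V →+ (L.preTwJet E).obj V →+ L.Jet V :=
  liftAddHom
    (AddMonoidHom.mk' (fun ψ : L.Jet V => AddMonoidHom.mk' (fun w : (L.UEdual E).obj V =>
      (jetMul L V ψ).comp (dualOp L E V w))
      (fun w w' => AddMonoidHom.ext fun t =>
        (congrArg (fun d : (L.preTwJet E).obj V →+ L.Jet V => jetMul L V ψ (d t))
          (map_add (dualOp L E V) w w')).trans (map_add _ _ _)))
      (fun ψ ψ' => AddMonoidHom.ext fun w => AddMonoidHom.ext fun t => Jet.add_mul _ _ _))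
    (fun c ψ w => AddMonoidHom.ext fun t => by
      refine (Jet.smul_mul c ψ (dualOp L E V w t)).trans ?_
      exact (Jet.mul_smul' c ψ _).symm.trans
        (congrArg (Jet.mul ψ) (dualOp_smul (UEA.ιR _ c) w t).symm))

lemma jetDualOp_tmul (ψ : L.Jet V) (w : (L.UEdual E).obj V) (t : (L.preTwJet E).obj V) :
    jetDualOp (ψ ⊗ₜ w) t = Jet.mul ψ (dualOp L E V w t) := rfl

/-- Checked on generators: a function can be moved onto either factor, and `x` acts on a product of
jets as a derivation (`jetNab_mul`), just as it acts on a tensor product. -/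
lemma jetDualOp_tensorAct (D : L.UE V) (z : L.Jet V ⊗[Sec O V] (L.UEdual E).obj V)
    (t : (L.preTwJet E).obj V) :
    jetDualOp (UEA.tensorAct (L.Jet V) ((L.UEdual E).obj V) D z) t = D • jetDualOp z t := by
  induction D using UEA.induction generalizing z with
  | hR c =>
    rw [UEA.tensorAct_ιR, jet_ιR_smul]
    induction z with
    | zero => rw [smul_zero, map_zero]; exact (smul_zero _).symm
    | tmul ψ w => exact Jet.smul_mul c ψ _
    | add y z hy hz =>
      rw [smul_add, map_add, map_add, AddMonoidHom.add_apply, AddMonoidHom.add_apply, hy, hz,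
        smul_add]
  | hL x =>
    rw [UEA.tensorAct_ιL]
    induction z with
    | zero => rw [map_zero, map_zero]; exact (smul_zero _).symm
    | tmul ψ w =>
      rw [UEA.tensorL_tmul, map_add, AddMonoidHom.add_apply, jetDualOp_tmul, jetDualOp_tmul,
        jetDualOp_tmul, dualOp_smul]
      exact (jetNab_mul x ψ _).symm
    | add y z hy hz =>
      rw [map_add, map_add, map_add, AddMonoidHom.add_apply, AddMonoidHom.add_apply, hy, hz,
        smul_add]
  | hadd a b ha hb =>
    rw [UEA.tensorAct_add, map_add, AddMonoidHom.add_apply, ha, hb, add_smul]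
  | hmul a b ha hb => rw [UEA.tensorAct_mul, ha, hb, mul_smul]

lemma jueContract_jueTmul (f : E.dual.obj V) (φ : L.Jet V) (e : E.obj V) (D : L.UE V)
    (g : E.dual.obj V) : jueContract f (jueTmul φ e D g) =
      φ ⊗ₜ[Sec O V] ((PMod.ev f e • (D ⊗ₜ g) : (L.UEdual E).obj V)) := rfl

lemma jetDualOp_jueContract (f : E.dual.obj V) (m : (L.preJetUE E).obj V)
    (t : (L.preTwJet E).obj V) :
    jetDualOp (jueContract f m) t = twContract f (jueOp L E V m t) := by
  let a : (L.preJetUE E).obj V →+ L.Jet V :=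
    (jetDualOp.flip t).comp (jueContract (L := L) f).toAddMonoidHom
  let b : (L.preJetUE E).obj V →+ L.Jet V :=
    (twContract f).toAddMonoidHom.comp ((jueOp L E V).flip t)
  have key : ∀ φ e D g, a (jueTmul φ e D g) = b (jueTmul φ e D g) := fun φ e D g => by
    change jetDualOp (jueContract f (jueTmul φ e D g)) t =
      twContract f (jueOp L E V (jueTmul φ e D g) t)
    rw [jueOp_jueTmul, jueContract_jueTmul, jetDualOp_tmul, twContract_tmul]
    have h := dualOp_smul (UEA.ιR _ (PMod.ev f e)) (D ⊗ₜ g) t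
    exact (congrArg (Jet.mul φ) h).trans (Jet.mul_smul' _ φ _)
  exact jueMul_ext key m

lemma jueOp_jueInsert [CharZero K] (nL : L.Connection L.toPMod) (fr : L.toPMod.Frame r V)
    (φ : L.Jet V) (e : E.obj V) (z : L.Jet V ⊗[Sec O V] (L.UEdual E).obj V)
    (t : (L.preTwJet E).obj V) :
    jueOp L E V (jueInsert φ e z) t = Jet.mul φ (jetDualOp z t) ⊗ₜ[Sec O V] e := by
  induction z with
  | zero =>
    rw [map_zero, map_zero, map_zero]
    exact ((congrArg (· ⊗ₜ[Sec O V] e) (map_zero (jetMul L V φ))).trans (zero_tmul _ _)).symm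
  | tmul ψ w => exact congrArg (· ⊗ₜ[Sec O V] e) (jet_mul_assoc nL fr φ ψ _)
  | add y z hy hz =>
    rw [map_add, map_add, map_add, AddMonoidHom.add_apply, AddMonoidHom.add_apply, hy, hz,
      Jet.mul_add, add_tmul]

/-- The product contracts `f` with the second element, applies `D` through the coproduct and inserts
`φ` and `e`. On twisted jets these become the contraction by `f`, the action of `D`, and
multiplication by `φ` followed by `⊗ e`; the insertion needs associativity of jets. -/
lemma jueOp_jueMul [CharZero K] (nL : L.Connection L.toPMod) (fr : L.toPMod.Frame r V)
    (m n : (L.preJetUE E).obj V) (t : (L.preTwJet E).obj V) :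
    jueOp L E V (jueMul L E V m n) t = jueOp L E V m (jueOp L E V n t) := by
  refine jueMul_ext (a := ((jueOp L E V).flip t).comp ((jueMul L E V).flip n))
    (b := (jueOp L E V).flip (jueOp L E V n t)) (fun φ e D f => ?_) m
  change jueOp L E V (jueMulLeft φ e D f n) t = jueOp L E V (jueTmul φ e D f) (jueOp L E V n t)
  rw [jueMulLeft_tmul, jueOp_jueInsert nL fr, jetDualOp_tensorAct, jetDualOp_jueContract,
    jueOp_jueTmul]

end Operators

end LieAlgebroid
end LieAlg

namespace LieAlg

variable {K : Type u} [Field K] {X : TopCat.{u}} {O : TopCat.Sheaf (CommAlgCat.{u} K) X}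

/-! ### Dual frames, and orders of the operators on jets. -/

namespace PMod.Frame

variable {E : PMod O} {V W : Opens X} {q : ℕ} (b : E.Frame q V)

/-- The dual frame. -/
def dualVec (c : Fin q) : E.dual.obj V :=
  PMod.Hom.mk (G := PMod.unit O) (fun h => (b.restrict h).basis.coord c) fun {W W'} h h' m => by
    have := repr_res (b.restrict h) h' m c
    simp only [Module.Basis.coord_apply]
    refine Eq.trans ?_ this
    have hb : (b.restrict (h'.trans h)) = (b.restrict h).restrict h' := by
      simp only [restrict, E.res_res]
    rw [hb]

lemma ev_dualVec (c : Fin q) (s : E.obj V) : PMod.ev (b.dualVec c) s = b.basis.repr s c := by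
  have h := repr_res b le_rfl s c
  rw [E.res_refl, rs_refl] at h
  exact h

lemma sum_ev_smul_dualVec (f : E.dual.obj V) : ∑ c, PMod.ev f (b.vec c) • b.dualVec c = f := by
  refine PMod.Hom.ext fun W h m => ?_
  let A : E.dual.obj V →+ Sec O W :=
    AddMonoidHom.mk' (fun g : E.dual.obj V => PMod.evOn g h m) fun _ _ => rfl
  refine (map_sum A (fun c => PMod.ev f (b.vec c) • b.dualVec c) Finset.univ).trans ?_
  refine Eq.trans ?_ (congrArg (PMod.evOn f h) ((b.restrict h).basis.sum_repr m))
  rw [map_sum]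
  refine Finset.sum_congr rfl fun c _ => ?_
  refine Eq.trans ?_ ((PMod.evOn f h).map_smul _ _).symm
  rw [basis_apply, restrict_vec]
  change rs O h (PMod.ev f (b.vec c)) * (b.restrict h).basis.repr m c = _ * _
  rw [mul_comm]
  exact congrArg ((b.restrict h).basis.repr m c * ·)
    (PMod.Hom.app_res (G := PMod.unit O) f le_rfl h (b.vec c)).symm

end PMod.Frame

namespace LieAlgebroid

variable {L : LieAlgebroid O} {E : PMod O} {U V W : Opens X} {r q : ℕ}

lemma ures_mem_fil (h : W ≤ V) {k : ℕ} {D : L.UE V} (hD : D ∈ UEA.fil (Sec O V) (L.obj V) k) :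
    L.ures h D ∈ UEA.fil (Sec O W) (L.obj W) k := by
  refine Submodule.span_induction (p := fun D _ => L.ures h D ∈ UEA.fil (Sec O W) (L.obj W) k)
    ?_ ?_ ?_ ?_ hD
  · rintro _ ⟨l, hl, rfl⟩
    rw [map_list_prod, List.map_map]
    refine Submodule.subset_span ⟨l.map (L.res h), by rwa [List.length_map], ?_⟩
    rw [List.map_map]
    exact congrArg List.prod (List.map_congr_left fun x _ => UEA.map_ιL (L.res h) x)
  · rw [map_zero]; exact Submodule.zero_mem _
  · intro x y _ _ hx hy
    rw [map_add]; exact Submodule.add_mem _ hx hy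
  · intro c x _ hx
    have := (UEA.mapₛ (L.res h)).map_smulₛₗ c x
    exact this ▸ Submodule.smul_mem _ (rs O h c) hx

section JetOperators

variable [CharZero K] (nL : L.Connection L.toPMod) (f : L.toPMod.Frame r V)

/-- The action of the enveloping algebra on jets. -/
abbrev jetEnd (V : Opens X) : L.UE V →+* AddMonoid.End (L.Jet V) :=
  Module.toAddMonoidEnd (L.UE V) (L.Jet V)

/-- The multiplication operators on jets. -/
abbrev jetMuls (L : LieAlgebroid O) (V : Opens X) : Set (AddMonoid.End (L.Jet V)) :=
  Set.range fun φ => jetMul L V φ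

-- `∇⁽²⁾ₓ` is a derivation, so its commutator with multiplication by `φ` is, up to sign,
-- multiplication by `∇⁽²⁾ₓ φ`; and multiplications commute with each other.
include nL f in
lemma orderLT_jetEnd_ιL (x : L.obj V) :
    OrderLT (jetMuls L V) 2 (jetEnd V (UEA.ιL (Sec O V) x)) := by
  rintro _ ⟨φ, rfl⟩
  let μ : AddMonoid.End (L.Jet V) := jetMul L V φ
  have h : μ * jetEnd V (UEA.ιL (Sec O V) x) - jetEnd V (UEA.ιL (Sec O V) x) * μ =
      jetMul L V (-jetNab V x φ) := by
    refine AddMonoidHom.ext fun ψ => ?_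
    change Jet.mul φ (jetNab V x ψ) - jetNab V x (Jet.mul φ ψ) = _
    rw [jetNab_mul, map_neg (jetMul L V)]
    change _ = -Jet.mul (jetNab V x φ) ψ
    abel
  refine (congrArg (OrderLT (jetMuls L V) 1) h).mpr (OrderLT.of_comm ?_)
  rintro _ ⟨χ, rfl⟩
  refine AddMonoidHom.ext fun ψ => ?_
  change Jet.mul χ (Jet.mul _ ψ) = Jet.mul _ (Jet.mul χ ψ)
  rw [← jet_mul_assoc nL f, ← jet_mul_assoc nL f, jet_mul_comm nL f χ]

-- Each factor from `L` contributes one order. A function acts through the second structure, which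
-- commutes with multiplication by jets.
include nL f in
lemma orderLT_jetEnd {k : ℕ} {D : L.UE V} (hD : D ∈ UEA.fil (Sec O V) (L.obj V) k) :
    OrderLT (jetMuls L V) (k + 1) (jetEnd V D) := by
  refine Submodule.span_induction
    (p := fun D _ => OrderLT (jetMuls L V) (k + 1) (jetEnd V D)) ?_ ?_ ?_ ?_ hD
  · rintro _ ⟨l, hl, rfl⟩
    rw [map_list_prod, List.map_map]
    refine OrderLT.mono (by omega) ((OrderLT.list_prod fun d hd => ?_).mono
      (le_of_eq (by rw [List.length_map])) : OrderLT (jetMuls L V) (l.length + 1) _)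
    obtain ⟨x, _, rfl⟩ := List.mem_map.mp hd
    exact orderLT_jetEnd_ιL nL f x
  · rw [map_zero]; exact OrderLT.zero _
  · intro x y _ _ hx hy
    rw [map_add]; exact hx.add hy
  · intro c x _ hx
    rw [UEA.smul_def, map_mul]
    refine OrderLT.mono (m := 0 + k + 1) (by omega) (OrderLT.mul_succ (OrderLT.of_comm ?_) hx)
    rintro _ ⟨χ, rfl⟩
    exact AddMonoidHom.ext fun ψ => Jet.mul_smul' c χ ψ

/-- The multiplication operators on twisted jets. -/
abbrev twMuls (L : LieAlgebroid O) (E : PMod O) (V : Opens X) :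
    Set (AddMonoid.End ((L.preTwJet E).obj V)) :=
  Set.range fun φ => (L.jetPairing E).app V φ

include nL f in
lemma orderLT_jueOp_jueTmul (φ : L.Jet V) (e : E.obj V) {k : ℕ} {D : L.UE V}
    (hD : D ∈ UEA.fil (Sec O V) (L.obj V) k) (g : E.dual.obj V) :
    OrderLT (twMuls L E V) (k + 1) (jueOp L E V (jueTmul φ e D g)) := by
  -- Commutators with multiplications pass through the contraction by `g` and through `ψ ↦ φ ψ ⊗ e`,
  -- so the order is that of `D`.
  let G : AddMonoid.End (L.Jet V) →+ AddMonoid.End ((L.preTwJet E).obj V) :=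
    AddMonoidHom.mk' (fun d => (((TensorProduct.mk (Sec O V) (L.Jet V) (E.obj V)).flip
      e).toAddMonoidHom.comp (jetMul L V φ)).comp (AddMonoidHom.comp d (twContract g).toAddMonoidHom))
      fun d d' => AddMonoidHom.ext fun t => map_add (((TensorProduct.mk (Sec O V) (L.Jet V)
        (E.obj V)).flip e).toAddMonoidHom.comp (jetMul L V φ)) (d (twContract g t))
          (d' (twContract g t))
  refine OrderLT.map (T := twMuls L E V) G ?_ (orderLT_jetEnd nL f hD)
  rintro _ ⟨ψ, rfl⟩
  refine ⟨_, ⟨ψ, rfl⟩, fun d => AddMonoidHom.ext fun t => ?_⟩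
  change Jet.mul φ (Jet.mul ψ (d (twContract g t)) - d (Jet.mul ψ (twContract g t))) ⊗ₜ[Sec O V] e =
    Jet.mul ψ (Jet.mul φ (d (twContract g t))) ⊗ₜ[Sec O V] e -
      Jet.mul φ (d (twContract g (twMul ψ t))) ⊗ₜ[Sec O V] e
  rw [twContract_twMul, ← sub_tmul]
  refine congrArg (· ⊗ₜ[Sec O V] e) ((map_sub (jetMul L V φ) _ _).trans ?_)
  refine congrArg₂ (· - ·) ?_ rfl
  change Jet.mul φ (Jet.mul ψ _) = _
  rw [← jet_mul_assoc nL f, ← jet_mul_assoc nL f, jet_mul_comm nL f φ]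

-- The definition of `Diff` asks for one bound valid over all smaller open sets. The filtration
-- degree of `D` provides it, since restriction does not raise it.
include nL in
lemma exists_orderLT_jueOp (f : L.toPMod.Frame r V) (m : (L.preJetUE E).obj V) :
    ∃ k, ∀ (W : Opens X) (h : W ≤ V),
      OrderLT (twMuls L E W) k (jueOp L E W ((L.preJetUE E).res h m)) := by
  let H : AddSubgroup ((L.preJetUE E).obj V) :=
    { carrier := {m | ∃ k, ∀ (W : Opens X) (h : W ≤ V),
        OrderLT (twMuls L E W) k (jueOp L E W ((L.preJetUE E).res h m))}
      add_mem' := fun {m m'} ⟨k, hk⟩ ⟨k', hk'⟩ => ⟨k + k', fun W h => by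
        rw [map_add, map_add]
        exact ((hk W h).mono (by omega)).add ((hk' W h).mono (by omega))⟩
      zero_mem' := ⟨0, fun W h => by rw [map_zero, map_zero]; rfl⟩
      neg_mem' := fun {m} ⟨k, hk⟩ => ⟨k, fun W h => by
        rw [map_neg, map_neg]
        exact (hk W h).neg⟩ }
  -- Extensionality is available for additive maps, so the claim that `H` contains everything is
  -- proved as the vanishing of the quotient map on generators.
  have key : ∀ m, QuotientAddGroup.mk' H m = 0 := fun m => by
    refine jueMul_ext (a := QuotientAddGroup.mk' H) (b := 0) (fun φ e D g => ?_) m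
    refine (QuotientAddGroup.eq_zero_iff _).mpr ?_
    obtain ⟨k, hk⟩ := UEA.exists_mem_fil D
    exact ⟨k + 1, fun W h => orderLT_jueOp_jueTmul nL (f.restrict h) (Jet.restrict h φ)
      (E.res h e) (ures_mem_fil h hk) (E.dual.res h g)⟩
  exact (QuotientAddGroup.eq_zero_iff _).mp (key m)

end JetOperators

end LieAlgebroid
end LieAlg

namespace LieAlg

variable {K : Type u} [Field K] {X : TopCat.{u}} {O : TopCat.Sheaf (CommAlgCat.{u} K) X}

namespace LieAlgebroid

variable {L : LieAlgebroid O} {E : PMod O} {U V W : Opens X} {r q : ℕ}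

/-! ### Operators on jets transported to power series. -/

section LocalOperators

variable [CharZero K] (nL : L.Connection L.toPMod) (f : L.toPMod.Frame r V)

/-- The formal expansion of jets as an isomorphism. -/
def jetSerEquiv : L.Jet V ≃+ MvPowerSeries (Fin r) (Sec O V) :=
  AddEquiv.ofBijective (jetSer nL f) (jetSer_bijective nL f)

lemma jetSer_symm (g : MvPowerSeries (Fin r) (Sec O V)) :
    jetSer nL f ((jetSerEquiv nL f).symm g) = g := (jetSerEquiv nL f).apply_symm_apply g

lemma symm_jetSer (φ : L.Jet V) : (jetSerEquiv nL f).symm (jetSer nL f φ) = φ :=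
  (jetSerEquiv nL f).symm_apply_apply φ

lemma smul₁_symm (c : Sec O V) (g : MvPowerSeries (Fin r) (Sec O V)) :
    (jetSerEquiv nL f).symm (c • g) = Jet.smul₁ c ((jetSerEquiv nL f).symm g) :=
  (jetSer_bijective nL f).1 (by rw [jetSer_smul₁, jetSer_symm, jetSer_symm])

lemma mul_symm (g g' : MvPowerSeries (Fin r) (Sec O V)) :
    (jetSerEquiv nL f).symm (g * g') =
      Jet.mul ((jetSerEquiv nL f).symm g) ((jetSerEquiv nL f).symm g') :=
  (jetSer_bijective nL f).1 (by rw [jetSer_mul, jetSer_symm, jetSer_symm, jetSer_symm])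

/-- The operator on power series which corresponds to an operator on jets. -/
def serEnd (d : AddMonoid.End (L.Jet V)) (hd : ∀ c φ, d (Jet.smul₁ c φ) = Jet.smul₁ c (d φ)) :
    Module.End (Sec O V) (MvPowerSeries (Fin r) (Sec O V)) where
  toFun g := jetSer nL f (d ((jetSerEquiv nL f).symm g))
  map_add' g g' := by rw [map_add, map_add, map_add]
  map_smul' c g := by rw [smul₁_symm, hd, jetSer_smul₁]; rfl

lemma serEnd_apply (d : AddMonoid.End (L.Jet V)) (hd) (g : MvPowerSeries (Fin r) (Sec O V)) :
    serEnd nL f d hd g = jetSer nL f (d ((jetSerEquiv nL f).symm g)) := rfl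

lemma serEnd_jetSer (d : AddMonoid.End (L.Jet V)) (hd) (φ : L.Jet V) :
    serEnd nL f d hd (jetSer nL f φ) = jetSer nL f (d φ) := by
  rw [serEnd_apply, symm_jetSer]

lemma orderLT_serEnd {d : AddMonoid.End (L.Jet V)} (hd) {k : ℕ} (h : OrderLT (jetMuls L V) k d) :
    OrderLT (psMul (Sec O V) r) k (serEnd nL f d hd) := by
  let G : Module.End (Sec O V) (MvPowerSeries (Fin r) (Sec O V)) →+ AddMonoid.End (L.Jet V) :=
    AddMonoidHom.mk' (fun D => ((jetSerEquiv nL f).symm.toAddMonoidHom.comp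
      D.toAddMonoidHom).comp (jetSer nL f)) fun D D' => AddMonoidHom.ext fun φ =>
        map_add (jetSerEquiv nL f).symm (D (jetSer nL f φ)) (D' (jetSer nL f φ))
  have hG : ∀ D φ, G D φ = (jetSerEquiv nL f).symm (D (jetSer nL f φ)) := fun _ _ => rfl
  refine OrderLT.of_map (T := jetMuls L V) G ?_ ?_ ?_
  · intro D D' e
    refine LinearMap.ext fun g => (jetSerEquiv nL f).symm.injective ?_
    rw [← jetSer_symm nL f g, ← hG, ← hG, e]
  · rintro _ ⟨g, rfl⟩
    refine ⟨_, ⟨(jetSerEquiv nL f).symm g, rfl⟩, fun D => AddMonoidHom.ext fun φ => ?_⟩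
    change (jetSerEquiv nL f).symm (g * D (jetSer nL f φ) - D (g * jetSer nL f φ)) =
      Jet.mul _ ((jetSerEquiv nL f).symm (D (jetSer nL f φ))) -
        (jetSerEquiv nL f).symm (D (jetSer nL f (Jet.mul ((jetSerEquiv nL f).symm g) φ)))
    rw [map_sub, mul_symm, jetSer_mul, jetSer_symm]
  · have : G (serEnd nL f d hd) = d := AddMonoidHom.ext fun φ =>
      (hG _ φ).trans (by rw [serEnd_jetSer, symm_jetSer]; rfl)
    rwa [this]

lemma smul_smul₁ (D : L.UE V) (c : Sec O V) (φ : L.Jet V) :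
    D • Jet.smul₁ c φ = Jet.smul₁ c (D • φ) := rfl

/-- The action of the monomials in a frame on power series. -/
def monoOp (α : Fin r →₀ ℕ) : Module.End (Sec O V) (MvPowerSeries (Fin r) (Sec O V)) :=
  serEnd nL f (jetEnd V (fmono f α)) fun c φ => smul_smul₁ _ c φ

lemma monoOp_jetSer (α : Fin r →₀ ℕ) (φ : L.Jet V) :
    monoOp nL f α (jetSer nL f φ) = jetSer nL f (fmono f α • φ) := serEnd_jetSer nL f _ _ φ

lemma orderLT_monoOp (α : Fin r →₀ ℕ) :
    OrderLT (psMul (Sec O V) r) (α.degree + 1) (monoOp nL f α) :=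
  orderLT_serEnd nL f _ (orderLT_jetEnd nL f (UEA.mono_mem_fil _ α))

lemma isUnit_mfac (R : Type*) [CommRing R] [Algebra K R] (α : Fin r →₀ ℕ) :
    IsUnit (mfac α : R) := IsUnit.of_mul_eq_one _ (mul_natInv K (mfac_ne_zero α))

lemma constantCoeff_jetSer (φ : L.Jet V) :
    MvPowerSeries.constantCoeff (jetSer nL f φ) = jetEv V φ := by
  have h := derivAt_pser K (lnab nL V) (jetNab V) (lvec f) (jetEv V) φ 0
  rw [derivAt_apply, mfac_zero, Nat.cast_one, one_mul] at h
  refine Eq.trans h ?_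
  rw [(isFiltered_jet f).formMap_eq K _ (jetVal_zero f) 0 (fun β hβ => by simp at hβ), jetVal_zero]

/-- If the series vanishes below degree `|α|`, so do the values of the jet on monomials
(`triangular_zero`). Then the value on the monomial `α`, which is the constant term on the left,
equals `formMap` at `α`, that is, `α!` times the coefficient. -/
lemma constantCoeff_monoOp (α : Fin r →₀ ℕ) (g : MvPowerSeries (Fin r) (Sec O V))
    (hg : ∀ β : Fin r →₀ ℕ, β.degree < α.degree → MvPowerSeries.coeff β g = 0) :
    MvPowerSeries.constantCoeff (monoOp nL f α g) = mfac α * MvPowerSeries.coeff α g := by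
  obtain ⟨φ, rfl⟩ := (jetSer_bijective nL f).2 g
  have hF : ∀ β, formMap K (lnab nL V) (jetNab V) (lvec f) (jetEv V) φ β =
      mfac β * MvPowerSeries.coeff β (jetSer nL f φ) := fun β => (derivAt_pser K _ _ _ _ φ β).symm
  have h0 : ∀ β : Fin r →₀ ℕ, β.degree < α.degree → jetVal f φ β = 0 :=
    triangular_zero (fun β : Fin r →₀ ℕ => β.degree)
      (T := formMap K (lnab nL V) (jetNab V) (lvec f) (jetEv V))
      (fun n t ht β hβ => (isFiltered_jet f).formMap_eq K _ (jetVal_zero f) β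
        fun γ hγ => ht γ (by omega))
      fun β hβ => by rw [hF, hg β hβ, mul_zero]
  rw [monoOp_jetSer, constantCoeff_jetSer, ← hF,
    (isFiltered_jet f).formMap_eq K _ (jetVal_zero f) α h0, jetEv_apply, Jet.smul_app, one_mul,
    ures_refl, jetVal_apply]

lemma coeff_jetSer_restrict (h : W ≤ V) (φ : L.Jet V) (α : Fin r →₀ ℕ) :
    MvPowerSeries.coeff α (jetSer nL (f.restrict h) (Jet.restrict h φ)) =
      rs O h (MvPowerSeries.coeff α (jetSer nL f φ)) := by
  have h1 : ∀ (x : L.obj V) (ψ : L.Jet V), Jet.restrict h (jetNab V x ψ) =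
      jetNab W (L.res h x) (Jet.restrict h ψ) := fun x ψ =>
    (Jet.restrict_smul h _ ψ).trans
        (congrArg (· • Jet.restrict h ψ) (UEA.map_ιL (L.res h) x))
  have h2 : ∀ ψ : L.Jet V, jetEv W (Jet.restrict h ψ) = rs O h (jetEv V ψ) := fun ψ =>
    (congrArg (Jet.app ψ h) (map_one (L.ures h)).symm).trans (Jet.app_res ψ le_rfl h 1)
  have h3 : ∀ n : ℕ, rs O h (natInv K (Sec O V) n) = natInv K (Sec O W) n := fun n =>
    (rsA O h).commutes _
  rw [jetSer, jetSer, coeff_pser, coeff_pser, map_mul, h3, formMap_apply, formMap_apply,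
    smul_eq_mul, smul_eq_mul, map_mul, h3, ← h2]
  refine congrArg (fun a => _ * (_ * jetEv W a)) ?_
  exact (map_symD (lnab nL V) (jetNab V) (lnab nL W) (jetNab W)
      (L.JetMod.res h).toAddMonoidHom (L.res h) h1
      (fun x y => (nL.nabla_res h x y).symm) _ _ _ φ).symm

/-- The jets whose formal expansions are monomials. -/
def monoJet (β : Fin r →₀ ℕ) : L.Jet V :=
  (jetSerEquiv nL f).symm (MvPowerSeries.monomial β 1)

/-- Expansions commute with restriction. So over a smaller open set the test jets for operators are
restrictions of sections over `V`. -/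
lemma monoJet_restrict (h : W ≤ V) (β : Fin r →₀ ℕ) :
    monoJet nL (f.restrict h) β = Jet.restrict h (monoJet nL f β) := by
  classical
  refine (jetSer_bijective nL (f.restrict h)).1 (MvPowerSeries.ext fun α => ?_)
  rw [monoJet, coeff_jetSer_restrict, monoJet, jetSer_symm, jetSer_symm,
    MvPowerSeries.coeff_monomial, MvPowerSeries.coeff_monomial]
  split_ifs
  · rw [map_one]
  · rw [map_zero]

end LocalOperators

/-! ### Matrix entries of operators on twisted jets. -/

section Entries

variable (b : E.Frame q V)

lemma tcoord_twMul (a : Fin q) (φ : L.Jet V) (t : (L.preTwJet E).obj V) :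
    tcoord b.basis a (twMul φ t) = Jet.mul φ (tcoord b.basis a t) :=
  DFunLike.congr_fun (twHom_ext (F := (tcoord b.basis a).toAddMonoidHom.comp (twMul φ))
    (G := (jetMul L V φ).comp (tcoord b.basis a).toAddMonoidHom)
    fun ψ s => (Jet.mul_smul' (b.basis.repr s a) φ ψ).symm) t

lemma tcoord_twSmul₁ (a : Fin q) (c : Sec O V) (t : (L.preTwJet E).obj V) :
    tcoord b.basis a (twSmul₁ c t) = Jet.smul₁ c (tcoord b.basis a t) :=
  DFunLike.congr_fun (twHom_ext (F := (tcoord b.basis a).toAddMonoidHom.comp (twSmul₁ c))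
    (G := (Jet.smul₁ c).toAddMonoidHom.comp (tcoord b.basis a).toAddMonoidHom)
    fun ψ s => ((Jet.smul₁ c).map_smul (b.basis.repr s a) ψ).symm) t

lemma twContract_dualVec (c : Fin q) (t : (L.preTwJet E).obj V) :
    twContract (b.dualVec c) t = tcoord b.basis c t :=
  DFunLike.congr_fun (twHom_ext (F := (twContract (b.dualVec c)).toAddMonoidHom)
    (G := (tcoord b.basis c).toAddMonoidHom)
    fun ψ s => congrArg (· • ψ) (b.ev_dualVec c s)) t

lemma jueOp_jueTmul_dualVec (φ : L.Jet V) (a c : Fin q) (D : L.UE V) (t : (L.preTwJet E).obj V) :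
    jueOp L E V (jueTmul φ (b.vec a) D (b.dualVec c)) t =
      Jet.mul φ (D • tcoord b.basis c t) ⊗ₜ[Sec O V] b.vec a :=
  congrArg (fun ψ => Jet.mul φ (D • ψ) ⊗ₜ[Sec O V] b.vec a) (twContract_dualVec b c t)

lemma tcoord_tmul_vec (a c : Fin q) (φ : L.Jet V) :
    tcoord b.basis a (φ ⊗ₜ[Sec O V] b.vec c) = if c = a then φ else 0 := by
  rw [← b.basis_apply, tcoord_tmul, b.basis.repr_self, Finsupp.single_apply, ite_smul, one_smul,
    zero_smul]

lemma tcoord_jueOp (φ ψ : L.Jet V) (a a' c c' : Fin q) (D : L.UE V) :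
    tcoord b.basis a (jueOp L E V (jueTmul φ (b.vec a') D (b.dualVec c'))
      (ψ ⊗ₜ[Sec O V] b.vec c)) = if a' = a ∧ c' = c then Jet.mul φ (D • ψ) else 0 := by
  refine (congrArg (tcoord b.basis a) (jueOp_jueTmul_dualVec b φ a' c' D _)).trans ?_
  rw [tcoord_tmul_vec, tcoord_tmul_vec]
  split_ifs with h1 h2 h3 h3 h3 <;> first | rfl | (exfalso; tauto) | skip
  · rw [smul_zero]; exact map_zero (jetMul L V φ)

/-- The matrix entries of an operator on twisted jets. -/
def twEntry (a c : Fin q) : AddMonoid.End ((L.preTwJet E).obj V) →+ AddMonoid.End (L.Jet V) :=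
  AddMonoidHom.mk' (fun d => ((tcoord b.basis a).toAddMonoidHom.comp d).comp
    ((TensorProduct.mk (Sec O V) (L.Jet V) (E.obj V)).flip (b.vec c)).toAddMonoidHom)
    fun d _ => AddMonoidHom.ext fun φ => map_add (tcoord b.basis a) (d (φ ⊗ₜ b.vec c)) _

lemma twEntry_apply (a c : Fin q) (d : AddMonoid.End ((L.preTwJet E).obj V)) (φ : L.Jet V) :
    twEntry b a c d φ = tcoord b.basis a (d (φ ⊗ₜ[Sec O V] b.vec c)) := rfl

lemma eq_sum_twEntry (d : AddMonoid.End ((L.preTwJet E).obj V)) (t : (L.preTwJet E).obj V) :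
    d t = ∑ a, ∑ c, twEntry b a c d (tcoord b.basis c t) ⊗ₜ[Sec O V] b.vec a := by
  have h : d t = ∑ c, d (tcoord b.basis c t ⊗ₜ[Sec O V] b.vec c) := by
    conv_lhs => rw [← sum_tcoord b.basis t]
    refine (map_sum d _ _).trans (Finset.sum_congr rfl fun c _ => ?_)
    rw [b.basis_apply]
  rw [Finset.sum_comm, h]
  refine Finset.sum_congr rfl fun c _ => ?_
  refine (sum_tcoord (N := L.Jet V) b.basis _).symm.trans (Finset.sum_congr rfl fun a _ => ?_)
  rw [twEntry_apply, b.basis_apply]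

lemma twEntry_smul₁ {d : AddMonoid.End ((L.preTwJet E).obj V)}
    (hd : ∀ c t, d (twSmul₁ c t) = twSmul₁ c (d t)) (a c : Fin q) (x : Sec O V) (φ : L.Jet V) :
    twEntry b a c d (Jet.smul₁ x φ) = Jet.smul₁ x (twEntry b a c d φ) := by
  rw [twEntry_apply, twEntry_apply, ← tcoord_twSmul₁, ← hd, twSmul₁_tmul]

/-- Multiplication by a jet is a scalar matrix in the frame, so taking entries is compatible with
commutators. -/
lemma orderLT_twEntry {d : AddMonoid.End ((L.preTwJet E).obj V)} {k : ℕ}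
    (h : OrderLT (twMuls L E V) k d) (a c : Fin q) :
    OrderLT (jetMuls L V) k (twEntry b a c d) := by
  refine OrderLT.map (S := twMuls L E V) (twEntry b a c) ?_ h
  rintro _ ⟨φ, rfl⟩
  refine ⟨_, ⟨φ, rfl⟩, fun d => AddMonoidHom.ext fun ψ => ?_⟩
  refine (map_sub (tcoord b.basis a) _ _).trans (congrArg₂ (· - ·) ?_ rfl)
  exact tcoord_twMul b a φ _

variable [CharZero K] (nL : L.Connection L.toPMod) (f : L.toPMod.Frame r V)

/-- An operator on twisted jets of order `≤ k` vanishes if it kills the monomials of degree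
`≤ k`. -/
lemma eq_zero_of_orderLT_tw {d : AddMonoid.End ((L.preTwJet E).obj V)} {k : ℕ}
    (hd : ∀ c t, d (twSmul₁ c t) = twSmul₁ c (d t)) (h : OrderLT (twMuls L E V) k d)
    (h0 : ∀ β c, d (monoJet nL f β ⊗ₜ[Sec O V] b.vec c) = 0) : d = 0 := by
  have key : ∀ a c φ, twEntry b a c d φ = 0 := fun a c φ => by
    -- The bound is weakened by one because `eq_zero_of_orderLT` is stated for orders `< k + 1`.
    have h1 := eq_zero_of_orderLT (OrderLT.succ (orderLT_serEnd nL f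
      (fun x φ => twEntry_smul₁ b hd a c x φ) (orderLT_twEntry b h a c))) fun β _ => by
        rw [serEnd_apply, twEntry_apply]
        exact (congrArg (fun t => jetSer nL f (tcoord b.basis a t)) (h0 β c)).trans
          (by rw [map_zero, map_zero])
    refine (jetSer_bijective nL f).1 ?_
    rw [← serEnd_jetSer nL f _ (fun x φ => twEntry_smul₁ b hd a c x φ), h1, map_zero]; rfl
  refine AddMonoidHom.ext fun t => (eq_sum_twEntry b d t).trans ?_
  exact Finset.sum_eq_zero fun a _ => Finset.sum_eq_zero fun c _ => by rw [key, zero_tmul]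

include nL f b in
/-- Differential operators on twisted jets which are linear over functions come from
`J(L) ⊗ U(L; E)`. -/
lemma exists_jueOp_eq {d : AddMonoid.End ((L.preTwJet E).obj V)} {k : ℕ}
    (hd : ∀ c t, d (twSmul₁ c t) = twSmul₁ c (d t)) (h : OrderLT (twMuls L E V) k d) :
    ∃ m, jueOp L E V m = d := by
  -- Each entry is a power series combination of the operators of the ordered monomials; its
  -- coefficients are the expansions of the jets in the preimage.
  choose g hg using fun a c => exists_eq_sum_of_orderLT (isUnit_mfac (K := K) (Sec O V))
    (constantCoeff_monoOp nL f) (orderLT_monoOp nL f) (OrderLT.succ (orderLT_serEnd nL f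
      (fun x φ => twEntry_smul₁ b hd a c x φ) (orderLT_twEntry b h a c)))
  refine ⟨∑ a, ∑ c, ∑ α ∈ lowIdx r k, jueTmul ((jetSerEquiv nL f).symm (g a c α)) (b.vec a)
    (fmono f α) (b.dualVec c), AddMonoidHom.ext fun t => ?_⟩
  refine Eq.trans ?_ (eq_sum_twEntry b d t).symm
  simp only [map_sum, AddMonoidHom.finsetSum_apply]
  refine Finset.sum_congr rfl fun a _ => Finset.sum_congr rfl fun c _ => ?_
  refine (Finset.sum_congr rfl fun α _ => jueOp_jueTmul_dualVec b _ a c _ t).trans ?_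
  rw [← sum_tmul]
  refine congrArg (· ⊗ₜ[Sec O V] b.vec a) ((jetSer_bijective nL f).1 ?_)
  rw [← serEnd_jetSer nL f _ (fun x φ => twEntry_smul₁ b hd a c x φ), hg, map_sum,
    LinearMap.sum_apply]
  refine Finset.sum_congr rfl fun α _ => ?_
  rw [jetSer_mul, jetSer_symm, ← monoOp_jetSer]; rfl

end Entries

/-! ### Normal forms in `E ⊗ U(L) ⊗ E^∨` and in `J(L) ⊗ U(L; E)`. -/

section Representations

variable (f : L.toPMod.Frame r V) (b : E.Frame q V)

lemma ueTmul_smul_mid (c : Sec O V) (e : E.obj V) (D : L.UE V) (g : E.dual.obj V) :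
    ueTmul (c • e) D g = ueTmul e (c • D) g :=
  (smul_tmul c e (D ⊗ₜ[(Sec O V)ᵐᵒᵖ] g))

lemma ueTmul_smul_right (c : Sec O V) (e : E.obj V) (D : L.UE V) (g : E.dual.obj V) :
    ueTmul e D (c • g) = ueTmul e (D * UEA.ιR _ c) g :=
  congrArg (e ⊗ₜ[Sec O V] ·)
    (smul_tmul (R := (Sec O V)ᵐᵒᵖ) (MulOpposite.op c) D g).symm

/-- The elements of `E ⊗ U(L) ⊗ E^∨` with given matrix entries. -/
def ueMatrix : (Fin q → Fin q → L.UE V) →+ (L.preTwUE E).obj V :=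
  AddMonoidHom.mk' (fun D => ∑ a, ∑ c, ueTmul (b.vec a) (D a c) (b.dualVec c)) fun D D' => by
    simp only [← Finset.sum_add_distrib]
    refine Finset.sum_congr rfl fun a _ => Finset.sum_congr rfl fun c _ => ?_
    exact (congrArg (b.vec a ⊗ₜ[Sec O V] ·) (add_tmul (D a c) (D' a c) (b.dualVec c))).trans
      (tmul_add _ _ _)

lemma ueMatrix_apply (D : Fin q → Fin q → L.UE V) :
    ueMatrix b D = ∑ a, ∑ c, ueTmul (b.vec a) (D a c) (b.dualVec c) := rfl

lemma ueTmul_zero (e : E.obj V) (g : E.dual.obj V) : ueTmul (L := L) e 0 g = 0 :=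
  (congrArg (e ⊗ₜ[Sec O V] ·) (zero_tmul (L.UE V) g)).trans (tmul_zero _ _)

lemma ueTmul_zero_left (D : L.UE V) (g : E.dual.obj V) : ueTmul (0 : E.obj V) D g = 0 :=
  zero_tmul _ _

lemma ueTmul_add_left (e e' : E.obj V) (D : L.UE V) (g : E.dual.obj V) :
    ueTmul (e + e') D g = ueTmul e D g + ueTmul e' D g := add_tmul _ _ _

lemma ueTmul_sum_right {ι : Type*} (s : Finset ι) (e : E.obj V) (D : L.UE V) (g : ι → E.dual.obj V) :
    ueTmul e D (∑ i ∈ s, g i) = ∑ i ∈ s, ueTmul e D (g i) :=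
  (congrArg (e ⊗ₜ[Sec O V] ·) (tmul_sum D s g)).trans (tmul_sum e s _)

/-- Coefficients in the frame of `E` are absorbed into `U(L)` by the left structure, those in the
dual frame by the right structure. -/
lemma ueMatrix_surjective : Function.Surjective (ueMatrix (L := L) b) := by
  classical
  let H := (ueMatrix (L := L) b).range
  have h1 : ∀ a D c, ueTmul (b.vec a) D (b.dualVec c) ∈ H := fun a D c => by
    refine ⟨fun a' c' => if a' = a ∧ c' = c then D else 0, ?_⟩
    rw [ueMatrix_apply, Finset.sum_eq_single a, Finset.sum_eq_single c, if_pos ⟨rfl, rfl⟩]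
    · intro c' _ hc
      rw [if_neg fun h => hc h.2, ueTmul_zero]
    · simp
    · intro a' _ ha
      exact Finset.sum_eq_zero fun c' _ => by rw [if_neg fun h => ha h.1, ueTmul_zero]
    · simp
  have h2 : ∀ e D c, ueTmul e D (b.dualVec c) ∈ H := fun e D c => by
    refine Submodule.span_induction (p := fun e _ => ∀ D, ueTmul e D (b.dualVec c) ∈ H)
      ?_ ?_ ?_ ?_ (b.basis.mem_span e) D
    · rintro _ ⟨a, rfl⟩ D
      rw [b.basis_apply]; exact h1 a D c
    · intro D
      rw [ueTmul_zero_left]; exact H.zero_mem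
    · intro x y _ _ hx hy D
      rw [ueTmul_add_left]; exact H.add_mem (hx D) (hy D)
    · intro x e _ he D
      rw [ueTmul_smul_mid]; exact he _
  have h3 : ∀ e D g, ueTmul e D g ∈ H := fun e D g => by
    rw [← b.sum_ev_smul_dualVec g, ueTmul_sum_right]
    refine H.sum_mem fun c _ => ?_
    rw [ueTmul_smul_right]; exact h2 _ _ _
  intro m
  have key : QuotientAddGroup.mk' H m = 0 := jueMul₁_ext (a := QuotientAddGroup.mk' H) (b := 0)
    (fun e D g => (QuotientAddGroup.eq_zero_iff _).mpr (h3 e D g)) m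
  exact (QuotientAddGroup.eq_zero_iff _).mp key

lemma jueTmul_smul_mid (c : Sec O V) (φ : L.Jet V) (e : E.obj V) (D : L.UE V) (g : E.dual.obj V) :
    jueTmul φ e (c • D) g = jueTmul (c • φ) e D g :=
  (congrArg (φ ⊗ₜ[Sec O V] ·) (tmul_smul c e (D ⊗ₜ[(Sec O V)ᵐᵒᵖ] g))).trans
    (smul_tmul c φ (ueTmul e D g)).symm

/-- Every section of `J(L) ⊗ U(L; E)` is a combination of products of jets, frame vectors, monomials
and dual frame vectors. -/
lemma exists_eq_sum_jueTmul (m : (L.preJetUE E).obj V) :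
    ∃ (k : ℕ) (φ : Fin q → Fin q → (Fin r →₀ ℕ) → L.Jet V),
      m = ∑ a, ∑ c, ∑ α ∈ lowIdx r k, jueTmul (φ a c α) (b.vec a) (fmono f α) (b.dualVec c) := by
  classical
  let T (φ : L.Jet V) (a c : Fin q) (α : Fin r →₀ ℕ) : (L.preJetUE E).obj V :=
    jueTmul φ (b.vec a) (fmono f α) (b.dualVec c)
  have T_zero : ∀ a c α, T 0 a c α = 0 := fun a c α => zero_tmul _ _
  have T_add : ∀ φ φ' a c α, T (φ + φ') a c α = T φ a c α + T φ' a c α :=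
    fun φ φ' a c α => add_tmul _ _ _
  -- Sums with different degree bounds are brought to a common bound by padding with zeros.
  have mono : ∀ (k l : ℕ) (φ : Fin q → Fin q → (Fin r →₀ ℕ) → L.Jet V), k ≤ l →
      ∃ φ' : Fin q → Fin q → (Fin r →₀ ℕ) → L.Jet V, ∑ a, ∑ c, ∑ α ∈ lowIdx r k, T (φ a c α) a c α
        = ∑ a, ∑ c, ∑ α ∈ lowIdx r l, T (φ' a c α) a c α := fun k l φ hkl => by
    refine ⟨fun a c α => if α ∈ lowIdx r k then φ a c α else 0, ?_⟩
    refine Finset.sum_congr rfl fun a _ => Finset.sum_congr rfl fun c _ => ?_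
    have hsub : lowIdx r k ⊆ lowIdx r l := fun α hα =>
      mem_lowIdx.mpr ((mem_lowIdx.mp hα).trans hkl)
    rw [← Finset.sum_subset hsub fun α _ hα =>
      (congrArg (T · a c α) (if_neg hα)).trans (T_zero a c α)]
    exact Finset.sum_congr rfl fun α hα => (congrArg (T · a c α) (if_pos hα)).symm
  let H : AddSubgroup ((L.preJetUE E).obj V) :=
    { carrier := {m | ∃ (k : ℕ) (φ : Fin q → Fin q → (Fin r →₀ ℕ) → L.Jet V),
        m = ∑ a, ∑ c, ∑ α ∈ lowIdx r k, T (φ a c α) a c α}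
      zero_mem' := ⟨0, 0, (Finset.sum_eq_zero fun a _ => Finset.sum_eq_zero fun c _ =>
        Finset.sum_eq_zero fun α _ => T_zero a c α).symm⟩
      add_mem' := by
        rintro _ _ ⟨k, φ, rfl⟩ ⟨k', φ', rfl⟩
        obtain ⟨ψ, hψ⟩ := mono k (k + k') φ (by omega)
        obtain ⟨ψ', hψ'⟩ := mono k' (k + k') φ' (by omega)
        refine ⟨k + k', ψ + ψ', ?_⟩
        simp only [hψ, hψ', ← Finset.sum_add_distrib, Pi.add_apply, T_add]
      neg_mem' := by
        rintro _ ⟨k, φ, rfl⟩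
        refine ⟨k, -φ, ?_⟩
        simp only [← Finset.sum_neg_distrib, Pi.neg_apply]
        exact Finset.sum_congr rfl fun a _ => Finset.sum_congr rfl fun c _ =>
          Finset.sum_congr rfl fun α _ => (neg_tmul _ _).symm }
  have h1 : ∀ φ a c α, T φ a c α ∈ H := fun φ a c α => by
    refine ⟨α.degree, fun a' c' α' => if a' = a ∧ c' = c ∧ α' = α then φ else 0, ?_⟩
    rw [Finset.sum_eq_single a, Finset.sum_eq_single c, Finset.sum_eq_single α]
    · exact (congrArg (T · a c α) (if_pos ⟨rfl, rfl, rfl⟩)).symm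
    · intro α' _ h
      exact (congrArg (T · a c α') (if_neg fun h' => h h'.2.2)).trans (T_zero a c α')
    · intro h
      exact absurd (mem_lowIdx.mpr le_rfl) h
    · intro c' _ h
      exact Finset.sum_eq_zero fun α' _ =>
        (congrArg (T · a c' α') (if_neg fun h' => h h'.2.1)).trans (T_zero a c' α')
    · simp
    · intro a' _ h
      exact Finset.sum_eq_zero fun c' _ => Finset.sum_eq_zero fun α' _ =>
        (congrArg (T · a' c' α') (if_neg fun h' => h h'.1)).trans (T_zero a' c' α')
    · simp
  -- The monomials are a basis for the left structure, and left coefficients move across `E` into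
  -- the second structure of the jet factor.
  have h2 : ∀ φ a D c, jueTmul φ (b.vec a) D (b.dualVec c) ∈ H := fun φ a D c => by
    refine Submodule.span_induction
      (p := fun D _ => ∀ φ, jueTmul φ (b.vec a) D (b.dualVec c) ∈ H)
      ?_ ?_ ?_ ?_ ((ubasis f).mem_span D) φ
    · rintro _ ⟨α, rfl⟩ φ
      rw [ubasis_apply]; exact h1 φ a c α
    · intro φ
      rw [jueTmul, ueTmul_zero, tmul_zero]; exact H.zero_mem
    · intro x y _ _ hx hy φ
      have : jueTmul φ (b.vec a) (x + y) (b.dualVec c) =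
          jueTmul φ (b.vec a) x (b.dualVec c) + jueTmul φ (b.vec a) y (b.dualVec c) := by
        refine (congrArg (fun w => φ ⊗ₜ[Sec O V] (b.vec a ⊗ₜ[Sec O V] w))
          (add_tmul x y (b.dualVec c))).trans ?_
        exact (congrArg (φ ⊗ₜ[Sec O V] ·) (tmul_add _ _ _)).trans (tmul_add _ _ _)
      rw [this]
      exact H.add_mem (hx φ) (hy φ)
    · intro x D _ hD φ
      rw [jueTmul_smul_mid]; exact hD _
  have h3 : ∀ φ w, (φ ⊗ₜ[Sec O V] w : (L.preJetUE E).obj V) ∈ H := fun φ w => by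
    obtain ⟨D, rfl⟩ := ueMatrix_surjective b w
    rw [ueMatrix_apply, tmul_sum]
    refine H.sum_mem fun a _ => ?_
    rw [tmul_sum]
    exact H.sum_mem fun c _ => h2 φ a _ c
  induction m using TensorProduct.induction_on with
  | zero => exact H.zero_mem
  | tmul φ w => exact h3 φ w
  | add x y hx hy => exact H.add_mem hx hy

include f b in
/-- The action of `J(L) ⊗ U(L; E)` on twisted jets is faithful. -/
lemma eq_zero_of_jueOp_eq_zero [CharZero K] (nL : L.Connection L.toPMod) {m : (L.preJetUE E).obj V}
    (h : ∀ t, jueOp L E V m t = 0) : m = 0 := by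
  classical
  obtain ⟨k, φ, rfl⟩ := exists_eq_sum_jueTmul f b m
  have key : ∀ a c, ∀ α ∈ lowIdx r k, jetSer nL f (φ a c α) = 0 := fun a c => by
    refine eq_zero_of_sum_eq_zero (isUnit_mfac (K := K) (Sec O V))
      (constantCoeff_monoOp nL f) fun g => ?_
    obtain ⟨ψ, rfl⟩ := (jetSer_bijective nL f).2 g
    -- Testing on `ψ ⊗ b.vec c` and taking the coordinate `a` isolates one matrix entry, where the
    -- ordered monomials are independent.
    have h1 := congrArg (tcoord b.basis a) (h (ψ ⊗ₜ[Sec O V] b.vec c))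
    simp only [map_sum, AddMonoidHom.finsetSum_apply, map_zero] at h1
    have h2 : ∑ a', ∑ c', ∑ α ∈ lowIdx r k, (if a' = a ∧ c' = c then
        Jet.mul (φ a' c' α) (fmono f α • ψ) else 0) = 0 :=
      Eq.trans (Finset.sum_congr rfl fun a' _ => Finset.sum_congr rfl fun c' _ =>
        Finset.sum_congr rfl fun α _ => (tcoord_jueOp b _ ψ a a' c c' _).symm) h1
    rw [Finset.sum_eq_single a, Finset.sum_eq_single c] at h2
    · refine Eq.trans (Finset.sum_congr rfl fun α _ => ?_)
        ((map_sum (jetSer nL f) _ _).symm.trans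
          ((congrArg (jetSer nL f) h2).trans (map_zero _)))
      rw [monoOp_jetSer, ← jetSer_mul, if_pos ⟨rfl, rfl⟩]
    · intro c' _ hc
      exact Finset.sum_eq_zero fun α _ => if_neg fun h => hc h.2
    · simp
    · intro a' _ ha
      exact Finset.sum_eq_zero fun c' _ => Finset.sum_eq_zero fun α _ => if_neg fun h => ha h.1
    · simp
  refine Finset.sum_eq_zero fun a _ => Finset.sum_eq_zero fun c _ => Finset.sum_eq_zero
    fun α hα => ?_
  have h0 : φ a c α = 0 := (jetSer_bijective nL f).1 ((key a c α hα).trans (map_zero _).symm)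
  rw [h0]
  exact zero_tmul _ _

end Representations

end LieAlgebroid
end LieAlg

namespace LieAlg

variable {K : Type u} [Field K] {X : TopCat.{u}} {O : TopCat.Sheaf (CommAlgCat.{u} K) X}

namespace PMod.Frame

variable {E : PMod O} {V W W' : Opens X} {q : ℕ} (b : E.Frame q V)

lemma restrict_restrict (h : W ≤ V) (h' : W' ≤ W) :
    (b.restrict h).restrict h' = b.restrict (h'.trans h) := by
  simp only [restrict, E.res_res]

lemma dualVec_res (h : W ≤ V) (c : Fin q) : E.dual.res h (b.dualVec c) = (b.restrict h).dualVec c :=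
  PMod.Hom.ext fun W' h' m => by
    change (b.restrict (h'.trans h)).basis.repr m c = ((b.restrict h).restrict h').basis.repr m c
    rw [restrict_restrict]

end PMod.Frame

namespace LieAlgebroid

variable {L : LieAlgebroid O} {E : PMod O} {U V W : Opens X} {r q : ℕ}

/-! ### The pairing of `E ⊗ U(L) ⊗ E^∨` with twisted jets. -/

section Values

lemma twContract_twSmul₁ (g : E.dual.obj V) (c : Sec O V) (t : (L.preTwJet E).obj V) :
    twContract g (twSmul₁ c t) = Jet.smul₁ c (twContract g t) :=
  DFunLike.congr_fun (twHom_ext (F := (twContract g).toAddMonoidHom.comp (twSmul₁ c))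
    (G := (Jet.smul₁ c).toAddMonoidHom.comp (twContract g).toAddMonoidHom)
    fun ψ s => ((Jet.smul₁ c).map_smul (PMod.ev g s) ψ).symm) t

variable (L E) in
/-- The pairing of `E ⊗ U(L) ⊗ E^∨` with twisted jets:
`(e ⊗ D ⊗ f, φ ⊗ s) ↦ φ(D f(s)) e`. -/
def valPairing : PMod.Pairing (L.preTwUE E) (L.preTwJet E) E where
  app V := AddMonoidHom.mk' (fun m => (evOne (E := E)).toAddMonoidHom.comp (ueOp L E V m))
    fun m m' => AddMonoidHom.ext fun t => (congrArg (fun d : (L.preTwJet E).obj V →+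
      (L.preTwJet E).obj V => evOne (d t)) (map_add (ueOp L E V) m m')).trans (map_add _ _ _)
  app_res h m t := (congrArg evOne (ueOp_res h m t)).trans (evOne_res h _)

lemma valPairing_ueTmul (e : E.obj V) (D : L.UE V) (g : E.dual.obj V) (t : (L.preTwJet E).obj V) :
    (valPairing L E).app V (ueTmul e D g) t = Jet.app (twContract g t) le_rfl D • e := by
  change jetEv V (D • twContract g t) • e = _
  rw [jetEv_apply, Jet.smul_app, one_mul, ures_refl]

lemma valPairing_twSmul₁ (m : (L.preTwUE E).obj V) (c : Sec O V) (t : (L.preTwJet E).obj V) :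
    (valPairing L E).app V m (twSmul₁ c t) = c • (valPairing L E).app V m t := by
  refine jueMul₁_ext (a := ((valPairing L E).app V).flip (twSmul₁ c t))
    (b := (DistribSMul.toAddMonoidHom _ c).comp (((valPairing L E).app V).flip t))
    (fun e D g => ?_) m
  change (valPairing L E).app V (ueTmul e D g) (twSmul₁ c t) =
    c • (valPairing L E).app V (ueTmul e D g) t
  rw [valPairing_ueTmul, valPairing_ueTmul, twContract_twSmul₁, Jet.smul₁_app, rs_refl, mul_smul]

lemma InIdeal.mono {k l : ℕ} (hkl : k ≤ l) {φ : L.Jet V} (h : InIdeal l φ) : InIdeal k φ :=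
  fun W hW j hj => h W hW j (hj.trans_le hkl)

/-- If `D` has order at most `k`, the element `e ⊗ D ⊗ g` kills `I ^ (k + 1)`: right multiplication
by the function `g(s)` does not raise the order. -/
lemma exists_inIdeal_valPairing (m : (L.preTwUE E).obj V) :
    ∃ k, ∀ (W : Opens X) (h : W ≤ V) (φ : L.Jet W), InIdeal k φ → ∀ s : E.obj W,
      (valPairing L E).app W ((L.preTwUE E).res h m) (φ ⊗ₜ[Sec O W] s) = 0 := by
  let H : AddSubgroup ((L.preTwUE E).obj V) :=
    { carrier := {m | ∃ k, ∀ (W : Opens X) (h : W ≤ V) (φ : L.Jet W), InIdeal k φ →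
        ∀ s : E.obj W, (valPairing L E).app W ((L.preTwUE E).res h m) (φ ⊗ₜ[Sec O W] s) = 0}
      add_mem' := fun {m m'} ⟨k, hk⟩ ⟨k', hk'⟩ => ⟨k + k', fun W h φ hφ s => by
        rw [map_add, map_add, AddMonoidHom.add_apply, hk W h φ (hφ.mono (by omega)),
          hk' W h φ (hφ.mono (by omega)), add_zero]⟩
      zero_mem' := ⟨0, fun W h φ _ s => by rw [map_zero, map_zero]; rfl⟩
      neg_mem' := fun {m} ⟨k, hk⟩ => ⟨k, fun W h φ hφ s => by
        rw [map_neg, map_neg, AddMonoidHom.neg_apply, hk W h φ hφ, neg_zero]⟩ }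
  have key : QuotientAddGroup.mk' H m = 0 := by
    refine jueMul₁_ext (a := QuotientAddGroup.mk' H) (b := 0) (fun e D g => ?_) m
    refine (QuotientAddGroup.eq_zero_iff _).mpr ?_
    obtain ⟨k, hk⟩ := UEA.exists_mem_fil D
    refine ⟨k + 1, fun W h φ hφ s => ?_⟩
    refine (valPairing_ueTmul (E.res h e) (L.ures h D) (E.dual.res h g) _).trans ?_
    rw [twContract_tmul, ring_smul_app_refl]
    refine (congrArg (· • E.res h e) (hφ W le_rfl k (Nat.lt_succ_self k) _ ?_)).trans
      (zero_smul _ _)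
    exact UEA.mul_ιR_mem_fil (ures_mem_fil h hk) _
  exact (QuotientAddGroup.eq_zero_iff _).mp key

variable (f : L.toPMod.Frame r V) (b : E.Frame q V)

lemma ueMatrix_res (h : W ≤ V) (D : Fin q → Fin q → L.UE V) :
    (L.preTwUE E).res h (ueMatrix b D) = ueMatrix (b.restrict h) fun a c => L.ures h (D a c) := by
  rw [ueMatrix_apply, ueMatrix_apply, map_sum]
  refine Finset.sum_congr rfl fun a _ => ?_
  rw [map_sum]
  refine Finset.sum_congr rfl fun c _ => ?_
  exact congrArg (ueTmul (E.res h (b.vec a)) (L.ures h (D a c))) (b.dualVec_res h c)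

lemma valPairing_ueMatrix (D : Fin q → Fin q → L.UE V) (φ : L.Jet V) (c : Fin q) :
    (valPairing L E).app V (ueMatrix b D) (φ ⊗ₜ[Sec O V] b.vec c) =
      ∑ a, Jet.app φ le_rfl (D a c) • b.vec a := by
  rw [ueMatrix_apply, map_sum, AddMonoidHom.finsetSum_apply]
  refine Finset.sum_congr rfl fun a _ => ?_
  rw [map_sum, AddMonoidHom.finsetSum_apply, Finset.sum_eq_single c]
  · rw [valPairing_ueTmul, twContract_dualVec, tcoord_tmul_vec, if_pos rfl]
  · intro c' _ hc
    rw [valPairing_ueTmul, twContract_dualVec, tcoord_tmul_vec, if_neg hc.symm]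
    exact zero_smul _ _
  · simp

/-- The dual jets of the monomials in a frame. -/
def dualJet (α : Fin r →₀ ℕ) : L.Jet V := jetOf f fun β => if β = α then 1 else 0

lemma jetVal_dualJet (α β : Fin r →₀ ℕ) :
    jetVal f (dualJet f α) β = if β = α then 1 else 0 :=
  jetOf_app f _ β

include f b in
/-- The pairing of `E ⊗ U(L) ⊗ E^∨` with twisted jets is nondegenerate. -/
lemma eq_zero_of_valPairing_eq_zero {m : (L.preTwUE E).obj V}
    (h : ∀ t, (valPairing L E).app V m t = 0) : m = 0 := by
  obtain ⟨D, rfl⟩ := ueMatrix_surjective b m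
  -- The dual jet of the monomial `α`, placed in the column `c`, reads off the coefficients at `α`
  -- of the entries in that column.
  have hD : D = 0 := by
    funext a c
    refine (ubasis f).repr.injective (Finsupp.ext fun α => ?_)
    have h1 := h (dualJet f α ⊗ₜ[Sec O V] b.vec c)
    rw [valPairing_ueMatrix] at h1
    have h2 := congrArg (fun x => b.basis.repr x a) h1
    simp only [← b.basis_apply] at h2
    rw [b.basis.repr_sum_self, map_zero, Finsupp.zero_apply] at h2
    refine Eq.trans ?_ (DFunLike.congr_fun (map_zero (ubasis f).repr) α).symm
    rw [Finsupp.zero_apply, ← h2]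
    conv_rhs => rw [← (ubasis f).linearCombination_repr (D a c),
      Finsupp.linearCombination_apply, Finsupp.sum, map_sum]
    have h3 : ∀ β, Jet.app (dualJet f α) le_rfl
        ((ubasis f).repr (D a c) β • ubasis f β) = if β = α then (ubasis f).repr (D a c) α else 0 :=
      fun β => by
        rw [map_smul, ubasis_apply, ← jetVal_apply, jetVal_dualJet]
        split_ifs with hβ
        · rw [hβ, smul_eq_mul, mul_one]
        · exact smul_zero _
    rw [Finset.sum_congr rfl fun β _ => h3 β, Finset.sum_ite_eq']
    split_ifs with hα
    · rfl
    · exact Finsupp.notMem_support_iff.mp hα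
  rw [hD, map_zero]

lemma inIdeal_of_jetVal {k : ℕ} {φ : L.Jet V} (h : ∀ α, α.degree < k → jetVal f φ α = 0) :
    InIdeal k φ := fun W hW j hj D hD => by
  refine app_eq_zero_of_mem_fil (f.restrict hW) (φ := Jet.restrict hW φ) (n := k) (fun α hα => ?_)
    hj hD
  rw [jetVal_restrict, h α hα, map_zero]

/-- A Taylor truncation for the first structure: removing the values on monomials of degree at most
`k` leaves a jet which vanishes in all degrees below `k`. -/
lemma inIdeal_sub_sum_dualJet (h : W ≤ V) (k : ℕ) (φ : L.Jet W) :
    InIdeal k (φ - ∑ α ∈ lowIdx r k, Jet.smul₁ (jetVal (f.restrict h) φ α)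
      (Jet.restrict h (dualJet f α))) := by
  refine inIdeal_of_jetVal (f.restrict h) fun β hβ => ?_
  have h1 : ∀ (c : Sec O W) (ψ : L.Jet W), jetVal (f.restrict h) (Jet.smul₁ c ψ) β =
      c * jetVal (f.restrict h) ψ β := fun c ψ => by
    rw [jetVal_apply, Jet.smul₁_app, rs_refl]; rfl
  rw [map_sub, map_sum, Pi.sub_apply, Finset.sum_apply, Finset.sum_eq_single β, h1,
    jetVal_restrict, jetVal_dualJet, if_pos rfl, map_one, mul_one, sub_self]
  · intro α _ hα
    rw [h1, jetVal_restrict, jetVal_dualJet, if_neg hα.symm, map_zero, mul_zero]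
  · exact fun h => absurd (mem_lowIdx.mpr hβ.le) h

include f b in
/-- Continuous linear maps on twisted jets come from `E ⊗ U(L) ⊗ E^∨`. -/
lemma exists_valPairing_eq {k : ℕ} (p : ∀ W : Opens X, W ≤ V → (L.preTwJet E).obj W →+ E.obj W)
    (hres : ∀ (W : Opens X) (h : W ≤ V) t, p W h ((L.preTwJet E).res h t) = E.res h (p V le_rfl t))
    (hsm : ∀ (W : Opens X) (h : W ≤ V) c t, p W h (twSmul₁ c t) = c • p W h t)
    (h0 : ∀ (W : Opens X) (h : W ≤ V) (φ : L.Jet W), InIdeal k φ → ∀ s : E.obj W,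
      p W h (φ ⊗ₜ[Sec O W] s) = 0) :
    ∃ m, ∀ (W : Opens X) (h : W ≤ V) t,
      (valPairing L E).app W ((L.preTwUE E).res h m) t = p W h t := by
  -- By continuity only the values on the dual jets with `|α| ≤ k` matter; their coordinates are the
  -- coefficients of the matrix.
  let D : Fin q → Fin q → L.UE V := fun a c => ∑ α ∈ lowIdx r k,
    b.basis.repr (p V le_rfl (dualJet f α ⊗ₜ[Sec O V] b.vec c)) a • fmono f α
  refine ⟨ueMatrix b D, fun W h t => ?_⟩
  have key : ∀ (φ : L.Jet W) c, (valPairing L E).app W ((L.preTwUE E).res h (ueMatrix b D))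
      (φ ⊗ₜ[Sec O W] (b.restrict h).vec c) = p W h (φ ⊗ₜ[Sec O W] (b.restrict h).vec c) := by
    intro φ c
    have h1 := h0 W h _ (inIdeal_sub_sum_dualJet f h k φ) ((b.restrict h).vec c)
    rw [sub_tmul, map_sub, sub_eq_zero, sum_tmul, map_sum] at h1
    rw [h1, ueMatrix_res, valPairing_ueMatrix]
    have h2 : ∀ α ∈ lowIdx r k, p W h (Jet.smul₁ (jetVal (f.restrict h) φ α)
        (Jet.restrict h (dualJet f α)) ⊗ₜ[Sec O W] (b.restrict h).vec c) =
        ∑ a, (jetVal (f.restrict h) φ α * rs O h (b.basis.repr (p V le_rfl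
          (dualJet f α ⊗ₜ[Sec O V] b.vec c)) a)) • (b.restrict h).vec a := fun α _ => by
      refine (hsm W h _ ((L.preTwJet E).res h (dualJet f α ⊗ₜ[Sec O V] b.vec c))).trans ?_
      rw [hres]
      conv_lhs => rw [← b.basis.sum_repr (p V le_rfl (dualJet f α ⊗ₜ[Sec O V] b.vec c)), map_sum,
        Finset.smul_sum]
      refine Finset.sum_congr rfl fun a _ => ?_
      rw [LinearMap.map_smulₛₗ, b.basis_apply, mul_smul]; rfl
    rw [Finset.sum_congr rfl h2, Finset.sum_comm]
    refine Finset.sum_congr rfl fun a _ => ?_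
    rw [← Finset.sum_smul, map_sum, map_sum]
    refine congrArg (· • (b.restrict h).vec a) (Finset.sum_congr rfl fun α _ => ?_)
    have h3 : L.ures h (b.basis.repr (p V le_rfl (dualJet f α ⊗ₜ[Sec O V] b.vec c)) a • fmono f α) =
        rs O h (b.basis.repr (p V le_rfl (dualJet f α ⊗ₜ[Sec O V] b.vec c)) a) •
          fmono (f.restrict h) α := by
      rw [← ures_fmono]
      exact (UEA.mapₛ (L.res h)).map_smulₛₗ _ _
    rw [h3, map_smul, smul_eq_mul, mul_comm]; rfl
  rw [← sum_tcoord (b.restrict h).basis t, map_sum, map_sum]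
  refine Finset.sum_congr rfl fun c _ => ?_
  rw [PMod.Frame.basis_apply]
  exact key _ c

end Values

/-! ### Twisted jets over open sets with frames. -/

section LocalSheaves

lemma twVal_res (f : L.toPMod.Frame r V) (b : E.Frame q V) (h : W ≤ V) (t : (L.preTwJet E).obj V)
    (α : Fin r →₀ ℕ) : twVal (f.restrict h) (b.restrict h) ((L.preTwJet E).res h t) α =
      E.res h (twVal f b t α) := by
  refine (b.restrict h).basis.repr.injective (Finsupp.ext fun a => ?_)
  rw [twVal_repr, b.repr_res, twVal_repr, ← jetVal_restrict]
  refine congrArg (jetVal (f.restrict h) · α) ?_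
  refine DFunLike.congr_fun (twHom_ext
    (F := (tcoord (b.restrict h).basis a).toAddMonoidHom.comp ((L.preTwJet E).res h).toAddMonoidHom)
    (G := (L.JetMod.res h).toAddMonoidHom.comp (tcoord b.basis a).toAddMonoidHom)
    fun φ s => ?_) t
  refine Eq.trans ?_ ((L.JetMod.res h).map_smulₛₗ (b.basis.repr s a) φ).symm
  exact congrArg (fun c : Sec O W => c • Jet.restrict h φ) (b.repr_res h s a)

/-- In frames, twisted jets are a product of copies of the sheaf `E`, compatibly with restriction.
So the presheaf tensor product already glues there, even though the multi-indices form an infinite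
set in general. -/
lemma gluingBelow_preTwJet (hE : E.IsSheaf) (f : L.toPMod.Frame r V) (b : E.Frame q V) :
    (L.preTwJet E).GluingBelow V :=
  PMod.gluingBelow_of_equiv hE (fun _ h => twVal (f.restrict h) (b.restrict h))
    (fun _ h => twVal_bijective _ _) fun W W' h h' m i => by
      rw [← twVal_res, PMod.Frame.restrict_restrict, PMod.Frame.restrict_restrict]

/-- The existence of frames of `L` and `E` over `V`. -/
def HasFrames (L : LieAlgebroid O) (E : PMod O) (r q : ℕ) (V : Opens X) : Prop :=
  Nonempty (L.toPMod.Frame r V) ∧ Nonempty (E.Frame q V)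

lemma isLocalBasis_hasFrames (hL : L.toPMod.IsLocallyFree r) (hEq : E.IsLocallyFree q) :
    IsLocalBasis (HasFrames L E r q) where
  mono h hV := ⟨hV.1.map (·.restrict h), hV.2.map (·.restrict h)⟩
  cover x := by
    obtain ⟨V, hxV, e, he⟩ := hL x
    obtain ⟨W, hxW, e', he'⟩ := hEq x
    exact ⟨V ⊓ W, ⟨hxV, hxW⟩,
      ⟨PMod.Frame.restrict ⟨e, fun W h => (he W h).1, fun W h => (he W h).2⟩ inf_le_left⟩,
      ⟨PMod.Frame.restrict ⟨e', fun W h => (he' W h).1, fun W h => (he' W h).2⟩ inf_le_right⟩⟩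

/-- Endomorphisms of the sections of the sheaf thereby become endomorphisms of the tensor product
itself, where frames can be used. -/
lemma HasFrames.toSh_bijective (hE : E.IsSheaf) (hV : HasFrames L E r q V) :
    Function.Bijective ((L.preTwJet E).toSh V) :=
  hV.1.elim fun f => hV.2.elim fun b => (gluingBelow_preTwJet hE f b).toSh_bijective

end LocalSheaves

end LieAlgebroid
end LieAlg

namespace LieAlg

variable {K : Type u} [Field K] {X : TopCat.{u}} {O : TopCat.Sheaf (CommAlgCat.{u} K) X}

namespace PMod

variable {E : PMod O} {V W : Opens X}

/-- The sections of a sheaf agree with those of its associated sheaf. -/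
def secEquiv (hE : E.IsSheaf) (V : Opens X) : E.obj V ≃ₗ[Sec O V] E.sh.obj V :=
  LinearEquiv.ofBijective (E.toSh V) (hE.gluingBelow V).toSh_bijective

lemma secEquiv_symm_toSh (hE : E.IsSheaf) (m : E.obj V) : (secEquiv hE V).symm (E.toSh V m) = m :=
  (secEquiv hE V).symm_apply_apply m

lemma secEquiv_symm_res (hE : E.IsSheaf) (h : W ≤ V) (s : E.sh.obj V) :
    (secEquiv hE W).symm (E.sh.res h s) = E.res h ((secEquiv hE V).symm s) := by
  obtain ⟨m, rfl⟩ := (secEquiv hE V).surjective s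
  rw [LinearEquiv.symm_apply_apply]
  refine (secEquiv hE W).injective ?_
  rw [LinearEquiv.apply_symm_apply]
  exact res_toSh h m

end PMod

namespace LieAlgebroid

variable {L : LieAlgebroid O} {E : PMod O} {U V W : Opens X} {r q : ℕ}

lemma smulAct₁_toSh (c : Sec O V) (t : (L.preTwJet E).obj V) :
    L.smulAct₁ c ((L.preTwJet E).toSh V t) = (L.preTwJet E).toSh V (twSmul₁ c t) :=
  (L.smulPairing₁ E).sh_toSh _ _

lemma smulAct₁_res (h : W ≤ V) (c : Sec O V) (t : (L.TwJet E).obj V) :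
    L.smulAct₁ (rs O h c) ((L.TwJet E).res h t) = (L.TwJet E).res h (L.smulAct₁ c t) := by
  refine Eq.trans ?_ ((L.smulPairing₁ E).sh.app_res h _ t)
  exact congrArg (fun a => (L.smulPairing₁ E).sh.app W a ((L.TwJet E).res h t))
    (PMod.res_toSh (F := PMod.unit O) h c).symm

/-! ### The isomorphism with continuous morphisms. -/

section EnvelopingIso

/-- Serves to represent sections of associated sheaves locally when no frames are needed. -/
lemma isLocalBasis_true : IsLocalBasis fun _ : Opens X => True :=
  ⟨fun _ h => h, fun _ => ⟨⊤, trivial, trivial⟩⟩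

lemma valPairing_sh_smulAct₁ (s : (L.preTwUE E).sh.obj V) (c : Sec O V) (t : (L.TwJet E).obj V) :
    (valPairing L E).sh.app V s (L.smulAct₁ c t) = c • (valPairing L E).sh.app V s t := by
  refine PMod.sh_ext fun x hx => ?_
  obtain ⟨W, hxW, hW, m, n, -, hm, hn⟩ := isLocalBasis_true.exists_toSh₂ s t x hx
  refine ⟨W, hxW, hW, ?_⟩
  have h1 : (L.TwJet E).res hW (L.smulAct₁ c t) =
      (L.preTwJet E).toSh W (twSmul₁ (rs O hW c) n) := by
    rw [← smulAct₁_res, ← smulAct₁_toSh]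
    exact congrArg (L.smulAct₁ (rs O hW c)) hn
  refine ((valPairing L E).sh.app_res hW s (L.smulAct₁ c t)).symm.trans ?_
  refine Eq.trans ?_ ((E.sh.res hW).map_smulₛₗ c _).symm
  refine Eq.trans ?_ (congrArg (rs O hW c • ·) ((valPairing L E).sh.app_res hW s t))
  refine (congrArg₂ (fun s t => (valPairing L E).sh.app W s t) hm h1).trans ?_
  refine Eq.trans ?_ (congrArg (rs O hW c • ·)
    (congrArg₂ (fun s t => (valPairing L E).sh.app W s t) hm hn).symm)
  refine ((valPairing L E).sh_toSh m _).trans ?_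
  refine Eq.trans ?_ (congrArg (rs O hW c • ·) ((valPairing L E).sh_toSh m n).symm)
  rw [valPairing_twSmul₁, map_smul]

/-- The components of the morphism given by a section of `E ⊗ U(L) ⊗ E^∨`. -/
def contApp (hE : E.IsSheaf) (V : Opens X) (s : (L.preTwUE E).sh.obj V) :
    (L.TwJet E).obj V →+ E.obj V :=
  (PMod.secEquiv hE V).symm.toLinearMap.toAddMonoidHom.comp ((valPairing L E).sh.app V s)

lemma contApp_apply (hE : E.IsSheaf) (s : (L.preTwUE E).sh.obj V) (t : (L.TwJet E).obj V) :
    contApp hE V s t = (PMod.secEquiv hE V).symm ((valPairing L E).sh.app V s t) := rfl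

lemma contApp_res (hE : E.IsSheaf) (h : W ≤ V) (s : (L.preTwUE E).sh.obj V)
    (t : (L.TwJet E).obj V) : contApp hE W ((L.preTwUE E).sh.res h s) ((L.TwJet E).res h t) =
      E.res h (contApp hE V s t) :=
  (congrArg (PMod.secEquiv hE W).symm ((valPairing L E).sh.app_res h s t)).trans
    (PMod.secEquiv_symm_res hE h _)

lemma contApp_smulAct₁ (hE : E.IsSheaf) (s : (L.preTwUE E).sh.obj V) (c : Sec O V)
    (t : (L.TwJet E).obj V) : contApp hE V s (L.smulAct₁ c t) = c • contApp hE V s t :=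
  (congrArg (PMod.secEquiv hE V).symm (valPairing_sh_smulAct₁ s c t)).trans
    ((PMod.secEquiv hE V).symm.map_smul c _)

lemma contApp_toSh (hE : E.IsSheaf) (m : (L.preTwUE E).obj V) (t : (L.preTwJet E).obj V) :
    contApp hE V ((L.preTwUE E).toSh V m) ((L.preTwJet E).toSh V t) =
      (valPairing L E).app V m t := by
  rw [contApp_apply, PMod.Pairing.sh_toSh, PMod.secEquiv_symm_toSh]

lemma exists_contApp_eq_zero (hE : E.IsSheaf) (s : (L.preTwUE E).sh.obj U) (x : X) (hx : x ∈ U) :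
    ∃ (V : Opens X) (_ : x ∈ V) (_ : V ≤ U) (k : ℕ), ∀ (W : Opens X) (h : W ≤ U) (_ : W ≤ V)
      (φ : L.Jet W), InIdeal k φ → ∀ e : E.obj W,
        contApp hE W ((L.preTwUE E).sh.res h s) (L.twJet φ e) = 0 := by
  obtain ⟨V, hxV, hV, m, -, hm⟩ := isLocalBasis_true.exists_toSh s x hx
  obtain ⟨k, hk⟩ := exists_inIdeal_valPairing m
  refine ⟨V, hxV, hV, k, fun W h hW φ hφ e => ?_⟩
  have h1 : (L.preTwUE E).sh.res h s = (L.preTwUE E).toSh W ((L.preTwUE E).res hW m) := by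
    rw [← PMod.res_toSh, ← hm]; rfl
  rw [h1]
  exact (contApp_toSh hE _ _).trans (hk W hW φ hφ e)

/-- The continuous morphism given by a section of `E ⊗ U(L) ⊗ E^∨`. -/
def contHom (hE : E.IsSheaf) (U : Opens X) (s : (L.preTwUE E).sh.obj U) : HomCont L E U :=
  ⟨fun W => contApp hE W.1 ((L.preTwUE E).sh.res W.2 s),
    fun V _ h t => contApp_res hE h ((L.preTwUE E).sh.res V.2 s) t,
    fun _ c t => contApp_smulAct₁ hE _ c t,
    fun x hx => by
      obtain ⟨V, hxV, hV, k, h⟩ := exists_contApp_eq_zero hE s x hx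
      exact ⟨V, hxV, hV, k, fun W hW φ hφ e => h W.1 W.2 hW φ hφ e⟩⟩

lemma contHom_app (hE : E.IsSheaf) (s : (L.preTwUE E).sh.obj U) (h : V ≤ U)
    (t : (L.TwJet E).obj V) : (contHom hE U s).app h t =
      (PMod.secEquiv hE V).symm ((valPairing L E).sh.app V ((L.preTwUE E).sh.res h s) t) := rfl

lemma contHom_toSh_app (hE : E.IsSheaf) (m : (L.preTwUE E).obj U) (h : V ≤ U)
    (t : (L.preTwJet E).obj V) :
    (contHom hE U ((L.preTwUE E).toSh U m)).app h ((L.preTwJet E).toSh V t) =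
      (valPairing L E).app V ((L.preTwUE E).res h m) t := by
  rw [contHom_app, PMod.res_toSh, PMod.Pairing.sh_toSh, PMod.secEquiv_symm_toSh]

lemma HomCont.ext {P Q : HomCont L E U}
    (h : ∀ (V : Opens X) (hV : V ≤ U) t, P.app hV t = Q.app hV t) : P = Q :=
  Subtype.ext (funext fun V => AddMonoidHom.ext fun t => h V.1 V.2 t)

lemma HomCont.app_res (P : HomCont L E U) (h : V ≤ U) (h' : W ≤ V) (t : (L.TwJet E).obj V) :
    P.app (h'.trans h) ((L.TwJet E).res h' t) = E.res h' (P.app h t) :=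
  P.2.1 ⟨V, h⟩ ⟨W, h'.trans h⟩ h' t

lemma HomCont.app_smulAct₁ (P : HomCont L E U) (h : V ≤ U) (c : Sec O V) (t : (L.TwJet E).obj V) :
    P.app h (L.smulAct₁ c t) = c • P.app h t := P.2.2.1 ⟨V, h⟩ c t

/-- The map from `E ⊗ U(L) ⊗ E^∨` to the continuous morphisms. -/
def contHomMap (hE : E.IsSheaf) (U : Opens X) : (L.preTwUE E).sh.obj U →+ HomCont L E U :=
  AddMonoidHom.mk' (contHom hE U) fun s t => HomCont.ext fun V h x => by
    change _ = (contHom hE U s).app h x + (contHom hE U t).app h x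
    rw [contHom_app, contHom_app, contHom_app, map_add, map_add, AddMonoidHom.add_apply, map_add]

/-- Continuous morphisms are separated because `E` is a sheaf. Over open sets with frames,
injectivity is nondegeneracy of the pairing and surjectivity is `exists_valPairing_eq`. -/
lemma contHomMap_bijective (hG : IsLocalBasis (HasFrames L E r q)) (hE : E.IsSheaf) (U : Opens X) :
    Function.Bijective (contHomMap (L := L) hE U) := by
  refine hG.bijective_of_local (T := HomCont L E) (fun h => HomCont.restrict h) (fun _ _ _ => rfl)
    (fun U P Q h => HomCont.ext fun V hV t => ?_) (contHomMap hE) (fun h s => rfl)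
    (fun V hV m hm => ?_) (fun U P x hx => ?_) U
  · refine (hE.gluingBelow V).ext fun x hx => ?_
    obtain ⟨W, hxW, hW, e⟩ := h x (hV hx)
    refine ⟨W ⊓ V, ⟨hxW, hx⟩, inf_le_right, ?_⟩
    rw [← HomCont.app_res, ← HomCont.app_res]
    exact congrArg (fun P : HomCont L E W => P.app (inf_le_left : W ⊓ V ≤ W) _) e
  · obtain ⟨⟨f⟩, ⟨b⟩⟩ := hV
    refine eq_zero_of_valPairing_eq_zero f b fun t => ?_
    have h1 := contHom_toSh_app hE m le_rfl t
    rw [PMod.res_refl] at h1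
    exact h1.symm.trans
      (congrArg (fun P : HomCont L E V => P.app le_rfl ((L.preTwJet E).toSh V t)) hm)
  · obtain ⟨V₀, hxV₀, hV₀, k, hk⟩ := P.2.2.2 x hx
    obtain ⟨V, hxV, hV, hGV⟩ := hG.exists_le x hxV₀
    obtain ⟨⟨f⟩, ⟨b⟩⟩ := id hGV
    obtain ⟨m, hm⟩ := exists_valPairing_eq f b (k := k)
      (fun W h => (P.app (h.trans (hV.trans hV₀))).comp ((L.preTwJet E).toSh W).toAddMonoidHom)
      (fun W h t => (congrArg (P.app (h.trans (hV.trans hV₀))) (PMod.res_toSh h t).symm).trans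
        (P.app_res (hV.trans hV₀) h _))
      (fun W h c t => (congrArg (P.app (h.trans (hV.trans hV₀))) (smulAct₁_toSh c t).symm).trans
        (P.app_smulAct₁ _ c _))
      fun W h φ hφ s => hk ⟨W, h.trans (hV.trans hV₀)⟩ (h.trans hV) φ hφ s
    refine ⟨V, hxV, hV.trans hV₀, m, hGV, HomCont.ext fun W h t => ?_⟩
    obtain ⟨t, rfl⟩ := ((hG.mono h hGV).toSh_bijective hE).2 t
    exact (contHom_toSh_app hE m h t).trans (hm W h t)

lemma contHom_ueTmul_app (hE : E.IsSheaf) (e : E.obj U) (D : L.UE U) (f : E.dual.obj U)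
    (h : V ≤ U) (φ : L.Jet V) (s : E.obj V) :
    (contHom hE U ((L.preTwUE E).toSh U (ueTmul e D f))).app h (L.twJet φ s) =
      Jet.app φ le_rfl (L.ures h D * UEA.ιR (L.obj V) (PMod.evOn f h s)) • E.res h e := by
  refine (contHom_toSh_app hE _ h _).trans ?_
  refine (valPairing_ueTmul (E.res h e) (L.ures h D) (E.dual.res h f) _).trans ?_
  rw [twContract_tmul, ring_smul_app_refl]
  rfl

end EnvelopingIso

/-! ### The isomorphism `j`. -/

section SymmetrizationIso

variable [CharZero K] (nL : L.Connection L.toPMod) (nE : L.Connection E)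
  (hG : IsLocalBasis (HasFrames L E r q))

/-- The correspondence between twisted jets for `L` and its abelianization, over open sets with
frames. -/
def symPre : hG.PreEquiv (L.preTwJet E) (L.abelian.preTwJet E) where
  app V hV := jpre nL nE hV.1.some hV.2.some
  app_res {V W} hV h m := (jpre_eq_iff (hG.mono h hV).1.some (hG.mono h hV).2.some).mpr
    (Corr.res hV.1.some h ((jpre_eq_iff hV.1.some hV.2.some).mp rfl))

lemma corr_symPre (hV : HasFrames L E r q V) (t : (L.preTwJet E).obj V) :
    Corr nL nE t ((symPre nL nE hG).app V hV t) :=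
  (jpre_eq_iff hV.1.some hV.2.some).mp rfl

lemma symPre_eq (hV : HasFrames L E r q V) {t : (L.preTwJet E).obj V}
    {s : (L.abelian.preTwJet E).obj V} (h : Corr nL nE t s) : (symPre nL nE hG).app V hV t = s :=
  (jpre_eq_iff hV.1.some hV.2.some).mpr h

lemma symPre_twSmul₁ (hV : HasFrames L E r q V) (c : Sec O V) (t : (L.preTwJet E).obj V) :
    (symPre nL nE hG).app V hV (twSmul₁ c t) = c • (symPre nL nE hG).app V hV t := by
  rw [← twSmul₁_abelian]
  exact symPre_eq nL nE hG hV ((corr_symPre nL nE hG hV t).twSmul₁ hV.1.some hV.2.some c)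

/-- Checked on local representatives: expansions are linear for the first structure, and for the
abelianization the two structures agree. -/
lemma sh_smulAct₁ (c : Sec O U) (t : (L.TwJet E).obj U) :
    (symPre nL nE hG).sh U (L.smulAct₁ c t) = c • (symPre nL nE hG).sh U t := by
  refine PMod.sh_ext fun x hx => ?_
  obtain ⟨V, hxV, hV, m, hGV, hm⟩ := hG.exists_toSh t x hx
  refine ⟨V, hxV, hV, ?_⟩
  rw [LinearMap.map_smulₛₗ, ← IsLocalBasis.PreEquiv.sh_res, ← IsLocalBasis.PreEquiv.sh_res,
    ← smulAct₁_res, hm, smulAct₁_toSh, IsLocalBasis.PreEquiv.sh_toSh _ hGV,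
    IsLocalBasis.PreEquiv.sh_toSh _ hGV, symPre_twSmul₁, map_smul]

lemma twSmul₁_algebraMap (c : K) (t : (L.preTwJet E).obj V) :
    twSmul₁ (algebraMap K (Sec O V) c) t = algebraMap K (Sec O V) c • t :=
  DFunLike.congr_fun (twHom_ext (F := twSmul₁ (algebraMap K (Sec O V) c))
    (G := DistribSMul.toAddMonoidHom _ (algebraMap K (Sec O V) c)) fun φ s =>
      (congrArg (· ⊗ₜ[Sec O V] s) (smul₁_algebraMap c φ)).trans (smul_tmul' _ _ _).symm) t

lemma smulAct₁_algebraMap (c : K) (t : (L.TwJet E).obj U) :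
    L.smulAct₁ (algebraMap K (Sec O U) c) t = algebraMap K (Sec O U) c • t := by
  refine PMod.sh_ext fun x hx => ?_
  obtain ⟨V, hV, hxV, m, hm⟩ := t.isLocal ⟨x, hx⟩
  have hm' : (L.preTwJet E).sh.res hV t = (L.preTwJet E).toSh V m :=
    PMod.ShObj.ext fun y => hm y.1 y.2
  refine ⟨V, hxV, hV, ?_⟩
  have hc : rs O hV (algebraMap K (Sec O U) c) = algebraMap K (Sec O V) c := (rsA O hV).commutes c
  rw [LinearMap.map_smulₛₗ, ← smulAct₁_res, hm', smulAct₁_toSh, hc, twSmul₁_algebraMap, map_smul]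

/-- The isomorphism `J(L; E) ≅ Ŝym(L^∨) ⊗ E` given by connections. -/
def symIso (U : Opens X) : (L.TwJet E).obj U ≃ₗ[K] (L.SymMod E).obj U :=
  { (symPre nL nE hG).sh U with
    map_smul' := fun c t => (congrArg ((symPre nL nE hG).sh U) (smulAct₁_algebraMap c t).symm).trans
      (sh_smulAct₁ nL nE hG _ t) }

lemma symIso_res (h : V ≤ U) (t : (L.TwJet E).obj U) :
    symIso nL nE hG V ((L.TwJet E).res h t) = (L.SymMod E).res h (symIso nL nE hG U t) := rfl

lemma symIso_smulAct₁ (c : Sec O U) (t : (L.TwJet E).obj U) :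
    symIso nL nE hG U (L.smulAct₁ c t) = c • symIso nL nE hG U t := sh_smulAct₁ nL nE hG c t

lemma symIso_toSh (hV : HasFrames L E r q V) (t : (L.preTwJet E).obj V) :
    symIso nL nE hG V ((L.preTwJet E).toSh V t) =
      (L.abelian.preTwJet E).toSh V ((symPre nL nE hG).app V hV t) :=
  IsLocalBasis.PreEquiv.sh_toSh _ hV t

lemma symProd_res (h : V ≤ U) {n : ℕ} (x : Fin n → L.obj U) :
    L.abelian.ures h (symProd x) = symProd (L.res h ∘ x) := by
  refine (map_list_prod (L.abelian.ures h) _).trans ?_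
  rw [List.map_ofFn]
  exact congrArg (fun l => List.prod (List.ofFn l))
    (funext fun i => UEA.map_ιL (L.abelian.res h) (x i))

/-- Both sides are compatible with restriction, and over an open set with frames the formula is
`Corr.symPairing_eq`. -/
lemma symEval_symIso (t : (L.preTwJet E).obj U) (n : ℕ) (x : Fin n → L.obj U) :
    symEval (symIso nL nE hG U ((L.preTwJet E).toSh U t)) x =
      (n.factorial : K)⁻¹ • E.toSh U (evOne (dpow nL nE n t x)) := by
  refine PMod.sh_ext fun y hy => ?_
  obtain ⟨V, hyV, hV, hGV⟩ := hG.exists_le y hy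
  refine ⟨V, hyV, hV, ?_⟩
  have hc : rs O hV (algebraMap K (Sec O U) (n.factorial : K)⁻¹) =
    algebraMap K (Sec O V) (n.factorial : K)⁻¹ := (rsA O hV).commutes _
  refine Eq.trans ?_ (Eq.symm ((E.sh.res hV).map_smulₛₗ (algebraMap K (Sec O U) (n.factorial : K)⁻¹)
    (E.toSh U (evOne (dpow nL nE n t x)))))
  rw [symEval, ← PMod.Pairing.app_res, ← symIso_res, PMod.res_toSh, PMod.res_toSh, PMod.res_toSh,
    symIso_toSh nL nE hG hGV, PMod.Pairing.sh_toSh, ← evOne_res, ← dpow_res, hc, ← map_smul,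
    ← (corr_symPre nL nE hG hGV _).symPairing_eq]
  exact congrArg (fun D => E.toSh V ((symPairing L E).app V D _)) (symProd_res hV x)

end SymmetrizationIso

end LieAlgebroid
end LieAlg

namespace LieAlg

variable {K : Type u} [Field K] {X : TopCat.{u}} {O : TopCat.Sheaf (CommAlgCat.{u} K) X}

namespace LieAlgebroid

variable {L : LieAlgebroid O} {E : PMod O} {U V W : Opens X} {r q : ℕ}

/-! ### The action on sections of the sheaf `J(L; E)`. -/

section OperatorPairing

variable (L E) in
/-- The action of `J(L) ⊗ U(L; E)` on twisted jets, as a pairing of presheaves. -/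
def opPairing : PMod.Pairing (L.preJetUE E) (L.preTwJet E) (L.preTwJet E) where
  app := jueOp L E
  app_res h m t := jueOp_res h m t

/-- The action of sections of `J(L) ⊗ U(L; E)` on sections of `J(L; E)`. -/
abbrev opAct (V : Opens X) : (L.JetUE E).obj V →+ (L.TwJet E).obj V →+ (L.TwJet E).obj V :=
  (opPairing L E).sh.app V

lemma opAct_res (h : W ≤ V) (s : (L.JetUE E).obj V) (t : (L.TwJet E).obj V) :
    opAct W ((L.JetUE E).res h s) ((L.TwJet E).res h t) = (L.TwJet E).res h (opAct V s t) :=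
  (opPairing L E).sh.app_res h s t

lemma opAct_toSh (m : (L.preJetUE E).obj V) (t : (L.preTwJet E).obj V) :
    opAct V ((L.preJetUE E).toSh V m) ((L.preTwJet E).toSh V t) =
      (L.preTwJet E).toSh V (jueOp L E V m t) :=
  (opPairing L E).sh_toSh m t

lemma opAct_smulAct₁ (s : (L.JetUE E).obj V) (c : Sec O V) (t : (L.TwJet E).obj V) :
    opAct V s (L.smulAct₁ c t) = L.smulAct₁ c (opAct V s t) := by
  refine PMod.sh_ext fun x hx => ?_
  obtain ⟨W, hxW, hW, m, n, -, hm, hn⟩ := isLocalBasis_true.exists_toSh₂ s t x hx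
  refine ⟨W, hxW, hW, ?_⟩
  refine (opAct_res hW s (L.smulAct₁ c t)).symm.trans ?_
  refine Eq.trans ?_ (smulAct₁_res hW c (opAct V s t))
  refine Eq.trans ?_ (congrArg (L.smulAct₁ (rs O hW c)) (opAct_res hW s t))
  refine (congrArg₂ (fun s t => opAct W s t) hm ((smulAct₁_res hW c t).symm.trans
    ((congrArg (L.smulAct₁ (rs O hW c)) hn).trans (smulAct₁_toSh _ n)))).trans ?_
  refine Eq.trans ?_ (congrArg (L.smulAct₁ (rs O hW c))
    ((congrArg₂ (fun s t => opAct W s t) hm hn).trans (opAct_toSh m n)).symm)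
  refine (opAct_toSh m _).trans ?_
  rw [jueOp_twSmul₁, smulAct₁_toSh]

lemma opAct_smul (c : Sec O V) (s : (L.JetUE E).obj V) (t : (L.TwJet E).obj V) :
    opAct V (c • s) t = c • opAct V s t := by
  refine PMod.sh_ext fun x hx => ?_
  obtain ⟨W, hxW, hW, m, n, -, hm, hn⟩ := isLocalBasis_true.exists_toSh₂ s t x hx
  refine ⟨W, hxW, hW, ?_⟩
  refine (opAct_res hW (c • s) t).symm.trans ?_
  refine Eq.trans ?_ (((L.TwJet E).res hW).map_smulₛₗ c (opAct V s t)).symm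
  refine Eq.trans ?_ (congrArg (rs O hW c • ·) (opAct_res hW s t))
  refine (congrArg₂ (fun s t => opAct W s t) ((((L.JetUE E).res hW).map_smulₛₗ c s).trans
    ((congrArg (rs O hW c • ·) hm).trans (((L.preJetUE E).toSh W).map_smul _ m).symm)) hn).trans ?_
  refine Eq.trans ?_ (congrArg (rs O hW c • ·)
    ((congrArg₂ (fun s t => opAct W s t) hm hn).trans (opAct_toSh m n)).symm)
  refine (opAct_toSh _ n).trans ?_
  rw [jueOp_smul_left, map_smul]

lemma opAct_mul [CharZero K] (nL : L.Connection L.toPMod) (hG : IsLocalBasis (HasFrames L E r q))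
    (s s' : (L.JetUE E).obj V) (t : (L.TwJet E).obj V) :
    opAct V (s * s') t = opAct V s (opAct V s' t) := by
  refine PMod.sh_ext fun x hx => ?_
  obtain ⟨W', hxW', hW', m', n', hG', hm', hn'⟩ := hG.exists_toSh₂ s' t x hx
  -- Three sections have to be represented over one open set, which takes a second shrinking.
  obtain ⟨W, hxW, hW₀, m, hGW, hm₀⟩ := hG.exists_toSh ((L.JetUE E).res hW' s) x hxW'
  have hW := hW₀.trans hW'
  have hm : (L.JetUE E).res hW s = (L.preJetUE E).toSh W m := hm₀
  have hs' : (L.JetUE E).res hW s' = (L.preJetUE E).toSh W ((L.preJetUE E).res hW₀ m') := by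
    rw [← PMod.res_toSh, ← hm']; rfl
  have ht : (L.TwJet E).res hW t = (L.preTwJet E).toSh W ((L.preTwJet E).res hW₀ n') := by
    rw [← PMod.res_toSh, ← hn']; rfl
  generalize (L.preJetUE E).res hW₀ m' = m' at hs'
  generalize (L.preTwJet E).res hW₀ n' = n at ht
  refine ⟨W, hxW, hW, ?_⟩
  have hmul : (L.JetUE E).res hW (s * s') = (L.preJetUE E).toSh W (jueMul L E W m m') :=
    ((juePairing L E).sh.app_res hW s s').symm.trans
      ((congrArg₂ (fun s s' => (juePairing L E).sh.app W s s') hm hs').trans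
        ((juePairing L E).sh_toSh m m'))
  refine (opAct_res hW _ t).symm.trans ?_
  refine Eq.trans ?_ (opAct_res hW s _)
  refine (congrArg₂ (fun s t => opAct W s t) hmul ht).trans ?_
  refine Eq.trans ?_ (congrArg₂ (fun s t => opAct W s t) hm
    ((opAct_res hW s' t).symm.trans ((congrArg₂ (fun s t => opAct W s t) hs' ht).trans
      (opAct_toSh m' n)))).symm
  refine (opAct_toSh _ n).trans (Eq.trans ?_ (opAct_toSh m _).symm)
  exact congrArg _ (jueOp_jueMul nL hGW.1.some m m' n)

end OperatorPairing

/-! ### Differential operators on `Ŝym(L^∨) ⊗ E` and the isomorphism `Φ`. -/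

section DifferentialOperators

variable [CharZero K] (nL : L.Connection L.toPMod) (nE : L.Connection E)
  (hG : IsLocalBasis (HasFrames L E r q)) (hE : E.IsSheaf)

/-- The isomorphism between twisted jets and sections of `Ŝym(L^∨) ⊗ E` over an open set with
frames. -/
def symEquiv (hW : HasFrames L E r q W) : (L.preTwJet E).obj W ≃+ (L.SymMod E).obj W :=
  (AddEquiv.ofBijective ((L.preTwJet E).toSh W).toAddMonoidHom (hW.toSh_bijective hE)).trans
    (symIso nL nE hG W).toAddEquiv

lemma symEquiv_apply (hW : HasFrames L E r q W) (t : (L.preTwJet E).obj W) :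
    symEquiv nL nE hG hE hW t = symIso nL nE hG W ((L.preTwJet E).toSh W t) := rfl

lemma symEquiv_twSmul₁ (hW : HasFrames L E r q W) (c : Sec O W) (t : (L.preTwJet E).obj W) :
    symEquiv nL nE hG hE hW (twSmul₁ c t) = c • symEquiv nL nE hG hE hW t := by
  rw [symEquiv_apply, symEquiv_apply, ← smulAct₁_toSh, symIso_smulAct₁]

lemma symEquiv_twMul (hW : HasFrames L E r q W) {φ : L.Jet W} {ψ : L.abelian.Jet W}
    (h : jetSer (zeroConn L L.abelian.toPMod) (abFrame hW.1.some) ψ = jetSer nL hW.1.some φ)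
    (t : (L.preTwJet E).obj W) :
    symEquiv nL nE hG hE hW (twMul φ t) = L.abelian.jetAct ψ (symEquiv nL nE hG hE hW t) := by
  rw [symEquiv_apply, symEquiv_apply, symIso_toSh nL nE hG hW, symIso_toSh nL nE hG hW,
    symPre_eq nL nE hG hW ((corr_symPre nL nE hG hW t).twMul hW.1.some hW.2.some h)]
  exact ((L.abelian.jetPairing E).sh_toSh ψ _).symm

/-- Transport of endomorphisms of `Ŝym(L^∨) ⊗ E` to twisted jets. -/
def symConj (hW : HasFrames L E r q W) :
    Module.End (Sec O W) ((L.SymMod E).obj W) →+ AddMonoid.End ((L.preTwJet E).obj W) :=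
  AddMonoidHom.mk' (fun d => ((symEquiv nL nE hG hE hW).symm.toAddMonoidHom.comp
    d.toAddMonoidHom).comp (symEquiv nL nE hG hE hW).toAddMonoidHom) fun d d' =>
      AddMonoidHom.ext fun t => map_add (symEquiv nL nE hG hE hW).symm
        (d (symEquiv nL nE hG hE hW t)) (d' (symEquiv nL nE hG hE hW t))

lemma symEquiv_symConj (hW : HasFrames L E r q W) (d : Module.End (Sec O W) ((L.SymMod E).obj W))
    (t : (L.preTwJet E).obj W) : symEquiv nL nE hG hE hW (symConj nL nE hG hE hW d t) =
      d (symEquiv nL nE hG hE hW t) :=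
  (symEquiv nL nE hG hE hW).apply_symm_apply _

lemma symConj_injective (hW : HasFrames L E r q W) :
    Function.Injective (symConj nL nE hG hE hW) := fun d d' h => by
  refine LinearMap.ext fun u => ?_
  obtain ⟨t, rfl⟩ := (symEquiv nL nE hG hE hW).surjective u
  rw [← symEquiv_symConj, h, symEquiv_symConj]

lemma symConj_twSmul₁ (hW : HasFrames L E r q W) (d : Module.End (Sec O W) ((L.SymMod E).obj W))
    (c : Sec O W) (t : (L.preTwJet E).obj W) : symConj nL nE hG hE hW d (twSmul₁ c t) =
      twSmul₁ c (symConj nL nE hG hE hW d t) := by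
  refine (symEquiv nL nE hG hE hW).injective ?_
  rw [symEquiv_symConj, symEquiv_twSmul₁, map_smul, symEquiv_twSmul₁, symEquiv_symConj]

/-- `j` intertwines multiplication by two jets with the same expansion, so conjugation by `j`
matches the commutators. -/
lemma symConj_commutator (hW : HasFrames L E r q W) {φ : L.Jet W} {ψ : L.abelian.Jet W}
    (h : jetSer (zeroConn L L.abelian.toPMod) (abFrame hW.1.some) ψ = jetSer nL hW.1.some φ)
    {μ : AddMonoid.End ((L.preTwJet E).obj W)} (hμ : μ = (L.jetPairing E).app W φ)
    (d : Module.End (Sec O W) ((L.SymMod E).obj W)) :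
    symConj nL nE hG hE hW (L.abelian.jetAct ψ * d - d * L.abelian.jetAct ψ) =
      μ * symConj nL nE hG hE hW d - symConj nL nE hG hE hW d * μ := by
  subst hμ
  refine AddMonoidHom.ext fun t => (symEquiv nL nE hG hE hW).injective ?_
  refine (symEquiv_symConj nL nE hG hE hW _ t).trans ?_
  refine Eq.trans ?_ (map_sub (symEquiv nL nE hG hE hW)
    (twMul φ (symConj nL nE hG hE hW d t)) (symConj nL nE hG hE hW d (twMul φ t))).symm
  rw [symEquiv_twMul nL nE hG hE hW h, symEquiv_symConj, symEquiv_symConj,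
    symEquiv_twMul nL nE hG hE hW h]
  rfl

/-- The multiplication operators on `Ŝym(L^∨) ⊗ E`. -/
abbrev symMuls (L : LieAlgebroid O) (E : PMod O) (W : Opens X) :
    Set (Module.End (Sec O W) ((L.SymMod E).obj W)) :=
  Set.range fun φ : L.abelian.Jet W => L.abelian.jetAct (E := E) φ

/-- Every jet of the abelianization shares its expansion with a jet of `L`, and conversely. So the
two sets of multiplication operators correspond under conjugation. -/
lemma orderLT_symConj (hW : HasFrames L E r q W) {k : ℕ}
    {d : Module.End (Sec O W) ((L.SymMod E).obj W)} :
    OrderLT (twMuls L E W) k (symConj nL nE hG hE hW d) ↔ OrderLT (symMuls L E W) k d := by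
  constructor
  · refine OrderLT.of_map _ (symConj_injective nL nE hG hE hW) ?_
    rintro _ ⟨ψ, rfl⟩
    obtain ⟨φ, hφ⟩ := (jetSer_bijective nL hW.1.some).2
      (jetSer (zeroConn L L.abelian.toPMod) (abFrame hW.1.some) ψ)
    exact ⟨_, ⟨φ, rfl⟩, symConj_commutator nL nE hG hE hW hφ.symm rfl⟩
  · refine OrderLT.map _ ?_
    rintro _ ⟨φ, rfl⟩
    obtain ⟨ψ, hψ⟩ := (jetSer_bijective (zeroConn L L.abelian.toPMod) (abFrame hW.1.some)).2
      (jetSer nL hW.1.some φ)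
    exact ⟨_, ⟨ψ, rfl⟩, symConj_commutator nL nE hG hE hW hψ rfl⟩

/-- The endomorphism of `Ŝym(L^∨) ⊗ E` given by a section of `J(L) ⊗ U(L; E)`. -/
def diffEnd (W : Opens X) (s : (L.JetUE E).obj W) :
    Module.End (Sec O W) ((L.SymMod E).obj W) where
  toFun u := symIso nL nE hG W (opAct W s ((symIso nL nE hG W).symm u))
  map_add' u v := by rw [map_add, map_add, map_add]
  map_smul' c u := by
    obtain ⟨t, rfl⟩ := (symIso nL nE hG W).surjective u
    rw [← symIso_smulAct₁, LinearEquiv.symm_apply_apply, LinearEquiv.symm_apply_apply,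
      opAct_smulAct₁, symIso_smulAct₁]
    rfl

lemma diffEnd_symIso (s : (L.JetUE E).obj W) (t : (L.TwJet E).obj W) :
    diffEnd nL nE hG W s (symIso nL nE hG W t) = symIso nL nE hG W (opAct W s t) :=
  congrArg (fun t => symIso nL nE hG W (opAct W s t)) ((symIso nL nE hG W).symm_apply_apply t)

lemma diffEnd_res (h : W ≤ V) (s : (L.JetUE E).obj V) (u : (L.SymMod E).obj V) :
    diffEnd nL nE hG W ((L.JetUE E).res h s) ((L.SymMod E).res h u) =
      (L.SymMod E).res h (diffEnd nL nE hG V s u) := by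
  obtain ⟨t, rfl⟩ := (symIso nL nE hG V).surjective u
  rw [← symIso_res, diffEnd_symIso, diffEnd_symIso, ← symIso_res, opAct_res]

lemma symConj_diffEnd (hW : HasFrames L E r q W) (m : (L.preJetUE E).obj W) :
    symConj nL nE hG hE hW (diffEnd nL nE hG W ((L.preJetUE E).toSh W m)) = jueOp L E W m := by
  refine AddMonoidHom.ext fun t => (symEquiv nL nE hG hE hW).injective ?_
  refine (symEquiv_symConj nL nE hG hE hW _ t).trans ?_
  rw [symEquiv_apply, symEquiv_apply, diffEnd_symIso, opAct_toSh]

include hE in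
lemma exists_orderLT_diffEnd (s : (L.JetUE E).obj U) (x : X) (hx : x ∈ U) :
    ∃ (V : Opens X) (_ : x ∈ V) (_ : V ≤ U) (k : ℕ), ∀ (W : Opens X) (h : W ≤ U), W ≤ V →
      OrderLT (symMuls L E W) k (diffEnd nL nE hG W ((L.JetUE E).res h s)) := by
  obtain ⟨V, hxV, hV, m, hGV, hm⟩ := hG.exists_toSh s x hx
  obtain ⟨k, hk⟩ := exists_orderLT_jueOp nL hGV.1.some m
  refine ⟨V, hxV, hV, k, fun W h hW => ?_⟩
  have h1 : (L.JetUE E).res h s = (L.preJetUE E).toSh W ((L.preJetUE E).res hW m) := by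
    rw [← PMod.res_toSh, ← hm]; rfl
  rw [h1, ← orderLT_symConj nL nE hG hE (hG.mono hW hGV), symConj_diffEnd]
  exact hk W hW

/-- The differential operator given by a section of `J(L) ⊗ U(L; E)`. -/
def diffOp (U : Opens X) (s : (L.JetUE E).obj U) : Diff L E U :=
  ⟨fun W => diffEnd nL nE hG W.1 ((L.JetUE E).res W.2 s),
    fun V _ h u => diffEnd_res nL nE hG h ((L.JetUE E).res V.2 s) u,
    fun x hx => by
      obtain ⟨V, hxV, hV, k, hk⟩ := exists_orderLT_diffEnd nL nE hG hE s x hx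
      exact ⟨V, hxV, hV, k, fun W hW => hk W.1 W.2 hW⟩⟩

lemma diffOp_app (s : (L.JetUE E).obj U) (h : V ≤ U) :
    Diff.app (diffOp nL nE hG hE U s) h = diffEnd nL nE hG V ((L.JetUE E).res h s) := rfl

lemma Diff.ext {d d' : Diff L E U} (h : ∀ (V : Opens X) (hV : V ≤ U) u,
    Diff.app d hV u = Diff.app d' hV u) : d = d' :=
  Subtype.ext (funext fun V => LinearMap.ext fun u => h V.1 V.2 u)

lemma Diff.app_res (d : Diff L E U) (h : V ≤ U) (h' : W ≤ V) (u : (L.SymMod E).obj V) :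
    Diff.app d (h'.trans h) ((L.SymMod E).res h' u) = (L.SymMod E).res h' (Diff.app d h u) :=
  d.2.1 ⟨V, h⟩ ⟨W, h'.trans h⟩ h' u

/-- The map from `J(L) ⊗ U(L; E)` to differential operators, as a linear map. -/
def diffOpHom (U : Opens X) : (L.JetUE E).obj U →ₗ[K] Diff L E U where
  toFun := diffOp nL nE hG hE U
  map_add' s s' := Diff.ext fun V hV u => by
    obtain ⟨t, rfl⟩ := (symIso nL nE hG V).surjective u
    change _ = Diff.app (diffOp nL nE hG hE U s) hV _ + Diff.app (diffOp nL nE hG hE U s') hV _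
    rw [diffOp_app, diffOp_app, diffOp_app, diffEnd_symIso, diffEnd_symIso, diffEnd_symIso,
      map_add, map_add, AddMonoidHom.add_apply, map_add]
  map_smul' c s := Diff.ext fun V hV u => by
    obtain ⟨t, rfl⟩ := (symIso nL nE hG V).surjective u
    have hc : rs O hV (algebraMap K (Sec O U) c) = algebraMap K (Sec O V) c :=
      (rsA O hV).commutes c
    have hs : (L.JetUE E).res hV (c • s) =
        algebraMap K (Sec O V) c • (L.JetUE E).res hV s :=
      (((L.JetUE E).res hV).map_smulₛₗ (algebraMap K (Sec O U) c) s).trans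
        (congrArg (· • (L.JetUE E).res hV s) hc)
    change _ = c • Diff.app (diffOp nL nE hG hE U s) hV _
    rw [diffOp_app, diffOp_app, diffEnd_symIso, diffEnd_symIso, hs, opAct_smul]
    exact (symIso nL nE hG V).map_smul c _

lemma diffOp_mul (s s' : (L.JetUE E).obj U) : diffOp nL nE hG hE U (s * s') =
    diffOp nL nE hG hE U s * diffOp nL nE hG hE U s' := Diff.ext fun V hV u => by
  obtain ⟨t, rfl⟩ := (symIso nL nE hG V).surjective u
  change _ = Diff.app (diffOp nL nE hG hE U s) hV (Diff.app (diffOp nL nE hG hE U s') hV _)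
  rw [diffOp_app, diffOp_app, diffOp_app, diffEnd_symIso, diffEnd_symIso, diffEnd_symIso,
    ← opAct_mul nL hG]
  exact congrArg (fun s => symIso nL nE hG V (opAct V s t))
    ((juePairing L E).sh.app_res hV s s').symm

-- Over a small `V` the operator comes from some `m`. Over `W ≤ V` this does not follow by
-- restriction alone, as sections over `W` need not extend; but both operators agree on restrictions
-- from `V`, among them the monomial jets tensored with frame vectors, and these determine an
-- operator of finite order.
include nL nE hG hE in
lemma exists_diffOp_toSh_eq (d : Diff L E U) (x : X) (hx : x ∈ U) :
    ∃ (V : Opens X) (_ : x ∈ V) (h : V ≤ U) (m : (L.preJetUE E).obj V), HasFrames L E r q V ∧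
      diffOp nL nE hG hE V ((L.preJetUE E).toSh V m) = Diff.restrict h d := by
  obtain ⟨V₀, hxV₀, hV₀, k, hk⟩ := d.2.2 x hx
  obtain ⟨V, hxV, hV, hGV⟩ := hG.exists_le x hxV₀
  have hVU := hV.trans hV₀
  obtain ⟨⟨f⟩, ⟨b⟩⟩ := id hGV
  have hord : ∀ (W : Opens X) (h : W ≤ V),
      OrderLT (twMuls L E W) k (symConj nL nE hG hE (hG.mono h hGV) (Diff.app d (h.trans hVU))) :=
    fun W h => (orderLT_symConj nL nE hG hE _).mpr (hk ⟨W, h.trans hVU⟩ (h.trans hV))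
  obtain ⟨m, hm⟩ := exists_jueOp_eq b nL f (symConj_twSmul₁ nL nE hG hE _ _) (hord V le_rfl)
  obtain ⟨l, hl⟩ := exists_orderLT_jueOp nL f m
  refine ⟨V, hxV, hVU, m, hGV, Diff.ext fun W h u => ?_⟩
  have hGW := hG.mono h hGV
  let δ : AddMonoid.End ((L.preTwJet E).obj W) :=
    symConj nL nE hG hE hGW (Diff.app d (h.trans hVU))
  let μ : AddMonoid.End ((L.preTwJet E).obj W) := jueOp L E W ((L.preJetUE E).res h m)
  have hres : ∀ t, δ ((L.preTwJet E).res h t) = (L.preTwJet E).res h (jueOp L E V m t) := fun t => by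
    refine (symEquiv nL nE hG hE hGW).injective ?_
    refine (symEquiv_symConj nL nE hG hE hGW _ _).trans ?_
    have hr : ∀ t, symEquiv nL nE hG hE hGW ((L.preTwJet E).res h t) =
        (L.SymMod E).res h (symEquiv nL nE hG hE hGV t) := fun t => by
      rw [symEquiv_apply, symEquiv_apply, ← PMod.res_toSh, symIso_res]
    rw [hr, hr, Diff.app_res d hVU h]
    refine congrArg _ ((symEquiv_symConj nL nE hG hE hGV _ _).symm.trans ?_)
    exact congrArg (fun d : AddMonoid.End _ => symEquiv nL nE hG hE hGV (d t)) hm.symm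
  -- The bounds `k` for `d` and `l` for `m` are combined into `k + l`, which bounds the difference.
  have key : δ - μ = 0 := by
    refine eq_zero_of_orderLT_tw (k := k + l) (b.restrict h) nL (f.restrict h) (fun c t => ?_)
      (((hord W h).mono (by omega)).sub ((hl W h).mono (by omega))) fun β c => ?_
    · refine Eq.trans ?_ (map_sub (twSmul₁ c) (δ t) (μ t)).symm
      exact congrArg₂ (· - ·) (symConj_twSmul₁ nL nE hG hE _ _ c t) (jueOp_twSmul₁ _ c t)
    · rw [monoJet_restrict]
      exact sub_eq_zero.mpr ((hres (monoJet nL f β ⊗ₜ[Sec O V] b.vec c)).trans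
        (jueOp_res h m (monoJet nL f β ⊗ₜ[Sec O V] b.vec c)).symm)
  have h2 := (symConj_diffEnd nL nE hG hE hGW ((L.preJetUE E).res h m)).trans
    (sub_eq_zero.mp key).symm
  rw [diffOp_app, PMod.res_toSh, symConj_injective nL nE hG hE hGW h2]
  rfl

/-- Injectivity over open sets with frames is faithfulness of the action on twisted jets, and local
surjectivity is `exists_diffOp_toSh_eq`. -/
lemma diffOpHom_bijective (U : Opens X) : Function.Bijective (diffOpHom nL nE hG hE U) := by
  refine hG.bijective_of_local (T := fun U => Diff L E U) (fun h => Diff.restrict h)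
    (fun _ _ _ => rfl) (fun U d d' h => Diff.ext fun V hV u => ?_)
    (fun U => (diffOpHom nL nE hG hE U).toAddMonoidHom) (fun h s => rfl)
    (fun V hV m hm => ?_) (fun U d x hx => exists_diffOp_toSh_eq nL nE hG hE d x hx) U
  · refine PMod.sh_ext fun x hx => ?_
    obtain ⟨W, hxW, hW, e⟩ := h x (hV hx)
    refine ⟨W ⊓ V, ⟨hxW, hx⟩, inf_le_right, ?_⟩
    refine (Diff.app_res d hV inf_le_right u).symm.trans ?_
    refine Eq.trans ?_ (Diff.app_res d' hV inf_le_right u)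
    exact congrArg (fun d : Diff L E W => Diff.app d (inf_le_left : W ⊓ V ≤ W) _) e
  · refine eq_zero_of_jueOp_eq_zero hV.1.some hV.2.some nL fun t => ?_
    have h1 : diffEnd nL nE hG V ((L.preJetUE E).toSh V m) = 0 := by
      have h2 := congrArg (fun d : Diff L E V => Diff.app d le_rfl) hm
      refine Eq.trans ?_ h2
      exact congrArg (diffEnd nL nE hG V) ((L.JetUE E).res_refl _).symm
    have h3 := symConj_diffEnd nL nE hG hE hV m
    rw [h1, map_zero] at h3
    exact DFunLike.congr_fun h3.symm t

/-- The isomorphism between `J(L) ⊗ U(L; E)` and the sheaf of differential operators of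
`Ŝym(L^∨) ⊗ E`. -/
def diffIso (U : Opens X) : (L.JetUE E).obj U ≃ₗ[K] Diff L E U :=
  LinearEquiv.ofBijective (diffOpHom nL nE hG hE U) (diffOpHom_bijective nL nE hG hE U)

lemma diffIso_jetUE_app (φ : L.Jet U) (e : E.obj U) (D : L.UE U) (f : E.dual.obj U) (h : V ≤ U)
    (ψ : L.Jet V) (s : E.obj V) :
    Diff.app (diffIso nL nE hG hE U (jetUE φ e D f)) h (symIso nL nE hG V (L.twJet ψ s)) =
      symIso nL nE hG V (L.twJet (Jet.mul (Jet.restrict h φ)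
        (L.ures h D • PMod.evOn f h s • ψ)) (E.res h e)) := by
  refine (diffEnd_symIso nL nE hG _ _).trans (congrArg (symIso nL nE hG V) ?_)
  refine (congrArg (fun s' => opAct V s' (L.twJet ψ s)) (PMod.res_toSh h _)).trans ?_
  refine (opAct_toSh _ _).trans (congrArg ((L.preTwJet E).toSh V) ?_)
  refine (jueOp_jueTmul (Jet.restrict h φ) (E.res h e) (L.ures h D) (E.dual.res h f) _).trans ?_
  rw [twContract_tmul]
  rfl

end DifferentialOperators

end LieAlgebroid
end LieAlg

end

theorem mainTheorem9 {K : Type u} [Field K] [CharZero K] {X : TopCat.{u}}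
    (O : TopCat.Sheaf (CommAlgCat.{u} K) X)
    (L : LieAlg.LieAlgebroid O) (r : ℕ) (hL : L.toPMod.IsLocallyFree r)
    (E : LieAlg.PMod O) (hE : E.IsSheaf) (q : ℕ) (hEq : E.IsLocallyFree q)
    (nL : L.Connection L.toPMod) (nE : L.Connection E) :
    -- the canonical isomorphism `E ⊗ₗ U(L) ⊗ᵣ E^∨ ≅ U(L; E) = Hom^cont(J(L; E), E)`
    (∃ κ : ∀ U : Opens X, (L.preTwUE E).sh.obj U ≃+ LieAlg.LieAlgebroid.HomCont L E U,
      (∀ (U V : Opens X) (h : V ≤ U) (s : (L.preTwUE E).sh.obj U),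
        κ V ((L.preTwUE E).sh.res h s) = (κ U s).restrict h) ∧
      ∀ (U : Opens X) (e : E.obj U) (D : L.UE U) (f : E.dual.obj U) (V : Opens X) (h : V ≤ U)
        (φ : L.Jet V) (s : E.obj V),
        (κ U ((L.preTwUE E).toSh U (LieAlg.LieAlgebroid.ueTmul e D f))).app h (L.twJet φ s) =
          LieAlg.Jet.app φ le_rfl (L.ures h D *
            LieAlg.UEA.ιR (L.obj V) (LieAlg.PMod.evOn f h s)) • E.res h e) ∧
    -- the map `j` given by the two connections
    ∃ j : ∀ U : Opens X, (L.TwJet E).obj U ≃ₗ[K] (L.SymMod E).obj U,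
      (∀ (U V : Opens X) (h : V ≤ U) (s : (L.TwJet E).obj U),
        j V ((L.TwJet E).res h s) = (L.SymMod E).res h (j U s)) ∧
      (∀ (U : Opens X) (t : (L.preTwJet E).obj U) (n : ℕ) (x : Fin n → L.obj U),
        LieAlg.LieAlgebroid.symEval (j U ((L.preTwJet E).toSh U t)) x =
          (n.factorial : K)⁻¹ •
            E.toSh U (LieAlg.LieAlgebroid.evOne (LieAlg.LieAlgebroid.dpow nL nE n t x))) ∧
      -- the isomorphism of sheaves of algebras
      ∃ Φ : ∀ U : Opens X, (L.JetUE E).obj U ≃ₗ[K] L.Diff E U,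
        (∀ (U V : Opens X) (h : V ≤ U) (s : (L.JetUE E).obj U),
          Φ V ((L.JetUE E).res h s) = LieAlg.LieAlgebroid.Diff.restrict h (Φ U s)) ∧
        (∀ (U : Opens X) (s t : (L.JetUE E).obj U), Φ U (s * t) = Φ U s * Φ U t) ∧
        ∀ (U : Opens X) (φ : L.Jet U) (e : E.obj U) (D : L.UE U) (f : E.dual.obj U)
          (V : Opens X) (h : V ≤ U) (ψ : L.Jet V) (s : E.obj V),
          LieAlg.LieAlgebroid.Diff.app (Φ U (LieAlg.LieAlgebroid.jetUE φ e D f)) h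
              (j V (L.twJet ψ s)) =
            j V (L.twJet
              (LieAlg.Jet.mul (LieAlg.Jet.restrict h φ)
                (L.ures h D • LieAlg.PMod.evOn f h s • ψ))
              (E.res h e)) := by
  have hG := LieAlg.LieAlgebroid.isLocalBasis_hasFrames hL hEq
  refine ⟨⟨fun U => AddEquiv.ofBijective (LieAlg.LieAlgebroid.contHomMap hE U)
    (LieAlg.LieAlgebroid.contHomMap_bijective hG hE U), fun U V h s => rfl,
    fun U e D f V h φ s => LieAlg.LieAlgebroid.contHom_ueTmul_app hE e D f h φ s⟩,
    LieAlg.LieAlgebroid.symIso nL nE hG, fun U V h s => rfl,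
    fun U t n x => LieAlg.LieAlgebroid.symEval_symIso nL nE hG t n x,
    LieAlg.LieAlgebroid.diffIso nL nE hG hE, fun U V h s => rfl,
    fun U s t => LieAlg.LieAlgebroid.diffOp_mul nL nE hG hE s t,
    fun U φ e D f V h ψ s => LieAlg.LieAlgebroid.diffIso_jetUE_app nL nE hG hE φ e D f h ψ s⟩
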